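/- Let $G$ be a finite graph. A tree decomposition of $G$ is a finite tree $T$ with a bag $\beta(t)\subseteq V(G)$ for every node $t$ such that the bags cover all vertices, every edge has both ends in some bag, and for every vertex the nodes whose bag contains it form a subtree; its width is $w=\max_t|\beta(t)|-1$. It is given as input as a list of the bags and of the parent pointers of $T$, rooted at some node, parents listed before children. The bipartite graph of a matrix $U$ has the rows and columns of $U$ as vertices and an edge $ax$ whenever $U_{a,x}\neq0$ (so a bag consists of a set $\alpha(t)$ of rows and a set $\chi(t)$ of columns, and $w=\max_t(|\alpha(t)|+|\chi(t)|)-1$). The symmetric graph of a symmetric matrix $B$ has the indices of $B$ as vertices and an edge $ij$ whenever $B_{ij}\neq 0$. The loop hafnian of $B$ is $\mathrm{lHaf}(B)=\sum_\pi\prod_{ij\in\pi}B_{ij}$, the sum being over all perfect matchings $\pi$ of the indices, where loops $ii$ are allowed in $\pi$. Time is the number of steps on a random access machine whose elementary steps are reading and writing memory, addition, subtraction and comparison of natural numbers (used as indices and counters), conversion of such a number to a complex number, exact complex arithmetic operations, and producing a root of unity $e^{2\pi i/n}$. All constants are absolute, $|T|$ is the number of nodes of $T$, and in the bounds below $w$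 is to be read as $\max(w,1)$ in the polynomial factor and $\log c$ as $\log\max(c,2)$. (1) There is an algorithm that, given a complex $N\times N$ matrix $U$ and a tree decomposition of width $w$ of its bipartite graph, computes the permanent of $U$ exactly in time $O((N+|T|)\,w^2 2^w)$. (2) There is an algorithm that, given a complex symmetric $N\times N$ matrix $B$ and a tree decomposition of width $w$ of its symmetric graph, computes $\mathrm{lHaf}(B)$ exactly in time $O((N+|T|)\,w^2 2^w)$. (3) (Collisions.) Let $U$ be a complex $M\times M$ matrix, and let $\alpha_1,\dots,\alpha_k$ and $r_1,\dots,r_k$ be lists of row and of column indices in which every index occurs at most $c$ times. There is an algorithm that, given $U$, the numbers of occurrences of the indices in the two lists, and a tree decomposition of width $w$ of the bipartite graph of the submatrix of $U$ on the distinct indices $\{\alpha_i\}$ and $\{r_j\}$, computes the permanent of the $k\times k$ matrix $(U_{\alpha_i,r_j})_{i,j}$ exactly in time $O((k+|T|)\,w(2c+1)^w\log c)$. (4) Let $B$ be a complex symmetric $M\times M$ matrix and let $r_1,\dots,r_k$ be a list of indices in which every index occurs at most $c$ times. There is an algorithm that, given $B$, the numbers of occurrences of the indices in the list, and a tree decomposition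 of width $w$ of the symmetric graph of the submatrix of $B$ on the distinct indices $\{r_j\}$, computes the loop hafnian of the $k\times k$ matrix $(B_{r_i,r_j})_{i,j}$ exactly in time $O((k+|T|)\,w(2c+1)^w\log c)$. In particular, for tree decompositions with $O(N)$ (respectively $O(k)$) nodes, the running times are $O(Nw^22^w)$ in (1) and (2) and $O(kw(2c+1)^w\log c)$ in (3) and (4). -/

import Mathlib

/-! ## Tree decompositions and the graphs of a matrix -/

/-- A tree decomposition of a graph `G`, with nodes `ι`: a tree on `ι` and a bag of vertices for
every node, such that the bags cover all vertices and all edges and the nodes whose bag contains a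
given vertex form a subtree. -/
structure TreeDecomposition {V : Type*} (G : SimpleGraph V) (ι : Type*) where
  tree : SimpleGraph ι
  isTree : tree.IsTree
  bag : ι → Finset V
  vertex_mem : ∀ v, ∃ t, v ∈ bag t
  edge_mem : ∀ u v, G.Adj u v → ∃ t, u ∈ bag t ∧ v ∈ bag t
  subtree : ∀ v, (tree.induce {t | v ∈ bag t}).Connected

/-- The width: the largest size of a bag, minus one. -/
def TreeDecomposition.width {V ι : Type*} [Fintype ι] {G : SimpleGraph V}
    (D : TreeDecomposition G ι) : ℕ :=
  (Finset.univ.sup fun t => (D.bag t).card) - 1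

/-- The bipartite graph of a matrix: the vertices are the rows and the columns, and the row `a` is
joined to the column `x` when the entry `U a x` is nonzero. A bag of a tree decomposition of this
graph is the disjoint union of a set `α(t)` of rows and a set `χ(t)` of columns. -/
def bipartiteGraph {A X : Type*} (U : Matrix A X ℂ) : SimpleGraph (A ⊕ X) :=
  SimpleGraph.fromRel fun u v => ∃ a x, u = Sum.inl a ∧ v = Sum.inr x ∧ U a x ≠ 0

/-- The graph of a symmetric matrix: distinct indices `i`, `j` are joined when `B i j` is nonzero.
The loops at the nonzero diagonal entries are left out, since they put no condition on a tree
decomposition (every vertex lies in some bag). -/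
def symmetricGraph {X : Type*} (B : Matrix X X ℂ) : SimpleGraph X :=
  SimpleGraph.fromRel fun i j => B i j ≠ 0

/-! ## The loop hafnian -/

/-- The weight `B i j` of the unordered pair (possibly a loop) `ij`. -/
def edgeWeight {X : Type*} (B : Matrix X X ℂ) (hB : B.IsSymm) : Sym2 X → ℂ :=
  Sym2.lift ⟨fun i j => B i j, fun i j => hB.apply j i⟩

/-- A set of edges, loops allowed, is a perfect matching when every vertex is on exactly one of
its edges. -/
def IsLoopPerfectMatching {X : Type*} (π : Finset (Sym2 X)) : Prop :=
  ∀ v, ∃! e, e ∈ π ∧ v ∈ e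

open Classical in
/-- The loop hafnian `∑_π ∏_{ij ∈ π} B i j`, the sum being over all perfect matchings with loops
allowed; those that use a pair with `B i j = 0` contribute `0`. -/
noncomputable def loopHafnian {X : Type*} [Fintype X] (B : Matrix X X ℂ) (hB : B.IsSymm) : ℂ :=
  ∑ π : Finset (Sym2 X) with IsLoopPerfectMatching π, ∏ e ∈ π, edgeWeight B hB e

/-- The number of times that the value `i` is taken by the list `r 0, …, r (k - 1)`. -/
def occupancy {k M : ℕ} (r : Fin k → Fin M) (i : Fin M) : ℕ :=
  (Finset.univ.filter fun l => r l = i).card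

/-! ## A random access machine with exact complex arithmetic -/

/-- A memory: scalar variables and two-dimensional arrays holding natural numbers (indices), and
two-dimensional arrays holding complex numbers. Variables and arrays are named by numerals. -/
structure Memory where
  var : ℕ → ℕ
  idx : ℕ → ℕ → ℕ → ℕ
  num : ℕ → ℕ → ℕ → ℂ

/-- Index expressions; `get a e f` reads the entry `(e, f)` of the index array `a`, and
subtraction is truncated. -/
inductive IExp where
  | lit (n : ℕ)
  | var (x : ℕ)
  | get (a : ℕ) (e f : IExp)
  | add (e f : IExp)
  | sub (e f : IExp)

/-- Complex expressions; `get a e f` reads the entry `(e, f)` of the number array `a`, `cast`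
converts an index to a number, and `root e` is the root of unity `exp (2 π i / e)`. -/
inductive NExp where
  | cast (e : IExp)
  | root (e : IExp)
  | get (a : ℕ) (e f : IExp)
  | add (x y : NExp)
  | sub (x y : NExp)
  | mul (x y : NExp)
  | div (x y : NExp)

/-- Tests. Only indices can be compared. -/
inductive BExp where
  | lt (e f : IExp)
  | eq (e f : IExp)
  | not (b : BExp)
  | and (b c : BExp)

/-- Programs. -/
inductive Program where
  | skip
  | setVar (x : ℕ) (e : IExp)
  | setIdx (a : ℕ) (e f : IExp) (v : IExp)
  | setNum (a : ℕ) (e f : IExp) (v : NExp)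
  | seq (p q : Program)
  | ite (b : BExp) (p q : Program)
  | loop (b : BExp) (p : Program)

/-- The value of an index expression. -/
def IExp.eval (s : Memory) : IExp → ℕ
  | lit n => n
  | var x => s.var x
  | get a e f => s.idx a (e.eval s) (f.eval s)
  | add e f => e.eval s + f.eval s
  | sub e f => e.eval s - f.eval s

/-- The number of operations in an index expression. -/
def IExp.cost : IExp → ℕ
  | lit _ => 1
  | var _ => 1
  | get _ e f => 1 + e.cost + f.cost
  | add e f => 1 + e.cost + f.cost
  | sub e f => 1 + e.cost + f.cost

/-- The value of a complex expression. -/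
noncomputable def NExp.eval (s : Memory) : NExp → ℂ
  | cast e => (e.eval s : ℂ)
  | root e => Complex.exp (2 * Real.pi * Complex.I / (e.eval s : ℂ))
  | get a e f => s.num a (e.eval s) (f.eval s)
  | add x y => x.eval s + y.eval s
  | sub x y => x.eval s - y.eval s
  | mul x y => x.eval s * y.eval s
  | div x y => x.eval s / y.eval s

/-- The number of operations in a complex expression. -/
def NExp.cost : NExp → ℕ
  | cast e => 1 + e.cost
  | root e => 1 + e.cost
  | get _ e f => 1 + e.cost + f.cost
  | add x y => 1 + x.cost + y.cost
  | sub x y => 1 + x.cost + y.cost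
  | mul x y => 1 + x.cost + y.cost
  | div x y => 1 + x.cost + y.cost

/-- The outcome of a test. -/
def BExp.eval (s : Memory) : BExp → Bool
  | lt e f => decide (e.eval s < f.eval s)
  | eq e f => decide (e.eval s = f.eval s)
  | not b => !(b.eval s)
  | and b c => b.eval s && c.eval s

/-- The number of operations in a test. -/
def BExp.cost : BExp → ℕ
  | lt e f => 1 + e.cost + f.cost
  | eq e f => 1 + e.cost + f.cost
  | not b => 1 + b.cost
  | and b c => 1 + b.cost + c.cost

/-- Assignment to a variable. -/
def Memory.setVar (s : Memory) (x v : ℕ) : Memory :=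
  { s with var := Function.update s.var x v }

/-- Assignment to an entry of an index array. -/
def Memory.setIdx (s : Memory) (a i j v : ℕ) : Memory :=
  { s with
    idx := Function.update s.idx a
      (Function.update (s.idx a) i (Function.update (s.idx a i) j v)) }

/-- Assignment to an entry of a number array. -/
noncomputable def Memory.setNum (s : Memory) (a i j : ℕ) (v : ℂ) : Memory :=
  { s with
    num := Function.update s.num a
      (Function.update (s.num a) i (Function.update (s.num a i) j v)) }

/-- `Exec p s t s'`: started in the memory `s`, the program `p` halts after `t` steps in the
memory `s'`. -/
inductive Exec : Program → Memory → ℕ → Memory → Prop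
  | skip (s : Memory) : Exec .skip s 1 s
  | setVar (s : Memory) (x : ℕ) (e : IExp) :
      Exec (.setVar x e) s (1 + e.cost) (s.setVar x (e.eval s))
  | setIdx (s : Memory) (a : ℕ) (e f v : IExp) :
      Exec (.setIdx a e f v) s (1 + e.cost + f.cost + v.cost)
        (s.setIdx a (e.eval s) (f.eval s) (v.eval s))
  | setNum (s : Memory) (a : ℕ) (e f : IExp) (v : NExp) :
      Exec (.setNum a e f v) s (1 + e.cost + f.cost + v.cost)
        (s.setNum a (e.eval s) (f.eval s) (v.eval s))
  | seq {p q : Program} {s s' s'' : Memory} {t t' : ℕ} :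
      Exec p s t s' → Exec q s' t' s'' → Exec (.seq p q) s (t + t') s''
  | ite_true {b : BExp} {p q : Program} {s s' : Memory} {t : ℕ} :
      b.eval s = true → Exec p s t s' → Exec (.ite b p q) s (1 + b.cost + t) s'
  | ite_false {b : BExp} {p q : Program} {s s' : Memory} {t : ℕ} :
      b.eval s = false → Exec q s t s' → Exec (.ite b p q) s (1 + b.cost + t) s'
  | loop_true {b : BExp} {p : Program} {s s' s'' : Memory} {t t' : ℕ} :
      b.eval s = true → Exec p s t s' → Exec (.loop b p) s' t' s'' →
        Exec (.loop b p) s (1 + b.cost + t + t') s''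
  | loop_false {b : BExp} {p : Program} {s : Memory} :
      b.eval s = false → Exec (.loop b p) s (1 + b.cost) s

/-- Started on the input `s`, the program `p` halts after at most `T` steps, with the number `z`
in the entry `(0, 0)` of the number array `1`. -/
def ComputesWithin (p : Program) (s : Memory) (z : ℂ) (T : ℝ) : Prop :=
  ∃ (t : ℕ) (s' : Memory), Exec p s t s' ∧ s'.num 1 0 0 = z ∧ (t : ℝ) ≤ T

/-! ## The input of the programs -/

/-- A listing of a tree decomposition: the nodes are numbered `0, 1, …, n - 1`, starting with a
root and so that the parent of every other node has a smaller number, and every bag is written as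
a list without repetitions. -/
structure Listing {V ι : Type*} [Fintype ι] {G : SimpleGraph V} (D : TreeDecomposition G ι) where
  node : Fin (Fintype.card ι) ≃ ι
  parent : Fin (Fintype.card ι) → Fin (Fintype.card ι)
  parent_lt : ∀ t, t.val ≠ 0 → parent t < t
  parent_adj : ∀ t, t.val ≠ 0 → D.tree.Adj (node t) (node (parent t))
  bagList : Fin (Fintype.card ι) → List V
  nodup : ∀ t, (bagList t).Nodup
  mem_bagList : ∀ t v, v ∈ bagList t ↔ v ∈ D.bag (node t)

/-- A function on `{0, …, n - 1}`, continued by a default value to all natural numbers. -/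
def extendFin {n : ℕ} {β : Type*} (d : β) (f : Fin n → β) (i : ℕ) : β :=
  if h : i < n then f ⟨i, h⟩ else d

/-- The memory that holds an input: the variable `0` is the number of nodes, the variable `1` is
the dimension of the matrix, the index array `0` holds the parents, the arrays `1` and `2` hold the
lengths and the members of the row parts of the bags, the arrays `3` and `4` those of the column
parts, the arrays `5` and `6` the multiplicities of the rows and of the columns, and the number
array `0` holds the matrix. Everything else is zero. -/
def inputMemory {n M : ℕ} (parent : Fin n → Fin n) (rows cols : Fin n → List (Fin M))
    (rowMult colMult : Fin M → ℕ) (U : Matrix (Fin M) (Fin M) ℂ) : Memory where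
  var
    | 0 => n
    | 1 => M
    | _ => 0
  idx
    | 0, t, 0 => extendFin 0 (fun i => (parent i).val) t
    | 1, t, 0 => extendFin 0 (fun i => (rows i).length) t
    | 2, t, j => (extendFin [] (fun i => (rows i).map Fin.val) t).getD j 0
    | 3, t, 0 => extendFin 0 (fun i => (cols i).length) t
    | 4, t, j => (extendFin [] (fun i => (cols i).map Fin.val) t).getD j 0
    | 5, i, 0 => extendFin 0 rowMult i
    | 6, i, 0 => extendFin 0 colMult i
    | _, _, _ => 0
  num
    | 0, i, j => extendFin 0 (fun a => extendFin 0 (U a) j) i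
    | _, _, _ => 0

/-- The input for a permanent: the matrix `U`, the multiplicities of its rows and columns, and a
tree decomposition whose vertices `v` stand for the rows and columns `label v`. -/
def permanentInput {V ι : Type*} [Fintype ι] {G : SimpleGraph V} {D : TreeDecomposition G ι}
    {M : ℕ} (U : Matrix (Fin M) (Fin M) ℂ) (rowMult colMult : Fin M → ℕ) (L : Listing D)
    (label : V → Fin M ⊕ Fin M) : Memory :=
  inputMemory L.parent (fun t => (L.bagList t).filterMap fun v => (label v).getLeft?)
    (fun t => (L.bagList t).filterMap fun v => (label v).getRight?) rowMult colMult U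

/-- The input for a loop hafnian: the matrix `B`, the multiplicities of its indices, and a tree
decomposition whose vertices `v` stand for the indices `label v`. -/
def loopHafnianInput {V ι : Type*} [Fintype ι] {G : SimpleGraph V} {D : TreeDecomposition G ι}
    {M : ℕ} (B : Matrix (Fin M) (Fin M) ℂ) (mult : Fin M → ℕ) (L : Listing D)
    (label : V → Fin M) : Memory :=
  inputMemory L.parent (fun t => (L.bagList t).map label) (fun _ => []) mult (fun _ => 0) B

/-! All four claims reduce to one coefficient extraction. For weights `b` on labels `v` with
multiplicities `m v`, let Z = exp(∑_{u<v} b_uv x_u x_v + ∑_v b_vv (x_v + x_v²/2)). Its derivatives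
satisfy ∂_v Z = (b_vv + ∑_u b_vu x_u) Z, which is, coefficient by coefficient, the expansion of a
loop hafnian along one index: the index is looped, or it is matched to another one. Hence the loop
hafnian of the matrix with repeated indices is ∏ (m v)! times the coefficient of ∏ x_v^(m v) in Z
(`loopHafnianOn_eq_coeff`, `pderiv_prod_localFactor`). The diagonal weight enters twice, since a
copy of v can be looped or matched to another copy of v. A permanent is the loop hafnian of the
bipartite matrix (`permanent_eq_loopHafnianOn`), so one program serves all parts; a flag switches
off the weights between two rows.

The coefficient is found by variable elimination. In a rooted tree decomposition the nodes of a
vertex form a subtree with a highest node, its top. The vertices are eliminated with the deepest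
tops first, and R e is the set of later vertices in the top bag of e. It has at most w elements, it
contains all later neighbors of e, and the order is perfect: of two members of R e, the later one
belongs to R of the earlier one (`IsNumbering.isEliminationOrder`). Eliminating e means multiplying
its local factor by the messages received, taking (m e)! times the coefficient of x_e^(m e), and
sending the resulting series in the variables R e to the first vertex f of R e. `pending` is the
quantity preserved by this.

The series are truncated at the exponents m and multiplied by a fast Fourier transform in
essentially linear time. The difficulty is to recognize, in a one-dimensional cyclic convolution,
which pairs of exponent vectors add without a carry. An exponent vector is sent to its mixed radix
value plus H times the sum of the values of its proper tails. Carries in an addition change the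
second part by exactly their number, so modulo H L they are detected as soon as H is twice the box
size and L exceeds the number of variables (`exists_carry`, `linearIndex_add_modEq_iff`). A product
on a box of N vectors in l variables costs O(N l log(N l)) (`wp_truncatedMul`).

Two estimates bound the number of products on the full box of f, of size at most (m f + 1)(c+1)^w.
It is at most the number of children of f. It is also at most w + 2, since the message of a child
omits some member of {f} ∪ R f, or has all of them, and messages with the same first omission are
first multiplied together in a slot, on a box of size at most (c+1)^w (`wp_sendMessage`). With c = 1
the first estimate gives w² 2^w per vertex. In general, the sum of the multiplicities and the second
estimate give w³ (c+1)^w log c up to constants for each occurrence of an index, and a quadratic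
factor in w is absorbed by ((2c+1)/(c+1))^w ≥ (3/2)^w (`sum_vertexCost_le`, `quadratic_mul_pow_le`).
-/

/-! ## A program logic with step counts -/

/-- Started in `s`, the program `p` halts, and its step count and final memory satisfy `Q`. -/
def WP (p : Program) (s : Memory) (Q : ℕ → Memory → Prop) : Prop :=
  ∃ t s', Exec p s t s' ∧ Q t s'

theorem WP.mono {p : Program} {s : Memory} {Q Q' : ℕ → Memory → Prop} (h : WP p s Q)
    (hQ : ∀ t s', Q t s' → Q' t s') : WP p s Q' := by
  obtain ⟨t, s', he, hq⟩ := h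
  exact ⟨t, s', he, hQ _ _ hq⟩

theorem wp_skip {s : Memory} {Q : ℕ → Memory → Prop} : WP .skip s Q ↔ Q 1 s := by
  constructor
  · rintro ⟨t, s', ⟨⟩, hq⟩; exact hq
  · exact fun h => ⟨_, _, .skip s, h⟩

theorem wp_setVar {s : Memory} {x : ℕ} {e : IExp} {Q : ℕ → Memory → Prop} :
    WP (.setVar x e) s Q ↔ Q (1 + e.cost) (s.setVar x (e.eval s)) := by
  constructor
  · rintro ⟨t, s', ⟨⟩, hq⟩; exact hq
  · exact fun h => ⟨_, _, .setVar s x e, h⟩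

theorem wp_setIdx {s : Memory} {a : ℕ} {e f v : IExp} {Q : ℕ → Memory → Prop} :
    WP (.setIdx a e f v) s Q ↔
      Q (1 + e.cost + f.cost + v.cost) (s.setIdx a (e.eval s) (f.eval s) (v.eval s)) := by
  constructor
  · rintro ⟨t, s', ⟨⟩, hq⟩; exact hq
  · exact fun h => ⟨_, _, .setIdx s a e f v, h⟩

theorem wp_setNum {s : Memory} {a : ℕ} {e f : IExp} {v : NExp} {Q : ℕ → Memory → Prop} :
    WP (.setNum a e f v) s Q ↔
      Q (1 + e.cost + f.cost + v.cost) (s.setNum a (e.eval s) (f.eval s) (v.eval s)) := by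
  constructor
  · rintro ⟨t, s', ⟨⟩, hq⟩; exact hq
  · exact fun h => ⟨_, _, .setNum s a e f v, h⟩

theorem wp_seq {p q : Program} {s : Memory} {Q : ℕ → Memory → Prop} :
    WP (.seq p q) s Q ↔ WP p s fun t s' => WP q s' fun t' s'' => Q (t + t') s'' := by
  constructor
  · rintro ⟨t, s', h, hq⟩
    cases h with
    | seq h₁ h₂ => exact ⟨_, _, h₁, _, _, h₂, hq⟩
  · rintro ⟨t, s', h₁, t', s'', h₂, hq⟩
    exact ⟨_, _, .seq h₁ h₂, hq⟩

theorem wp_ite {b : BExp} {p q : Program} {s : Memory} {Q : ℕ → Memory → Prop} :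
    WP (.ite b p q) s Q ↔
      if b.eval s = true then WP p s fun t s' => Q (1 + b.cost + t) s'
      else WP q s fun t s' => Q (1 + b.cost + t) s' := by
  split_ifs with hb
  · constructor
    · rintro ⟨t, s', h, hq⟩
      cases h with
      | ite_true _ h => exact ⟨_, _, h, hq⟩
      | ite_false h' _ => simp [hb] at h'
    · rintro ⟨t, s', h, hq⟩
      exact ⟨_, _, .ite_true hb h, hq⟩
  · constructor
    · rintro ⟨t, s', h, hq⟩
      cases h with
      | ite_true h' _ => exact absurd h' hb
      | ite_false _ h => exact ⟨_, _, h, hq⟩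
    · rintro ⟨t, s', h, hq⟩
      exact ⟨_, _, .ite_false (by simpa using hb) h, hq⟩

/-- The two memories agree on all variables and arrays with a number below `k`. -/
structure Frame (k : ℕ) (s s' : Memory) : Prop where
  var : ∀ x, x < k → s'.var x = s.var x
  idx : ∀ a, a < k → s'.idx a = s.idx a
  num : ∀ a, a < k → s'.num a = s.num a

theorem Frame.refl (k : ℕ) (s : Memory) : Frame k s s := ⟨by simp, by simp, by simp⟩

theorem Frame.trans {k : ℕ} {s s' s'' : Memory} (h : Frame k s s') (h' : Frame k s' s'') :
    Frame k s s'' :=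
  ⟨fun x hx => (h'.var x hx).trans (h.var x hx), fun x hx => (h'.idx x hx).trans (h.idx x hx),
    fun x hx => (h'.num x hx).trans (h.num x hx)⟩

theorem Frame.mono {k l : ℕ} {s s' : Memory} (h : Frame k s s') (hl : l ≤ k) : Frame l s s' :=
  ⟨fun x hx => h.var x (hx.trans_le hl), fun x hx => h.idx x (hx.trans_le hl),
    fun x hx => h.num x (hx.trans_le hl)⟩

/-- The program assigns only to variables and arrays with a number that is at least `k`. -/
def Program.fresh (k : ℕ) : Program → Bool
  | skip => true
  | setVar x _ => decide (k ≤ x)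
  | setIdx a _ _ _ => decide (k ≤ a)
  | setNum a _ _ _ => decide (k ≤ a)
  | seq p q => p.fresh k && q.fresh k
  | ite _ p q => p.fresh k && q.fresh k
  | loop _ p => p.fresh k

/-- Subprograms use higher numbers for their variables and arrays than the programs calling them.
That the caller's data survive is then a syntactic fact about the code, checked by evaluation, and
loop invariants need not mention these data. -/
theorem Exec.frame {k : ℕ} {p : Program} {s s' : Memory} {t : ℕ} (h : Exec p s t s')
    (hp : p.fresh k = true) : Frame k s s' := by
  induction h with
  | skip | loop_false => exact Frame.refl _ _
  | setVar s x e =>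
    have hk : k ≤ x := by simpa [Program.fresh] using hp
    exact ⟨fun y hy => Function.update_of_ne (by omega) _ _, fun _ _ => rfl, fun _ _ => rfl⟩
  | setIdx s a e f v =>
    have hk : k ≤ a := by simpa [Program.fresh] using hp
    exact ⟨fun _ _ => rfl, fun y hy => Function.update_of_ne (by omega) _ _, fun _ _ => rfl⟩
  | setNum s a e f v =>
    have hk : k ≤ a := by simpa [Program.fresh] using hp
    exact ⟨fun _ _ => rfl, fun _ _ => rfl, fun y hy => Function.update_of_ne (by omega) _ _⟩
  | seq _ _ h₁ h₂ =>
    simp only [Program.fresh, Bool.and_eq_true] at hp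
    exact (h₁ hp.1).trans (h₂ hp.2)
  | ite_true _ _ h₁ =>
    simp only [Program.fresh, Bool.and_eq_true] at hp
    exact h₁ hp.1
  | ite_false _ _ h₁ =>
    simp only [Program.fresh, Bool.and_eq_true] at hp
    exact h₁ hp.2
  | loop_true _ _ _ h₁ h₂ =>
    exact (h₁ hp).trans (h₂ hp)

theorem WP.frame {p : Program} {s : Memory} {Q : ℕ → Memory → Prop} (h : WP p s Q) (k : ℕ)
    (hp : p.fresh k = true) : WP p s fun t s' => Q t s' ∧ Frame k s s' := by
  obtain ⟨t, s', he, hq⟩ := h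
  exact ⟨t, s', he, hq, he.frame hp⟩

/-- A loop with `n` rounds, the invariant `Inv`, and the bound `T i` for the first `i` rounds. -/
theorem wp_loop {b : BExp} {p : Program} {s : Memory} (k n : ℕ) (Inv : ℕ → Memory → Prop)
    (T : ℕ → ℕ) (hk : p.fresh k = true) (h0 : Inv 0 s)
    (hb : ∀ i < n, ∀ s', Frame k s s' → Inv i s' → b.eval s' = true ∧
      WP p s' fun t s'' => T i + (t + 1 + b.cost) ≤ T (i + 1) ∧ Inv (i + 1) s'')
    (he : ∀ s', Frame k s s' → Inv n s' → b.eval s' = false) :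
    WP (.loop b p) s fun t s' => t ≤ T n + 1 + b.cost ∧ Inv n s' ∧ Frame k s s' := by
  -- Induction on the number `j` of rounds still to come, since an execution of a loop is built from
  -- its last round backwards.
  have key : ∀ j ≤ n, ∀ s', Frame k s s' → Inv (n - j) s' →
      WP (.loop b p) s' fun t s'' =>
        T (n - j) + t ≤ T n + 1 + b.cost ∧ Inv n s'' ∧ Frame k s s'' := by
    intro j
    induction j with
    | zero =>
      intro _ s' hf hi
      exact ⟨_, _, .loop_false (he s' hf hi), by simp; omega, hi, hf⟩
    | succ j ih =>
      intro hj s' hf hi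
      obtain ⟨hbt, t, s'', hex, ht, hi'⟩ := hb (n - (j + 1)) (by omega) s' hf hi
      rw [show n - (j + 1) + 1 = n - j by omega] at ht hi'
      obtain ⟨t', s₃, hex', ht', hi₃, hf₃⟩ :=
        ih (by omega) s'' (hf.trans (hex.frame hk)) hi'
      exact ⟨_, _, .loop_true hbt hex hex', by omega, hi₃, hf₃⟩
  have := key n le_rfl s (Frame.refl _ _) (by simpa using h0)
  simp only [Nat.sub_self] at this
  exact this.mono fun t s' h => ⟨by omega, h.2⟩

theorem WP.computesWithin {p : Program} {s : Memory} {z : ℂ} {T : ℝ} {T' : ℕ}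
    (h : WP p s fun t s' => t ≤ T' ∧ s'.num 1 0 0 = z) (hT : (T' : ℝ) ≤ T) :
    ComputesWithin p s z T := by
  obtain ⟨t, s', he, ht, hz⟩ := h
  exact ⟨t, s', he, hz, le_trans (by exact_mod_cast ht) hT⟩

/-! ### Reading an updated memory -/

section Read

variable (s : Memory) (x v a i j : ℕ) (z : ℂ)

theorem Memory.setVar_var (y : ℕ) : (s.setVar x v).var y = if y = x then v else s.var y := by
  simp [Memory.setVar, Function.update_apply]

theorem Memory.setVar_idx : (s.setVar x v).idx = s.idx := rfl

theorem Memory.setVar_num : (s.setVar x v).num = s.num := rfl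

theorem Memory.setIdx_var : (s.setIdx a i j v).var = s.var := rfl

theorem Memory.setIdx_num : (s.setIdx a i j v).num = s.num := rfl

theorem Memory.setIdx_idx (b k l : ℕ) : (s.setIdx a i j v).idx b k l =
    if b = a ∧ k = i ∧ l = j then v else s.idx b k l := by
  by_cases h1 : b = a <;> by_cases h2 : k = i <;> by_cases h3 : l = j <;>
    simp [Memory.setIdx, h1, h2, h3, Function.update_of_ne]

theorem Memory.setNum_var : (s.setNum a i j z).var = s.var := rfl

theorem Memory.setNum_idx : (s.setNum a i j z).idx = s.idx := rfl

theorem Memory.setNum_num (b k l : ℕ) : (s.setNum a i j z).num b k l =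
    if b = a ∧ k = i ∧ l = j then z else s.num b k l := by
  by_cases h1 : b = a <;> by_cases h2 : k = i <;> by_cases h3 : l = j <;>
    simp [Memory.setNum, h1, h2, h3, Function.update_of_ne]

end Read

attribute [simp] wp_skip wp_setVar wp_setIdx wp_setNum wp_seq wp_ite Memory.setVar_var
  Memory.setVar_idx Memory.setVar_num Memory.setIdx_var Memory.setIdx_num Memory.setIdx_idx
  Memory.setNum_var Memory.setNum_idx Memory.setNum_num IExp.eval IExp.cost NExp.eval NExp.cost
  BExp.eval BExp.cost

/-! ## The fast Fourier transform -/

/-- The root of unity `exp (2 π i / n)`. -/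
noncomputable def rootOfUnity (n : ℕ) : ℂ := Complex.exp (2 * Real.pi * Complex.I / (n : ℂ))

theorem rootOfUnity_isPrimitiveRoot {n : ℕ} (hn : n ≠ 0) : IsPrimitiveRoot (rootOfUnity n) n :=
  Complex.isPrimitiveRoot_exp n hn

theorem rootOfUnity_pow_self {n : ℕ} (hn : n ≠ 0) : rootOfUnity n ^ n = 1 :=
  (rootOfUnity_isPrimitiveRoot hn).pow_eq_one

theorem rootOfUnity_two_mul_sq (n : ℕ) : rootOfUnity (2 * n) ^ 2 = rootOfUnity n := by
  rw [rootOfUnity, rootOfUnity, ← Complex.exp_nat_mul]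
  congr 1
  rcases eq_or_ne n 0 with rfl | hn
  · simp
  · have : (n : ℂ) ≠ 0 := by exact_mod_cast hn
    push_cast
    field_simp

theorem rootOfUnity_two_mul_pow {n : ℕ} (hn : n ≠ 0) : rootOfUnity (2 * n) ^ n = -1 := by
  rw [rootOfUnity, ← Complex.exp_nat_mul, ← Complex.exp_pi_mul_I]
  congr 1
  have : (n : ℂ) ≠ 0 := by exact_mod_cast hn
  push_cast
  field_simp

/-- The discrete Fourier transform of `f 0, …, f (n - 1)`. -/
noncomputable def dft (n : ℕ) (f : ℕ → ℂ) (a : ℕ) : ℂ :=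
  ∑ u ∈ Finset.range n, f u * rootOfUnity n ^ (u * a)

/-- The `k`-th stage of the fast Fourier transform of length `2 ^ h`: for `b < 2 ^ (h - k)`, the
entries `b 2 ^ k + a` are the transform of the values at the places `b + 2 ^ (h - k) u`. -/
noncomputable def fftStage (h : ℕ) (f : ℕ → ℂ) (k c : ℕ) : ℂ :=
  ∑ u ∈ Finset.range (2 ^ k), f (c / 2 ^ k + 2 ^ (h - k) * u) * rootOfUnity (2 ^ k) ^ (u * (c % 2 ^ k))

theorem sum_range_two_mul {M : Type*} [AddCommMonoid M] (f : ℕ → M) (n : ℕ) :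
    ∑ u ∈ Finset.range (2 * n), f u =
      ∑ v ∈ Finset.range n, f (2 * v) + ∑ v ∈ Finset.range n, f (2 * v + 1) := by
  induction n with
  | zero => simp
  | succ n ih =>
    rw [show 2 * (n + 1) = 2 * n + 1 + 1 by ring, Finset.sum_range_succ, Finset.sum_range_succ, ih,
      Finset.sum_range_succ, Finset.sum_range_succ]
    abel

theorem fftStage_zero (h : ℕ) (f : ℕ → ℂ) (c : ℕ) : fftStage h f 0 c = f c := by
  simp [fftStage, Nat.mod_one]

theorem fftStage_self (h : ℕ) (f : ℕ → ℂ) {c : ℕ} (hc : c < 2 ^ h) :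
    fftStage h f h c = dft (2 ^ h) f c := by
  simp [fftStage, dft, Nat.mod_eq_of_lt hc, Nat.div_eq_of_lt hc]

/-- Cooley–Tukey: the sum over u is split by parity. The square of the root of order 2^(k+1) is the
root of order 2^k, so both halves are entries of stage k, and the odd terms carry one extra factor.
-/
theorem fftStage_succ_aux {h k : ℕ} (hk : k < h) (f : ℕ → ℂ) (b a : ℕ) (ha : a < 2 ^ (k + 1)) :
    fftStage h f (k + 1) (2 ^ (k + 1) * b + a) =
      ∑ v ∈ Finset.range (2 ^ k), f (b + 2 ^ (h - k) * v) * rootOfUnity (2 ^ k) ^ (v * a) +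
      rootOfUnity (2 ^ (k + 1)) ^ a *
        ∑ v ∈ Finset.range (2 ^ k), f (b + 2 ^ (h - 1 - k) + 2 ^ (h - k) * v) *
          rootOfUnity (2 ^ k) ^ (v * a) := by
  have h1 : (2 ^ (k + 1) * b + a) / 2 ^ (k + 1) = b := by
    rw [Nat.mul_add_div (by positivity), Nat.div_eq_of_lt ha, add_zero]
  have h2 : (2 ^ (k + 1) * b + a) % 2 ^ (k + 1) = a := by
    rw [Nat.mul_add_mod, Nat.mod_eq_of_lt ha]
  have h3 : 2 ^ (h - k) = 2 * 2 ^ (h - (k + 1)) := by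
    rw [← pow_succ']; congr 1; omega
  have h3' : 2 ^ (k + 1) = 2 * 2 ^ k := pow_succ' _ _
  have h4 : rootOfUnity (2 ^ k) = rootOfUnity (2 ^ (k + 1)) ^ 2 := by
    rw [h3', rootOfUnity_two_mul_sq]
  rw [fftStage, h1, h2, show 2 ^ (k + 1) = 2 * 2 ^ k by ring, sum_range_two_mul, Finset.mul_sum,
    h3, show h - 1 - k = h - (k + 1) by omega, h4, show 2 ^ (k + 1) = 2 * 2 ^ k by ring]
  congr 1 <;> refine Finset.sum_congr rfl fun v _ => ?_
  · rw [← pow_mul]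
    congr 2 <;> ring
  · rw [← pow_mul, mul_left_comm, ← pow_add]
    congr 2 <;> ring

/-- The two outputs of a butterfly differ by a shift of a by 2^k. This shift does not change the
roots of order 2^k, and it multiplies the twiddle factor by -1. With q = 2^k b + a, the outputs are
at 2^(k+1) b + a and 2^k places further. -/
theorem fftStage_succ {h k q : ℕ} (hk : k < h) (f : ℕ → ℂ) :
    fftStage h f (k + 1) (2 * q - q % 2 ^ k) =
      fftStage h f k q + rootOfUnity (2 ^ (k + 1)) ^ (q % 2 ^ k) *
        fftStage h f k (q + 2 ^ (h - 1)) ∧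
    fftStage h f (k + 1) (2 * q - q % 2 ^ k + 2 ^ k) =
      fftStage h f k q - rootOfUnity (2 ^ (k + 1)) ^ (q % 2 ^ k) *
        fftStage h f k (q + 2 ^ (h - 1)) := by
  have hs : 0 < 2 ^ k := by positivity
  set a := q % 2 ^ k with ha
  set b := q / 2 ^ k with hb
  have hq : q = 2 ^ k * b + a := (Nat.div_add_mod _ _).symm
  have hal : a < 2 ^ k := Nat.mod_lt _ hs
  have h1 : 2 * q - a = 2 ^ (k + 1) * b + a := by
    have : 2 ^ (k + 1) * b = 2 * (2 ^ k * b) := by ring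
    omega
  have h2 : 2 * q - a + 2 ^ k = 2 ^ (k + 1) * b + (a + 2 ^ k) := by omega
  have h3 : 2 ^ (k + 1) = 2 * 2 ^ k := by ring
  have hh : 2 ^ (h - 1) = 2 ^ k * 2 ^ (h - 1 - k) := by
    rw [← pow_add]; congr 1; omega
  have e1 : fftStage h f k q =
      ∑ v ∈ Finset.range (2 ^ k), f (b + 2 ^ (h - k) * v) * rootOfUnity (2 ^ k) ^ (v * a) := rfl
  have e2 : fftStage h f k (q + 2 ^ (h - 1)) =
      ∑ v ∈ Finset.range (2 ^ k), f (b + 2 ^ (h - 1 - k) + 2 ^ (h - k) * v) *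
          rootOfUnity (2 ^ k) ^ (v * a) := by
    rw [fftStage, hh, Nat.add_mul_div_left _ _ hs, Nat.add_mul_mod_self_left]
  have e3 : ∀ v, rootOfUnity (2 ^ k) ^ (v * (a + 2 ^ k)) = rootOfUnity (2 ^ k) ^ (v * a) := by
    intro v
    rw [mul_add, pow_add, mul_comm v (2 ^ k), pow_mul _ (2 ^ k), rootOfUnity_pow_self hs.ne']
    simp
  rw [h2, h1, fftStage_succ_aux hk f b a (by omega),
    fftStage_succ_aux hk f b (a + 2 ^ k) (by omega), ← e1, ← e2]
  refine ⟨rfl, ?_⟩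
  simp only [e3]
  rw [← e1, ← e2, pow_add, h3, rootOfUnity_two_mul_pow hs.ne']
  ring

/-- The butterflies of one pass together fill the whole next stage. -/
theorem exists_fftStage_index {h k c : ℕ} (hk : k < h) (hc : c < 2 ^ h) : ∃ q < 2 ^ (h - 1),
    c = 2 * q - q % 2 ^ k ∨ c = 2 * q - q % 2 ^ k + 2 ^ k := by
  have hs : 0 < 2 ^ k := by positivity
  have h3 : 2 ^ (k + 1) = 2 * 2 ^ k := by ring
  set b := c / 2 ^ (k + 1)
  set a := c % 2 ^ (k + 1)
  have hcab : c = 2 ^ (k + 1) * b + a := (Nat.div_add_mod _ _).symm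
  have ha : a < 2 ^ (k + 1) := Nat.mod_lt _ (by positivity)
  have hb : b < 2 ^ (h - 1 - k) := by
    apply Nat.div_lt_of_lt_mul
    rwa [← pow_add, show k + 1 + (h - 1 - k) = h by omega]
  have hh : 2 ^ (h - 1) = 2 ^ k * 2 ^ (h - 1 - k) := by
    rw [← pow_add]; congr 1; omega
  have hle : 2 ^ k * b + 2 ^ k ≤ 2 ^ (h - 1) := by
    rw [hh, ← Nat.mul_succ]
    exact Nat.mul_le_mul_left _ hb
  have hbb : 2 ^ (k + 1) * b = 2 * (2 ^ k * b) := by rw [h3, mul_assoc]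
  by_cases hlt : a < 2 ^ k
  · refine ⟨2 ^ k * b + a, by omega, Or.inl ?_⟩
    rw [Nat.mul_add_mod, Nat.mod_eq_of_lt hlt]
    omega
  · refine ⟨2 ^ k * b + (a - 2 ^ k), by omega, Or.inr ?_⟩
    rw [Nat.mul_add_mod, Nat.mod_eq_of_lt (by omega)]
    omega

/-- One butterfly of the fast Fourier transform. Variables: `66` the length, `67` half of it,
`80` the stage, `81` the block length, `82` the place, `83` the place in its block. Row `k` of the
number array `80` holds the stage `k`; the number array `81` holds the current power of a root of
unity and the root itself. -/
def fftButterfly : Program :=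
  .seq (.setNum 80 (.add (.var 80) (.lit 1)) (.sub (.add (.var 82) (.var 82)) (.var 83))
    (.add (.get 80 (.var 80) (.var 82))
      (.mul (.get 81 (.lit 0) (.lit 0)) (.get 80 (.var 80) (.add (.var 82) (.var 67)))))) <|
  .seq (.setNum 80 (.add (.var 80) (.lit 1))
      (.add (.sub (.add (.var 82) (.var 82)) (.var 83)) (.var 81))
    (.sub (.get 80 (.var 80) (.var 82))
      (.mul (.get 81 (.lit 0) (.lit 0)) (.get 80 (.var 80) (.add (.var 82) (.var 67)))))) <|
  .seq (.setNum 81 (.lit 0) (.lit 0) (.mul (.get 81 (.lit 0) (.lit 0)) (.get 81 (.lit 0) (.lit 1)))) <|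
  .seq (.setVar 83 (.add (.var 83) (.lit 1))) <|
  .seq (.ite (.eq (.var 83) (.var 81))
    (.seq (.setVar 83 (.lit 0)) (.setNum 81 (.lit 0) (.lit 0) (.cast (.lit 1)))) .skip) <|
  .setVar 82 (.add (.var 82) (.lit 1))

/-- All butterflies of one stage. -/
def fftPass : Program :=
  .seq (.setNum 81 (.lit 0) (.lit 1) (.root (.add (.var 81) (.var 81)))) <|
  .seq (.setNum 81 (.lit 0) (.lit 0) (.cast (.lit 1))) <|
  .seq (.setVar 82 (.lit 0)) <|
  .seq (.setVar 83 (.lit 0)) <|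
  .seq (.loop (.lt (.var 82) (.var 67)) fftButterfly) <|
  .seq (.setVar 81 (.add (.var 81) (.var 81))) <|
  .setVar 80 (.add (.var 80) (.lit 1))

/-- The fast Fourier transform of row `0` of the number array `80`; the result is in the row given
by the variable `80`. -/
def fft : Program :=
  .seq (.setVar 80 (.lit 0)) <|
  .seq (.setVar 81 (.lit 1)) <|
  .loop (.lt (.var 81) (.var 66)) fftPass

/-- Stage k is read from row k and stage k + 1 written to row k + 1, so nothing that is still needed
is overwritten. The residue of q and the power of the root are carried along, as the machine has
neither division of indices nor powers. -/
theorem wp_fftButterfly {s : Memory} {h k q : ℕ} (hk : k < h) (f : ℕ → ℂ) (hq : q < 2 ^ (h - 1))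
    (h67 : s.var 67 = 2 ^ (h - 1)) (h80 : s.var 80 = k) (h81 : s.var 81 = 2 ^ k)
    (h82 : s.var 82 = q) (h83 : s.var 83 = q % 2 ^ k)
    (hW : s.num 81 0 1 = rootOfUnity (2 ^ (k + 1)))
    (htw : s.num 81 0 0 = rootOfUnity (2 ^ (k + 1)) ^ (q % 2 ^ k))
    (hX : ∀ c < 2 ^ h, s.num 80 k c = fftStage h f k c) :
    WP fftButterfly s fun t s' => t ≤ 90 ∧ s'.var 80 = k ∧ s'.var 81 = 2 ^ k ∧
      s'.var 82 = q + 1 ∧ s'.var 83 = (q + 1) % 2 ^ k ∧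
      s'.num 81 0 1 = rootOfUnity (2 ^ (k + 1)) ∧
      s'.num 81 0 0 = rootOfUnity (2 ^ (k + 1)) ^ ((q + 1) % 2 ^ k) ∧
      (∀ r, r ≠ k + 1 → s'.num 80 r = s.num 80 r) ∧
      ∀ c, s'.num 80 (k + 1) c = if c = 2 * q - q % 2 ^ k ∨ c = 2 * q - q % 2 ^ k + 2 ^ k then
        fftStage h f (k + 1) c else s.num 80 (k + 1) c := by
  have hs : 0 < 2 ^ k := by positivity
  obtain ⟨e1, e2⟩ := fftStage_succ (q := q) hk f
  have hh : 2 ^ h = 2 * 2 ^ (h - 1) := by rw [← pow_succ']; congr 1; omega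
  have hmod : (q + 1) % 2 ^ k = if q % 2 ^ k + 1 = 2 ^ k then 0 else q % 2 ^ k + 1 := by
    rw [Nat.add_mod_eq_ite (m := q), ]
    rcases Nat.lt_or_ge 1 (2 ^ k) with h1 | h1
    · rw [Nat.mod_eq_of_lt h1]
      have := Nat.mod_lt q hs
      split_ifs <;> omega
    · have h2 : 2 ^ k = 1 := by omega
      simp [h2, Nat.mod_one]
  have x1 := hX q (by omega)
  have x2 := hX (q + 2 ^ (h - 1)) (by omega)
  by_cases hc : q % 2 ^ k + 1 = 2 ^ k
  · simp [fftButterfly, h67, h80, h81, h82, h83, hW, htw, x1, x2, hmod, hc]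
    refine ⟨fun r hr => funext fun j => by simp [hr], fun c => ?_⟩
    rw [← two_mul]
    by_cases c1 : c = 2 * q - q % 2 ^ k
    · subst c1
      simp [e1]
    · by_cases c2 : c = 2 * q - q % 2 ^ k + 2 ^ k
      · subst c2
        simp [e2]
      · simp [c1, c2]
  · simp [fftButterfly, h67, h80, h81, h82, h83, hW, htw, x1, x2, hmod, hc]
    refine ⟨(pow_succ _ _).symm, fun r hr => funext fun j => by simp [hr], fun c => ?_⟩
    rw [← two_mul]
    by_cases c1 : c = 2 * q - q % 2 ^ k
    · subst c1
      simp [e1]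
    · by_cases c2 : c = 2 * q - q % 2 ^ k + 2 ^ k
      · subst c2
        simp [e2]
      · simp [c1, c2]

theorem wp_fftPass {s : Memory} {h k : ℕ} (hk : k < h) (f : ℕ → ℂ)
    (h67 : s.var 67 = 2 ^ (h - 1)) (h80 : s.var 80 = k) (h81 : s.var 81 = 2 ^ k)
    (hX : ∀ c < 2 ^ h, s.num 80 k c = fftStage h f k c) :
    WP fftPass s fun t s' => t ≤ 100 * 2 ^ h ∧ s'.var 80 = k + 1 ∧ s'.var 81 = 2 ^ (k + 1) ∧
      ∀ c < 2 ^ h, s'.num 80 (k + 1) c = fftStage h f (k + 1) c := by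
  have hh : 2 ^ h = 2 * 2 ^ (h - 1) := by rw [← pow_succ']; congr 1; omega
  have hpos : 0 < 2 ^ (h - 1) := by positivity
  simp only [fftPass, wp_seq, wp_setNum, wp_setVar]
  refine WP.mono (wp_loop 80 (2 ^ (h - 1)) (fun q s' => s'.var 80 = k ∧ s'.var 81 = 2 ^ k ∧
      s'.var 82 = q ∧ s'.var 83 = q % 2 ^ k ∧ s'.num 81 0 1 = rootOfUnity (2 ^ (k + 1)) ∧
      s'.num 81 0 0 = rootOfUnity (2 ^ (k + 1)) ^ (q % 2 ^ k) ∧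
      (∀ c < 2 ^ h, s'.num 80 k c = fftStage h f k c) ∧
      ∀ q' < q, s'.num 80 (k + 1) (2 * q' - q' % 2 ^ k) = 
          fftStage h f (k + 1) (2 * q' - q' % 2 ^ k) ∧
        s'.num 80 (k + 1) (2 * q' - q' % 2 ^ k + 2 ^ k) = 
          fftStage h f (k + 1) (2 * q' - q' % 2 ^ k + 2 ^ k)) (fun q => q * 95) (by decide) ?_ ?_ ?_) ?_
  · simp [h80, h81, pow_succ', two_mul, rootOfUnity]
    exact hX
  · rintro q hq s' hf ⟨i1, i2, i3, i4, i5, i6, i7, i8⟩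
    have g67 : s'.var 67 = 2 ^ (h - 1) := by rw [hf.var 67 (by norm_num)]; simpa using h67
    refine ⟨by simp [i3, g67, hq], (wp_fftButterfly hk f hq g67 i1 i2 i3 i4 i5 i6 i7).mono ?_⟩
    rintro t s'' ⟨ht, j1, j2, j3, j4, j5, j6, j7, j8⟩
    refine ⟨by simp; omega, j1, j2, j3, j4, j5, j6, ?_, ?_⟩
    · intro c hc
      rw [j7 k (by omega), i7 c hc]
    · intro q' hq'
      rw [j8, j8]
      rcases Nat.lt_succ_iff_lt_or_eq.mp hq' with hlt | rfl
      · rw [(i8 q' hlt).1, (i8 q' hlt).2]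
        simp
      · simp
  · rintro s' hf ⟨i1, i2, i3, -⟩
    have g67 : s'.var 67 = 2 ^ (h - 1) := by rw [hf.var 67 (by norm_num)]; simpa using h67
    simp [i3, g67]
  · rintro t s' ⟨ht, ⟨i1, i2, i3, i4, i5, i6, i7, i8⟩, hf⟩
    simp at ht
    simp [i1, i2, pow_succ']
    refine ⟨by omega, by omega, fun c hc => ?_⟩
    obtain ⟨q, hq, rfl | rfl⟩ := exists_fftStage_index hk hc
    · exact (i8 q hq).1
    · exact (i8 q hq).2

theorem wp_fft {s : Memory} {h : ℕ} (h66 : s.var 66 = 2 ^ h)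
    (h67 : s.var 67 = 2 ^ (h - 1)) :
    WP fft s fun t s' => t ≤ 120 * (2 ^ h * (h + 1)) ∧ s'.var 80 = h ∧
      (∀ c < 2 ^ h, s'.num 80 h c = dft (2 ^ h) (s.num 80 0) c) ∧ Frame 80 s s' := by
  refine WP.mono (WP.frame (Q := fun t s' => t ≤ 120 * (2 ^ h * (h + 1)) ∧ s'.var 80 = h ∧
      (∀ c < 2 ^ h, s'.num 80 h c = dft (2 ^ h) (s.num 80 0) c)) ?_ 80 (by decide))
    (by rintro t s' ⟨⟨a, b, c⟩, d⟩; exact ⟨a, b, c, d⟩)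
  simp only [fft, wp_seq, wp_setVar]
  refine WP.mono (wp_loop 80 h (fun k s' => s'.var 80 = k ∧ s'.var 81 = 2 ^ k ∧
      (∀ c < 2 ^ h, s'.num 80 k c = fftStage h (s.num 80 0) k c)) (fun k => k * (105 * 2 ^ h))
      (by decide) ?_ ?_ ?_) ?_
  · simp [fftStage_zero]
  · rintro k hk s' hf ⟨i1, i2, i3⟩
    have g67 : s'.var 67 = 2 ^ (h - 1) := by rw [hf.var 67 (by norm_num)]; simpa using h67
    have g66 : s'.var 66 = 2 ^ h := by rw [hf.var 66 (by norm_num)]; simpa using h66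
    refine ⟨by simpa [i2, g66] using Nat.pow_lt_pow_right one_lt_two hk, (wp_fftPass hk _ g67 i1 i2 i3).mono ?_⟩
    rintro t s'' ⟨ht, j⟩
    refine ⟨?_, j⟩
    have : 0 < 2 ^ h := by positivity
    simp
    nlinarith
  · rintro s' hf ⟨i1, i2, i3⟩
    have g66 : s'.var 66 = 2 ^ h := by rw [hf.var 66 (by norm_num)]; simpa using h66
    simp [i2, g66]
  · rintro t s' ⟨ht, ⟨i1, i2, i3⟩, hf⟩
    refine ⟨?_, i1, fun c hc => by rw [i3 c hc, fftStage_self h _ hc]⟩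
    have : 0 < 2 ^ h := by positivity
    simp at ht ⊢
    nlinarith

/-- A cyclic convolution, read off from a product of Fourier transforms by a third transform. -/
theorem dft_mul_dft {n : ℕ} (hn : n ≠ 0) (f g : ℕ → ℂ) (c : ℕ) :
    dft n (fun a => dft n f a * dft n g a) c =
      n * ∑ i ∈ Finset.range n, ∑ j ∈ Finset.range n, if n ∣ i + j + c then f i * g j else 0 := by
  -- Orthogonality of characters. Three forward transforms suffice for a convolution; the sign that
  -- an inverse transform would have is accounted for when the result is read.
  have hsum : ∀ t, ∑ a ∈ Finset.range n, rootOfUnity n ^ (a * t) = if n ∣ t then (n : ℂ) else 0 := by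
    intro t
    have hp := rootOfUnity_isPrimitiveRoot hn
    split_ifs with h
    · obtain ⟨k, rfl⟩ := h
      rw [Finset.sum_congr rfl (g := fun _ => (1 : ℂ)), Finset.sum_const] 
      · simp
      · intro a _
        rw [show a * (n * k) = n * (a * k) by ring, pow_mul, hp.pow_eq_one, one_pow]
    · have h1 : rootOfUnity n ^ t ≠ 1 := fun h' => h (hp.dvd_of_pow_eq_one t h')
      have := geom_sum_eq h1 n
      simp_rw [mul_comm _ t, pow_mul]
      rw [this, ← pow_mul, mul_comm, pow_mul, hp.pow_eq_one]
      simp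
  simp only [dft]
  have : ∀ a, ((∑ u ∈ Finset.range n, f u * rootOfUnity n ^ (u * a)) *
      ∑ u ∈ Finset.range n, g u * rootOfUnity n ^ (u * a)) * rootOfUnity n ^ (a * c) =
      ∑ i ∈ Finset.range n, ∑ j ∈ Finset.range n, f i * g j * rootOfUnity n ^ (a * (i + j + c)) := by
    intro a
    rw [Finset.sum_mul_sum, Finset.sum_mul]
    refine Finset.sum_congr rfl fun i _ => ?_
    rw [Finset.sum_mul]
    refine Finset.sum_congr rfl fun j _ => ?_
    ring
  simp_rw [this]
  rw [Finset.sum_comm, Finset.mul_sum]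
  refine Finset.sum_congr rfl fun i _ => ?_
  rw [Finset.sum_comm, Finset.mul_sum]
  refine Finset.sum_congr rfl fun j _ => ?_
  rw [← Finset.mul_sum, hsum]
  split_ifs <;> ring

/-! ## Mixed radix numbers and truncated power series -/

section MixedRadix

variable (m : ℕ → ℕ)

/-- The number of exponent vectors on the list `D` that are bounded by `m`. -/
def boxSize (D : List ℕ) : ℕ := (D.map fun v => m v + 1).prod

/-- The exponent vector `ν` on the list `D`, read as a mixed radix number. -/
def mixedRadix : List ℕ → (ℕ → ℕ) → ℕ
  | [], _ => 0
  | v :: D, ν => ν v + (m v + 1) * mixedRadix D ν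

/-- The sum of the values of `mixedRadix` on the proper tails of `D`: it detects carries. -/
def carryWeight : List ℕ → (ℕ → ℕ) → ℕ
  | [], _ => 0
  | _ :: D, ν => mixedRadix m D ν + carryWeight D ν

/-- The linear function of `ν` with the weights `x`, `(m v + 1) x + H`, … on the list `D`. -/
def linearIndex (H : ℕ) : ℕ → List ℕ → (ℕ → ℕ) → ℕ
  | _, [], _ => 0
  | x, v :: D, ν => ν v * x + linearIndex H ((m v + 1) * x + H) D ν

theorem boxSize_cons (v : ℕ) (D : List ℕ) : boxSize m (v :: D) = (m v + 1) * boxSize m D := by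
  simp [boxSize]

@[simp] theorem boxSize_nil : boxSize m [] = 1 := rfl

theorem boxSize_concat (D : List ℕ) (v : ℕ) : boxSize m (D ++ [v]) = boxSize m D * (m v + 1) := by
  simp [boxSize]

theorem boxSize_pos (D : List ℕ) : 0 < boxSize m D := by
  induction D with
  | nil => simp
  | cons v D ih => rw [boxSize_cons]; positivity

theorem mixedRadix_concat (D : List ℕ) (v : ℕ) (ν : ℕ → ℕ) :
    mixedRadix m (D ++ [v]) ν = mixedRadix m D ν + boxSize m D * ν v := by
  induction D with
  | nil => simp [mixedRadix]
  | cons u D ih =>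
    rw [List.cons_append, mixedRadix, ih, mixedRadix, boxSize_cons]
    ring

variable {m}

theorem mixedRadix_lt {D : List ℕ} {ν : ℕ → ℕ} (h : ∀ v ∈ D, ν v ≤ m v) :
    mixedRadix m D ν < boxSize m D := by
  induction D with
  | nil => simp [mixedRadix]
  | cons v D ih =>
    have h1 := h v (by simp)
    have h2 := ih fun u hu => h u (by simp [hu])
    rw [mixedRadix, boxSize_cons]
    nlinarith

theorem mixedRadix_congr {D : List ℕ} {μ ν : ℕ → ℕ} (h : ∀ v ∈ D, μ v = ν v) :
    mixedRadix m D μ = mixedRadix m D ν := by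
  induction D with
  | nil => rfl
  | cons v D ih =>
    rw [mixedRadix, mixedRadix, h v (by simp), ih fun u hu => h u (by simp [hu])]

theorem mixedRadix_injOn {D : List ℕ} {μ ν : ℕ → ℕ} (hμ : ∀ v ∈ D, μ v ≤ m v)
    (hν : ∀ v ∈ D, ν v ≤ m v) (h : mixedRadix m D μ = mixedRadix m D ν) :
    ∀ v ∈ D, μ v = ν v := by
  induction D with
  | nil => simp
  | cons v D ih =>
    rw [mixedRadix, mixedRadix] at h
    have h1 := hμ v (by simp)
    have h2 := hν v (by simp)
    have h3 : μ v = ν v := by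
      have := congrArg (· % (m v + 1)) h
      simpa [Nat.add_mul_mod_self_left, Nat.mod_eq_of_lt (Nat.lt_succ_of_le h1),
        Nat.mod_eq_of_lt (Nat.lt_succ_of_le h2)] using this
    have h4 : mixedRadix m D μ = mixedRadix m D ν := by
      rw [h3] at h
      exact Nat.eq_of_mul_eq_mul_left (Nat.succ_pos (m v)) (Nat.add_left_cancel h)
    intro u hu
    rcases List.mem_cons.mp hu with rfl | hu
    · exact h3
    · exact ih (fun u hu => hμ u (by simp [hu])) (fun u hu => hν u (by simp [hu])) h4 u hu

theorem exists_mixedRadix {D : List ℕ} (hD : D.Nodup) {i : ℕ} (hi : i < boxSize m D) :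
    ∃ ν : ℕ → ℕ, (∀ v ∈ D, ν v ≤ m v) ∧ (∀ v ∉ D, ν v = 0) ∧ mixedRadix m D ν = i := by
  induction D generalizing i with
  | nil =>
    refine ⟨0, by simp, by simp, ?_⟩
    simp at hi
    simp [mixedRadix, hi]
  | cons v D ih =>
    obtain ⟨hv, hD⟩ := List.nodup_cons.mp hD
    rw [boxSize_cons] at hi
    obtain ⟨ν, h1, h2, h3⟩ := ih hD (Nat.div_lt_of_lt_mul hi)
    have hne : ∀ u ∈ D, u ≠ v := fun u hu h => hv (h ▸ hu)
    -- The head of the list is the least significant digit.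
    refine ⟨Function.update ν v (i % (m v + 1)), ?_, ?_, ?_⟩
    · intro u hu
      rcases List.mem_cons.mp hu with rfl | hu
      · simpa using Nat.le_of_lt_succ (Nat.mod_lt i (Nat.succ_pos _))
      · rw [Function.update_of_ne (hne u hu)]
        exact h1 u hu
    · intro u hu
      rw [List.mem_cons, not_or] at hu
      rw [Function.update_of_ne hu.1]
      exact h2 u hu.2
    · rw [mixedRadix, Function.update_self,
        mixedRadix_congr fun u hu => Function.update_of_ne (hne u hu) _ _, h3]
      exact Nat.mod_add_div _ _

/-- The recursion w ↦ (m v + 1) w + H for the weights adds one H for every proper tail in which a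
digit occurs. Being linear in `ν`, the combination of the value and the carry detector is additive,
and it can be tabulated by additions only. -/
theorem linearIndex_eq (H x : ℕ) (D : List ℕ) (ν : ℕ → ℕ) :
    linearIndex m H x D ν = x * mixedRadix m D ν + H * carryWeight m D ν := by
  induction D generalizing x with
  | nil => simp [linearIndex, mixedRadix, carryWeight]
  | cons v D ih =>
    rw [linearIndex, ih, mixedRadix, carryWeight]
    ring

/-- In the addition of two mixed radix numbers, with a carry `t` into the last digit and no
overflow, the weights `carryWeight` are additive exactly when nothing is carried. -/
theorem exists_carry {D : List ℕ} {a b c : ℕ → ℕ} {t : ℕ} (ha : ∀ v ∈ D, a v ≤ m v)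
    (hb : ∀ v ∈ D, b v ≤ m v) (hc : ∀ v ∈ D, c v ≤ m v) (ht : t ≤ 1)
    (h : mixedRadix m D a + mixedRadix m D b + t = mixedRadix m D c) :
    ∃ κ ≤ D.length, carryWeight m D c = carryWeight m D a + carryWeight m D b + κ ∧
      (κ = 0 → t = 0 → ∀ v ∈ D, a v + b v = c v) := by
  induction D generalizing t with
  | nil => exact ⟨0, le_rfl, by simp [carryWeight], by simp⟩
  | cons v D ih =>
    have ha' := ha v (by simp)
    have hb' := hb v (by simp)
    have hc' := hc v (by simp)
    simp only [mixedRadix] at h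
    -- Here `t'` is the carry out of the least significant digit. It is at most 1 because both
    -- digits are at most `m v` and the incoming carry is at most 1; it becomes the incoming carry
    -- of the tail, and `κ` is the sum of all these carries.
    obtain ⟨t', ht', e1, e2⟩ : ∃ t' ≤ 1, a v + b v + t = c v + (m v + 1) * t' ∧
        mixedRadix m D a + mixedRadix m D b + t' = mixedRadix m D c := by
      have hlt : mixedRadix m D a + mixedRadix m D b ≤ mixedRadix m D c := by
        by_contra! hlt
        have : (m v + 1) * (mixedRadix m D c + 1) ≤
            (m v + 1) * (mixedRadix m D a + mixedRadix m D b) := Nat.mul_le_mul_left _ hlt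
        nlinarith
      obtain ⟨t', e⟩ := Nat.exists_eq_add_of_le hlt
      rw [e] at h
      have e1 : a v + b v + t = c v + (m v + 1) * t' := by nlinarith
      refine ⟨t', ?_, e1, e.symm⟩
      by_contra! h2
      have : (m v + 1) * 2 ≤ (m v + 1) * t' := Nat.mul_le_mul_left _ h2
      omega
    obtain ⟨κ, k1, k2, k3⟩ := ih (fun u hu => ha u (by simp [hu])) (fun u hu => hb u (by simp [hu]))
      (fun u hu => hc u (by simp [hu])) ht' e2
    refine ⟨t' + κ, by simp; omega, by simp only [carryWeight]; omega, ?_⟩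
    intro h0 ht0
    obtain ⟨rfl, rfl⟩ : t' = 0 ∧ κ = 0 := by omega
    intro u hu
    rcases List.mem_cons.mp hu with rfl | hu
    · omega
    · exact k3 rfl rfl u hu

/-- Modulo `H L`, the index `linearIndex` turns sums into sums that can be recognized. -/
theorem linearIndex_add_modEq_iff {D : List ℕ} {a b c : ℕ → ℕ} {H L : ℕ} (ha : ∀ v ∈ D, a v ≤ m v)
    (hb : ∀ v ∈ D, b v ≤ m v) (hc : ∀ v ∈ D, c v ≤ m v) (hH : 2 * boxSize m D ≤ H)
    (hL : D.length < L) :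
    linearIndex m H 1 D a + linearIndex m H 1 D b ≡ linearIndex m H 1 D c [MOD H * L] ↔
      ∀ v ∈ D, a v + b v = c v := by
  have hHpos : 0 < H := by have := boxSize_pos m D; omega
  constructor
  · intro h
    simp only [linearIndex_eq, one_mul] at h
    have ea := mixedRadix_lt ha
    have eb := mixedRadix_lt hb
    have ec := mixedRadix_lt hc
    -- Modulo `H` only the mixed radix values are left. As `H` is at least twice the box size, both
    -- sides are less than `H`, and the congruence is an equality.
    have h1 : mixedRadix m D a + mixedRadix m D b = mixedRadix m D c := by
      have h1 := h.of_mul_right L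
      have h2 : mixedRadix m D a + mixedRadix m D b ≡ mixedRadix m D c [MOD H] := by
        unfold Nat.ModEq at h1 ⊢
        have e1 : mixedRadix m D a + H * carryWeight m D a +
          (mixedRadix m D b + H * carryWeight m D b) = mixedRadix m D a + mixedRadix m D b +
            H * (carryWeight m D a + carryWeight m D b) := by ring
        rwa [e1, Nat.add_mul_mod_self_left, Nat.add_mul_mod_self_left] at h1
      exact Nat.ModEq.eq_of_lt_of_lt h2 (by omega) (by omega)
    obtain ⟨κ, k1, k2, k3⟩ := exists_carry (t := 0) ha hb hc (by simp) (by simpa using h1)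
    refine k3 ?_ rfl
    rw [k2, ← h1, show mixedRadix m D a + H * carryWeight m D a +
      (mixedRadix m D b + H * carryWeight m D b) = (mixedRadix m D a + mixedRadix m D b +
        H * (carryWeight m D a + carryWeight m D b)) + 0 by ring,
      show mixedRadix m D a + mixedRadix m D b + H * (carryWeight m D a + carryWeight m D b + κ) =
      (mixedRadix m D a + mixedRadix m D b +
        H * (carryWeight m D a + carryWeight m D b)) + H * κ by ring] at h
    have h2 := Nat.ModEq.add_left_cancel' _ h
    have h3 : H * L ∣ H * κ := (Nat.modEq_zero_iff_dvd).mp h2.symm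
    -- The number of carries is divisible by `L` and at most the length of the list, which is less
    -- than `L`; so it vanishes.
    exact Nat.eq_zero_of_dvd_of_lt (Nat.dvd_of_mul_dvd_mul_left hHpos h3) (by omega)
  · intro h
    have : linearIndex m H 1 D a + linearIndex m H 1 D b = linearIndex m H 1 D c := by
      generalize 1 = x
      clear hH hL
      induction D generalizing x with
      | nil => rfl
      | cons v D ih =>
        simp only [linearIndex]
        rw [← ih (fun u hu => ha u (by simp [hu])) (fun u hu => hb u (by simp [hu]))
          (fun u hu => hc u (by simp [hu])) (fun u hu => h u (by simp [hu])), ← h v (by simp)]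
        ring
    rw [this]

end MixedRadix

/-! ### Tables of coefficients -/

/-- `A` lists the coefficients of the power series `F` at the exponent vectors on the list `D` that
are bounded by `m`, and `F` involves only the variables in `D`. -/
structure IsTable (m : ℕ → ℕ) (D : List ℕ) (A : ℕ → ℂ) (F : MvPowerSeries ℕ ℂ) : Prop where
  coeff_eq : ∀ ν : ℕ →₀ ℕ, (∀ v ∈ D, ν v ≤ m v) → (∀ v ∉ D, ν v = 0) →
    A (mixedRadix m D ν) = MvPowerSeries.coeff ν F
  coeff_zero : ∀ ν : ℕ →₀ ℕ, ∀ v ∉ D, ν v ≠ 0 → MvPowerSeries.coeff ν F = 0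

/-- The number that the addition of `φ v` for every occurrence of `v` in `ν` gives. -/
def weightedSum (φ : ℕ → ℕ) (D : List ℕ) (ν : ℕ → ℕ) : ℕ := (D.map fun v => ν v * φ v).sum

/-- The two factors of a product have tables on different lists. As exponents outside the smaller
list vanish, one set of weights serves both. -/
theorem weightedSum_subset {φ : ℕ → ℕ} {D E : List ℕ} {ν : ℕ → ℕ} (hD : D.Nodup) (hE : E.Nodup)
    (h : ∀ v ∈ E, v ∈ D) (hν : ∀ v ∉ E, ν v = 0) : weightedSum φ E ν = weightedSum φ D ν := by
  rw [weightedSum, weightedSum, ← List.sum_toFinset _ hE, ← List.sum_toFinset _ hD]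
  refine Finset.sum_subset (fun v => by simpa using h v) fun v _ hv => ?_
  rw [hν v (by simpa using hv), zero_mul]

/-- The product of two truncated power series as a sum over pairs of table entries whose indices
match modulo `n`. -/
theorem IsTable.mul {m : ℕ → ℕ} {K J : List ℕ} {A B C : ℕ → ℂ} {F G : MvPowerSeries ℕ ℂ}
    {φ e e' : ℕ → ℕ} {n : ℕ} (hK : K.Nodup) (hJ : J.Nodup) (hJK : ∀ v ∈ J, v ∈ K)
    (hF : IsTable m K A F) (hG : IsTable m J B G)
    (hφ : ∀ a b c : ℕ → ℕ, (∀ v ∈ K, a v ≤ m v) → (∀ v ∈ K, b v ≤ m v) → (∀ v ∈ K, c v ≤ m v) →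
      (weightedSum φ K a + weightedSum φ K b ≡ weightedSum φ K c [MOD n] ↔
        ∀ v ∈ K, a v + b v = c v))
    (he : ∀ ν : ℕ → ℕ, (∀ v ∈ K, ν v ≤ m v) → e (mixedRadix m K ν) = weightedSum φ K ν % n)
    (he' : ∀ ν : ℕ → ℕ, (∀ v ∈ J, ν v ≤ m v) → e' (mixedRadix m J ν) = weightedSum φ J ν % n)
    (hC : ∀ k < boxSize m K, C k = ∑ i ∈ Finset.range (boxSize m K),
      ∑ j ∈ Finset.range (boxSize m J), if e i + e' j ≡ e k [MOD n] then A i * B j else 0) :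
    IsTable m K C (F * G) := by
  classical
  refine ⟨fun ν hν hν0 => ?_, fun ν v hv h0 => ?_⟩
  · rw [hC _ (mixedRadix_lt hν), MvPowerSeries.coeff_mul, ← Finset.sum_product', ← Finset.sum_filter]
    symm
    have key : ∀ x ∈ Finset.HasAntidiagonal.antidiagonal ν, (∀ v, x.1 v + x.2 v = ν v) := by
      intro x hx v
      rw [← Finset.HasAntidiagonal.mem_antidiagonal.mp hx]
      rfl
    have ext_of {D : List ℕ} {μ μ' : ℕ →₀ ℕ} (h : ∀ v ∈ D, μ v = μ' v) (h1 : ∀ v ∉ D, μ v = 0)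
        (h2 : ∀ v ∉ D, μ' v = 0) : μ = μ' := by
      ext v
      by_cases hv : v ∈ D
      · exact h v hv
      · rw [h1 v hv, h2 v hv]
    -- Only pairs whose second component is supported on `J` contribute, and those are the ones that
    -- the table of `G` lists.
    rw [← Finset.sum_filter_of_ne (p := fun x : (ℕ →₀ ℕ) × (ℕ →₀ ℕ) => ∀ v ∉ J, x.2 v = 0)]
    swap
    · intro x hx hne v hv
      by_contra h0
      exact hne (by rw [hG.coeff_zero x.2 v hv h0, mul_zero])
    have hb : ∀ x ∈ (Finset.HasAntidiagonal.antidiagonal ν).filter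
        (fun x : (ℕ →₀ ℕ) × (ℕ →₀ ℕ) => ∀ v ∉ J, x.2 v = 0),
        (∀ v ∈ K, x.1 v ≤ m v) ∧ (∀ v ∉ K, x.1 v = 0) ∧ (∀ v ∈ K, x.2 v ≤ m v) ∧
        (∀ v ∉ J, x.2 v = 0) := by
      intro x hx
      obtain ⟨h1, h2⟩ := Finset.mem_filter.mp hx
      have h3 := key x h1
      refine ⟨fun v hv => ?_, fun v hv => ?_, fun v hv => ?_, h2⟩
      · have := hν v hv; have := h3 v; omega
      · have := hν0 v hv; have := h3 v; omega
      · have := hν v hv; have := h3 v; omega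
    -- Splittings of `ν` correspond to pairs of table positions; by `hφ`, the positions that match
    -- modulo `n` are exactly those of vectors with sum `ν`.
    refine Finset.sum_bij (fun x _ => (mixedRadix m K x.1, mixedRadix m J x.2)) ?_ ?_ ?_ ?_
    · intro x hx
      obtain ⟨h1, h2, h3, h4⟩ := hb x hx
      have h3' : ∀ v ∈ J, x.2 v ≤ m v := fun v hv => h3 v (hJK v hv)
      rw [Finset.mem_filter, Finset.mem_product, Finset.mem_range, Finset.mem_range]
      refine ⟨⟨mixedRadix_lt h1, mixedRadix_lt h3'⟩, ?_⟩
      simp only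
      rw [he _ h1, he' _ h3', he _ hν, weightedSum_subset hK hJ hJK h4]
      have := (hφ x.1 x.2 ν h1 h3 hν).mpr fun v _ => key x (Finset.mem_filter.mp hx).1 v
      exact (((Nat.mod_modEq _ _).add (Nat.mod_modEq _ _)).trans this).trans (Nat.mod_modEq _ _).symm
    · intro x hx y hy hxy
      obtain ⟨h1, h2, h3, h4⟩ := hb x hx
      obtain ⟨g1, g2, g3, g4⟩ := hb y hy
      obtain ⟨e1, e2⟩ := Prod.mk.injEq _ _ _ _ ▸ hxy
      refine Prod.ext (ext_of (mixedRadix_injOn h1 g1 e1) h2 g2) (ext_of (mixedRadix_injOn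
        (fun v hv => h3 v (hJK v hv)) (fun v hv => g3 v (hJK v hv)) e2) h4 g4)
    · rintro ⟨i, j⟩ hij
      rw [Finset.mem_filter, Finset.mem_product, Finset.mem_range, Finset.mem_range] at hij
      obtain ⟨⟨hi, hj⟩, hmod⟩ := hij
      obtain ⟨a, a1, a2, rfl⟩ := exists_mixedRadix hK hi
      obtain ⟨b, b1, b2, rfl⟩ := exists_mixedRadix hJ hj
      have b1' : ∀ v ∈ K, b v ≤ m v := by
        intro v hv
        by_cases hvJ : v ∈ J
        · exact b1 v hvJ
        · rw [b2 v hvJ]; exact Nat.zero_le _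
      simp only at hmod
      rw [he _ a1, he' _ b1, he _ hν, weightedSum_subset hK hJ hJK b2] at hmod
      have hsum := (hφ a b ν a1 b1' hν).mp ((((Nat.mod_modEq _ _).add (Nat.mod_modEq _ _)).symm.trans
        hmod).trans (Nat.mod_modEq _ _))
      have hsum' : ∀ v, a v + b v = ν v := by
        intro v
        by_cases hv : v ∈ K
        · exact hsum v hv
        · rw [a2 v hv, b2 v fun h => hv (hJK v h), hν0 v hv]
      refine ⟨(Finsupp.onFinset K.toFinset a fun v hv => ?_,
        Finsupp.onFinset K.toFinset b fun v hv => ?_), ?_, ?_⟩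
      · by_contra h; exact hv (a2 v (by simpa using h))
      · by_contra h; exact hv (b2 v fun h' => h (by simpa using hJK v h'))
      · rw [Finset.mem_filter, Finset.HasAntidiagonal.mem_antidiagonal]
        exact ⟨Finsupp.ext hsum', b2⟩
      · rfl
    · intro x hx
      obtain ⟨h1, h2, h3, h4⟩ := hb x hx
      rw [hF.coeff_eq _ h1 h2, hG.coeff_eq _ (fun v hv => h3 v (hJK v hv)) h4]
  · rw [MvPowerSeries.coeff_mul]
    refine Finset.sum_eq_zero fun x hx => ?_
    have hx' : x.1 v + x.2 v = ν v := by
      rw [← Finset.HasAntidiagonal.mem_antidiagonal.mp hx]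
      rfl
    by_cases h : x.1 v = 0
    · rw [hG.coeff_zero x.2 v (fun h' => hv (hJK v h')) (by omega), mul_zero]
    · rw [hF.coeff_zero x.1 v hv h, zero_mul]

/-! ### The index map of a truncated multiplication -/

/-- `A 0, A 1, …` begins with the list `D`. -/
def StoresList (A : ℕ → ℕ) (D : List ℕ) : Prop := ∀ i (h : i < D.length), A i = D[i]

/-- Sets the variable `75` to the product of the variable `74` and of the entry of the index array
`22` at the variable `73`, plus one. -/
def extendSize : Program :=
  .seq (.setVar 75 (.var 74)) <|
  .seq (.setVar 72 (.lit 0)) <|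
  .loop (.lt (.var 72) (.get 22 (.var 73) (.lit 0)))
    (.seq (.setVar 75 (.add (.var 75) (.var 74))) (.setVar 72 (.add (.var 72) (.lit 1))))

/-- Index expressions have no product, so the new size is found by repeated addition. The time is
proportional to the range of the new digit and hence covered by the growth of the box. -/
theorem wp_extendSize {s : Memory} {q k : ℕ} (h74 : s.var 74 = q) (h22 : s.idx 22 (s.var 73) 0 = k) :
    WP extendSize s fun t s' => t ≤ 20 * (k + 1) ∧ s'.var 75 = q * (k + 1) ∧ s'.idx = s.idx ∧
      s'.num = s.num ∧ ∀ x, x ≠ 72 → x ≠ 75 → s'.var x = s.var x := by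
  simp only [extendSize, wp_seq, wp_setVar]
  refine WP.mono (wp_loop 70 k (fun i s' => s'.var 72 = i ∧ s'.var 75 = q * (i + 1) ∧ s'.idx = s.idx ∧
      s'.num = s.num ∧ ∀ x, x ≠ 72 → x ≠ 75 → s'.var x = s.var x) (fun i => i * 20) (by decide)
      ?_ ?_ ?_) ?_
  · simp +contextual [h74]
  · rintro i hi s' hf ⟨i1, i2, i3, i4, i5⟩
    have g73 := i5 73 (by norm_num) (by norm_num)
    have g74 := i5 74 (by norm_num) (by norm_num)
    simp [i1, i2, i3, i4, g73, h22, hi, g74, h74]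
    refine ⟨by omega, by ring, ?_⟩
    intro x hx hx'
    simp [hx, hx', i5]
  · rintro s' hf ⟨i1, i2, i3, i4, i5⟩
    have g73 := i5 73 (by norm_num) (by norm_num)
    simp [i1, i3, g73, h22]
  · rintro t s' ⟨ht, ⟨i1, i2, i3, i4, i5⟩, hf⟩
    simp at ht ⊢
    exact ⟨by omega, i2, i3, i4, i5⟩

/-- Extends the index map in row `var 60` of the index array `71` to one more variable. -/
def fillIndexMap : Program :=
  .seq (.setVar 76 (.var 74)) <|
  .loop (.lt (.var 76) (.var 75)) <|
    .seq (.setVar 70 (.add (.get 71 (.var 60) (.sub (.var 76) (.var 74)))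
      (.get 60 (.var 73) (.lit 0)))) <|
    .seq (.ite (.lt (.var 70) (.var 66)) .skip (.setVar 70 (.sub (.var 70) (.var 66)))) <|
    .seq (.setIdx 71 (.var 60) (.var 76) (.var 70)) <|
    .setVar 76 (.add (.var 76) (.lit 1))

theorem weightedSum_concat (φ : ℕ → ℕ) (D : List ℕ) (v : ℕ) (ν : ℕ → ℕ) :
    weightedSum φ (D ++ [v]) ν = weightedSum φ D ν + ν v * φ v := by
  simp [weightedSum]

theorem weightedSum_congr {φ φ' : ℕ → ℕ} {D : List ℕ} {μ ν : ℕ → ℕ} (h : ∀ v ∈ D, μ v = ν v)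
    (h' : ∀ v ∈ D, φ v = φ' v) : weightedSum φ D μ = weightedSum φ' D ν := by
  rw [weightedSum, weightedSum]
  congr 1
  exact List.map_congr_left fun v hv => by rw [h v hv, h' v hv]

/-- The new variable is the most significant digit. An entry in which it is positive arises from the
entry one old box size before it, where this digit is one less, by adding the weight of the
variable. Both summands are less than `n`, so one conditional subtraction reduces the sum. -/
theorem wp_fillIndexMap {s : Memory} {m φ : ℕ → ℕ} {D : List ℕ} {v n row : ℕ} (hv : v ∉ D)
    (h60 : s.var 60 = row) (h66 : s.var 66 = n) (hn : 0 < n) (h73 : s.var 73 = v)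
    (h74 : s.var 74 = boxSize m D) (h75 : s.var 75 = boxSize m D * (m v + 1))
    (hφ : s.idx 60 v 0 = φ v) (hφn : φ v < n)
    (hE : ∀ ν : ℕ → ℕ, (∀ u ∈ D, ν u ≤ m u) →
      s.idx 71 row (mixedRadix m D ν) = weightedSum φ D ν % n) :
    WP fillIndexMap s fun t s' => t ≤ 40 * (boxSize m D * m v) + 20 ∧
      (∀ ν : ℕ → ℕ, (∀ u ∈ D ++ [v], ν u ≤ m u) →
        s'.idx 71 row (mixedRadix m (D ++ [v]) ν) = weightedSum φ (D ++ [v]) ν % n) ∧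
      (∀ r, r ≠ row → s'.idx 71 r = s.idx 71 r) ∧ (∀ a, a ≠ 71 → s'.idx a = s.idx a) ∧
      ∀ x, x ≠ 70 → x ≠ 76 → s'.var x = s.var x := by
  simp only [fillIndexMap, wp_seq, wp_setVar]
  have hpos := boxSize_pos m D
  refine WP.mono (wp_loop 70 (boxSize m D * m v) (fun i s' => s'.var 76 = boxSize m D + i ∧
      (∀ ν : ℕ → ℕ, (∀ u ∈ D ++ [v], ν u ≤ m u) → mixedRadix m (D ++ [v]) ν < boxSize m D + i →
        s'.idx 71 row (mixedRadix m (D ++ [v]) ν) = weightedSum φ (D ++ [v]) ν % n) ∧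
      (∀ r, r ≠ row → s'.idx 71 r = s.idx 71 r) ∧ (∀ a, a ≠ 71 → s'.idx a = s.idx a) ∧
      ∀ x, x ≠ 70 → x ≠ 76 → s'.var x = s.var x) (fun i => i * 40) (by decide)
      ?_ ?_ ?_) ?_
  · simp +contextual only [Memory.setVar_var, Memory.setVar_idx, IExp.eval, h74, if_true, add_zero,
      true_and, implies_true, if_false, and_true]
    intro ν hν hlt
    rw [mixedRadix_concat] at hlt ⊢
    have h0 : ν v = 0 := by
      by_contra h0
      have := Nat.mul_le_mul_left (boxSize m D) (Nat.one_le_iff_ne_zero.mpr h0)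
      omega
    rw [weightedSum_concat, h0, mul_zero, zero_mul, add_zero, add_zero]
    exact hE ν fun u hu => hν u (by simp [hu])
  · rintro i hi s' hf ⟨i1, i2, i3, i4, i5⟩
    have g60 := (i5 60 (by norm_num) (by norm_num)).trans h60
    have g66 := (i5 66 (by norm_num) (by norm_num)).trans h66
    have g73 := (i5 73 (by norm_num) (by norm_num)).trans h73
    have g74 := (i5 74 (by norm_num) (by norm_num)).trans h74
    have g75 := (i5 75 (by norm_num) (by norm_num)).trans h75
    have gφ : s'.idx 60 v 0 = φ v := by rw [i4 60 (by norm_num), hφ]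
    have key : ∀ ν : ℕ → ℕ, (∀ u ∈ D ++ [v], ν u ≤ m u) →
        mixedRadix m (D ++ [v]) ν = boxSize m D + i →
        weightedSum φ (D ++ [v]) ν % n = (s'.idx 71 row i + φ v) % n ∧ s'.idx 71 row i < n := by
      intro ν hν hνi
      have hν' : ∀ u ∈ D, ν u ≤ m u := fun u hu => hν u (by simp [hu])
      have hlt := mixedRadix_lt hν'
      have hne : ∀ u ∈ D, u ≠ v := fun u hu h => hv (h ▸ hu)
      have h0 : ν v ≠ 0 := by
        intro h0
        rw [mixedRadix_concat, h0] at hνi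
        omega
      have hνm := hν v (by simp)
      set μ := Function.update ν v (ν v - 1) with hμ
      have hμv : μ v = ν v - 1 := by simp [hμ]
      have hμu : ∀ u ∈ D, μ u = ν u := fun u hu => Function.update_of_ne (hne u hu) _ _
      have hμm : ∀ u ∈ D ++ [v], μ u ≤ m u := by
        intro u hu
        rcases List.mem_append.mp hu with hu | hu
        · rw [hμu u hu]; exact hν' u hu
        · rw [List.mem_singleton.mp hu, hμv]; omega
      obtain ⟨k, hk⟩ := Nat.exists_eq_succ_of_ne_zero h0
      have hμi : mixedRadix m (D ++ [v]) μ = i := by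
        rw [mixedRadix_concat] at hνi ⊢
        rw [mixedRadix_congr hμu, hμv, hk]
        rw [hk] at hνi
        simp only [Nat.succ_eq_add_one, Nat.add_sub_cancel, mul_add, mul_one] at hνi ⊢
        omega
      have := i2 μ hμm (by omega)
      rw [hμi] at this
      rw [this]
      refine ⟨?_, Nat.mod_lt _ hn⟩
      rw [weightedSum_concat, weightedSum_concat, weightedSum_congr hμu fun _ _ => rfl, hμv, hk,
        Nat.mod_add_mod]
      congr 1
      simp only [Nat.succ_eq_add_one, Nat.add_sub_cancel]
      ring
    have hlt : boxSize m D + i < boxSize m D * (m v + 1) := by rw [mul_add, mul_one]; omega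
    have hfin : ∀ x, ((s'.idx 71 row i < n → s'.idx 71 row i + φ v < n → x = s'.idx 71 row i + φ v) ∧
        (s'.idx 71 row i < n → ¬ s'.idx 71 row i + φ v < n → x = s'.idx 71 row i + φ v - n)) →
        ∀ ν : ℕ → ℕ, (∀ u ∈ D ++ [v], ν u ≤ m u) →
        mixedRadix m (D ++ [v]) ν < boxSize m D + (i + 1) →
        (if mixedRadix m (D ++ [v]) ν = boxSize m D + i then x else
          s'.idx 71 row (mixedRadix m (D ++ [v]) ν)) = weightedSum φ (D ++ [v]) ν % n := by
      rintro x ⟨hx1, hx2⟩ ν hν hνlt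
      split_ifs with heq
      · obtain ⟨k1, k2⟩ := key ν hν heq
        rw [k1]
        by_cases hc : s'.idx 71 row i + φ v < n
        · rw [hx1 k2 hc, Nat.mod_eq_of_lt hc]
        · rw [hx2 k2 hc, Nat.mod_eq_sub_mod (by omega), Nat.mod_eq_of_lt (by omega)]
      · exact i2 ν hν (by omega)
    by_cases hc : s'.idx 71 row i + φ v < n
    · simp only [BExp.eval, IExp.eval, i1, g75, hlt, decide_true, wp_seq, wp_setVar, wp_setIdx,
        Memory.setVar_idx, g60, g74, g73, gφ, Nat.add_sub_cancel_left, wp_ite, Memory.setVar_var,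
        g66, hc, wp_skip, Memory.setIdx_idx, Memory.setIdx_var, IExp.cost, BExp.cost,
        Nat.reduceEqDiff, reduceIte, true_and]
      refine ⟨by omega, by ring, fun ν hν hνlt => ?_, fun r hr => ?_, fun a ha => ?_,
        fun x hx hx' => ?_⟩
      · exact hfin _ ⟨fun _ _ => rfl, fun _ h => absurd hc h⟩ ν hν hνlt
      · funext j; simp [hr, i3 r hr]
      · funext j l; simp [ha, i4 a ha]
      · simp [hx, hx', i5 x hx hx']
    · simp only [BExp.eval, IExp.eval, i1, g75, hlt, decide_true, wp_seq, wp_setVar, wp_setIdx,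
        Memory.setVar_idx, g60, g74, g73, gφ, Nat.add_sub_cancel_left, wp_ite, Memory.setVar_var,
        g66, hc, wp_skip, Memory.setIdx_idx, Memory.setIdx_var, IExp.cost, BExp.cost,
        Nat.reduceEqDiff, reduceIte, true_and, decide_false,
        Bool.false_eq_true]
      refine ⟨by omega, by ring, fun ν hν hνlt => ?_, fun r hr => ?_, fun a ha => ?_,
        fun x hx hx' => ?_⟩
      · exact hfin _ ⟨fun _ h => absurd h hc, fun _ _ => rfl⟩ ν hν hνlt
      · funext j; simp [hr, i3 r hr]
      · funext j l; simp [ha, i4 a ha]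
      · simp [hx, hx', i5 x hx hx']
  · rintro s' hf ⟨i1, i2, i3, i4, i5⟩
    have g75 := (i5 75 (by norm_num) (by norm_num)).trans h75
    simp [i1, g75, mul_add, add_comm]
  · rintro t s' ⟨ht, ⟨i1, i2, i3, i4, i5⟩, hf⟩
    simp at ht
    refine ⟨by simp; omega, fun ν hν => i2 ν hν ?_, i3, i4, i5⟩
    have := mixedRadix_lt hν
    rw [boxSize_concat, mul_add, mul_one] at this
    omega

/-- Tabulates the index map of the list of variables in row `var 60` of the index array `40`. -/
def buildIndexMap : Program :=
  .seq (.setVar 74 (.lit 1)) <|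
  .seq (.setIdx 71 (.var 60) (.lit 0) (.lit 0)) <|
  .seq (.setVar 71 (.lit 0)) <|
  .seq (.loop (.lt (.var 71) (.get 41 (.var 60) (.lit 0))) <|
    .seq (.setVar 73 (.get 40 (.var 60) (.var 71))) <|
    .seq extendSize <|
    .seq fillIndexMap <|
    .seq (.setVar 74 (.var 75)) <|
    .setVar 71 (.add (.var 71) (.lit 1))) <|
  .setIdx 72 (.var 60) (.lit 0) (.var 74)

theorem wp_buildIndexMap {s : Memory} {m : ℕ → ℕ} {D : List ℕ} {n row : ℕ} (hD : D.Nodup)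
    (h60 : s.var 60 = row) (h66 : s.var 66 = n) (hn : 0 < n)
    (h41 : s.idx 41 row 0 = D.length) (h40 : StoresList (s.idx 40 row) D)
    (h22 : ∀ v ∈ D, s.idx 22 v 0 = m v) (hφ : ∀ v ∈ D, s.idx 60 v 0 < n) :
    WP buildIndexMap s fun t s' => t ≤ 100 * (boxSize m D + D.length) ∧
      s'.idx 72 row 0 = boxSize m D ∧
      (∀ ν : ℕ → ℕ, (∀ u ∈ D, ν u ≤ m u) → s'.idx 71 row (mixedRadix m D ν) =
        weightedSum (fun v => s.idx 60 v 0) D ν % n) ∧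
      (∀ r, r ≠ row → s'.idx 71 r = s.idx 71 r ∧ s'.idx 72 r = s.idx 72 r) ∧ Frame 70 s s' := by
  refine WP.mono (WP.frame (Q := fun t s' => t ≤ 100 * (boxSize m D + D.length) ∧
      s'.idx 72 row 0 = boxSize m D ∧
      (∀ ν : ℕ → ℕ, (∀ u ∈ D, ν u ≤ m u) → s'.idx 71 row (mixedRadix m D ν) =
        weightedSum (fun v => s.idx 60 v 0) D ν % n) ∧
      (∀ r, r ≠ row → s'.idx 71 r = s.idx 71 r ∧ s'.idx 72 r = s.idx 72 r)) ?_ 70 (by decide))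
    (by rintro t s' ⟨⟨a, b, c, d⟩, e⟩; exact ⟨a, b, c, d, e⟩)
  simp only [buildIndexMap, wp_seq, wp_setVar, wp_setIdx]
  refine WP.mono (wp_loop 70 D.length (fun p s' => s'.var 71 = p ∧
      s'.var 74 = boxSize m (D.take p) ∧
      (∀ ν : ℕ → ℕ, (∀ u ∈ D.take p, ν u ≤ m u) → s'.idx 71 row (mixedRadix m (D.take p) ν) =
        weightedSum (fun v => s.idx 60 v 0) (D.take p) ν % n) ∧
      (∀ r, r ≠ row → s'.idx 71 r = s.idx 71 r) ∧ s'.idx 72 = s.idx 72)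
      -- A potential: the work of a round is proportional to the growth of the box, up to a
      -- constant, so the total telescopes to the final box size.
      (fun p => 60 * boxSize m (D.take p) + 80 * p) (by decide) ?_ ?_ ?_) ?_
  · refine ⟨by simp, by simp, ?_, fun r hr => funext fun j => by simp [hr, h60],
      funext₂ fun r j => by simp⟩
    simp [mixedRadix, weightedSum, h60]
  · rintro p hp s' hf ⟨i1, i2, i3, i4, i5⟩
    have g60 : s'.var 60 = row := by rw [hf.var 60 (by norm_num)]; simpa using h60
    have g66 : s'.var 66 = n := by rw [hf.var 66 (by norm_num)]; simpa using h66
    have g41 : s'.idx 41 row 0 = D.length := by rw [hf.idx 41 (by norm_num)]; simpa using h41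
    have g40 : s'.idx 40 row p = D[p] := by rw [hf.idx 40 (by norm_num)]; simpa using h40 p hp
    have gv : s'.idx 22 D[p] 0 = m D[p] := by
      rw [hf.idx 22 (by norm_num)]; simpa using h22 _ (List.getElem_mem hp)
    have gφ : s'.idx 60 D[p] 0 = s.idx 60 D[p] 0 := by
      rw [hf.idx 60 (by norm_num)]; simp
    have htake : D.take (p + 1) = D.take p ++ [D[p]] := List.take_succ_eq_append_getElem hp
    have hnot : D[p] ∉ D.take p := by
      have := hD.sublist (List.take_sublist (p + 1) D)
      rw [htake, List.nodup_append] at this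
      intro h
      exact this.2.2 _ h _ (by simp) rfl
    refine ⟨by simp [i1, g60, g41, hp], ?_⟩
    simp only [wp_seq, wp_setVar, IExp.eval, g60, i1, g40]
    refine WP.mono (wp_extendSize (k := m D[p]) (by simpa using i2) (by simpa using gv)) ?_
    rintro t₁ s₁ ⟨ht₁, j1, j2, j3, j4⟩
    have j4' : ∀ x, x ≠ 72 → x ≠ 75 → x ≠ 73 → s₁.var x = s'.var x := by
      intro x hx hx' hx''
      rw [j4 x hx hx']
      simp [hx'']
    have k73 : s₁.var 73 = D[p] := by rw [j4 73 (by norm_num) (by norm_num)]; simp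
    refine WP.mono (wp_fillIndexMap (m := m) (φ := fun v => s.idx 60 v 0) (n := n) (row := row) hnot
      (by rw [j4'] <;> simp [g60]) (by rw [j4'] <;> simp [g66]) hn k73
      (by rw [j4'] <;> simp [i2]) j1 (by rw [j2]; simpa using gφ)
      (hφ _ (List.getElem_mem hp)) (fun ν hν => by rw [j2]; simpa using i3 ν hν)) ?_
    rintro t₂ s₂ ⟨ht₂, l1, l2, l3, l4⟩
    have k75 : s₂.var 75 = boxSize m (D.take (p + 1)) := by
      rw [l4 75 (by norm_num) (by norm_num), j1, htake, boxSize_concat]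
    have k71 : s₂.var 71 = p := by
      rw [l4 71 (by norm_num) (by norm_num), j4'] <;> simp [i1]
    have hb := boxSize_pos m (D.take p)
    have hbm : m D[p] ≤ boxSize m (D.take p) * m D[p] := Nat.le_mul_of_pos_left _ hb
    simp only [Memory.setVar_var, Memory.setVar_idx, k75, k71, IExp.cost, BExp.cost,
      Nat.reduceEqDiff, reduceIte, true_and]
    refine ⟨?_, ?_, fun r hr => ?_, ?_⟩
    · rw [htake, boxSize_concat, mul_add, mul_one]
      omega
    · rw [htake]
      exact l1
    · rw [l2 r hr, j2]
      exact i4 r hr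
    · rw [l3 72 (by norm_num), j2]
      exact i5
  · rintro s' hf ⟨i1, i2, i3, i4, i5⟩
    have g60 : s'.var 60 = row := by rw [hf.var 60 (by norm_num)]; simpa using h60
    have g41 : s'.idx 41 row 0 = D.length := by rw [hf.idx 41 (by norm_num)]; simpa using h41
    simp [i1, g60, g41]
  · rintro t s' ⟨ht, ⟨i1, i2, i3, i4, i5⟩, hf⟩
    have g60 : s'.var 60 = row := by rw [hf.var 60 (by norm_num)]; simpa using h60
    rw [List.take_length] at ht i2 i3
    have := boxSize_pos m D
    refine ⟨by simp at ht ⊢; omega, by simp [g60, i2], ?_, ?_⟩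
    · simpa using i3
    · intro r hr
      refine ⟨funext fun j => by simp [i4 r hr], funext fun j => by simp [g60, hr, i5]⟩

/-! ### Truncated multiplication -/

/-- The function that takes the value `A i` at the place `e i`, for `i < N`. -/
noncomputable def scatter (N : ℕ) (e : ℕ → ℕ) (A : ℕ → ℂ) (c : ℕ) : ℂ :=
  ∑ i ∈ Finset.range N, if e i = c then A i else 0

theorem dft_congr {n : ℕ} {f g : ℕ → ℂ} (h : ∀ c < n, f c = g c) (a : ℕ) : dft n f a = dft n g a :=
  Finset.sum_congr rfl fun u hu => by rw [h u (Finset.mem_range.mp hu)]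

theorem sum_scatter {N n : ℕ} {e : ℕ → ℕ} (he : ∀ i < N, e i < n) (A : ℕ → ℂ) (w : ℕ → ℂ) :
    ∑ c ∈ Finset.range n, scatter N e A c * w c = ∑ i ∈ Finset.range N, A i * w (e i) := by
  simp only [scatter, Finset.sum_mul]
  rw [Finset.sum_comm]
  refine Finset.sum_congr rfl fun i hi => ?_
  rw [Finset.sum_eq_single (e i)]
  · simp
  · intro c _ hc
    simp [hc.symm]
  · intro h
    exact absurd (Finset.mem_range.mpr (he i (Finset.mem_range.mp hi))) h

/-- Places the table in row `var x` of the number array `60` according to row `row` of the index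
map, and transforms the result. -/
def loadTable (row x : ℕ) : Program :=
  .seq (.setVar 76 (.lit 0)) <|
  .seq (.loop (.lt (.var 76) (.var 66)) <|
    .seq (.setNum 80 (.lit 0) (.var 76) (.cast (.lit 0))) (.setVar 76 (.add (.var 76) (.lit 1)))) <|
  .seq (.setVar 76 (.lit 0)) <|
  .seq (.loop (.lt (.var 76) (.get 72 (.lit row) (.lit 0))) <|
    .seq (.setNum 80 (.lit 0) (.get 71 (.lit row) (.var 76)) (.get 60 (.var x) (.var 76)))
      (.setVar 76 (.add (.var 76) (.lit 1)))) fft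

/-- The loop assigns where `scatter` adds. Injectivity of the index map makes the two agree;
positions that are not hit have been set to zero beforehand, as the row may contain an earlier
transform. -/
theorem wp_loadTable {s : Memory} {row x h N : ℕ} (hx : x < 76) (h66 : s.var 66 = 2 ^ h)
    (h67 : s.var 67 = 2 ^ (h - 1)) (h72 : s.idx 72 row 0 = N) (hN : N ≤ 2 ^ h)
    (hinj : ∀ i < N, ∀ j < N, s.idx 71 row i = s.idx 71 row j → i = j) :
    WP (loadTable row x) s fun t s' => t ≤ 200 * (2 ^ h * (h + 1)) ∧ s'.var 80 = h ∧
      (∀ c < 2 ^ h, s'.num 80 h c =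
        dft (2 ^ h) (scatter N (s.idx 71 row) (s.num 60 (s.var x))) c) ∧ Frame 76 s s' := by
  refine WP.mono (WP.frame (Q := fun t s' => t ≤ 200 * (2 ^ h * (h + 1)) ∧ s'.var 80 = h ∧
      (∀ c < 2 ^ h, s'.num 80 h c =
        dft (2 ^ h) (scatter N (s.idx 71 row) (s.num 60 (s.var x))) c)) ?_ 76 (by simp [loadTable, Program.fresh]; decide))
    (by rintro t s' ⟨⟨a, b, c⟩, d⟩; exact ⟨a, b, c, d⟩)
  simp only [loadTable, wp_seq, wp_setVar, IExp.cost]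
  refine WP.mono (wp_loop 76 (2 ^ h) (fun i s' => s'.var 76 = i ∧ ∀ c < i, s'.num 80 0 c = 0)
    (fun i => i * 20) (by decide) (by simp) ?_ ?_) ?_
  · rintro i hi s' hf ⟨i1, i2⟩
    have g66 : s'.var 66 = 2 ^ h := by rw [hf.var 66 (by norm_num)]; simpa using h66
    simp [i1, g66, hi]
    refine ⟨by omega, fun c hc hne => i2 c (by omega)⟩
  · rintro s' hf ⟨i1, i2⟩
    have g66 : s'.var 66 = 2 ^ h := by rw [hf.var 66 (by norm_num)]; simpa using h66
    simp [i1, g66]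
  rintro t₁ s₁ ⟨ht₁, ⟨-, hzero⟩, hf₁⟩
  refine WP.mono (wp_loop 76 N (fun i s' => s'.var 76 = i ∧
      ∀ c < 2 ^ h, s'.num 80 0 c = scatter i (s.idx 71 row) (s.num 60 (s.var x)) c)
    (fun i => i * 20) (by simp [Program.fresh]) ?_ ?_ ?_) ?_
  · simpa [scatter] using hzero
  · rintro i hi s' hf ⟨i1, i2⟩
    have g71 : s'.idx 71 = s.idx 71 := by
      rw [hf.idx 71 (by norm_num), Memory.setVar_idx, hf₁.idx 71 (by norm_num), Memory.setVar_idx]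
    have g72 : s'.idx 72 = s.idx 72 := by
      rw [hf.idx 72 (by norm_num), Memory.setVar_idx, hf₁.idx 72 (by norm_num), Memory.setVar_idx]
    have gx : s'.var x = s.var x := by
      rw [hf.var x hx, Memory.setVar_var, if_neg hx.ne, hf₁.var x hx, Memory.setVar_var,
        if_neg hx.ne]
    have g60 : s'.num 60 = s.num 60 := by
      rw [hf.num 60 (by norm_num), Memory.setVar_num, hf₁.num 60 (by norm_num), Memory.setVar_num]
    simp [i1, g71, g72, gx, g60, h72, hi]
    refine ⟨by omega, fun c hc => ?_⟩
    rw [scatter, Finset.sum_range_succ, ← scatter]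
    split_ifs with h1 h2 h2
    · rw [h1, scatter, Finset.sum_eq_zero, zero_add]
      intro j hj
      rw [if_neg]
      intro hij
      have hj' := Finset.mem_range.mp hj
      have := hinj j (hj'.trans hi) i hi hij
      omega
    · exact absurd h1.symm h2
    · exact absurd h2.symm h1
    · rw [i2 c hc, add_zero]
  · rintro s' hf ⟨i1, i2⟩
    have g72 : s'.idx 72 = s.idx 72 := by
      rw [hf.idx 72 (by norm_num), Memory.setVar_idx, hf₁.idx 72 (by norm_num), Memory.setVar_idx]
    simp [i1, g72, h72]
  rintro t₂ s₂ ⟨ht₂, ⟨-, hsc⟩, hf₂⟩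
  have g : ∀ y < 76, s₂.var y = s.var y := by
    intro y hy
    rw [hf₂.var y hy, Memory.setVar_var, if_neg hy.ne, hf₁.var y hy, Memory.setVar_var,
      if_neg hy.ne]
  refine WP.mono (wp_fft (h := h) (by rw [g 66 (by norm_num), h66])
    (by rw [g 67 (by norm_num), h67])) ?_
  rintro t₃ s₃ ⟨ht₃, j1, j2, -⟩
  refine ⟨?_, j1, fun c hc => ?_⟩
  · simp only [BExp.cost, IExp.cost] at ht₁ ht₂
    have : 1 ≤ 2 ^ h := Nat.one_le_two_pow
    nlinarith
  · rw [j2 c hc, dft_congr hsc]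

/-! ### Length and weights of the index map -/

/-- Sets the variable `63` to the size of the table on the list of variables in row `0`. -/
def computeSize : Program :=
  .seq (.setVar 63 (.lit 1)) <|
  .seq (.setVar 71 (.lit 0)) <|
  .loop (.lt (.var 71) (.get 41 (.lit 0) (.lit 0))) <|
    .seq (.setVar 73 (.get 40 (.lit 0) (.var 71))) <|
    .seq (.setVar 74 (.var 63)) <|
    .seq extendSize <|
    .seq (.setVar 63 (.var 75)) <|
    .setVar 71 (.add (.var 71) (.lit 1))

theorem wp_computeSize {s : Memory} {m : ℕ → ℕ} {D : List ℕ}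
    (h41 : s.idx 41 0 0 = D.length) (h40 : StoresList (s.idx 40 0) D)
    (h22 : ∀ v ∈ D, s.idx 22 v 0 = m v) :
    WP computeSize s fun t s' => t ≤ 100 * (boxSize m D + D.length) ∧
      s'.var 63 = boxSize m D ∧ s'.idx = s.idx ∧ s'.num = s.num ∧ Frame 63 s s' := by
  refine WP.mono (WP.frame (Q := fun t s' => t ≤ 100 * (boxSize m D + D.length) ∧
      s'.var 63 = boxSize m D ∧ s'.idx = s.idx ∧ s'.num = s.num) ?_ 63 (by decide))
    (by rintro t s' ⟨⟨a, b, c, d⟩, e⟩; exact ⟨a, b, c, d, e⟩)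
  simp only [computeSize, wp_seq, wp_setVar]
  refine WP.mono (wp_loop 63 D.length (fun p s' => s'.var 71 = p ∧
      s'.var 63 = boxSize m (D.take p) ∧ s'.idx = s.idx ∧ s'.num = s.num)
      (fun p => 20 * boxSize m (D.take p) + 60 * p) (by decide) ?_ ?_ ?_) ?_
  · simp
  · rintro p hp s' hf ⟨i1, i2, i3, i4⟩
    have htake : D.take (p + 1) = D.take p ++ [D[p]] := List.take_succ_eq_append_getElem hp
    have gv := h22 D[p] (List.getElem_mem hp)
    have gp := h40 p hp
    refine ⟨by simp [i1, i3, h41, hp], ?_⟩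
    simp only [wp_seq, wp_setVar, IExp.eval, i1, i2, i3, Memory.setVar_var, Memory.setVar_idx, gp]
    refine WP.mono (wp_extendSize (q := boxSize m (D.take p)) (k := m D[p]) (by simp)
      (by simp [i3, gv])) ?_
    rintro t₁ s₁ ⟨ht₁, j1, j2, j3, j4⟩
    have k71 : s₁.var 71 = p := by
      rw [j4 71 (by norm_num) (by norm_num)]; simp [i1]
    have hb := boxSize_pos m (D.take p)
    have hbm : m D[p] ≤ boxSize m (D.take p) * m D[p] := Nat.le_mul_of_pos_left _ hb
    simp only [Memory.setVar_idx, Memory.setVar_num, k71, j1, j2, j3, i3, i4,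
      IExp.cost, BExp.cost, Nat.reduceEqDiff, reduceIte, and_true, htake,
      boxSize_concat]
    rw [mul_add (boxSize m (D.take p)), mul_one]
    omega
  · rintro s' hf ⟨i1, i2, i3, i4⟩
    simp [i1, i3, h41]
  · rintro t s' ⟨ht, ⟨i1, i2, i3, i4⟩, hf⟩
    rw [List.take_length] at ht i2
    have := boxSize_pos m D
    exact ⟨by simp at ht ⊢; omega, i2, i3, i4⟩

/-- Chooses the length `var 66` of the transforms: `var 65` is a power of two that is at least twice
`var 63`, and `var 66` is its product with a power of two above the length of the list. -/
def computeLength : Program :=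
  .seq (.setVar 64 (.lit 1)) <|
  .seq (.loop (.lt (.var 64) (.var 63)) (.setVar 64 (.add (.var 64) (.var 64)))) <|
  .seq (.setVar 65 (.add (.var 64) (.var 64))) <|
  .seq (.setVar 66 (.var 65)) <|
  .seq (.setVar 67 (.var 64)) <|
  .seq (.setVar 68 (.lit 1)) <|
  .loop (.not (.lt (.get 41 (.lit 0) (.lit 0)) (.var 68))) <|
    .seq (.setVar 68 (.add (.var 68) (.var 68))) <|
    .seq (.setVar 67 (.add (.var 67) (.var 67))) <|
    .setVar 66 (.add (.var 66) (.var 66))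

/-- The least such exponent is what repeated doubling finds: the guard holds at all smaller
exponents, and minimality gives the upper bound. -/
theorem exists_two_pow_ge (N : ℕ) (hN : 0 < N) :
    ∃ a, N ≤ 2 ^ a ∧ 2 ^ a < 2 * N ∧ (∀ i < a, 2 ^ i < N) ∧ a ≤ N := by
  classical
  have hex : ∃ a, N ≤ 2 ^ a := ⟨N, Nat.lt_two_pow_self.le⟩
  refine ⟨Nat.find hex, Nat.find_spec hex, ?_, fun i hi => not_le.mp (Nat.find_min hex hi),
    Nat.find_min' hex Nat.lt_two_pow_self.le⟩
  rcases Nat.eq_zero_or_pos (Nat.find hex) with h | h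
  · rw [h]; omega
  · have := Nat.find_min hex (Nat.sub_lt h one_pos)
    have h2 : 2 ^ Nat.find hex = 2 * 2 ^ (Nat.find hex - 1) := by
      rw [← pow_succ']; congr 1; omega
    omega

/-- The modulus H is 2^(a+1) with 2^a the least power of two that is at least `N`, and L is the
least power of two that is at least `ℓ + 1`. Since 2^a < 2N and L < 2(ℓ + 1), rounding to powers of
two costs only a constant factor. -/
theorem wp_computeLength {s : Memory} {N ℓ : ℕ} (hN : 0 < N) (h63 : s.var 63 = N)
    (h41 : s.idx 41 0 0 = ℓ) :
    WP computeLength s fun t s' => t ≤ 100 * (N + ℓ) ∧ s'.idx = s.idx ∧ s'.num = s.num ∧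
      (∃ h H L, s'.var 65 = H ∧ s'.var 66 = 2 ^ h ∧ s'.var 67 = 2 ^ (h - 1) ∧ 2 ^ h = H * L ∧
        0 < h ∧ 2 * N ≤ H ∧ ℓ < L ∧ 2 ^ h ≤ 8 * N * (ℓ + 1)) ∧ Frame 64 s s' := by
  refine WP.mono (WP.frame (Q := fun t s' => t ≤ 100 * (N + ℓ) ∧ s'.idx = s.idx ∧
    s'.num = s.num ∧ ∃ h H L, s'.var 65 = H ∧ s'.var 66 = 2 ^ h ∧ s'.var 67 = 2 ^ (h - 1) ∧
      2 ^ h = H * L ∧ 0 < h ∧ 2 * N ≤ H ∧ ℓ < L ∧ 2 ^ h ≤ 8 * N * (ℓ + 1)) ?_ 64 (by decide))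
    (by rintro t s' ⟨⟨a, b, c, d⟩, e⟩; exact ⟨a, b, c, d, e⟩)
  obtain ⟨a, a1, a2, a3, a4⟩ := exists_two_pow_ge N hN
  obtain ⟨b, b1, b2, b3, b4⟩ := exists_two_pow_ge (ℓ + 1) (by omega)
  simp only [computeLength, wp_seq, wp_setVar]
  refine WP.mono (wp_loop 64 a (fun i s' => s'.var 64 = 2 ^ i ∧ s'.idx = s.idx ∧ s'.num = s.num)
    (fun i => i * 20) (by decide) (by simp) ?_ ?_) ?_
  · rintro i hi s' hf ⟨i1, i2, i3⟩
    have g63 : s'.var 63 = N := by rw [hf.var 63 (by norm_num)]; simpa using h63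
    simp [i1, i2, i3, g63, a3 i hi, pow_succ]
    omega
  · rintro s' hf ⟨i1, i2, i3⟩
    have g63 : s'.var 63 = N := by rw [hf.var 63 (by norm_num)]; simpa using h63
    simp [i1, g63, a1]
  rintro t₁ s₁ ⟨ht₁, ⟨i1, i2, i3⟩, hf₁⟩
  refine WP.mono (wp_loop 66 b (fun i s' => s'.var 68 = 2 ^ i ∧ s'.var 67 = 2 ^ (a + i) ∧
      s'.var 66 = 2 ^ (a + i + 1) ∧ s'.idx = s.idx ∧ s'.num = s.num)
    (fun i => i * 30) (by decide) ?_ ?_ ?_) ?_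
  · simp [i1, i2, i3, pow_succ, mul_two]
  · rintro i hi s' hf ⟨j1, j2, j3, j4, j5⟩
    have := b3 i hi
    simp [j1, j2, j3, j4, j5, h41]
    refine ⟨by omega, by omega, ?_, ?_, ?_⟩ <;> ring
  · rintro s' hf ⟨j1, j2, j3, j4, j5⟩
    simp [j1, j4, h41]
    omega
  rintro t₂ s₂ ⟨ht₂, ⟨j1, j2, j3, j4, j5⟩, hf₂⟩
  have k65 : s₂.var 65 = 2 ^ (a + 1) := by
    rw [hf₂.var 65 (by norm_num)]
    simp [i1, pow_succ, mul_two]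
  refine ⟨?_, j4, j5, a + b + 1, 2 ^ (a + 1), 2 ^ b, k65, j3, by rw [j2]; rfl, by ring, by omega,
    by rw [pow_succ]; omega, by omega, ?_⟩
  · simp at ht₁ ht₂ ⊢
    omega
  · rw [show 2 ^ (a + b + 1) = 2 ^ a * 2 ^ b * 2 by ring]
    have : 2 ^ a * 2 ^ b ≤ (2 * N) * (2 * (ℓ + 1)) := Nat.mul_le_mul (by omega) (by omega)
    nlinarith

/-- Subtracts `var 66` from `var 70` if this is possible. -/
def reduceMod : Program :=
  .ite (.lt (.var 70) (.var 66)) .skip (.setVar 70 (.sub (.var 70) (.var 66)))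

theorem wp_reduceMod {s : Memory} {x n : ℕ} (h66 : s.var 66 = n) (h70 : s.var 70 = x)
    (hx : x < 2 * n) : WP reduceMod s fun t s' => t ≤ 10 ∧ s'.var 70 = x % n ∧
      (∀ y, y ≠ 70 → s'.var y = s.var y) ∧ s'.idx = s.idx ∧ s'.num = s.num := by
  by_cases hc : x < n
  · simp [reduceMod, h66, h70, hc, Nat.mod_eq_of_lt hc]
  · simp +contextual [reduceMod, h66, h70, hc]
    rw [Nat.mod_eq_sub_mod (by omega), Nat.mod_eq_of_lt (by omega)]

/-- Computes the weights of the index map for the list of variables in row `0`. -/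
def computeWeights : Program :=
  .seq (.setVar 69 (.lit 1)) <|
  .seq (.setVar 71 (.lit 0)) <|
  .loop (.lt (.var 71) (.get 41 (.lit 0) (.lit 0))) <|
    .seq (.setVar 73 (.get 40 (.lit 0) (.var 71))) <|
    .seq (.setIdx 60 (.var 73) (.lit 0) (.var 69)) <|
    .seq (.setVar 70 (.var 65)) <|
    .seq reduceMod <|
    .seq (.setVar 72 (.lit 0)) <|
    .seq (.loop (.lt (.var 72) (.add (.get 22 (.var 73) (.lit 0)) (.lit 1)))
      (.seq (.setVar 70 (.add (.var 70) (.var 69))) <|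
      .seq reduceMod <|
      .setVar 72 (.add (.var 72) (.lit 1)))) <|
    .seq (.setVar 69 (.var 70)) <|
    .setVar 71 (.add (.var 71) (.lit 1))

/-- The weights `x`, `(m v + 1) x + H`, … of `linearIndex`. -/
def linearWeight (m : ℕ → ℕ) (H x : ℕ) (D : List ℕ) : ℕ :=
  D.foldl (fun y v => (m v + 1) * y + H) x

/-- The machine keeps the weights reduced modulo `n`; this does not affect residues of the linear
index. -/
theorem linearIndex_modEq {m φ : ℕ → ℕ} {H n : ℕ} (D : List ℕ) (x : ℕ)
    (h : ∀ p (hp : p < D.length), φ D[p] ≡ linearWeight m H x (D.take p) [MOD n]) (ν : ℕ → ℕ) :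
    weightedSum φ D ν ≡ linearIndex (m := m) H x D ν [MOD n] := by
  induction D generalizing x with
  | nil => rfl
  | cons v D ih =>
    have h0 := h 0 (by simp)
    simp only [List.getElem_cons_zero, List.take_zero, linearWeight, List.foldl_nil] at h0
    rw [linearIndex, weightedSum, List.map_cons, List.sum_cons]
    refine (h0.mul_left _).add (ih _ fun p hp => ?_)
    have := h (p + 1) (by simpa using hp)
    rwa [List.getElem_cons_succ, List.take_succ_cons] at this

/-- The product with `m v + 1` is again a repeated addition, with a reduction after every step. The
bound `H < 2 * n` allows the first reduction to be a single subtraction. -/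
theorem wp_computeWeights {s : Memory} {m : ℕ → ℕ} {D : List ℕ} {n H : ℕ} (hD : D.Nodup)
    (h66 : s.var 66 = n) (h65 : s.var 65 = H) (hn : 1 < n) (hH : H < 2 * n)
    (h41 : s.idx 41 0 0 = D.length) (h40 : StoresList (s.idx 40 0) D)
    (h22 : ∀ v ∈ D, s.idx 22 v 0 = m v) :
    WP computeWeights s fun t s' => t ≤ 200 * (boxSize m D + D.length) ∧
      (∀ v ∈ D, s'.idx 60 v 0 < n) ∧
      (∀ p (hp : p < D.length), s'.idx 60 D[p] 0 ≡ linearWeight m H 1 (D.take p) [MOD n]) ∧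
      (∀ a, a ≠ 60 → s'.idx a = s.idx a) ∧ s'.num = s.num ∧ ∀ x < 69, s'.var x = s.var x := by
  simp only [computeWeights, wp_seq, wp_setVar]
  refine WP.mono (wp_loop 60 D.length (fun p s' => s'.var 71 = p ∧
      s'.var 69 < n ∧ s'.var 69 ≡ linearWeight m H 1 (D.take p) [MOD n] ∧
      (∀ q (hq : q < D.length), q < p → s'.idx 60 D[q] 0 < n ∧
        s'.idx 60 D[q] 0 ≡ linearWeight m H 1 (D.take q) [MOD n]) ∧
      (∀ a, a ≠ 60 → s'.idx a = s.idx a) ∧ s'.num = s.num ∧ ∀ x < 69, s'.var x = s.var x)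
      (fun p => 40 * boxSize m (D.take p) + 120 * p) (by decide) ?_ ?_ ?_) ?_
  · simp +contextual [hn, linearWeight, Nat.ModEq.refl]
    intro x hx
    rw [if_neg (by omega), if_neg (by omega)]
  · rintro p hp s' - ⟨i1, i2, i3, i4, i5, i6, i7⟩
    have htake : D.take (p + 1) = D.take p ++ [D[p]] := List.take_succ_eq_append_getElem hp
    have gv : s'.idx 22 D[p] 0 = m D[p] := by rw [i5 22 (by norm_num), h22 _ (List.getElem_mem hp)]
    have gp : s'.idx 40 0 p = D[p] := by rw [i5 40 (by norm_num), h40 p hp]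
    have gl : s'.idx 41 0 0 = D.length := by rw [i5 41 (by norm_num), h41]
    have g65 : s'.var 65 = H := by rw [i7 65 (by norm_num), h65]
    have g66 : s'.var 66 = n := by rw [i7 66 (by norm_num), h66]
    refine ⟨by simp [i1, gl, hp], ?_⟩
    simp only [wp_seq, wp_setVar, wp_setIdx, IExp.eval, i1, Memory.setVar_var, Memory.setVar_idx, gp]
    refine WP.mono (wp_reduceMod (x := H) (n := n) (by simp [g66]) (by simp [g65]) hH) ?_
    rintro t₁ s₁ ⟨ht₁, j1, j2, j3, j4⟩
    have k66 : s₁.var 66 = n := by rw [j2 66 (by norm_num)]; simp [g66]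
    have k69 : s₁.var 69 = s'.var 69 := by rw [j2 69 (by norm_num)]; simp
    have k73 : s₁.var 73 = D[p] := by rw [j2 73 (by norm_num)]; simp
    have k71 : s₁.var 71 = p := by rw [j2 71 (by norm_num)]; simp [i1]
    have kv : s₁.idx 22 D[p] 0 = m D[p] := by rw [j3]; simp [gv]
    refine WP.mono (wp_loop 70 (m D[p] + 1) (fun i s'' => s''.var 72 = i ∧
      s''.var 70 = (i * s'.var 69 + H) % n ∧ s''.var 71 = p ∧ s''.idx = s₁.idx ∧
      s''.num = s₁.num ∧ s''.var 73 = D[p]) (fun i => i * 40) (by decide) ?_ ?_ ?_) ?_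
    · simp [j1, k71, k73]
    · rintro i hi s'' hf ⟨l1, l2, l3, l4, l5, l6⟩
      have n66 : s''.var 66 = n := by rw [hf.var 66 (by norm_num)]; simp [k66]
      have n69 : s''.var 69 = s'.var 69 := by rw [hf.var 69 (by norm_num)]; simp [k69]
      have hlt : (i * s'.var 69 + H) % n < n := Nat.mod_lt _ (by omega)
      refine ⟨by simp [l1, l4, l6, kv]; omega, ?_⟩
      simp only [wp_seq, wp_setVar, IExp.eval, l2, n69]
      refine WP.mono (wp_reduceMod (x := (i * s'.var 69 + H) % n + s'.var 69) (n := n)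
        (by simp [n66]) (by simp) (by omega)) ?_
      rintro t₂ s₂ ⟨ht₂, q1, q2, q3, q4⟩
      have r72 : s₂.var 72 = i := by rw [q2 72 (by norm_num)]; simp [l1]
      have r71 : s₂.var 71 = p := by rw [q2 71 (by norm_num)]; simp [l3]
      have r73 : s₂.var 73 = D[p] := by rw [q2 73 (by norm_num)]; simp [l6]
      simp [r72, r71, r73, q1, q3, q4, l4, l5]
      refine ⟨by omega, ?_⟩
      congr 1
      ring
    · rintro s'' hf ⟨l1, l2, l3, l4, l5, l6⟩
      simp [l1, l4, l6, kv]
    · rintro t₂ s₂ ⟨ht₂, ⟨l1, l2, l3, l4, l5, l6⟩, hf₂⟩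
      have hb := boxSize_pos m (D.take p)
      have hbm : m D[p] ≤ boxSize m (D.take p) * m D[p] := Nat.le_mul_of_pos_left _ hb
      have hidx : ∀ q (hq : q < D.length), s₂.idx 60 D[q] 0 =
          if q = p then s'.var 69 else s'.idx 60 D[q] 0 := by
        intro q hq
        rw [l4, j3]
        simp [hD.getElem_inj_iff]
      refine ⟨?_, ?_, ?_, ?_, ?_, ?_, ?_, ?_⟩
      · simp at ht₂
        rw [htake, boxSize_concat, mul_add (boxSize m (D.take p)), mul_one]
        simp
        omega
      · simp [l3]
      · simp only [Nat.reduceEqDiff, reduceIte, l2]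
        exact Nat.mod_lt _ (by omega)
      · simp only [Nat.reduceEqDiff, reduceIte, l2, htake, linearWeight,
          List.foldl_append, List.foldl_cons, List.foldl_nil]
        exact (Nat.mod_modEq _ _).trans ((i3.mul_left _).add_right _)
      · intro q hq hqp
        simp only [hidx q hq]
        split_ifs with h
        · subst h; exact ⟨i2, i3⟩
        · exact i4 q hq (by omega)
      · intro a ha
        rw [l4, j3]
        funext u j
        simp [ha, i5]
      · rw [Memory.setVar_num, Memory.setVar_num, l5, j4]
        simp [i6]
      · intro x hx
        have e1 := hf₂.var x (by omega)
        have e2 := j2 x (by omega)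
        simp only [Memory.setVar_var, Memory.setIdx_var] at e1 e2 ⊢
        rw [if_neg (by omega), if_neg (by omega), e1, if_neg (by omega), e2, if_neg (by omega),
          if_neg (by omega), i7 x hx]
  · rintro s' - ⟨i1, i2, i3, i4, i5, i6, i7⟩
    have gl : s'.idx 41 0 0 = D.length := by rw [i5 41 (by norm_num), h41]
    simp [i1, gl]
  · rintro t s' ⟨ht, ⟨i1, i2, i3, i4, i5, i6, i7⟩, hf⟩
    rw [List.take_length] at ht
    have := boxSize_pos m D
    refine ⟨by simp at ht ⊢; omega, ?_, fun p hp => (i4 p hp hp).2, i5, i6, i7⟩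
    intro v hv
    obtain ⟨p, hp, rfl⟩ := List.mem_iff_getElem.mp hv
    exact (i4 p hp hp).1

/-- The convolution of the transformed tables: multiplies the two transforms, transforms back, and
reads off the entries of the product table. -/
def multiplyTables : Program :=
  .seq (loadTable 0 61) <|
  .seq (.setVar 76 (.lit 0)) <|
  .seq (.loop (.lt (.var 76) (.var 66)) <|
    .seq (.setNum 75 (.lit 0) (.var 76) (.get 80 (.var 80) (.var 76)))
      (.setVar 76 (.add (.var 76) (.lit 1)))) <|
  .seq (loadTable 1 62) <|
  .seq (.setVar 76 (.lit 0)) <|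
  .seq (.loop (.lt (.var 76) (.var 66)) <|
    .seq (.setNum 80 (.lit 0) (.var 76)
        (.mul (.get 75 (.lit 0) (.var 76)) (.get 80 (.var 80) (.var 76))))
      (.setVar 76 (.add (.var 76) (.lit 1)))) <|
  .seq fft <|
  .seq (.setVar 76 (.lit 0)) <|
  .loop (.lt (.var 76) (.var 63)) <|
    .seq (.setVar 70 (.sub (.var 66) (.get 71 (.lit 0) (.var 76)))) <|
    .seq (.ite (.lt (.var 70) (.var 66)) .skip (.setVar 70 (.lit 0))) <|
    .seq (.setNum 60 (.var 61) (.var 76)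
      (.div (.get 80 (.var 80) (.var 70)) (.cast (.var 66)))) <|
    .setVar 76 (.add (.var 76) (.lit 1))

/-- The third transform, read at the place c, collects the pairs with i + j + c ≡ 0. The entry for i
+ j ≡ k is therefore at n - k, which for k = 0 is the place 0. -/
theorem dft_scatter_mul {n N N' : ℕ} (hn : n ≠ 0) {e e' : ℕ → ℕ} (he : ∀ i < N, e i < n)
    (he' : ∀ i < N', e' i < n) (A B : ℕ → ℂ) {k : ℕ} (hk : k < n) :
    dft n (fun a => dft n (scatter N e A) a * dft n (scatter N' e' B) a)
        (if n - k < n then n - k else 0) / n =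
      ∑ i ∈ Finset.range N, ∑ j ∈ Finset.range N', if e i + e' j ≡ k [MOD n] then A i * B j else 0 := by
  have hn' : (n : ℂ) ≠ 0 := by exact_mod_cast hn
  rw [dft_mul_dft hn, mul_div_cancel_left₀ _ hn']
  have hiff : ∀ i j, n ∣ i + j + (if n - k < n then n - k else 0) ↔ i + j ≡ k [MOD n] := by
    intro i j
    rcases Nat.eq_zero_or_pos k with rfl | hk0
    · simp [Nat.modEq_zero_iff_dvd]
    · rw [if_pos (by omega)]
      constructor
      · intro h
        have h1 : i + j + (n - k) + k ≡ 0 + k [MOD n] := Nat.ModEq.add_right k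
          ((Nat.modEq_zero_iff_dvd).mpr h)
        rw [show i + j + (n - k) + k = i + j + n by omega, zero_add] at h1
        have h2 : i + j + n ≡ i + j [MOD n] := by simp [Nat.ModEq]
        exact h2.symm.trans h1
      · intro h
        rw [← Nat.modEq_zero_iff_dvd]
        have := h.add_right (n - k)
        rw [show k + (n - k) = n by omega] at this
        exact this.trans (by simp [Nat.ModEq])
  simp only [hiff]
  have h1 : ∀ i j, (if i + j ≡ k [MOD n] then scatter N e A i * scatter N' e' B j else 0) =
      scatter N e A i * (scatter N' e' B j * if i + j ≡ k [MOD n] then 1 else 0) := by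
    intro i j
    split_ifs <;> ring
  simp only [h1, ← Finset.mul_sum, sum_scatter he]
  refine Finset.sum_congr rfl fun i _ => ?_
  rw [sum_scatter he', Finset.mul_sum]
  refine Finset.sum_congr rfl fun j _ => ?_
  split_ifs <;> ring

/-- The first transform is saved in the number array `75`, because the second one reuses the array
`80`. The product table may replace the first factor, as both factors have been transformed by the
time the output is written. -/
theorem wp_multiplyTables {s : Memory} {h N N' : ℕ} (hh : 0 < h) (h66 : s.var 66 = 2 ^ h)
    (h67 : s.var 67 = 2 ^ (h - 1)) (h63 : s.var 63 = N) (h72 : s.idx 72 0 0 = N)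
    (h72' : s.idx 72 1 0 = N') (hN : N ≤ 2 ^ h) (hN' : N' ≤ 2 ^ h)
    (he : ∀ i < N, s.idx 71 0 i < 2 ^ h) (he' : ∀ i < N', s.idx 71 1 i < 2 ^ h)
    (hinj : ∀ i < N, ∀ j < N, s.idx 71 0 i = s.idx 71 0 j → i = j)
    (hinj' : ∀ i < N', ∀ j < N', s.idx 71 1 i = s.idx 71 1 j → i = j) :
    WP multiplyTables s fun t s' => t ≤ 700 * (2 ^ h * (h + 1)) ∧
      (∀ k < N, s'.num 60 (s.var 61) k = ∑ i ∈ Finset.range N, ∑ j ∈ Finset.range N',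
        if s.idx 71 0 i + s.idx 71 1 j ≡ s.idx 71 0 k [MOD 2 ^ h] then
          s.num 60 (s.var 61) i * s.num 60 (s.var 62) j else 0) ∧
      ∀ r, r ≠ s.var 61 → s'.num 60 r = s.num 60 r := by
  set f := scatter N (s.idx 71 0) (s.num 60 (s.var 61)) with hf
  set g := scatter N' (s.idx 71 1) (s.num 60 (s.var 62)) with hg
  have hpos : 1 ≤ 2 ^ h := Nat.one_le_two_pow
  simp only [multiplyTables, wp_seq, wp_setVar, IExp.cost]
  refine WP.mono (wp_loadTable (row := 0) (x := 61) (by norm_num) h66 h67 h72 hN hinj) ?_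
  rintro t₁ s₁ ⟨ht₁, v1, n1, f1⟩
  rw [← hf] at n1
  refine WP.mono (wp_loop 75 (2 ^ h) (fun i s' => s'.var 76 = i ∧
      (∀ c < i, s'.num 75 0 c = dft (2 ^ h) f c) ∧ s'.num 80 = s₁.num 80 ∧ s'.var 80 = h)
    (fun i => i * 20) (by decide) ?_ ?_ ?_) ?_
  · simp [v1]
  · rintro i hi s' hf' ⟨i1, i2, i3, i4⟩
    have g66 : s'.var 66 = 2 ^ h := by
      rw [hf'.var 66 (by norm_num), Memory.setVar_var, f1.var 66 (by norm_num)]; simpa using h66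
    simp [i1, g66, hi, i4, i3, n1 i hi]
    refine ⟨by omega, ?_, ?_⟩
    · intro c hc
      split_ifs with hci
      · rw [hci]
      · exact i2 c (by omega)
    · funext r j; simp [i3]
  · rintro s' hf' ⟨i1, -⟩
    have g66 : s'.var 66 = 2 ^ h := by
      rw [hf'.var 66 (by norm_num), Memory.setVar_var, f1.var 66 (by norm_num)]; simpa using h66
    simp [i1, g66]
  rintro t₂ s₂ ⟨ht₂, ⟨-, n2, -⟩, f2⟩
  have f2' : Frame 75 s s₂ := (f1.mono (by norm_num)).trans
    (Frame.trans ⟨fun x hx => by simp [show x ≠ 76 by omega], by simp, by simp⟩ f2)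
  refine WP.mono (wp_loadTable (s := s₂) (row := 1) (x := 62) (h := h) (N := N') (by norm_num)
    (by rw [f2'.var 66 (by norm_num), h66]) (by rw [f2'.var 67 (by norm_num), h67])
    (by rw [f2'.idx 72 (by norm_num), h72']) hN' (by rw [f2'.idx 71 (by norm_num)]; exact hinj')) ?_
  rintro t₃ s₃ ⟨ht₃, v3, n3, f3⟩
  rw [f2'.idx 71 (by norm_num), f2'.num 60 (by norm_num), f2'.var 62 (by norm_num), ← hg] at n3
  have f3' := f2'.trans (f3.mono (by norm_num))
  have n3' : ∀ c < 2 ^ h, s₃.num 75 0 c = dft (2 ^ h) f c := by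
    rw [f3.num 75 (by norm_num)]
    exact n2
  clear n2 n1
  refine WP.mono (wp_loop 76 (2 ^ h) (fun i s' => s'.var 76 = i ∧
      (∀ c < i, s'.num 80 0 c = dft (2 ^ h) f c * dft (2 ^ h) g c) ∧
      (∀ c < 2 ^ h, s'.num 80 h c = dft (2 ^ h) g c) ∧ s'.var 80 = h)
    (fun i => i * 30) (by decide) ?_ ?_ ?_) ?_
  · simpa [v3] using n3
  · rintro i hi s' hf' ⟨i1, i2, i3, i4⟩
    have g66 : s'.var 66 = 2 ^ h := by
      rw [hf'.var 66 (by norm_num), Memory.setVar_var, f3'.var 66 (by norm_num)]; simpa using h66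
    have g75 : s'.num 75 0 i = dft (2 ^ h) f i := by
      rw [hf'.num 75 (by norm_num), Memory.setVar_num, n3' i hi]
    simp [i1, g66, hi, i4, i3, g75, hh.ne']
    refine ⟨by omega, ?_, fun c hc => i3 c hc⟩
    intro c hc
    split_ifs with hci
    · rw [hci]
    · exact i2 c (by omega)
  · rintro s' hf' ⟨i1, -⟩
    have g66 : s'.var 66 = 2 ^ h := by
      rw [hf'.var 66 (by norm_num), Memory.setVar_var, f3'.var 66 (by norm_num)]; simpa using h66
    simp [i1, g66]
  rintro t₄ s₄ ⟨ht₄, ⟨-, n4, -⟩, f4⟩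
  have f4' : Frame 75 s s₄ := f3'.trans
    (Frame.trans ⟨fun x hx => by simp [show x ≠ 76 by omega], by simp, by simp⟩ (f4.mono (by norm_num)))
  refine WP.mono (wp_fft (s := s₄) (h := h) (by rw [f4'.var 66 (by norm_num), h66])
    (by rw [f4'.var 67 (by norm_num), h67])) ?_
  rintro t₅ s₅ ⟨ht₅, v5, n5, f5⟩
  have f5' := f4'.trans (f5.mono (by norm_num))
  have n5' : ∀ k < 2 ^ h, s₅.num 80 h k =
      dft (2 ^ h) (fun a => dft (2 ^ h) f a * dft (2 ^ h) g a) k := by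
    intro k hk
    rw [n5 k hk, dft_congr n4]
  clear n5 n4 n3
  refine WP.mono (wp_loop 60 N (fun i s' => s'.var 76 = i ∧
      (∀ k < i, s'.num 60 (s.var 61) k =
        dft (2 ^ h) (fun a => dft (2 ^ h) f a * dft (2 ^ h) g a)
          (if 2 ^ h - s.idx 71 0 k < 2 ^ h then 2 ^ h - s.idx 71 0 k else 0) / (2 ^ h : ℕ)) ∧
      (∀ r, r ≠ s.var 61 → s'.num 60 r = s.num 60 r) ∧ s'.num 80 = s₅.num 80 ∧
      s'.idx = s₅.idx ∧ ∀ x, x ≠ 70 → x ≠ 76 → s'.var x = s₅.var x)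
    (fun i => i * 60) (by decide) ?_ ?_ ?_) ?_
  · simp +contextual [f5'.num 60 (by norm_num)]
  · rintro i hi s' - ⟨i1, i2, i3, i4, i5, i6⟩
    have g63 : s'.var 63 = N := by
      rw [i6 63 (by norm_num) (by norm_num), f5'.var 63 (by norm_num), h63]
    have g66 : s'.var 66 = 2 ^ h := by
      rw [i6 66 (by norm_num) (by norm_num), f5'.var 66 (by norm_num), h66]
    have g61 : s'.var 61 = s.var 61 := by
      rw [i6 61 (by norm_num) (by norm_num), f5'.var 61 (by norm_num)]
    have g80 : s'.var 80 = h := by rw [i6 80 (by norm_num) (by norm_num), v5]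
    have g71 : s'.idx 71 0 i = s.idx 71 0 i := by rw [i5, f5'.idx 71 (by norm_num)]
    have hlt : (if 2 ^ h - s.idx 71 0 i < 2 ^ h then 2 ^ h - s.idx 71 0 i else 0) < 2 ^ h := by
      split_ifs with hc
      · exact hc
      · exact hpos
    have hval := n5' _ hlt
    refine ⟨by simp [i1, g63, hi], ?_⟩
    by_cases hc : 2 ^ h - s.idx 71 0 i < 2 ^ h
    · rw [if_pos hc] at hval
      simp only [wp_seq, wp_setVar, wp_ite, wp_skip, wp_setNum, IExp.eval, NExp.eval, BExp.eval,
        Memory.setVar_var, Memory.setVar_idx, Memory.setVar_num, Memory.setNum_var,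
        Memory.setNum_num, Memory.setNum_idx, i1, g66, g61, g80, g71, i4, hc, hval, Nat.reduceEqDiff,
        reduceIte, decide_true, IExp.cost, NExp.cost, BExp.cost, true_and]
      refine ⟨by omega, fun k hk => ?_, fun r hr => ?_, ?_, i5, fun x hx hx' => ?_⟩
      · by_cases hki : k = i
        · subst hki
          simp [hc]
        · rw [if_neg hki]
          exact i2 k (by omega)
      · funext j; simp [hr, i3 r hr]
      · funext r j; simp [i4]
      · simp [hx, hx', i6 x hx hx']
    · rw [if_neg hc] at hval
      simp only [wp_seq, wp_setVar, wp_ite, wp_skip, wp_setNum, IExp.eval, NExp.eval, BExp.eval,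
        Memory.setVar_var, Memory.setVar_idx, Memory.setVar_num, Memory.setNum_var,
        Memory.setNum_num, Memory.setNum_idx, i1, g66, g61, g80, g71, i4, hc, hval, Nat.reduceEqDiff,
        reduceIte, decide_false, Bool.false_eq_true, IExp.cost, NExp.cost, BExp.cost, true_and]
      refine ⟨by omega, fun k hk => ?_, fun r hr => ?_, ?_, i5, fun x hx hx' => ?_⟩
      · by_cases hki : k = i
        · subst hki
          simp [hc]
        · rw [if_neg hki]
          exact i2 k (by omega)
      · funext j; simp [hr, i3 r hr]
      · funext r j; simp [i4]
      · simp [hx, hx', i6 x hx hx']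
  · rintro s' - ⟨i1, i2, i3, i4, i5, i6⟩
    have g63 : s'.var 63 = N := by
      rw [i6 63 (by norm_num) (by norm_num), f5'.var 63 (by norm_num), h63]
    simp [i1, g63]
  · rintro t₆ s₆ ⟨ht₆, ⟨-, n6, r6, -⟩, -⟩
    refine ⟨?_, fun k hk => ?_, r6⟩
    · simp only [BExp.cost, IExp.cost] at ht₂ ht₄ ht₆
      nlinarith
    · rw [n6 k hk, dft_scatter_mul (by positivity) he he' _ _ (he k hk)]

/-- Multiplies the table in row `var 61` of the number array `60`, for the list of variables in row
`0` of the index array `40`, by the table in row `var 62`, for the list in row `1`. -/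
def truncatedMul : Program :=
  .seq computeSize <|
  .seq computeLength <|
  .seq computeWeights <|
  .seq (.setVar 60 (.lit 0)) <|
  .seq buildIndexMap <|
  .seq (.setVar 60 (.lit 1)) <|
  .seq buildIndexMap multiplyTables

theorem boxSize_eq_prod (m : ℕ → ℕ) {D : List ℕ} (hD : D.Nodup) :
    boxSize m D = ∏ v ∈ D.toFinset, (m v + 1) := by
  rw [boxSize, List.prod_toFinset _ hD]

theorem boxSize_le_of_subset {m : ℕ → ℕ} {K J : List ℕ} (hK : K.Nodup) (hJ : J.Nodup)
    (h : ∀ v ∈ J, v ∈ K) : boxSize m J ≤ boxSize m K := by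
  rw [boxSize_eq_prod m hK, boxSize_eq_prod m hJ]
  refine Finset.prod_le_prod_of_subset_of_one_le' (fun v => by simpa using h v) ?_
  intro v _ _
  omega

theorem length_le_of_subset {K J : List ℕ} (hJ : J.Nodup) (h : ∀ v ∈ J, v ∈ K) :
    J.length ≤ K.length :=
  (hJ.subperm h).length_le

/-- The time is kept in terms of the transform length 2^h, which dominates the box size and the
number of variables, so that all linear preparations are absorbed in 2^h (h + 1). -/
theorem wp_truncatedMul {s : Memory} {m : ℕ → ℕ} {K J : List ℕ} (hK : K.Nodup) (hJ : J.Nodup)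
    (hJK : ∀ v ∈ J, v ∈ K) (h41 : s.idx 41 0 0 = K.length) (h41' : s.idx 41 1 0 = J.length)
    (h40 : StoresList (s.idx 40 0) K) (h40' : StoresList (s.idx 40 1) J)
    (h22 : ∀ v ∈ K, s.idx 22 v 0 = m v) {F G : MvPowerSeries ℕ ℂ}
    (hF : IsTable m K (s.num 60 (s.var 61)) F) (hG : IsTable m J (s.num 60 (s.var 62)) G) :
    WP truncatedMul s fun t s' =>
      (∃ h, 2 ^ h ≤ 8 * boxSize m K * (K.length + 1) ∧ t ≤ 2000 * (2 ^ h * (h + 1))) ∧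
      IsTable m K (s'.num 60 (s.var 61)) (F * G) ∧
      (∀ r, r ≠ s.var 61 → s'.num 60 r = s.num 60 r) ∧ Frame 60 s s' := by
  refine WP.mono (WP.frame (Q := fun t s' =>
      (∃ h, 2 ^ h ≤ 8 * boxSize m K * (K.length + 1) ∧ t ≤ 2000 * (2 ^ h * (h + 1))) ∧
      IsTable m K (s'.num 60 (s.var 61)) (F * G) ∧
      (∀ r, r ≠ s.var 61 → s'.num 60 r = s.num 60 r)) ?_ 60 (by decide))
    (by rintro t s' ⟨⟨a, b, c⟩, d⟩; exact ⟨a, b, c, d⟩)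
  have hNpos := boxSize_pos m K
  have hN' := boxSize_le_of_subset (m := m) hK hJ hJK
  have hlen := length_le_of_subset hJ hJK
  simp only [truncatedMul, wp_seq, wp_setVar, IExp.eval, IExp.cost]
  refine WP.mono (wp_computeSize h41 h40 h22) ?_
  rintro t₁ s₁ ⟨ht₁, v1, x1, n1, f1⟩
  refine WP.mono (wp_computeLength hNpos v1 (by rw [x1, h41])) ?_
  rintro t₂ s₂ ⟨ht₂, x2, n2, ⟨h, H, L, v65, v66, v67, hHL, hh, hH, hL, hle⟩, f2⟩
  have hn1 : 1 < 2 ^ h := Nat.one_lt_two_pow hh.ne'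
  have hx2 : s₂.idx = s.idx := x2.trans x1
  have hpow : 0 < 2 ^ h := by positivity
  have hH2 : H < 2 * 2 ^ h := by
    have : H ≤ 2 ^ h := by
      rw [hHL]
      exact Nat.le_mul_of_pos_right _ (by omega)
    omega
  refine WP.mono (wp_computeWeights (m := m) hK v66 v65 hn1 hH2 (by rw [hx2, h41])
    (by rw [hx2]; exact h40) (by rw [hx2]; exact h22)) ?_
  rintro t₃ s₃ ⟨ht₃, hφ, hw, x3, n3, v3⟩
  have hx3 : ∀ a, a ≠ 60 → s₃.idx a = s.idx a := fun a ha => by rw [x3 a ha, hx2]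
  set φ : ℕ → ℕ := fun v => s₃.idx 60 v 0 with hφdef
  refine WP.mono (wp_buildIndexMap (s := s₃.setVar 60 0) (m := m) (n := 2 ^ h) (row := 0) hK (by simp)
    (by simp [v3, v66]) hpow (by simp [hx3, h41]) (by simpa [hx3] using h40)
    (by simpa [hx3] using h22) (by simpa using hφ)) ?_
  rintro t₄ s₄ ⟨ht₄, e4, i4, -, f4⟩
  have h4v : ∀ x, x < 70 → x ≠ 60 → s₄.var x = s₃.var x := by
    intro x hx hx'
    rw [f4.var x hx]
    simp [hx']
  have h4i : ∀ a, a < 70 → s₄.idx a = s₃.idx a := by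
    intro a ha
    rw [f4.idx a ha]
    simp
  refine WP.mono (wp_buildIndexMap (s := s₄.setVar 60 1) (m := m) (n := 2 ^ h) (row := 1) hJ (by simp)
    (by simp [h4v, v3, v66]) hpow (by simp [h4i, hx3, h41'])
    (by simpa [h4i, hx3] using h40') (by simpa [h4i, hx3] using fun v hv => h22 v (hJK v hv))
    (by simpa [h4i] using fun v hv => hφ v (hJK v hv))) ?_
  rintro t₅ s₅ ⟨ht₅, e5, i5, r5, f5⟩
  have h5v : ∀ x, x < 69 → x ≠ 60 → s₅.var x = s₂.var x := by
    intro x hx hx'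
    rw [f5.var x (by omega), Memory.setVar_var, if_neg hx', h4v x (by omega) hx', v3 x hx]
  have h61 : s₅.var 61 = s.var 61 := by
    rw [h5v 61 (by norm_num) (by norm_num), f2.var 61 (by norm_num), f1.var 61 (by norm_num)]
  have h62 : s₅.var 62 = s.var 62 := by
    rw [h5v 62 (by norm_num) (by norm_num), f2.var 62 (by norm_num), f1.var 62 (by norm_num)]
  have h5n : s₅.num 60 = s.num 60 := by
    rw [f5.num 60 (by norm_num), Memory.setVar_num, f4.num 60 (by norm_num), Memory.setVar_num, n3,
      n2, n1]
  have i5' : ∀ ν : ℕ → ℕ, (∀ u ∈ J, ν u ≤ m u) →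
      s₅.idx 71 1 (mixedRadix m J ν) = weightedSum φ J ν % 2 ^ h := by
    intro ν hν
    rw [i5 ν hν]
    simp only [Memory.setVar_idx, h4i 60 (by norm_num), hφdef]
  have i4' : ∀ ν : ℕ → ℕ, (∀ u ∈ K, ν u ≤ m u) →
      s₅.idx 71 0 (mixedRadix m K ν) = weightedSum φ K ν % 2 ^ h := by
    intro ν hν
    have := i4 ν hν
    rw [(r5 0 (by norm_num)).1]
    simpa using this
  have hmod : ∀ a b c : ℕ → ℕ, (∀ v ∈ K, a v ≤ m v) → (∀ v ∈ K, b v ≤ m v) → (∀ v ∈ K, c v ≤ m v) →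
      (weightedSum φ K a + weightedSum φ K b ≡ weightedSum φ K c [MOD 2 ^ h] ↔
        ∀ v ∈ K, a v + b v = c v) := by
    intro a b c ha hb hc
    rw [← linearIndex_add_modEq_iff ha hb hc hH hL, ← hHL]
    have e := linearIndex_modEq (φ := φ) K 1 hw
    constructor
    · exact fun hmod => (((e a).add (e b)).symm.trans hmod).trans (e c)
    · exact fun hmod => (((e a).add (e b)).trans hmod).trans (e c).symm
  have hNle : boxSize m K ≤ 2 ^ h := by
    rw [hHL]
    exact (by omega : boxSize m K ≤ H).trans (Nat.le_mul_of_pos_right _ (by omega))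
  -- Injectivity is the case a + 0 = b of the recognition of sums.
  have inj : ∀ {D : List ℕ} {r : ℕ}, D.Nodup → (∀ v ∈ D, v ∈ K) →
      (∀ ν : ℕ → ℕ, (∀ u ∈ D, ν u ≤ m u) →
        s₅.idx 71 r (mixedRadix m D ν) = weightedSum φ D ν % 2 ^ h) →
      ∀ i < boxSize m D, ∀ j < boxSize m D, s₅.idx 71 r i = s₅.idx 71 r j → i = j := by
    intro D r hD hDK hr i hi j hj hij
    obtain ⟨a, a1, a2, rfl⟩ := exists_mixedRadix hD hi
    obtain ⟨b, b1, b2, rfl⟩ := exists_mixedRadix hD hj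
    have ext_le : ∀ {c : ℕ → ℕ}, (∀ v ∈ D, c v ≤ m v) → (∀ v ∉ D, c v = 0) → ∀ v ∈ K, c v ≤ m v := by
      intro c c1 c2 v _
      by_cases hv : v ∈ D
      · exact c1 v hv
      · rw [c2 v hv]; exact Nat.zero_le _
    rw [hr a a1, hr b b1, weightedSum_subset hK hD hDK a2, weightedSum_subset hK hD hDK b2] at hij
    have := (hmod a 0 b (ext_le a1 a2) (by simp) (ext_le b1 b2)).mp (by
      have h0 : weightedSum φ K 0 = 0 := by simp [weightedSum]
      rw [h0]
      exact hij)
    exact mixedRadix_congr fun v hv => by simpa using this v (hDK v hv)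
  have bnd : ∀ {D : List ℕ} {r : ℕ}, D.Nodup →
      (∀ ν : ℕ → ℕ, (∀ u ∈ D, ν u ≤ m u) →
        s₅.idx 71 r (mixedRadix m D ν) = weightedSum φ D ν % 2 ^ h) →
      ∀ i < boxSize m D, s₅.idx 71 r i < 2 ^ h := by
    intro D r hD hr i hi
    obtain ⟨a, a1, a2, rfl⟩ := exists_mixedRadix hD hi
    rw [hr a a1]
    exact Nat.mod_lt _ hpow
  refine WP.mono (wp_multiplyTables (s := s₅) (N := boxSize m K) (N' := boxSize m J) hh
    (by rw [h5v 66 (by norm_num) (by norm_num), v66])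
    (by rw [h5v 67 (by norm_num) (by norm_num), v67])
    (by rw [h5v 63 (by norm_num) (by norm_num), f2.var 63 (by norm_num), v1])
    (by rw [(r5 0 (by norm_num)).2]; simpa using e4) e5 hNle (by omega)
    (bnd hK i4') (bnd hJ i5') (inj hK (fun _ h => h) i4') (inj hJ hJK i5')) ?_
  rintro t₆ s₆ ⟨ht₆, hC, hr⟩
  rw [h61, h62, h5n] at hC
  rw [h61, h5n] at hr
  refine ⟨⟨h, hle, ?_⟩, IsTable.mul hK hJ hJK hF hG hmod i4' i5' hC, hr⟩
  have hKL : K.length ≤ 2 ^ h := by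
    rw [hHL]
    exact hL.le.trans (Nat.le_mul_of_pos_left _ (by omega))
  have hX : 2 ^ h ≤ 2 ^ h * (h + 1) := Nat.le_mul_of_pos_right _ (by omega)
  clear hF hG hC hr hφ hw inj bnd i4 i5 i4' i5' hmod
  generalize 2 ^ h * (h + 1) = X at *
  generalize 2 ^ h = P at *
  omega

/-! ## The generating function of the loop hafnian -/

open MvPowerSeries in
theorem coeff_X_mul_eq (F : MvPowerSeries ℕ ℂ) (s : ℕ) (n : ℕ →₀ ℕ) :
    coeff n (X s * F) = if n s = 0 then 0 else coeff (n - Finsupp.single s 1 : ℕ →₀ ℕ) F := by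
  classical
  rw [X, coeff_monomial_mul, one_mul]
  have : Finsupp.single s 1 ≤ n ↔ n s ≠ 0 := by
    rw [Finsupp.single_le_iff, Nat.one_le_iff_ne_zero]
  simp only [this]
  split_ifs <;> simp_all

/-- The coefficients of `exp (β (x + x ^ 2 / 2))`. -/
noncomputable def loopCoeff (β : ℂ) : ℕ → ℂ
  | 0 => 1
  | 1 => β
  | k + 2 => β * (loopCoeff β (k + 1) + loopCoeff β k) / (k + 2)

open Classical in
/-- The power series `exp (β (x_e + x_e ^ 2 / 2))`. -/
noncomputable def loopFactor (e : ℕ) (β : ℂ) : MvPowerSeries ℕ ℂ :=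
  fun n => if ∀ v, v ≠ e → n v = 0 then loopCoeff β (n e) else 0

open Classical in
/-- The power series `exp (b x_e x_u)`. -/
noncomputable def edgeFactor (e u : ℕ) (b : ℂ) : MvPowerSeries ℕ ℂ :=
  fun n => if n e = n u ∧ ∀ v, v ≠ e → v ≠ u → n v = 0 then b ^ n e / (n e).factorial else 0

section Factors

open MvPowerSeries

theorem coeff_loopFactor_zero (e : ℕ) (β : ℂ) : coeff 0 (loopFactor e β) = 1 := by
  classical
  exact (if_pos (by simp)).trans (by simp [loopCoeff])

theorem coeff_edgeFactor_zero (e u : ℕ) (b : ℂ) : coeff 0 (edgeFactor e u b) = 1 := by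
  classical
  exact (if_pos (by simp)).trans (by simp)

theorem edgeFactor_comm (e u : ℕ) (b : ℂ) : edgeFactor e u b = edgeFactor u e b := by
  classical
  funext n
  simp only [edgeFactor]
  have : (n e = n u ∧ ∀ v, v ≠ e → v ≠ u → n v = 0) ↔ (n u = n e ∧ ∀ v, v ≠ u → v ≠ e → n v = 0) := by
    constructor <;> exact fun h => ⟨h.1.symm, fun v h1 h2 => h.2 v h2 h1⟩
  rw [if_congr this rfl rfl]
  split_ifs with h
  · rw [h.1]
  · rfl

/-- The differential equation F' = β (1 + x) F, read off at x^k. -/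
theorem loopCoeff_succ (β : ℂ) (k : ℕ) : loopCoeff β (k + 1) * (k + 1) =
    β * (loopCoeff β k + if k = 0 then 0 else loopCoeff β (k - 1)) := by
  cases k with
  | zero => simp [loopCoeff]
  | succ k =>
    have : (k : ℂ) + 2 ≠ 0 := by exact_mod_cast (show k + 2 ≠ 0 by omega)
    rw [loopCoeff, if_neg (by omega), Nat.add_sub_cancel]
    push_cast
    rw [show (k : ℂ) + 1 + 1 = k + 2 by ring]
    field_simp

theorem pderiv_loopFactor_self (e : ℕ) (β : ℂ) :
    pderiv ℂ e (loopFactor e β) = C β * (1 + X e) * loopFactor e β := by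
  classical
  ext n
  rw [coeff_pderiv, mul_assoc, coeff_C_mul, add_mul, one_mul, map_add, coeff_X_mul_eq]
  simp only [coeff_apply, loopFactor]
  have h1 : (∀ v, v ≠ e → (n + Finsupp.single e 1 : ℕ →₀ ℕ) v = 0) ↔ ∀ v, v ≠ e → n v = 0 := by
    refine forall₂_congr fun v hv => ?_
    simp [hv.symm]
  have h2 : (∀ v, v ≠ e → (n - Finsupp.single e 1 : ℕ →₀ ℕ) v = 0) ↔ ∀ v, v ≠ e → n v = 0 := by
    refine forall₂_congr fun v hv => ?_
    simp [hv.symm]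
  simp only [h1, h2]
  by_cases h : ∀ v, v ≠ e → n v = 0
  · rw [if_pos h, if_pos h, if_pos h]
    simp [loopCoeff_succ]
  · simp [if_neg h]

/-- All derivatives are brought to the form L F, with a logarithmic derivative L that may be zero,
so that the rule for products applies uniformly. -/
theorem pderiv_loopFactor_of_ne {e v : ℕ} (hv : v ≠ e) (β : ℂ) :
    pderiv ℂ v (loopFactor e β) = 0 * loopFactor e β := by
  classical
  ext n
  rw [coeff_pderiv, zero_mul, coeff_zero]
  simp only [coeff_apply, loopFactor]
  rw [if_neg, zero_mul]
  intro h
  simpa using h v hv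

/-- At an exponent vector with equal exponents j at `e` and `u` the coefficient is b^j / j!. Raising
the exponent at `e` gives the derivative; lowering the one at `u` undoes the multiplication by x_u.
The two operations lead to the same equality condition. -/
theorem pderiv_edgeFactor_left {e u : ℕ} (heu : e ≠ u) (b : ℂ) :
    pderiv ℂ e (edgeFactor e u b) = C b * X u * edgeFactor e u b := by
  classical
  ext n
  rw [coeff_pderiv, mul_assoc, coeff_C_mul, coeff_X_mul_eq]
  simp only [coeff_apply, edgeFactor]
  have h1 : (∀ v, v ≠ e → v ≠ u → (n + Finsupp.single e 1 : ℕ →₀ ℕ) v = 0) ↔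
      ∀ v, v ≠ e → v ≠ u → n v = 0 := by
    refine forall₃_congr fun v hv _ => ?_
    simp [hv.symm]
  have h2 : (∀ v, v ≠ e → v ≠ u → (n - Finsupp.single u 1 : ℕ →₀ ℕ) v = 0) ↔
      ∀ v, v ≠ e → v ≠ u → n v = 0 := by
    refine forall₃_congr fun v _ hv => ?_
    simp [hv.symm]
  have e1 : (n + Finsupp.single e 1 : ℕ →₀ ℕ) e = n e + 1 := by simp
  have e2 : (n + Finsupp.single e 1 : ℕ →₀ ℕ) u = n u := by simp [heu]
  have e3 : (n - Finsupp.single u 1 : ℕ →₀ ℕ) e = n e := by simp [heu.symm]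
  have e4 : (n - Finsupp.single u 1 : ℕ →₀ ℕ) u = n u - 1 := by simp
  simp only [h1, h2, e1, e2, e3, e4]
  rcases Nat.eq_zero_or_pos (n u) with h0 | h0
  · rw [if_pos h0, if_neg (by omega)]
    simp
  · rw [if_neg h0.ne']
    have h3 : n e + 1 = n u ↔ n e = n u - 1 := by omega
    simp only [h3]
    split_ifs with h
    · have : (n e : ℂ) + 1 ≠ 0 := by exact_mod_cast Nat.succ_ne_zero (n e)
      have hf : ((n e).factorial : ℂ) ≠ 0 := by exact_mod_cast Nat.factorial_ne_zero _
      rw [Nat.factorial_succ, pow_succ]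
      push_cast
      field_simp
    · simp

theorem pderiv_edgeFactor_right {e u : ℕ} (heu : e ≠ u) (b : ℂ) :
    pderiv ℂ u (edgeFactor e u b) = C b * X e * edgeFactor e u b := by
  rw [edgeFactor_comm, pderiv_edgeFactor_left heu.symm]

theorem pderiv_edgeFactor_of_ne {e u v : ℕ} (he : v ≠ e) (hu : v ≠ u) (b : ℂ) :
    pderiv ℂ v (edgeFactor e u b) = 0 * edgeFactor e u b := by
  classical
  ext n
  rw [coeff_pderiv, zero_mul, coeff_zero]
  simp only [coeff_apply, edgeFactor]
  rw [if_neg, zero_mul]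
  rintro ⟨-, h⟩
  simpa using h v he hu

/-- Logarithmic derivatives add up. This replaces an exponential of power series: only the values at
zero and the logarithmic derivatives of the factors are used. -/
theorem pderiv_mul_of_eq {v : ℕ} {F G L L' : MvPowerSeries ℕ ℂ} (hF : pderiv ℂ v F = L * F)
    (hG : pderiv ℂ v G = L' * G) : pderiv ℂ v (F * G) = (L + L') * (F * G) := by
  rw [Derivation.leibniz, hF, hG, smul_eq_mul, smul_eq_mul]
  ring

theorem pderiv_prod_of_eq {v : ℕ} {ι : Type*} (S : Finset ι) {F L : ι → MvPowerSeries ℕ ℂ}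
    (h : ∀ i ∈ S, pderiv ℂ v (F i) = L i * F i) :
    pderiv ℂ v (∏ i ∈ S, F i) = (∑ i ∈ S, L i) * ∏ i ∈ S, F i := by
  classical
  induction S using Finset.induction_on with
  | empty => simp
  | insert i S hi ih =>
    rw [Finset.prod_insert hi, Finset.sum_insert hi]
    exact pderiv_mul_of_eq (h i (by simp)) (ih fun j hj => h j (by simp [hj]))

/-- The factor of the generating function that belongs to the loop at `e` and to the edges from `e`
to the vertices in `S`. -/
noncomputable def localFactor (b : ℕ → ℕ → ℂ) (e : ℕ) (S : Finset ℕ) : MvPowerSeries ℕ ℂ :=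
  loopFactor e (b e e) * ∏ u ∈ S, edgeFactor e u (b e u)

variable {b : ℕ → ℕ → ℂ} {e : ℕ} {S : Finset ℕ}

theorem coeff_localFactor_zero : coeff 0 (localFactor b e S) = 1 := by
  rw [localFactor, coeff_zero_eq_constantCoeff_apply, map_mul, map_prod,
    ← coeff_zero_eq_constantCoeff_apply, coeff_loopFactor_zero, Finset.prod_eq_one, one_mul]
  intro u _
  rw [← coeff_zero_eq_constantCoeff_apply, coeff_edgeFactor_zero]

theorem pderiv_localFactor_self (he : e ∉ S) : pderiv ℂ e (localFactor b e S) =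
    (C (b e e) * (1 + X e) + ∑ u ∈ S, C (b e u) * X u) * localFactor b e S :=
  pderiv_mul_of_eq (pderiv_loopFactor_self _ _) <| pderiv_prod_of_eq _ fun _ hu =>
    pderiv_edgeFactor_left (ne_of_mem_of_not_mem hu he).symm _

theorem pderiv_localFactor_of_mem (he : e ∉ S) {v : ℕ} (hv : v ∈ S) :
    pderiv ℂ v (localFactor b e S) = (C (b e v) * X e) * localFactor b e S := by
  have hve : v ≠ e := fun h => he (h ▸ hv)
  have := pderiv_mul_of_eq (pderiv_loopFactor_of_ne hve (b e e))
    (pderiv_prod_of_eq (v := v) S (F := fun u => edgeFactor e u (b e u))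
    (L := fun u => if v = u then C (b e u) * X e else 0) fun u hu => ?_)
  · rw [Finset.sum_ite_eq, if_pos hv, zero_add] at this
    exact this
  · split_ifs with h
    · subst h
      exact pderiv_edgeFactor_right hve.symm _
    · exact pderiv_edgeFactor_of_ne hve h _

theorem pderiv_localFactor_of_notMem {v : ℕ} (hve : v ≠ e) (hv : v ∉ S) :
    pderiv ℂ v (localFactor b e S) = 0 * localFactor b e S := by
  have := pderiv_mul_of_eq (pderiv_loopFactor_of_ne hve (b e e))
    (pderiv_prod_of_eq (v := v) S (F := fun u => edgeFactor e u (b e u)) (L := fun u => 0)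
      fun u hu => pderiv_edgeFactor_of_ne hve (fun h => hv (h ▸ hu)) _)
  rw [Finset.sum_const_zero, zero_add] at this
  exact this

/-- The derivative in x_v vanishes, and in characteristic zero this kills all coefficients with a
positive exponent at `v`. -/
theorem coeff_localFactor_of_notMem {v : ℕ} (hve : v ≠ e) (hv : v ∉ S) {n : ℕ →₀ ℕ} (hn : n v ≠ 0) :
    coeff n (localFactor b e S) = 0 := by
  have h := congrArg (coeff (n - Finsupp.single v 1)) (pderiv_localFactor_of_notMem (b := b) hve hv)
  rw [coeff_pderiv, zero_mul, coeff_zero, tsub_add_cancel_of_le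
    (Finsupp.single_le_iff.mpr (Nat.one_le_iff_ne_zero.mpr hn))] at h
  refine (mul_eq_zero.mp h).resolve_right ?_
  exact_mod_cast Nat.succ_ne_zero ((n - Finsupp.single v 1 : ℕ →₀ ℕ) v)

/-- The recursion for the coefficients with a positive exponent at a neighbor of `e`. -/
theorem coeff_localFactor_edge (he : e ∉ S) {u : ℕ} (hu : u ∈ S) {n : ℕ →₀ ℕ} (hn : n u ≠ 0) :
    coeff n (localFactor b e S) = if n e = 0 then 0 else
      b e u * coeff (n - Finsupp.single u 1 - Finsupp.single e 1) (localFactor b e S) / n u := by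
  have h := congrArg (coeff (n - Finsupp.single u 1)) (pderiv_localFactor_of_mem (b := b) he hu)
  have hue : u ≠ e := fun h => he (h ▸ hu)
  have e1 : (n - Finsupp.single u 1 : ℕ →₀ ℕ) e = n e := by simp [hue]
  have e2 : (((n - Finsupp.single u 1 : ℕ →₀ ℕ) u : ℕ) : ℂ) + 1 = n u := by
    obtain ⟨k, hk⟩ := Nat.exists_eq_succ_of_ne_zero hn
    simp [hk]
  rw [coeff_pderiv, mul_assoc, coeff_C_mul, coeff_X_mul_eq, tsub_add_cancel_of_le
    (Finsupp.single_le_iff.mpr (Nat.one_le_iff_ne_zero.mpr hn)), e1, e2] at h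
  have hn' : (n u : ℂ) ≠ 0 := by exact_mod_cast hn
  rw [eq_div_of_mul_eq hn' h]
  split_ifs <;> simp

/-- The coefficients at the powers of `x_e`. -/
theorem coeff_localFactor_single (he : e ∉ S) (k : ℕ) :
    coeff (Finsupp.single e k) (localFactor b e S) = loopCoeff (b e e) k := by
  induction k using Nat.strong_induction_on with
  | _ k ih =>
    cases k with
    | zero => rw [Finsupp.single_zero, coeff_localFactor_zero, loopCoeff]
    | succ k =>
      have h := congrArg (coeff (Finsupp.single e k)) (pderiv_localFactor_self (b := b) he)
      -- The edge terms of the logarithmic derivative contain some x_u with u ≠ e, so they are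
      -- invisible at a pure power of x_e.
      have hz : coeff (Finsupp.single e k)
          ((∑ u ∈ S, C (b e u) * X u) * localFactor b e S) = 0 := by
        rw [Finset.sum_mul, map_sum]
        refine Finset.sum_eq_zero fun u hu => ?_
        have hue : u ≠ e := fun h => he (h ▸ hu)
        rw [mul_assoc, coeff_C_mul, coeff_X_mul_eq, if_pos, mul_zero]
        simp [hue.symm]
      rw [coeff_pderiv, add_mul, map_add, hz, add_zero, mul_assoc, coeff_C_mul, add_mul, one_mul,
        map_add, coeff_X_mul_eq, ← Finsupp.single_add, Finsupp.single_eq_same, ih k (by omega),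
        ← Finsupp.single_tsub] at h
      have hk : (k : ℂ) + 1 ≠ 0 := by exact_mod_cast Nat.succ_ne_zero k
      refine mul_right_cancel₀ hk (h.trans ?_)
      rw [loopCoeff_succ]
      split_ifs with h0
      · rfl
      · rw [ih (k - 1) (by omega)]

/-- The product of the local factors is the generating function: its logarithmic derivatives are
those of `exp (∑ b_uv x_u x_v + ∑ b_vv (x_v + x_v ^ 2 / 2))`. -/
theorem pderiv_prod_localFactor {nv : ℕ} {R : ℕ → Finset ℕ} (hb : ∀ u v, b u v = b v u)
    (hR : ∀ e < nv, ∀ u ∈ R e, e < u ∧ u < nv)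
    (hbR : ∀ e u, e < u → u < nv → b e u ≠ 0 → u ∈ R e) {v : ℕ} (hv : v < nv) :
    pderiv ℂ v (∏ e ∈ Finset.range nv, localFactor b e (R e)) =
      (C (b v v) + ∑ u ∈ Finset.range nv, C (b v u) * X u) *
        ∏ e ∈ Finset.range nv, localFactor b e (R e) := by
  classical
  have hself : ∀ e < nv, e ∉ R e := fun e he h => lt_irrefl _ (hR e he e h).1
  -- The variable x_v occurs in the factor of `v` itself, through its loop and its later edges, and
  -- in the factors of earlier vertices, through the edge to `v`. Edges outside `R` have weight zero
  -- and may be added freely.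
  rw [pderiv_prod_of_eq (Finset.range nv) (L := fun e =>
    (if v = e then C (b v v) + ∑ u ∈ Finset.range nv, if v ≤ u then C (b v u) * X u else 0 else 0) +
      if e < v then C (b v e) * X e else 0)]
  · congr 1
    rw [Finset.sum_add_distrib, Finset.sum_ite_eq, if_pos (Finset.mem_range.mpr hv), add_assoc,
      ← Finset.sum_add_distrib]
    congr 1
    refine Finset.sum_congr rfl fun u _ => ?_
    by_cases h : v ≤ u
    · rw [if_pos h, if_neg (by omega), add_zero]
    · rw [if_neg h, if_pos (by omega), zero_add]
  · intro e he
    have he' := Finset.mem_range.mp he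
    rcases lt_trichotomy e v with h | rfl | h
    · rw [if_neg h.ne', if_pos h, zero_add]
      by_cases hm : v ∈ R e
      · rw [pderiv_localFactor_of_mem (hself e he') hm, hb]
      · rw [pderiv_localFactor_of_notMem h.ne' hm]
        have : b v e = 0 := by
          by_contra h0
          exact hm (hbR e v h hv (by rwa [hb]))
        rw [this, map_zero, zero_mul, zero_mul, zero_mul]
    · rw [if_pos rfl, if_neg (lt_irrefl _), add_zero, pderiv_localFactor_self (hself e he')]
      congr 1
      rw [mul_add, mul_one, add_assoc]
      congr 1
      rw [← Finset.sum_filter]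
      have hsub : insert e (R e) ⊆ (Finset.range nv).filter (e ≤ ·) := by
        intro u hu
        rw [Finset.mem_filter, Finset.mem_range]
        rcases Finset.mem_insert.mp hu with rfl | hu
        · exact ⟨he', le_rfl⟩
        · exact ⟨(hR e he' u hu).2, (hR e he' u hu).1.le⟩
      rw [← Finset.sum_subset hsub, Finset.sum_insert (hself e he')]
      intro u hu hu'
      rw [Finset.mem_filter, Finset.mem_range] at hu
      rw [Finset.mem_insert, not_or] at hu'
      have : b e u = 0 := by
        by_contra h0
        exact hu'.2 (hbR e u (lt_of_le_of_ne hu.2 (Ne.symm hu'.1)) hu.1 h0)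
      rw [this, map_zero, zero_mul]
    · rw [if_neg h.ne, if_neg (by omega), add_zero]
      exact pderiv_localFactor_of_notMem h.ne fun hm => by have := (hR e he' v hm).1; omega

end Factors

/-! ### Perfect matchings with loops -/

section Matchings

variable {X : Type*}

/-- A set of edges within `S`, loops allowed, that covers every element of `S` exactly once. -/
def IsMatchingOn (S : Finset X) (π : Finset (Sym2 X)) : Prop :=
  (∀ e ∈ π, ∀ v ∈ e, v ∈ S) ∧ ∀ v ∈ S, ∃! e, e ∈ π ∧ v ∈ e

open Classical in
/-- The loop hafnian of the restriction to `S` of the weights `w`. -/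
noncomputable def loopHafnianOn (w : Sym2 X → ℂ) (S : Finset X) : ℂ :=
  ∑ π ∈ S.sym2.powerset with IsMatchingOn S π, ∏ e ∈ π, w e

theorem IsMatchingOn.mem_powerset {S : Finset X} {π : Finset (Sym2 X)} (h : IsMatchingOn S π) :
    π ∈ S.sym2.powerset :=
  Finset.mem_powerset.mpr fun e he => Finset.mem_sym2_iff.mpr (h.1 e he)

theorem loopHafnianOn_empty (w : Sym2 X → ℂ) : loopHafnianOn w ∅ = 1 := by
  classical
  rw [loopHafnianOn, Finset.sum_eq_single ∅]
  · simp
  · intro π hπ hne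
    simp at hπ
    exact absurd hπ.1 hne
  · intro h
    exact absurd (Finset.mem_filter.mpr ⟨by simp, by simp [IsMatchingOn]⟩) h

/-- Together with `IsMatchingOn.erase` this makes the matchings of `S` containing the pair `pq`
correspond to the matchings of the rest; p = q is the case of a loop. -/
theorem IsMatchingOn.insert [DecidableEq X] {S : Finset X} {π : Finset (Sym2 X)} {p q : X} (hp : p ∈ S) (hq : q ∈ S)
    (h : IsMatchingOn (S \ {p, q}) π) : IsMatchingOn S (Insert.insert s(p, q) π) := by
  have hout : ∀ e ∈ π, p ∉ e ∧ q ∉ e := by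
    intro e he
    constructor <;> intro hv <;> simpa using h.1 e he _ hv
  refine ⟨fun e he v hv => ?_, fun v hv => ?_⟩
  · rcases Finset.mem_insert.mp he with rfl | he
    · rcases Sym2.mem_iff.mp hv with rfl | rfl <;> assumption
    · exact (Finset.mem_sdiff.mp (h.1 e he v hv)).1
  · by_cases hpq : v = p ∨ v = q
    · refine ⟨s(p, q), ⟨by simp, Sym2.mem_iff.mpr hpq⟩, ?_⟩
      rintro e ⟨he, hve⟩
      rcases Finset.mem_insert.mp he with h' | he₁
      · exact h'
      · rcases hpq with rfl | rfl
        · exact absurd hve (hout e he₁).1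
        · exact absurd hve (hout e he₁).2
    · obtain ⟨e, ⟨he, hve⟩, hu⟩ := h.2 v (by simp [hv, hpq])
      refine ⟨e, ⟨by simp [he], hve⟩, ?_⟩
      rintro e' ⟨he', hve'⟩
      rcases Finset.mem_insert.mp he' with rfl | he'
      · exact absurd (Sym2.mem_iff.mp hve') hpq
      · exact hu e' ⟨he', hve'⟩

theorem IsMatchingOn.erase [DecidableEq X] {S : Finset X} {π : Finset (Sym2 X)} {p q : X} (h : IsMatchingOn S π)
    (hpq : s(p, q) ∈ π) : IsMatchingOn (S \ {p, q}) (π.erase s(p, q)) := by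
  have huniq : ∀ e ∈ π, ∀ v, v ∈ e → (v = p ∨ v = q) → e = s(p, q) := by
    intro e he v hv hvpq
    obtain ⟨e', -, hu⟩ := h.2 v (h.1 e he v hv)
    rw [hu e ⟨he, hv⟩, hu s(p, q) ⟨hpq, Sym2.mem_iff.mpr hvpq⟩]
  refine ⟨fun e he v hv => ?_, fun v hv => ?_⟩
  · obtain ⟨hne, he⟩ := Finset.mem_erase.mp he
    rw [Finset.mem_sdiff, Finset.mem_insert, Finset.mem_singleton]
    exact ⟨h.1 e he v hv, fun hvpq => hne (huniq e he v hv hvpq)⟩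
  · rw [Finset.mem_sdiff, Finset.mem_insert, Finset.mem_singleton] at hv
    obtain ⟨e, ⟨he, hve⟩, hu⟩ := h.2 v hv.1
    refine ⟨e, ⟨Finset.mem_erase.mpr ⟨?_, he⟩, hve⟩, fun e' he' =>
      hu e' ⟨(Finset.mem_erase.mp he'.1).2, he'.2⟩⟩
    rintro rfl
    exact hv.2 (Sym2.mem_iff.mp hve)

/-- The expansion of the loop hafnian along the index `p`. -/
theorem loopHafnianOn_eq_sum [DecidableEq X] (w : Sym2 X → ℂ) {S : Finset X} {p : X} (hp : p ∈ S) :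
    loopHafnianOn w S = ∑ q ∈ S, w s(p, q) * loopHafnianOn w (S \ {p, q}) := by
  classical
  simp only [loopHafnianOn, Finset.mul_sum]
  rw [Finset.sum_sigma']
  symm
  have hout : ∀ {q : X} {π : Finset (Sym2 X)}, IsMatchingOn (S \ {p, q}) π → ∀ e ∈ π, p ∉ e := by
    intro q π h e he hv
    simpa using h.1 e he _ hv
  -- A matching is split by the partner of `p`, which is `p` itself for a loop. Injectivity holds
  -- since `p` lies on no edge of the remaining matching.
  refine Finset.sum_bij (fun x _ => insert s(p, x.1) x.2) ?_ ?_ ?_ ?_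
  · rintro ⟨q, π⟩ h
    rw [Finset.mem_sigma, Finset.mem_filter] at h
    have := h.2.2.insert hp h.1
    exact Finset.mem_filter.mpr ⟨this.mem_powerset, this⟩
  · rintro ⟨q, π⟩ h ⟨q', π'⟩ h' heq
    rw [Finset.mem_sigma, Finset.mem_filter] at h h'
    simp only at heq h h'
    have h1 : s(p, q) = s(p, q') := by
      have : s(p, q) ∈ insert s(p, q') π' := heq ▸ Finset.mem_insert_self _ _
      rcases Finset.mem_insert.mp this with h1 | h1
      · exact h1
      · exact absurd (Sym2.mem_mk_left p q) (hout h'.2.2 _ h1)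
    have h2 : q = q' := Sym2.congr_right.mp h1
    subst h2
    have h3 : π = π' := by
      have e1 : s(p, q) ∉ π := fun hm => hout h.2.2 _ hm (Sym2.mem_mk_left p q)
      have e2 : s(p, q) ∉ π' := fun hm => hout h'.2.2 _ hm (Sym2.mem_mk_left p q)
      rw [← Finset.erase_insert e1, heq, Finset.erase_insert e2]
    rw [h3]
  · intro π h
    rw [Finset.mem_filter] at h
    obtain ⟨e, ⟨he, hpe⟩, -⟩ := h.2.2 p hp
    obtain ⟨q, rfl⟩ := Sym2.mem_iff_exists.mp hpe
    have hm := h.2.erase he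
    refine ⟨⟨q, π.erase s(p, q)⟩, ?_, Finset.insert_erase he⟩
    rw [Finset.mem_sigma, Finset.mem_filter]
    exact ⟨h.2.1 _ he q (Sym2.mem_mk_right p q), hm.mem_powerset, hm⟩
  · rintro ⟨q, π⟩ h
    rw [Finset.mem_sigma, Finset.mem_filter] at h
    rw [Finset.prod_insert]
    exact fun hm => hout h.2.2 _ hm (Sym2.mem_mk_left p q)

theorem loopHafnian_eq_loopHafnianOn [Fintype X] (B : Matrix X X ℂ) (hB : B.IsSymm) :
    loopHafnian B hB = loopHafnianOn (edgeWeight B hB) Finset.univ := by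
  classical
  rw [loopHafnian, loopHafnianOn]
  refine Finset.sum_congr ?_ fun _ _ => rfl
  ext π
  rw [Finset.mem_filter, Finset.mem_filter]
  simp [IsLoopPerfectMatching, IsMatchingOn]

end Matchings

/-! ### Repeated indices and coefficients of the generating function -/

section Counting

variable {Y : Type*} (ρ : Y → ℕ)

/-- The numbers of elements of `S` with a given label. -/
noncomputable def labelCount (S : Finset Y) : ℕ →₀ ℕ := ∑ i ∈ S, Finsupp.single (ρ i) 1

theorem labelCount_apply (S : Finset Y) (u : ℕ) :
    labelCount ρ S u = (S.filter fun i => ρ i = u).card := by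
  rw [labelCount, Finsupp.finsetSum_apply, Finset.card_filter]
  refine Finset.sum_congr rfl fun i _ => ?_
  rw [Finsupp.single_apply]

theorem labelCount_erase [DecidableEq Y] {S : Finset Y} {p : Y} (hp : p ∈ S) :
    labelCount ρ (S.erase p) + Finsupp.single (ρ p) 1 = labelCount ρ S :=
  Finset.sum_erase_add _ _ hp

/-- The product of the factorials of the first `nv` exponents. -/
def factorialProd (nv : ℕ) (n : ℕ → ℕ) : ℕ := ∏ v ∈ Finset.range nv, (n v).factorial

theorem factorialProd_add_single {nv v : ℕ} (hv : v < nv) (n : ℕ →₀ ℕ) :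
    factorialProd nv (n + Finsupp.single v 1 : ℕ →₀ ℕ) = factorialProd nv n * (n v + 1) := by
  rw [factorialProd, factorialProd, ← Finset.mul_prod_erase _ _ (Finset.mem_range.mpr hv),
    ← Finset.mul_prod_erase _ _ (Finset.mem_range.mpr hv)]
  have : ∀ u ∈ (Finset.range nv).erase v,
      ((n + Finsupp.single v 1 : ℕ →₀ ℕ) u).factorial = (n u).factorial := by
    intro u hu
    simp [(Finset.mem_erase.mp hu).1]
  rw [Finset.prod_congr rfl this]
  simp only [Finsupp.add_apply, Finsupp.single_eq_same, Nat.factorial_succ]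
  ring

open MvPowerSeries in
/-- The loop hafnian of a matrix with repeated indices, as a coefficient of the generating
function. -/
theorem loopHafnianOn_eq_coeff [DecidableEq Y] {b : ℕ → ℕ → ℂ} {nv : ℕ} (hρ : ∀ i, ρ i < nv) {w : Sym2 Y → ℂ}
    (hw : ∀ i j, w s(i, j) = b (ρ i) (ρ j)) {Z : MvPowerSeries ℕ ℂ} (h0 : coeff 0 Z = 1)
    (hZ : ∀ v < nv, pderiv ℂ v Z = (C (b v v) + ∑ u ∈ Finset.range nv, C (b v u) * X u) * Z)
    (S : Finset Y) :
    loopHafnianOn w S = factorialProd nv (labelCount ρ S) * coeff (labelCount ρ S) Z := by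
  induction hc : S.card using Nat.strong_induction_on generalizing S with
  | _ c ih =>
    subst hc
    rcases S.eq_empty_or_nonempty with rfl | ⟨p, hp⟩
    · simp [loopHafnianOn_empty, labelCount, h0, factorialProd]
    · rw [loopHafnianOn_eq_sum w hp, ← Finset.add_sum_erase _ _ hp]
      set n := labelCount ρ (S.erase p) with hn
      have hS : labelCount ρ S = n + Finsupp.single (ρ p) 1 := (labelCount_erase ρ hp).symm
      have e1 : loopHafnianOn w (S \ {p, p}) = factorialProd nv n * coeff n Z := by
        rw [show S \ {p, p} = S.erase p by ext; simp [and_comm]]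
        exact ih _ (Finset.card_erase_lt_of_mem hp) _ rfl
      have e2 : ∀ q ∈ S.erase p, w s(p, q) * loopHafnianOn w (S \ {p, q}) =
          b (ρ p) (ρ q) * (factorialProd nv (n - Finsupp.single (ρ q) 1 : ℕ →₀ ℕ) *
            coeff (n - Finsupp.single (ρ q) 1) Z) := by
        intro q hq
        have hl : labelCount ρ (S \ {p, q}) = n - Finsupp.single (ρ q) 1 := by
          rw [hn, ← labelCount_erase ρ hq, add_tsub_cancel_right]
          congr 1
          ext x
          simp
          tauto
        rw [hw, ih _ (Finset.card_lt_card _) (S \ {p, q}) rfl, hl]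
        refine Finset.ssubset_iff_of_subset Finset.sdiff_subset |>.mpr ⟨p, hp, by simp⟩
      -- A term depends on the partner only through its label, so the partners are grouped by
      -- labels; the label u occurs n u times.
      have e3 : ∀ g : ℕ → ℂ, ∑ q ∈ S.erase p, g (ρ q) = ∑ u ∈ Finset.range nv, (n u : ℂ) * g u := by
        intro g
        have : ∀ u, (n u : ℂ) * g u = ∑ q ∈ S.erase p, if ρ q = u then g u else 0 := by
          intro u
          rw [hn, labelCount_apply, ← Finset.sum_filter, Finset.sum_const, nsmul_eq_mul]
        simp only [this]
        rw [Finset.sum_comm]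
        refine Finset.sum_congr rfl fun q _ => ?_
        rw [Finset.sum_ite_eq, if_pos (Finset.mem_range.mpr (hρ q))]
      rw [e1, hw, Finset.sum_congr rfl e2, e3 fun u => b (ρ p) u *
        (factorialProd nv (n - Finsupp.single u 1 : ℕ →₀ ℕ) * coeff (n - Finsupp.single u 1) Z), hS,
        factorialProd_add_single (hρ p)]
      have hco := congrArg (coeff n) (hZ (ρ p) (hρ p))
      rw [coeff_pderiv, add_mul, map_add, coeff_C_mul, Finset.sum_mul, map_sum] at hco
      -- The multiplicity `n u` turns the factorial of n u - 1 into that of n u. For n u = 0 both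
      -- sides vanish, which makes the truncated difference of exponents harmless.
      have e4 : ∀ u ∈ Finset.range nv, (n u : ℂ) * (b (ρ p) u *
          (factorialProd nv (n - Finsupp.single u 1 : ℕ →₀ ℕ) * coeff (n - Finsupp.single u 1) Z)) =
          factorialProd nv n * coeff n (C (b (ρ p) u) * X u * Z) := by
        intro u hu
        rw [mul_assoc, coeff_C_mul, coeff_X_mul_eq]
        by_cases h : n u = 0
        · rw [h, if_pos rfl]
          simp
        · rw [if_neg h]
          have h1 : n - Finsupp.single u 1 + Finsupp.single u 1 = n := tsub_add_cancel_of_le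
            (Finsupp.single_le_iff.mpr (Nat.one_le_iff_ne_zero.mpr h))
          have h2 := factorialProd_add_single (Finset.mem_range.mp hu) (n - Finsupp.single u 1)
          rw [h1] at h2
          have h3 : (n - Finsupp.single u 1 : ℕ →₀ ℕ) u + 1 = n u := by
            conv_rhs => rw [← h1]
            simp
          rw [h3] at h2
          rw [h2]
          push_cast
          ring
      rw [Finset.sum_congr rfl e4, ← Finset.mul_sum]
      push_cast
      linear_combination (-(factorialProd nv n : ℂ)) * hco

end Counting

/-! ### Permanents -/

/-- The symmetric matrix of the bipartite graph with the weights `U`, with `flag` times `U` on the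
rows. -/
def flaggedMatrix {Y : Type*} (flag : ℂ) (U : Matrix Y Y ℂ) : Matrix (Y ⊕ Y) (Y ⊕ Y) ℂ :=
  Matrix.fromBlocks (flag • U) U U.transpose 0

/-- Matchings with nonzero weight use only pairs of a row and a column, and a perfect matching of
this kind is the graph of a permutation. -/
theorem permanent_eq_loopHafnianOn {n : ℕ} (U : Matrix (Fin n) (Fin n) ℂ)
    {w : Sym2 (Fin n ⊕ Fin n) → ℂ}
    (hw : ∀ i j, w s(i, j) = flaggedMatrix 0 U i j) :
    U.permanent = loopHafnianOn w Finset.univ := by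
  classical
  have hll : ∀ i j, w s(Sum.inl i, Sum.inl j) = 0 := by simp [hw, flaggedMatrix]
  have hrr : ∀ i j, w s(Sum.inr i, Sum.inr j) = 0 := by simp [hw, flaggedMatrix]
  have hlr : ∀ i j, w s(Sum.inl i, Sum.inr j) = U i j := by simp [hw, flaggedMatrix]
  have hedge : ∀ e, w e ≠ 0 → ∃ i j, e = s(Sum.inl i, Sum.inr j) := by
    intro e
    induction e with
    | _ x y =>
      intro he
      rcases x with i | i <;> rcases y with j | j
      · exact absurd (hll i j) he
      · exact ⟨i, j, rfl⟩
      · exact ⟨j, i, Sym2.eq_swap⟩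
      · exact absurd (hrr i j) he
  have hinj : ∀ {i i' j j' : Fin n}, (s(Sum.inl i, Sum.inr j) : Sym2 (Fin n ⊕ Fin n)) =
      s(Sum.inl i', Sum.inr j') ↔ i = i' ∧ j = j' := by simp
  rw [Matrix.permanent, loopHafnianOn]
  have hprod : ∀ σ : Equiv.Perm (Fin n),
      ∏ e ∈ Finset.univ.image (fun i => (s(Sum.inl (σ i), Sum.inr i) : Sym2 (Fin n ⊕ Fin n))), w e =
        ∏ i, U (σ i) i := by
    intro σ
    rw [Finset.prod_image (fun i _ j _ h => (hinj.mp h).2)]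
    exact Finset.prod_congr rfl fun i _ => hlr _ _
  refine Finset.sum_of_injOn (fun σ => Finset.univ.image
    (fun i => (s(Sum.inl (σ i), Sum.inr i) : Sym2 (Fin n ⊕ Fin n)))) ?_ ?_ ?_ ?_
  · intro σ _ τ _ h
    ext1 i
    have : (s(Sum.inl (σ i), Sum.inr i) : Sym2 (Fin n ⊕ Fin n)) ∈
        Finset.univ.image (fun i => (s(Sum.inl (τ i), Sum.inr i) : Sym2 (Fin n ⊕ Fin n))) := by
      simp only at h
      rw [← h]
      exact Finset.mem_image_of_mem _ (Finset.mem_univ i)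
    obtain ⟨j, -, hj⟩ := Finset.mem_image.mp this
    obtain ⟨h1, rfl⟩ := hinj.mp hj
    exact h1.symm
  · intro σ _
    have hm : IsMatchingOn Finset.univ (Finset.univ.image
        (fun i => (s(Sum.inl (σ i), Sum.inr i) : Sym2 (Fin n ⊕ Fin n)))) := by
      refine ⟨fun _ _ _ _ => Finset.mem_univ _, fun v _ => ?_⟩
      rcases v with a | x
      · refine ⟨s(Sum.inl a, Sum.inr (σ.symm a)), ⟨Finset.mem_image.mpr
          ⟨σ.symm a, by simp, by simp⟩, by simp⟩, ?_⟩
        rintro e ⟨he, hv⟩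
        obtain ⟨i, -, rfl⟩ := Finset.mem_image.mp he
        have : a = σ i := by simpa using hv
        simp [this]
      · refine ⟨s(Sum.inl (σ x), Sum.inr x), ⟨Finset.mem_image.mpr
          ⟨x, by simp, by simp⟩, by simp⟩, ?_⟩
        rintro e ⟨he, hv⟩
        obtain ⟨i, -, rfl⟩ := Finset.mem_image.mp he
        have : x = i := by simpa using hv
        simp [this]
    exact Finset.mem_coe.mpr (Finset.mem_filter.mpr ⟨hm.mem_powerset, hm⟩)
  · intro π hπ hnot
    rw [Finset.mem_filter] at hπ
    by_contra hne
    have hne' : ∀ e ∈ π, w e ≠ 0 := fun e he => Finset.prod_ne_zero_iff.mp hne e he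
    -- The row matched to a column defines a map; it is injective because a row lies on only one
    -- edge, hence it is bijective by finiteness.
    have hex : ∀ x : Fin n, ∃ a, s(Sum.inl a, Sum.inr x) ∈ π := by
      intro x
      obtain ⟨e, ⟨he, hv⟩, -⟩ := hπ.2.2 (Sum.inr x) (Finset.mem_univ _)
      obtain ⟨i, j, rfl⟩ := hedge e (hne' e he)
      have : x = j := by simpa using hv
      exact ⟨i, this ▸ he⟩
    choose f hf using hex
    have hfinj : Function.Injective f := by
      intro x y hxy
      obtain ⟨e, -, hu⟩ := hπ.2.2 (Sum.inl (f x)) (Finset.mem_univ _)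
      have h1 := hu _ ⟨hf x, by simp⟩
      have h2 := hu _ ⟨hf y, by simp [hxy]⟩
      exact (hinj.mp (h1.trans h2.symm)).2
    have hfbij : Function.Bijective f := Finite.injective_iff_bijective.mp hfinj
    refine hnot ⟨Equiv.ofBijective f hfbij, by simp, ?_⟩
    ext e
    simp only [Finset.mem_image, Finset.mem_univ, true_and, Equiv.ofBijective_apply]
    constructor
    · rintro ⟨x, rfl⟩
      exact hf x
    · intro he
      obtain ⟨i, j, rfl⟩ := hedge e (hne' e he)
      refine ⟨j, ?_⟩
      obtain ⟨e', -, hu⟩ := hπ.2.2 (Sum.inr j) (Finset.mem_univ _)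
      rw [hu _ ⟨hf j, by simp⟩, hu _ ⟨he, by simp⟩]
  · intro σ _
    exact (hprod σ).symm

open MvPowerSeries

/-! ## Elimination of variables -/

/-- The variable `x_v` does not occur in `F`. -/
def FreeOf (v : ℕ) (F : MvPowerSeries ℕ ℂ) : Prop := ∀ ν : ℕ →₀ ℕ, ν v ≠ 0 → coeff ν F = 0

theorem FreeOf.one (v : ℕ) : FreeOf v 1 := by
  intro ν hν
  rw [coeff_one, if_neg]
  rintro rfl
  exact hν rfl

theorem FreeOf.mul {v : ℕ} {F G : MvPowerSeries ℕ ℂ} (hF : FreeOf v F) (hG : FreeOf v G) :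
    FreeOf v (F * G) := by
  intro ν hν
  rw [coeff_mul]
  refine Finset.sum_eq_zero fun x hx => ?_
  have h : x.1 v + x.2 v = ν v := by
    rw [← Finset.HasAntidiagonal.mem_antidiagonal.mp hx]
    rfl
  by_cases h1 : x.1 v = 0
  · rw [hG _ (by omega), mul_zero]
  · rw [hF _ h1, zero_mul]

theorem FreeOf.prod {v : ℕ} {ι : Type*} (S : Finset ι) {F : ι → MvPowerSeries ℕ ℂ}
    (h : ∀ i ∈ S, FreeOf v (F i)) : FreeOf v (∏ i ∈ S, F i) := by
  classical
  induction S using Finset.induction_on with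
  | empty => rw [Finset.prod_empty]; exact FreeOf.one v
  | insert i S hi ih =>
    rw [Finset.prod_insert hi]
    exact (h i (by simp)).mul (ih fun j hj => h j (by simp [hj]))

/-- The coefficient of `x_v ^ k` in `F`. -/
noncomputable def powerCoeff (v k : ℕ) (F : MvPowerSeries ℕ ℂ) : MvPowerSeries ℕ ℂ :=
  fun ν => if ν v = 0 then coeff (ν + Finsupp.single v k) F else 0

theorem coeff_powerCoeff (v k : ℕ) (F : MvPowerSeries ℕ ℂ) (ν : ℕ →₀ ℕ) :
    coeff ν (powerCoeff v k F) = if ν v = 0 then coeff (ν + Finsupp.single v k) F else 0 := rfl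

/-- A factor free of x_v cannot contribute to the power of x_v, so the whole power must come from
`F`. This is the locality that makes elimination cheap. -/
theorem coeff_mul_eq_coeff_powerCoeff_mul {v k : ℕ} {F G : MvPowerSeries ℕ ℂ} (hG : FreeOf v G)
    {n : ℕ →₀ ℕ} (hn : n v = 0) :
    coeff (n + Finsupp.single v k) (F * G) = coeff n (powerCoeff v k F * G) := by
  classical
  rw [coeff_mul, coeff_mul, ← Finset.sum_filter_of_ne (p := fun x => x.2 v = 0)]
  · symm
    refine Finset.sum_nbij' (fun x => (x.1 + Finsupp.single v k, x.2))
      (fun x => (x.1 - Finsupp.single v k, x.2)) ?_ ?_ ?_ ?_ ?_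
    · intro x hx
      rw [Finset.HasAntidiagonal.mem_antidiagonal] at hx
      have h : x.1 v + x.2 v = n v := by rw [← hx]; rfl
      rw [Finset.mem_filter, Finset.HasAntidiagonal.mem_antidiagonal]
      exact ⟨by rw [← hx]; exact add_right_comm _ _ _, by simp; omega⟩
    · intro x hx
      rw [Finset.mem_filter, Finset.HasAntidiagonal.mem_antidiagonal] at hx
      have h : x.1 v + x.2 v = n v + k := by
        have := DFunLike.congr_fun hx.1 v
        simpa using this
      rw [Finset.HasAntidiagonal.mem_antidiagonal]
      refine add_right_cancel (b := Finsupp.single v k) ?_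
      rw [add_right_comm, tsub_add_cancel_of_le, hx.1]
      rw [Finsupp.single_le_iff]
      omega
    · intro x _
      simp
    · intro x hx
      rw [Finset.mem_filter, Finset.HasAntidiagonal.mem_antidiagonal] at hx
      have h : x.1 v + x.2 v = n v + k := by
        have := DFunLike.congr_fun hx.1 v
        simpa using this
      simp only [Prod.ext_iff, and_true]
      rw [tsub_add_cancel_of_le]
      rw [Finsupp.single_le_iff]
      omega
    · intro x hx
      rw [Finset.HasAntidiagonal.mem_antidiagonal] at hx
      have h : x.1 v + x.2 v = n v := by rw [← hx]; rfl
      rw [coeff_powerCoeff, if_pos (by omega)]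
  · intro x _ hne
    by_contra h
    exact hne (by rw [hG _ h, mul_zero])

/-- The table of the message from a table with first variable `e`. -/
theorem IsTable.powerCoeff {m : ℕ → ℕ} {e : ℕ} {D : List ℕ} {A B : ℕ → ℂ} {F : MvPowerSeries ℕ ℂ}
    {z : ℂ} (he : e ∉ D) (hF : IsTable m (e :: D) A F)
    (hB : ∀ j < boxSize m D, B j = z * A (m e + (m e + 1) * j)) :
    IsTable m D B (C z * powerCoeff e (m e) F) := by
  constructor
  · intro ν h1 h2
    rw [hB _ (mixedRadix_lt h1), coeff_C_mul, coeff_powerCoeff, if_pos (h2 e he)]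
    have hne : ∀ v ∈ D, v ≠ e := fun v hv h => he (h ▸ hv)
    rw [← hF.coeff_eq]
    -- As `e` is the least significant digit, the vectors with the maximal exponent `m e` at `e` are
    -- the table entries at `m e + (m e + 1) * j`.
    · rw [mixedRadix, mixedRadix_congr (D := D) (μ := ⇑(ν + Finsupp.single e (m e))) (ν := ν)]
      · simp [h2 e he]
      · intro v hv
        simp [(hne v hv)]
    · intro v hv
      rcases List.mem_cons.mp hv with rfl | hv
      · simp [h2 v he]
      · simpa [hne v hv] using h1 v hv
    · intro v hv
      rw [List.mem_cons, not_or] at hv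
      simp [hv.1, h2 v hv.2]
  · intro ν v hv h0
    rw [coeff_C_mul, coeff_powerCoeff]
    split_ifs with h
    · rw [hF.coeff_zero _ v, mul_zero]
      · rw [List.mem_cons, not_or]
        exact ⟨fun hve => h0 (hve ▸ h), hv⟩
      · simp [h0]
    · simp

section Pending

variable (b : ℕ → ℕ → ℂ) (R : ℕ → List ℕ) (acc : ℕ → ℕ → MvPowerSeries ℕ ℂ)

/-- The part of the product that is attached to the vertex `f`: its local factor, and the messages
that have been accumulated in the slots `0, …, (R f).length + 1`. -/
noncomputable def attachedFactor (f : ℕ) : MvPowerSeries ℕ ℂ :=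
  localFactor b f (R f).toFinset * ∏ u ∈ Finset.range ((R f).length + 2), acc f u

/-- The exponent vector `m` on the vertices `e, …, nv - 1`. -/
noncomputable def exponentsFrom (nv : ℕ) (m : ℕ → ℕ) (e : ℕ) : ℕ →₀ ℕ :=
  ∑ v ∈ Finset.Ico e nv, Finsupp.single v (m v)

/-- What remains to be computed before the elimination of the vertex `e`. -/
noncomputable def pending (nv : ℕ) (m : ℕ → ℕ) (e : ℕ) : ℂ :=
  (∏ f ∈ Finset.Ico e nv, ((m f).factorial : ℂ)) *
    coeff (exponentsFrom nv m e) (∏ f ∈ Finset.Ico e nv, attachedFactor b R acc f)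

/-- Multiplies the series in the slot `u` of the vertex `f` by `F`. -/
noncomputable def accumulate (f u : ℕ) (F : MvPowerSeries ℕ ℂ) (f' u' : ℕ) : MvPowerSeries ℕ ℂ :=
  acc f' u' * if f' = f ∧ u' = u then F else 1

theorem exponentsFrom_apply (nv : ℕ) (m : ℕ → ℕ) (e v : ℕ) :
    exponentsFrom nv m e v = if e ≤ v ∧ v < nv then m v else 0 := by
  rw [exponentsFrom, Finsupp.finsetSum_apply]
  simp [Finsupp.single_apply]

variable {b R acc}

/-- After the split of the product at `e`, only one factor involves x_e, and the coefficient of the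
required power can be taken there alone. -/
theorem pending_eq {nv : ℕ} {m : ℕ → ℕ} {e : ℕ} (he : e < nv)
    (hfree : ∀ f, e < f → f < nv → FreeOf e (attachedFactor b R acc f)) :
    pending b R acc nv m e = (∏ f ∈ Finset.Ico (e + 1) nv, ((m f).factorial : ℂ)) *
      coeff (exponentsFrom nv m (e + 1))
        (C ((m e).factorial : ℂ) * powerCoeff e (m e) (attachedFactor b R acc e) *
          ∏ f ∈ Finset.Ico (e + 1) nv, attachedFactor b R acc f) := by
  rw [pending, Finset.prod_eq_prod_Ico_succ_bot he, Finset.prod_eq_prod_Ico_succ_bot he,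
    exponentsFrom, Finset.sum_eq_sum_Ico_succ_bot he, add_comm (Finsupp.single _ _),
    ← exponentsFrom, coeff_mul_eq_coeff_powerCoeff_mul, mul_assoc (C _), coeff_C_mul]
  · ring
  · refine FreeOf.prod _ fun f hf => ?_
    rw [Finset.mem_Ico] at hf
    exact hfree f hf.1 hf.2
  · rw [exponentsFrom_apply, if_neg (by omega)]

theorem prod_accumulate {e nv f u : ℕ} {F : MvPowerSeries ℕ ℂ} (hf : e ≤ f) (hf' : f < nv)
    (hu : u < (R f).length + 2) :
    ∏ f' ∈ Finset.Ico e nv, attachedFactor b R (accumulate acc f u F) f' =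
      F * ∏ f' ∈ Finset.Ico e nv, attachedFactor b R acc f' := by
  have h : ∀ f', attachedFactor b R (accumulate acc f u F) f' =
      attachedFactor b R acc f' * if f' = f then F else 1 := by
    intro f'
    simp only [attachedFactor, accumulate, Finset.prod_mul_distrib, mul_assoc]
    congr 2
    by_cases hff : f' = f
    · subst hff
      simp only [true_and, if_true, Finset.prod_ite_eq', Finset.mem_range, hu]
    · simp [hff]
  simp only [h, Finset.prod_mul_distrib, Finset.prod_ite_eq', Finset.mem_Ico, hf, hf', true_and,
    if_true]
  ring

/-- The elimination of a vertex without later neighbors. -/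
theorem pending_eq_mul {nv : ℕ} {m : ℕ → ℕ} {e : ℕ} (he : e < nv)
    (hfree : ∀ f, e < f → f < nv → FreeOf e (attachedFactor b R acc f)) {z : ℂ}
    (hz : C ((m e).factorial : ℂ) * powerCoeff e (m e) (attachedFactor b R acc e) = C z) :
    pending b R acc nv m e = z * pending b R acc nv m (e + 1) := by
  rw [pending_eq he hfree, hz, coeff_C_mul, pending]
  ring

/-- The elimination of a vertex with a message to a later vertex `f`. -/
theorem pending_eq_pending_accumulate {nv : ℕ} {m : ℕ → ℕ} {e f u : ℕ} (he : e < nv)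
    (hfree : ∀ f, e < f → f < nv → FreeOf e (attachedFactor b R acc f)) (hf : e < f) (hf' : f < nv)
    (hu : u < (R f).length + 2) :
    pending b R acc nv m e = pending b R (accumulate acc f u (C ((m e).factorial : ℂ) *
      powerCoeff e (m e) (attachedFactor b R acc e))) nv m (e + 1) := by
  rw [pending_eq he hfree, pending, prod_accumulate hf hf' hu]

theorem pending_self (nv : ℕ) (m : ℕ → ℕ) : pending b R acc nv m nv = 1 := by
  simp [pending, exponentsFrom]

end Pending

/-! ### Lists with one entry left out -/

/-- One round of a copying loop that skips a position. -/
theorem List.eraseIdx_take_succ {α : Type*} {L : List α} {u i : ℕ} (hi : i < L.length) :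
    (L.take (i + 1)).eraseIdx u =
      if i = u then (L.take i).eraseIdx u else (L.take i).eraseIdx u ++ [L[i]] := by
  rw [List.take_succ_eq_append_getElem hi]
  have hl : (L.take i).length = i := by simp; omega
  split_ifs with h
  · subst h
    rw [List.eraseIdx_append_of_length_le (by omega), hl, Nat.sub_self,
      List.eraseIdx_of_length_le (l := List.take i L) (by omega)]
    simp
  · rcases lt_or_gt_of_ne h with h | h
    · rw [List.eraseIdx_append_of_length_le (by omega), List.eraseIdx_of_length_le (l := List.take i L) (by omega), hl]
      congr 1
      exact List.eraseIdx_of_length_le (by simp; omega)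
    · rw [List.eraseIdx_append_of_lt_length (by omega)]

theorem List.mem_eraseIdx_of_subset {α : Type*} {L J : List α} {u : ℕ}
    (hJ : ∀ v ∈ J, v ∈ L) (hu : ∀ h : u < L.length, L[u] ∉ J) : ∀ v ∈ J, v ∈ L.eraseIdx u := by
  intro v hv
  obtain ⟨i, hi, rfl⟩ := List.getElem_of_mem (hJ v hv)
  rw [List.mem_eraseIdx_iff_getElem]
  refine ⟨i, hi, ?_, rfl⟩
  rintro rfl
  exact hu hi hv

/-! ## The tables of the local factors -/

/-- The memory holds, for every vertex `e`, the list of `e` and of its later neighbors `R e`, the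
weights of these neighbors, and the multiplicity of `e`. -/
structure HoldsNeighbors (s : Memory) (nv : ℕ) (m : ℕ → ℕ) (R : ℕ → List ℕ) (b : ℕ → ℕ → ℂ) :
    Prop where
  list : ∀ e < nv, StoresList (s.idx 20 e) (e :: R e)
  length : ∀ e < nv, s.idx 21 e 0 = (R e).length + 1
  mult : ∀ e < nv, s.idx 22 e 0 = m e
  weight : ∀ e < nv, ∀ i (h : i < (e :: R e).length), s.num 20 e i = b e (e :: R e)[i]

theorem HoldsNeighbors.of_frame {s s' : Memory} {nv : ℕ} {m : ℕ → ℕ} {R : ℕ → List ℕ}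
    {b : ℕ → ℕ → ℂ} {k : ℕ} (h : HoldsNeighbors s nv m R b) (hf : Frame k s s') (hk : 23 ≤ k) :
    HoldsNeighbors s' nv m R b := by
  constructor
  · rw [hf.idx 20 (by omega)]; exact h.list
  · rw [hf.idx 21 (by omega)]; exact h.length
  · rw [hf.idx 22 (by omega)]; exact h.mult
  · rw [hf.num 20 (by omega)]; exact h.weight

/-- Copies the list of the vertex `var x`, without the entry at `var y`, to row `dst` of the index
array `40`. -/
def copyErase (dst x y : ℕ) : Program :=
  .seq (.setVar 46 (.lit 0)) <|
  .seq (.setVar 47 (.lit 0)) <|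
  .seq (.loop (.lt (.var 46) (.get 21 (.var x) (.lit 0))) <|
    .seq (.ite (.eq (.var 46) (.var y)) .skip <|
      .seq (.setIdx 40 (.lit dst) (.var 47) (.get 20 (.var x) (.var 46)))
        (.setVar 47 (.add (.var 47) (.lit 1)))) <|
    .setVar 46 (.add (.var 46) (.lit 1))) <|
  .setIdx 41 (.lit dst) (.lit 0) (.var 47)

/-- The position may lie beyond the end of the list, in which case everything is copied. This serves
both for full lists and for messages that omit nothing. -/
theorem wp_copyErase {s : Memory} {dst x y f u : ℕ} {L : List ℕ} (hx : x < 46) (hy : y < 46)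
    (hxs : s.var x = f) (hys : s.var y = u) (hL : StoresList (s.idx 20 f) L)
    (hl : s.idx 21 f 0 = L.length) :
    WP (copyErase dst x y) s fun t s' => t ≤ 30 * (L.length + 1) ∧
      StoresList (s'.idx 40 dst) (L.eraseIdx u) ∧ s'.idx 41 dst 0 = (L.eraseIdx u).length ∧
      (∀ r, r ≠ dst → s'.idx 40 r = s.idx 40 r ∧ s'.idx 41 r = s.idx 41 r) ∧
      s'.num = s.num ∧ (∀ z, z ≠ 46 → z ≠ 47 → s'.var z = s.var z) ∧
      (∀ a, a ≠ 40 → a ≠ 41 → s'.idx a = s.idx a) := by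
  simp only [copyErase, wp_seq, wp_setVar]
  refine WP.mono (wp_loop 40 L.length (fun i s' => s'.var 46 = i ∧
      s'.var 47 = ((L.take i).eraseIdx u).length ∧
      StoresList (s'.idx 40 dst) ((L.take i).eraseIdx u) ∧
      (∀ r, r ≠ dst → s'.idx 40 r = s.idx 40 r) ∧
      s'.num = s.num ∧ (∀ z, z ≠ 46 → z ≠ 47 → s'.var z = s.var z) ∧
      (∀ a, a ≠ 40 → s'.idx a = s.idx a)) (fun i => i * 25)
      (by simp [Program.fresh]) ?_ ?_ ?_) ?_
  · simp +contextual [StoresList]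
  · rintro i hi s' hf ⟨i1, i2, i3, i4, i5, i6, i7⟩
    have gx : s'.var x = f := by rw [i6 x (by omega) (by omega), hxs]
    have gy : s'.var y = u := by rw [i6 y (by omega) (by omega), hys]
    have gi : s'.idx 20 f i = L[i] := by rw [i7 20 (by norm_num), hL i hi]
    have gl : s'.idx 21 f 0 = L.length := by rw [i7 21 (by norm_num), hl]
    refine ⟨by simp [i1, gx, gl, hi], ?_⟩
    by_cases hc : i = u
    · simp only [BExp.eval, IExp.eval, i1, gx, gy, gl, hi, hc, decide_true, wp_seq, wp_setVar,
        wp_ite, wp_skip, Memory.setVar_var, Memory.setVar_idx, Memory.setVar_num, IExp.cost,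
        BExp.cost, Nat.reduceEqDiff, reduceIte, true_and]
      subst hc
      rw [List.eraseIdx_take_succ hi, if_pos rfl]
      refine ⟨by omega, i2, i3, i4, i5, fun z hz hz' => ?_, i7⟩
      simp [hz, i6 z hz hz']
    · simp only [BExp.eval, IExp.eval, i1, gx, gy, gl, gi, hi, hc, decide_true, decide_false, wp_seq,
        wp_setVar, wp_setIdx, wp_ite, wp_skip, Memory.setVar_var, Memory.setVar_idx,
        Memory.setVar_num, Memory.setIdx_var, Memory.setIdx_idx, Memory.setIdx_num, IExp.cost,
        BExp.cost, Nat.reduceEqDiff, reduceIte, true_and, Bool.false_eq_true]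
      rw [List.eraseIdx_take_succ hi, if_neg hc]
      refine ⟨by omega, by simp [i2], ?_, fun r hr => ?_, i5, fun z hz hz' => ?_, fun a ha => ?_⟩
      · intro j hj
        simp only [List.length_append, List.length_singleton] at hj
        by_cases hjl : j = ((L.take i).eraseIdx u).length
        · simp [hjl, i2]
        · have hj' : j < ((L.take i).eraseIdx u).length := by omega
          rw [List.getElem_append_left hj', ← i3 j hj']
          simp [i2, hjl]
      · funext j
        simp [hr, i4 r hr]
      · simp [hz, hz', i6 z hz hz']
      · funext r j
        simp [ha, i7 a ha]
  · rintro s' hf ⟨i1, i2, i3, i4, i5, i6, i7⟩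
    have gx : s'.var x = f := by rw [i6 x (by omega) (by omega), hxs]
    have gl : s'.idx 21 f 0 = L.length := by rw [i7 21 (by norm_num), hl]
    simp [i1, gx, gl]
  · rintro t s' ⟨ht, ⟨i1, i2, i3, i4, i5, i6, i7⟩, hf⟩
    rw [List.take_length] at i2 i3
    simp only [IExp.cost, BExp.cost] at ht
    simp only [wp_setIdx, Memory.setIdx_var, Memory.setIdx_num, IExp.eval, IExp.cost, i2]
    refine ⟨by omega, ?_, by simp, fun r hr => ⟨?_, ?_⟩, i5, i6, fun a ha ha' => ?_⟩
    · intro j hj; simpa using i3 j hj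
    · funext j; simp [i4 r hr]
    · funext j; simp [hr, i7 41]
    · funext r j; simp [ha', i7 a ha]

/-- Extends the table of a local factor to the neighbor at the position `var 33`. -/
def extendLocalTable : Program :=
  .seq (.setVar 38 (.var 31)) <|
  .seq (.setVar 39 (.lit 0)) <|
  .seq (.loop (.lt (.var 39) (.get 22 (.get 20 (.var 30) (.var 33)) (.lit 0))) <|
    .seq (.setVar 38 (.add (.var 38) (.var 31))) (.setVar 39 (.add (.var 39) (.lit 1)))) <|
  .seq (.setVar 36 (.var 31)) <|
  .seq (.setVar 34 (.lit 0)) <|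
  .seq (.setVar 35 (.lit 1)) <|
  .seq (.setVar 37 (.lit 0)) <|
  .seq (.loop (.lt (.var 36) (.var 38)) <|
    .seq (.ite (.eq (.var 34) (.lit 0)) (.setNum 60 (.lit 0) (.var 36) (.cast (.lit 0))) <|
      .setNum 60 (.lit 0) (.var 36) (.div (.mul (.get 20 (.var 30) (.var 33))
        (.get 60 (.lit 0) (.sub (.sub (.var 36) (.var 31)) (.lit 1)))) (.cast (.var 35)))) <|
    .seq (.ite (.eq (.var 34) (.get 22 (.var 30) (.lit 0))) (.setVar 34 (.lit 0))
      (.setVar 34 (.add (.var 34) (.lit 1)))) <|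
    .seq (.setVar 37 (.add (.var 37) (.lit 1))) <|
    .seq (.ite (.eq (.var 37) (.var 31))
      (.seq (.setVar 37 (.lit 0)) (.setVar 35 (.add (.var 35) (.lit 1)))) .skip) <|
    .setVar 36 (.add (.var 36) (.lit 1))) <|
  .setVar 31 (.var 38)

theorem succ_mod_eq {i n : ℕ} (hn : 0 < n) :
    (i + 1) % n = if i % n + 1 = n then 0 else i % n + 1 := by
  have h := Nat.mod_lt i hn
  rw [← Nat.mod_add_mod]
  split_ifs with hc
  · rw [hc, Nat.mod_self]
  · exact Nat.mod_eq_of_lt (by omega)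

theorem succ_div_eq {i n : ℕ} (hn : 0 < n) :
    (i + 1) / n = if i % n + 1 = n then i / n + 1 else i / n := by
  have h := Nat.mod_lt i hn
  have h1 := Nat.div_add_mod i n
  split_ifs with hc
  · have : i + 1 = n * (i / n + 1) := by rw [mul_add, mul_one]; omega
    conv_lhs => rw [this]
    exact Nat.mul_div_cancel_left _ hn
  · have : i + 1 = i % n + 1 + n * (i / n) := by omega
    conv_lhs => rw [this]
    rw [Nat.add_mul_div_left _ _ hn, Nat.div_eq_of_lt (by omega), zero_add]

/-- The recursion along the edge `eu`, in terms of table positions: lowering the exponents of `e`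
(least significant digit) and of `u` (most significant digit) by one lowers the position by 1 and by
the old box size. The two exponents are the residue modulo `m e + 1` and the quotient by the old box
size. -/
theorem coeff_localFactor_concat {b : ℕ → ℕ → ℂ} {m : ℕ → ℕ} {e u i : ℕ} {S : Finset ℕ}
    {D : List ℕ} (he : e ∉ S) (hu : u ∈ S) (hD : (e :: D ++ [u]).Nodup) {ν : ℕ →₀ ℕ}
    (h1 : ∀ v ∈ e :: D ++ [u], ν v ≤ m v) (h2 : ∀ v ∉ e :: D ++ [u], ν v = 0)
    (hi : mixedRadix m (e :: D ++ [u]) ν = i) (hsz : boxSize m (e :: D) ≤ i) :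
    (i % (m e + 1) = 0 → MvPowerSeries.coeff ν (localFactor b e S) = 0) ∧
    (i % (m e + 1) ≠ 0 → ∃ μ : ℕ →₀ ℕ, (∀ v ∈ e :: D ++ [u], μ v ≤ m v) ∧
      (∀ v ∉ e :: D ++ [u], μ v = 0) ∧
      mixedRadix m (e :: D ++ [u]) μ = i - boxSize m (e :: D) - 1 ∧
      MvPowerSeries.coeff ν (localFactor b e S) =
        b e u * MvPowerSeries.coeff μ (localFactor b e S) / (i / boxSize m (e :: D) : ℕ)) := by
  have hpos := boxSize_pos m (e :: D)
  have hle : ∀ v ∈ e :: D, ν v ≤ m v := fun v hv => h1 v (by simp at hv ⊢; tauto)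
  have hlt := mixedRadix_lt hle
  have hmod : i % (m e + 1) = ν e := by
    rw [← hi, List.cons_append, mixedRadix, Nat.add_mul_mod_self_left, Nat.mod_eq_of_lt]
    exact Nat.lt_succ_of_le (h1 e (by simp))
  have hdiv : i / boxSize m (e :: D) = ν u := by
    rw [← hi, mixedRadix_concat, Nat.add_mul_div_left _ _ hpos, Nat.div_eq_of_lt hlt, zero_add]
  have hnu : ν u ≠ 0 := by
    rw [← hdiv]
    exact (Nat.div_pos hsz hpos).ne'
  have hue : u ≠ e := fun h => he (h ▸ hu)
  have huD : u ∉ D := by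
    have := (List.nodup_append.mp hD).2.2
    intro h
    exact this u (by simp [h]) u (by simp) rfl
  have heD : e ∉ D := by simp at hD; tauto
  rw [hmod, hdiv]
  refine ⟨fun h => by rw [coeff_localFactor_edge he hu hnu, if_pos h], fun h => ?_⟩
  refine ⟨ν - Finsupp.single u 1 - Finsupp.single e 1, fun v hv => ?_, fun v hv => ?_, ?_, ?_⟩
  · have := h1 v hv
    simp
    omega
  · simp [h2 v hv]
  · have hne : ∀ v ∈ D, v ≠ e ∧ v ≠ u := fun v hv => ⟨fun h => heD (h ▸ hv), fun h => huD (h ▸ hv)⟩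
    rw [mixedRadix_concat] at hi ⊢
    rw [mixedRadix] at hi ⊢
    rw [mixedRadix_congr (D := D) (ν := ν) fun v hv => by simp [(hne v hv).1, (hne v hv).2]]
    obtain ⟨k, hk⟩ := Nat.exists_eq_succ_of_ne_zero hnu
    obtain ⟨l, hl⟩ := Nat.exists_eq_succ_of_ne_zero h
    simp only [Finsupp.tsub_apply, Finsupp.single_apply, hue, hue.symm, if_true, if_false, hk, hl,
      Nat.succ_eq_add_one, mul_add, mul_one] at hi ⊢
    simp only [Nat.sub_zero, Nat.add_sub_cancel] at hi ⊢
    omega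
  · rw [coeff_localFactor_edge he hu hnu, if_neg h]

/-- Each new entry needs a constant number of steps, because the variables `34`, `37` and `35`
follow the digit of `e`, the residue modulo the old box size and the digit of `u` while the position
advances. The entry referred to by the recursion is always an earlier one. -/
theorem wp_extendLocalTable {s : Memory} {m : ℕ → ℕ} {b : ℕ → ℕ → ℂ} {e u p : ℕ} {S : Finset ℕ}
    {D : List ℕ} (he : e ∉ S) (hu : u ∈ S) (hD : (e :: D ++ [u]).Nodup)
    (h30 : s.var 30 = e) (h31 : s.var 31 = boxSize m (e :: D)) (h33 : s.var 33 = p)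
    (h20 : s.idx 20 e p = u) (h22 : s.idx 22 e 0 = m e) (h22' : s.idx 22 u 0 = m u)
    (hw : s.num 20 e p = b e u)
    (hA : ∀ ν : ℕ →₀ ℕ, (∀ v ∈ e :: D, ν v ≤ m v) → (∀ v ∉ e :: D, ν v = 0) →
      s.num 60 0 (mixedRadix m (e :: D) ν) = MvPowerSeries.coeff ν (localFactor b e S)) :
    WP extendLocalTable s fun t s' => t ≤ 80 * (boxSize m (e :: D) * m u) + 100 ∧
      s'.var 31 = boxSize m (e :: D ++ [u]) ∧ s'.var 33 = p ∧ s'.idx = s.idx ∧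
      (∀ ν : ℕ →₀ ℕ, (∀ v ∈ e :: D ++ [u], ν v ≤ m v) → (∀ v ∉ e :: D ++ [u], ν v = 0) →
        s'.num 60 0 (mixedRadix m (e :: D ++ [u]) ν) =
          MvPowerSeries.coeff ν (localFactor b e S)) ∧
      (∀ a, a ≠ 60 → s'.num a = s.num a) ∧ ∀ r, r ≠ 0 → s'.num 60 r = s.num 60 r := by
  have hpos := boxSize_pos m (e :: D)
  set q := boxSize m (e :: D) with hq
  simp only [extendLocalTable, wp_seq, wp_setVar]
  refine WP.mono (wp_loop 34 (m u) (fun i s' => s'.var 39 = i ∧ s'.var 38 = q * (i + 1) ∧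
      s'.idx = s.idx ∧ s'.num = s.num) (fun i => i * 20) (by decide) ?_ ?_ ?_) ?_
  · simp [h31]
  · rintro i hi s₁ hf ⟨i1, i2, i3, i4⟩
    have g30 : s₁.var 30 = e := by rw [hf.var 30 (by norm_num)]; simpa using h30
    have g31 : s₁.var 31 = q := by rw [hf.var 31 (by norm_num)]; simpa using h31
    have g33 : s₁.var 33 = p := by rw [hf.var 33 (by norm_num)]; simpa using h33
    simp [i1, i2, i3, i4, g30, g31, g33, h20, h22', hi]
    exact ⟨by omega, by ring⟩
  · rintro s₁ hf ⟨i1, i2, i3, i4⟩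
    have g30 : s₁.var 30 = e := by rw [hf.var 30 (by norm_num)]; simpa using h30
    have g33 : s₁.var 33 = p := by rw [hf.var 33 (by norm_num)]; simpa using h33
    simp [i1, i3, g30, g33, h20, h22']
  rintro t₁ s₁ ⟨ht₁, ⟨-, j38, jidx, jnum⟩, hf₁⟩
  have j30 : s₁.var 30 = e := by rw [hf₁.var 30 (by norm_num)]; simpa using h30
  have j31 : s₁.var 31 = q := by rw [hf₁.var 31 (by norm_num)]; simpa using h31
  have j33 : s₁.var 33 = p := by rw [hf₁.var 33 (by norm_num)]; simpa using h33
  refine WP.mono (wp_loop 34 (q * m u) (fun i s' => s'.var 36 = q + i ∧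
      s'.var 34 = (q + i) % (m e + 1) ∧ s'.var 37 = (q + i) % q ∧ s'.var 35 = (q + i) / q ∧
      s'.var 38 = q * (m u + 1) ∧ s'.idx = s.idx ∧
      (∀ ν : ℕ →₀ ℕ, (∀ v ∈ e :: D ++ [u], ν v ≤ m v) → (∀ v ∉ e :: D ++ [u], ν v = 0) →
        mixedRadix m (e :: D ++ [u]) ν < q + i → s'.num 60 0 (mixedRadix m (e :: D ++ [u]) ν) =
          MvPowerSeries.coeff ν (localFactor b e S)) ∧
      (∀ a, a ≠ 60 → s'.num a = s.num a) ∧ ∀ r, r ≠ 0 → s'.num 60 r = s.num 60 r)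
      (fun i => i * 60) (by decide) ?_ ?_ ?_) ?_
  · simp only [Memory.setVar_var, Memory.setVar_idx, Memory.setVar_num, IExp.eval, j31, j38, jidx,
      jnum, Nat.reduceEqDiff, reduceIte, true_and, add_zero, implies_true, and_true]
    refine ⟨?_, by simp, by simp [Nat.div_self hpos], ?_⟩
    · rw [hq, boxSize_cons, Nat.mul_mod_right]
    · intro ν h1 h2 hlt
      have hnu : ν u = 0 := by
        by_contra h0
        rw [mixedRadix_concat, ← hq] at hlt
        have := Nat.mul_le_mul_left q (Nat.one_le_iff_ne_zero.mpr h0)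
        omega
      rw [mixedRadix_concat, hnu, mul_zero, add_zero]
      refine hA ν (fun v hv => h1 v (by simp at hv ⊢; tauto)) fun v hv => ?_
      by_cases hvu : v = u
      · rw [hvu, hnu]
      · exact h2 v (by simp at hv ⊢; tauto)
  · rintro i hi s' hf ⟨i1, i2, i3, i4, i5, i6, i7, i8, i9⟩
    have g30 : s'.var 30 = e := by rw [hf.var 30 (by norm_num)]; simpa using j30
    have g31 : s'.var 31 = q := by rw [hf.var 31 (by norm_num)]; simpa using j31
    have g33 : s'.var 33 = p := by rw [hf.var 33 (by norm_num)]; simpa using j33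
    have gw : s'.num 20 e p = b e u := by rw [i8 20 (by norm_num), hw]
    have hlt : q + i < q * (m u + 1) := by rw [mul_add, mul_one]; omega
    have hfin : ∀ x, (∀ ν : ℕ →₀ ℕ, (∀ v ∈ e :: D ++ [u], ν v ≤ m v) →
          (∀ v ∉ e :: D ++ [u], ν v = 0) → mixedRadix m (e :: D ++ [u]) ν = q + i →
          x = MvPowerSeries.coeff ν (localFactor b e S)) →
        ∀ ν : ℕ →₀ ℕ, (∀ v ∈ e :: D ++ [u], ν v ≤ m v) → (∀ v ∉ e :: D ++ [u], ν v = 0) →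
          mixedRadix m (e :: D ++ [u]) ν < q + i + 1 →
          (if mixedRadix m (e :: D ++ [u]) ν = q + i then x else
            s'.num 60 0 (mixedRadix m (e :: D ++ [u]) ν)) =
          MvPowerSeries.coeff ν (localFactor b e S) := by
      intro x hx ν h1 h2 h3
      split_ifs with h
      · exact hx ν h1 h2 h
      · exact i7 ν h1 h2 (by omega)
    -- The update of the counters, shared by the two branches that write the new entry.
    have hstep : ∀ s₂ : Memory, s₂.var = s'.var → s₂.idx = s.idx →
        (∀ ν : ℕ →₀ ℕ, (∀ v ∈ e :: D ++ [u], ν v ≤ m v) → (∀ v ∉ e :: D ++ [u], ν v = 0) →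
          mixedRadix m (e :: D ++ [u]) ν < q + i + 1 →
          s₂.num 60 0 (mixedRadix m (e :: D ++ [u]) ν) =
          MvPowerSeries.coeff ν (localFactor b e S)) →
        (∀ a, a ≠ 60 → s₂.num a = s.num a) → (∀ r, r ≠ 0 → s₂.num 60 r = s.num 60 r) →
        WP (.seq (.ite (.eq (.var 34) (.get 22 (.var 30) (.lit 0))) (.setVar 34 (.lit 0))
            (.setVar 34 (.add (.var 34) (.lit 1)))) <|
          .seq (.setVar 37 (.add (.var 37) (.lit 1))) <|
          .seq (.ite (.eq (.var 37) (.var 31))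
            (.seq (.setVar 37 (.lit 0)) (.setVar 35 (.add (.var 35) (.lit 1)))) .skip) <|
          .setVar 36 (.add (.var 36) (.lit 1))) s₂ fun t s₃ => t ≤ 30 ∧ s₃.var 36 = q + (i + 1) ∧
            s₃.var 34 = (q + (i + 1)) % (m e + 1) ∧ s₃.var 37 = (q + (i + 1)) % q ∧
            s₃.var 35 = (q + (i + 1)) / q ∧ s₃.var 38 = q * (m u + 1) ∧ s₃.idx = s.idx ∧
            (∀ ν : ℕ →₀ ℕ, (∀ v ∈ e :: D ++ [u], ν v ≤ m v) → (∀ v ∉ e :: D ++ [u], ν v = 0) →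
              mixedRadix m (e :: D ++ [u]) ν < q + (i + 1) →
              s₃.num 60 0 (mixedRadix m (e :: D ++ [u]) ν) =
                MvPowerSeries.coeff ν (localFactor b e S)) ∧
            (∀ a, a ≠ 60 → s₃.num a = s.num a) ∧ ∀ r, r ≠ 0 → s₃.num 60 r = s.num 60 r := by
      intro s₂ k1 k2 k3 k4 k5
      simp only [← add_assoc, succ_mod_eq (Nat.succ_pos (m e)), succ_mod_eq hpos, succ_div_eq hpos,
        Nat.succ_eq_add_one, Nat.add_right_cancel_iff]
      by_cases hc : (q + i) % (m e + 1) = m e <;> by_cases hc' : (q + i) % q + 1 = q <;>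
      · simp only [BExp.eval, IExp.eval, k1, k2, i1, i2, i3, i4, i5, g30, g31, h22, hc, hc',
          decide_true, decide_false, wp_seq, wp_setVar, wp_ite, wp_skip, Memory.setVar_var,
          Memory.setVar_idx, Memory.setVar_num, IExp.cost, BExp.cost, Nat.reduceEqDiff, reduceIte,
          true_and, Bool.false_eq_true]
        exact ⟨by omega, k3, k4, k5⟩
    refine ⟨by simp [i1, i5, hlt], ?_⟩
    rw [wp_seq, wp_ite]
    by_cases hc : (q + i) % (m e + 1) = 0
    · rw [if_pos (by simp [i2, hc])]
      simp only [wp_setNum, IExp.eval, NExp.eval, i1]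
      refine WP.mono (hstep _ (by simp) (by simp [i6]) ?_ ?_ ?_) ?_
      · intro ν h1 h2 h3
        have := hfin 0 (fun ν h1 h2 h3 => ((coeff_localFactor_concat he hu hD h1 h2 h3
          (by omega)).1 hc).symm) ν h1 h2 h3
        simpa using this
      · intro a ha; funext r j; simp [ha, i8 a ha]
      · intro r hr; funext j; simp [hr, i9 r hr]
      · rintro t s₃ ⟨k1, k2⟩
        simp only [BExp.cost, IExp.cost, NExp.cost]
        exact ⟨by omega, k2⟩
    · rw [if_neg (by simp [i2, hc])]
      simp only [wp_setNum, IExp.eval, NExp.eval, i1, g30, g31, g33, i4]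
      refine WP.mono (hstep _ (by simp) (by simp [i6]) ?_ ?_ ?_) ?_
      · intro ν h1 h2 h3
        have := hfin (b e u * s'.num 60 0 (q + i - q - 1) / ((q + i) / q : ℕ))
          (fun ν h1 h2 h3 => ?_) ν h1 h2 h3
        · simpa [gw] using this
        · obtain ⟨μ, l1, l2, l3, l4⟩ := (coeff_localFactor_concat he hu hD h1 h2 h3
            (by omega)).2 hc
          rw [l4, ← i7 μ l1 l2 (by omega), l3]
      · intro a ha; funext r j; simp [ha, i8 a ha]
      · intro r hr; funext j; simp [hr, i9 r hr]
      · rintro t s₃ ⟨k1, k2⟩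
        simp only [BExp.cost, IExp.cost, NExp.cost]
        exact ⟨by omega, k2⟩
  · rintro s' hf ⟨i1, i2, i3, i4, i5, i6, i7, i8, i9⟩
    simp [i1, i5, mul_add, add_comm]
  · rintro t s' ⟨ht, ⟨i1, i2, i3, i4, i5, i6, i7, i8, i9⟩, hf⟩
    have g33 : s'.var 33 = p := by rw [hf.var 33 (by norm_num)]; simpa using j33
    simp only [BExp.cost, IExp.cost] at ht ht₁
    have : m u ≤ q * m u := Nat.le_mul_of_pos_left _ hpos
    simp only [Memory.setVar_var, Memory.setVar_idx, Memory.setVar_num, IExp.eval, IExp.cost,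
      Nat.reduceEqDiff, reduceIte]
    refine ⟨by omega, ?_, g33, i6, fun ν h1 h2 => i7 ν h1 h2 ?_, i8, i9⟩
    · rw [i5, boxSize_concat]
    · have := mixedRadix_lt h1
      rw [boxSize_concat, ← hq, mul_add, mul_one] at this
      omega

/-- Tabulates the local factor of the vertex `var 30` in row `0` of the number array `60`. -/
def localTable : Program :=
  .seq (.setNum 60 (.lit 0) (.lit 0) (.cast (.lit 1))) <|
  .seq (.setNum 60 (.lit 0) (.lit 1) (.get 20 (.var 30) (.lit 0))) <|
  .seq (.setVar 36 (.lit 2)) <|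
  .seq (.loop (.lt (.var 36) (.add (.get 22 (.var 30) (.lit 0)) (.lit 1))) <|
    .seq (.setNum 60 (.lit 0) (.var 36) (.div (.mul (.get 20 (.var 30) (.lit 0))
      (.add (.get 60 (.lit 0) (.sub (.var 36) (.lit 1)))
        (.get 60 (.lit 0) (.sub (.var 36) (.lit 2))))) (.cast (.var 36))))
      (.setVar 36 (.add (.var 36) (.lit 1)))) <|
  .seq (.setVar 31 (.add (.get 22 (.var 30) (.lit 0)) (.lit 1))) <|
  .seq (.setVar 33 (.lit 1)) <|
  .loop (.lt (.var 33) (.get 21 (.var 30) (.lit 0))) <|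
    .seq extendLocalTable (.setVar 33 (.add (.var 33) (.lit 1)))

/-- The time for one more neighbor is paid by the growth of the box, up to a constant. -/
theorem boxSize_mul_le {m : ℕ → ℕ} {e u : ℕ} {D : List ℕ} (p : ℕ) :
    100 * boxSize m (e :: D) + 200 * p + (80 * (boxSize m (e :: D) * m u) + 100) + 50 ≤
      100 * boxSize m (e :: D ++ [u]) + 200 * (p + 1) := by
  rw [boxSize_concat, mul_add, mul_one]
  omega

theorem wp_localTable {s : Memory} {m : ℕ → ℕ} {b : ℕ → ℕ → ℂ} {nv e : ℕ} {R : ℕ → List ℕ}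
    (hs : HoldsNeighbors s nv m R b) (hR : ∀ e < nv, (R e).Nodup ∧ ∀ u ∈ R e, e < u ∧ u < nv)
    (he : e < nv) (h30 : s.var 30 = e) :
    WP localTable s fun t s' =>
      t ≤ 200 * (boxSize m (e :: R e) + (R e).length + 1) ∧
      s'.var 31 = boxSize m (e :: R e) ∧ s'.idx = s.idx ∧
      IsTable m (e :: R e) (s'.num 60 0) (localFactor b e (R e).toFinset) ∧
      (∀ a, a ≠ 60 → s'.num a = s.num a) ∧ (∀ r, r ≠ 0 → s'.num 60 r = s.num 60 r) ∧
      Frame 31 s s' := by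
  refine WP.mono (WP.frame (Q := fun t s' => t ≤ 200 * (boxSize m (e :: R e) + (R e).length + 1) ∧
      s'.var 31 = boxSize m (e :: R e) ∧ s'.idx = s.idx ∧
      IsTable m (e :: R e) (s'.num 60 0) (localFactor b e (R e).toFinset) ∧
      (∀ a, a ≠ 60 → s'.num a = s.num a) ∧ (∀ r, r ≠ 0 → s'.num 60 r = s.num 60 r))
      ?_ 31 (by decide)) (by rintro t s' ⟨⟨h1, h2, h3, h4, h5, h6⟩, h7⟩; exact ⟨h1, h2, h3, h4, h5, h6, h7⟩)
  obtain ⟨hnd, hRe⟩ := hR e he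
  have heR : e ∉ R e := fun h => (hRe e h).1.false
  have heS : e ∉ (R e).toFinset := by simpa using heR
  set S := (R e).toFinset with hS
  have h22 := hs.mult e he
  have h21 := hs.length e he
  have hw0 : s.num 20 e 0 = b e e := hs.weight e he 0 (by simp)
  simp only [localTable, wp_seq, wp_setVar, wp_setNum]
  -- The entries 0 and 1 are written before the loop. If `m e = 0`, there are no rounds, and entry 1
  -- lies outside the initial table, about which the next invariant says nothing.
  refine WP.mono (wp_loop 35 (m e - 1) (fun i s' => s'.var 36 = i + 2 ∧ s'.idx = s.idx ∧
      (∀ k < i + 2, s'.num 60 0 k = loopCoeff (b e e) k) ∧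
      (∀ a, a ≠ 60 → s'.num a = s.num a) ∧ ∀ r, r ≠ 0 → s'.num 60 r = s.num 60 r)
      (fun i => i * 40) (by decide) ?_ ?_ ?_) ?_
  · refine ⟨by simp, by simp, ?_, ?_, ?_⟩
    · intro k hk
      rcases k with _ | _ | k
      · simp [loopCoeff]
      · simp [loopCoeff, h30, hw0]
      · omega
    · intro a ha; funext i j; simp [ha]
    · intro r hr; funext j; simp [hr]
  · rintro i hi s' hf ⟨i1, i2, i3, i4, i5⟩
    have g30 : s'.var 30 = e := by rw [hf.var 30 (by norm_num)]; simpa using h30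
    have gw : s'.num 20 e 0 = b e e := by rw [i4 20 (by norm_num), hw0]
    have h0 := i3 i (by omega)
    have h1 := i3 (i + 1) (by omega)
    have hlt : i + 2 < m e + 1 := by omega
    simp [i1, i2, g30, gw, h22, hlt, h0, h1]
    refine ⟨by omega, ?_, ?_, ?_⟩
    · intro k hk
      split_ifs with h
      · subst h
        simp [loopCoeff]
      · exact i3 k (by omega)
    · intro a ha; funext r j; simp [ha, i4 a ha]
    · intro r hr; funext j; simp [hr, i5 r hr]
  · rintro s' hf ⟨i1, i2, i3, i4, i5⟩
    have g30 : s'.var 30 = e := by rw [hf.var 30 (by norm_num)]; simpa using h30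
    simp [i1, i2, g30, h22]
    omega
  rintro t₁ s₁ ⟨ht₁, ⟨-, j2, j3, j4, j5⟩, hf₁⟩
  have j30 : s₁.var 30 = e := by rw [hf₁.var 30 (by norm_num)]; simpa using h30
  refine WP.mono (wp_loop 31 (R e).length (fun p s' => s'.var 33 = p + 1 ∧
      s'.var 31 = boxSize m (e :: (R e).take p) ∧ s'.idx = s.idx ∧
      (∀ ν : ℕ →₀ ℕ, (∀ v ∈ e :: (R e).take p, ν v ≤ m v) →
        (∀ v ∉ e :: (R e).take p, ν v = 0) →
        s'.num 60 0 (mixedRadix m (e :: (R e).take p) ν) =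
          MvPowerSeries.coeff ν (localFactor b e S)) ∧
      (∀ a, a ≠ 60 → s'.num a = s.num a) ∧ ∀ r, r ≠ 0 → s'.num 60 r = s.num 60 r)
      (fun p => 100 * boxSize m (e :: (R e).take p) + 200 * p) (by decide) ?_ ?_ ?_) ?_
  · simp only [Memory.setVar_var, Memory.setVar_idx, Memory.setVar_num, IExp.eval, j2, j30, h22,
      Nat.reduceEqDiff, reduceIte, true_and, List.take_zero, boxSize_cons, boxSize_nil, mul_one,
      mixedRadix, mul_zero, add_zero]
    refine ⟨fun ν h1 h2 => ?_, j4, j5⟩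
    have hν : ν = Finsupp.single e (ν e) := by
      ext v
      by_cases hv : v = e
      · simp [hv]
      · rw [h2 v (by simpa using hv), Finsupp.single_apply, if_neg (Ne.symm hv)]
    have hle := h1 e (by simp)
    rw [j3 _ (by omega)]
    conv_rhs => rw [hν]
    rw [coeff_localFactor_single heS]
  · rintro p hp s' hf ⟨i1, i2, i3, i4, i5, i6⟩
    have g30 : s'.var 30 = e := by rw [hf.var 30 (by norm_num)]; simpa using j30
    have htake : (R e).take (p + 1) = (R e).take p ++ [(R e)[p]] :=
      List.take_succ_eq_append_getElem hp
    have hmem := List.getElem_mem hp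
    have hnd' : (e :: (R e).take p ++ [(R e)[p]]).Nodup := by
      rw [List.cons_append, ← htake, List.nodup_cons]
      exact ⟨fun h => heR (List.mem_of_mem_take h), hnd.sublist (List.take_sublist _ _)⟩
    refine ⟨by simp [i1, i3, g30, h21, hp], ?_⟩
    rw [wp_seq]
    refine WP.mono (wp_extendLocalTable (m := m) (b := b) (p := p + 1) heS
      (List.mem_toFinset.mpr hmem) hnd' g30 i2 i1 ?_ ?_ ?_ ?_ i4) ?_
    · rw [i3, hs.list e he (p + 1) (by simpa using hp)]
      simp
    · rw [i3, h22]
    · rw [i3, hs.mult _ (hRe _ hmem).2]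
    · rw [i5 20 (by norm_num), hs.weight e he (p + 1) (by simpa using hp)]
      simp
    rintro t₂ s₂ ⟨ht₂, k1, k2, k3, k4, k5, k6⟩
    simp only [wp_setVar, Memory.setVar_var, Memory.setVar_idx, Memory.setVar_num, IExp.eval,
      IExp.cost, BExp.cost, k2, Nat.reduceEqDiff, reduceIte, true_and]
    have hsize := boxSize_mul_le (m := m) (e := e) (u := (R e)[p]) (D := (R e).take p) p
    rw [List.cons_append, ← htake] at hsize k1 k4
    refine ⟨by omega, k1, by rw [k3, i3], k4, fun a ha => ?_, fun r hr => ?_⟩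
    · rw [k5 a ha, i5 a ha]
    · rw [k6 r hr, i6 r hr]
  · rintro s' hf ⟨i1, i2, i3, i4, i5, i6⟩
    have g30 : s'.var 30 = e := by rw [hf.var 30 (by norm_num)]; simpa using j30
    simp [i1, i3, g30, h21]
  · rintro t₂ s₂ ⟨ht₂, ⟨k1, k2, k3, k4, k5, k6⟩, hf₂⟩
    rw [List.take_length] at k2 k4 ht₂
    have hm : m e + 1 ≤ boxSize m (e :: R e) := by
      rw [boxSize_cons]
      exact Nat.le_mul_of_pos_right _ (boxSize_pos m _)
    simp only [BExp.cost, IExp.cost, NExp.cost] at ht₁ ht₂ ⊢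
    refine ⟨by omega, k2, k3, ⟨k4, fun ν v hv h0 => ?_⟩, k5, k6⟩
    rw [List.mem_cons, not_or] at hv
    exact coeff_localFactor_of_notMem hv.1 (by simpa [hS] using hv.2) h0

/-! ## The messages of the elimination -/

/-- Puts the message of the vertex `var 30` in row `1` of the number array `60`. -/
def messageTable : Program :=
  .seq (.setNum 31 (.lit 0) (.lit 0) (.cast (.lit 1))) <|
  .seq (.setVar 36 (.lit 0)) <|
  .seq (.loop (.lt (.var 36) (.get 22 (.var 30) (.lit 0))) <|
    .seq (.setVar 36 (.add (.var 36) (.lit 1)))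
      (.setNum 31 (.lit 0) (.lit 0) (.mul (.cast (.var 36)) (.get 31 (.lit 0) (.lit 0))))) <|
  .seq (.setVar 36 (.get 22 (.var 30) (.lit 0))) <|
  .seq (.setVar 37 (.lit 0)) <|
  .loop (.lt (.var 36) (.var 31)) <|
    .seq (.setNum 60 (.lit 1) (.var 37)
      (.mul (.get 31 (.lit 0) (.lit 0)) (.get 60 (.lit 0) (.var 36)))) <|
    .seq (.setVar 36 (.add (.var 36) (.add (.get 22 (.var 30) (.lit 0)) (.lit 1)))) <|
    .setVar 37 (.add (.var 37) (.lit 1))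

/-- The wanted entries form an arithmetic progression with difference `m e + 1`, so they are
collected by a single pass. The factorial in the formula for the loop hafnian is multiplied in here.
-/
theorem wp_messageTable {s : Memory} {m : ℕ → ℕ} {e : ℕ} {D : List ℕ} {F : MvPowerSeries ℕ ℂ}
    (he : e ∉ D) (h30 : s.var 30 = e) (h31 : s.var 31 = boxSize m (e :: D))
    (h22 : s.idx 22 e 0 = m e) (hF : IsTable m (e :: D) (s.num 60 0) F) :
    WP messageTable s fun t s' => t ≤ 100 * (boxSize m (e :: D) + 1) ∧
      IsTable m D (s'.num 60 1) (C ((m e).factorial : ℂ) * powerCoeff e (m e) F) ∧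
      s'.idx = s.idx ∧ (∀ r, r ≠ 1 → s'.num 60 r = s.num 60 r) ∧ Frame 31 s s' := by
  refine WP.mono (WP.frame (Q := fun t s' => t ≤ 100 * (boxSize m (e :: D) + 1) ∧
      IsTable m D (s'.num 60 1) (C ((m e).factorial : ℂ) * powerCoeff e (m e) F) ∧
      s'.idx = s.idx ∧ ∀ r, r ≠ 1 → s'.num 60 r = s.num 60 r)
      ?_ 31 (by decide)) (by rintro t s' ⟨⟨h1, h2, h3, h4⟩, h5⟩; exact ⟨h1, h2, h3, h4, h5⟩)
  have hpos := boxSize_pos m D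
  simp only [messageTable, wp_seq, wp_setVar, wp_setNum]
  refine WP.mono (wp_loop 31 (m e) (fun i s' => s'.var 36 = i ∧ s'.idx = s.idx ∧
      s'.num 31 0 0 = (i.factorial : ℂ) ∧ s'.num 60 = s.num 60 ∧ s'.var 31 = s.var 31)
      (fun i => i * 20) (by decide) ?_ ?_ ?_) ?_
  · refine ⟨by simp, by simp, by simp, ?_, by simp⟩
    funext r j
    simp
  · rintro i hi s' hf ⟨i1, i2, i3, i4, i5⟩
    have g30 : s'.var 30 = e := by rw [hf.var 30 (by norm_num)]; simpa using h30
    simp [i1, i2, i3, g30, h22, hi, i5, Nat.factorial_succ]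
    refine ⟨by omega, ?_⟩
    funext r j
    simp [i4]
  · rintro s' hf ⟨i1, i2, i3, i4, i5⟩
    have g30 : s'.var 30 = e := by rw [hf.var 30 (by norm_num)]; simpa using h30
    simp [i1, i2, g30, h22]
  rintro t₁ s₁ ⟨ht₁, ⟨-, j2, j3, j4, j5⟩, hf₁⟩
  have j30 : s₁.var 30 = e := by rw [hf₁.var 30 (by norm_num)]; simpa using h30
  refine WP.mono (wp_loop 31 (boxSize m D) (fun i s' => s'.var 37 = i ∧
      s'.var 36 = m e + (m e + 1) * i ∧ s'.idx = s.idx ∧ s'.num 31 0 0 = ((m e).factorial : ℂ) ∧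
      (∀ j < i, s'.num 60 1 j = ((m e).factorial : ℂ) * s.num 60 0 (m e + (m e + 1) * j)) ∧
      (∀ r, r ≠ 1 → s'.num 60 r = s.num 60 r) ∧ s'.var 31 = s.var 31)
      (fun i => i * 30) (by decide) ?_ ?_ ?_) ?_
  · simp [j2, j3, j4, j5, j30, h22]
  · rintro i hi s' hf ⟨i1, i2, i3, i4, i5, i6, i7⟩
    have g30 : s'.var 30 = e := by rw [hf.var 30 (by norm_num)]; simpa using j30
    have hlt : m e + (m e + 1) * i < boxSize m (e :: D) := by
      rw [boxSize_cons]
      have := Nat.mul_le_mul_left (m e + 1) (Nat.succ_le_of_lt hi)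
      rw [Nat.mul_succ] at this
      omega
    simp [i1, i2, i3, i4, i6, i7, g30, h22, h31, hlt]
    refine ⟨by omega, by ring, ?_, ?_⟩
    · intro j hj
      split_ifs with h
      · rw [h]
      · exact i5 j (by omega)
    · intro r hr; funext j; simp [hr, i6 r hr]
  · rintro s' hf ⟨i1, i2, i3, i4, i5, i6, i7⟩
    simp [i2, i7, h31, boxSize_cons]
  · rintro t₂ s₂ ⟨ht₂, ⟨k1, k2, k3, k4, k5, k6, k7⟩, hf₂⟩
    have hm : m e + 1 ≤ boxSize m (e :: D) := by
      rw [boxSize_cons]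
      exact Nat.le_mul_of_pos_right _ hpos
    have hD : boxSize m D ≤ boxSize m (e :: D) := by
      rw [boxSize_cons]
      exact Nat.le_mul_of_pos_left _ (Nat.succ_pos _)
    simp only [BExp.cost, IExp.cost, NExp.cost] at ht₁ ht₂ ⊢
    exact ⟨by omega, hF.powerCoeff he k5, k3, k6⟩

/-- A bound for the time of a truncated multiplication on a box of size `N` with `l` variables. -/
def mulCost (N l : ℕ) : ℕ := 2000 * (8 * N * (l + 1) * (Nat.log 2 (8 * N * (l + 1)) + 1))

/-- The exponent of the transform length is at most the binary logarithm of the bound for it. -/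
theorem le_mulCost {h N l t : ℕ} (hN : 0 < N) (hh : 2 ^ h ≤ 8 * N * (l + 1))
    (ht : t ≤ 2000 * (2 ^ h * (h + 1))) : t ≤ mulCost N l := by
  refine ht.trans (Nat.mul_le_mul_left _ (Nat.mul_le_mul hh (Nat.succ_le_succ ?_)))
  exact (Nat.le_log_iff_pow_le (by norm_num) (by positivity)).mpr hh

theorem mulCost_mono {N N' l l' : ℕ} (hN : N ≤ N') (hl : l ≤ l') : mulCost N l ≤ mulCost N' l' := by
  have : 8 * N * (l + 1) ≤ 8 * N' * (l' + 1) :=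
    Nat.mul_le_mul (Nat.mul_le_mul_left _ hN) (by omega)
  exact Nat.mul_le_mul_left _ (Nat.mul_le_mul this (Nat.succ_le_succ (Nat.log_mono_right this)))

theorem mul_le_mulCost (N l : ℕ) : 16000 * (N * (l + 1)) ≤ mulCost N l := by
  rw [mulCost]
  calc 16000 * (N * (l + 1)) = 2000 * (8 * N * (l + 1) * 1) := by ring
    _ ≤ _ := Nat.mul_le_mul_left _ (Nat.mul_le_mul_left _ (by omega))

/-- Linear work on a table or on a list of variables is dominated by a single multiplication. -/
theorem add_le_mulCost {N : ℕ} (hN : 0 < N) (l : ℕ) : 8000 * N + 8000 * (l + 1) ≤ mulCost N l := by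
  refine le_trans ?_ (mul_le_mulCost N l)
  have h1 : N * 1 ≤ N * (l + 1) := Nat.mul_le_mul_left _ (by omega)
  have h2 : 1 * (l + 1) ≤ N * (l + 1) := Nat.mul_le_mul_right _ hN
  omega

/-- Multiplies the table of the vertex `var 30` by the tables in its slots. -/
def multiplySlots : Program :=
  .seq (.setVar 34 (.get 21 (.var 30) (.lit 0))) <|
  .seq (copyErase 0 30 34) <|
  .seq (.setVar 35 (.lit 0)) <|
  .loop (.lt (.var 35) (.add (.get 21 (.var 30) (.lit 0)) (.lit 1))) <|
    .seq (.ite (.eq (.get 30 (.var 30) (.var 35)) (.lit 0)) .skip <|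
      .seq (copyErase 1 30 35) <|
      .seq (.setVar 61 (.lit 0)) <|
      .seq (.setVar 62 (.get 30 (.var 30) (.var 35))) truncatedMul) <|
    .setVar 35 (.add (.var 35) (.lit 1))

/-- Only occupied slots cost a multiplication on the full box; an empty slot stands for the series 1
and is skipped in constant time. -/
theorem wp_multiplySlots {s : Memory} {m : ℕ → ℕ} {b : ℕ → ℕ → ℂ} {nv e : ℕ} {R : ℕ → List ℕ}
    {F : MvPowerSeries ℕ ℂ} {acc : ℕ → MvPowerSeries ℕ ℂ}
    (hs : HoldsNeighbors s nv m R b) (hR : ∀ e < nv, (R e).Nodup ∧ ∀ u ∈ R e, e < u ∧ u < nv)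
    (he : e < nv) (h30 : s.var 30 = e) (hF : IsTable m (e :: R e) (s.num 60 0) F)
    (hacc : ∀ u < (R e).length + 2, if s.idx 30 e u = 0 then acc u = 1 else
      IsTable m ((e :: R e).eraseIdx u) (s.num 60 (s.idx 30 e u)) (acc u)) :
    WP multiplySlots s fun t s' =>
      t ≤ 200 * ((R e).length + 2) + ((Finset.range ((R e).length + 2)).filter
        fun u => s.idx 30 e u ≠ 0).card * (2 * mulCost (boxSize m (e :: R e)) ((R e).length + 1)) ∧
      IsTable m (e :: R e) (s'.num 60 0) (F * ∏ u ∈ Finset.range ((R e).length + 2), acc u) ∧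
      (∀ r, r ≠ 0 → s'.num 60 r = s.num 60 r) ∧ Frame 34 s s' := by
  refine WP.mono (WP.frame (Q := fun t s' =>
      t ≤ 200 * ((R e).length + 2) + ((Finset.range ((R e).length + 2)).filter
        fun u => s.idx 30 e u ≠ 0).card * (2 * mulCost (boxSize m (e :: R e)) ((R e).length + 1)) ∧
      IsTable m (e :: R e) (s'.num 60 0) (F * ∏ u ∈ Finset.range ((R e).length + 2), acc u) ∧
      ∀ r, r ≠ 0 → s'.num 60 r = s.num 60 r)
      ?_ 34 (by decide)) (by rintro t s' ⟨⟨h1, h2, h3⟩, h4⟩; exact ⟨h1, h2, h3, h4⟩)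
  obtain ⟨hnd, hRe⟩ := hR e he
  have hnd' : (e :: R e).Nodup := List.nodup_cons.mpr ⟨fun h => (hRe e h).1.false, hnd⟩
  have hlt : ∀ v ∈ e :: R e, v < nv := by
    intro v hv
    rcases List.mem_cons.mp hv with rfl | hv
    exacts [he, (hRe v hv).2]
  set L := e :: R e with hL
  have hlen : L.length = (R e).length + 1 := by simp [hL]
  have hcost := add_le_mulCost (boxSize_pos m L) L.length
  have hlen' : (R e).length + 2 = L.length + 1 := by omega
  rw [hlen'] at hacc ⊢
  rw [← hlen]
  set c := mulCost (boxSize m L) L.length with hc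
  have h21 := hs.length e he
  rw [← hlen] at h21
  simp only [multiplySlots, wp_seq, wp_setVar]
  -- Leaving out the position after the last one copies the full list.
  refine WP.mono (wp_copyErase (f := e) (u := L.length) (L := L) (by norm_num) (by norm_num)
    (by simp [h30]) (by simp [h30, h21]) (by simpa using hs.list e he) (by simpa using h21)) ?_
  rintro t₁ s₁ ⟨ht₁, j1, j2, j3, j4, j5, j6⟩
  have j30 : s₁.var 30 = e := by rw [j5 30 (by norm_num) (by norm_num)]; simpa using h30
  rw [List.eraseIdx_of_length_le le_rfl] at j1 j2
  refine WP.mono (wp_loop 35 (L.length + 1) (fun i s' => s'.var 35 = i ∧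
      (StoresList (s'.idx 40 0) L ∧ s'.idx 41 0 0 = L.length) ∧
      IsTable m L (s'.num 60 0) (F * ∏ u ∈ Finset.range i, acc u) ∧
      ∀ r, r ≠ 0 → s'.num 60 r = s.num 60 r)
      (fun i => 40 * i + ((Finset.range i).filter fun u => s.idx 30 e u ≠ 0).card * (2 * c))
      (by decide) ?_ ?_ ?_) ?_
  · simp only [Memory.setVar_var, Memory.setVar_idx, Memory.setVar_num, IExp.eval, j4,
      Nat.reduceEqDiff, reduceIte, true_and, Finset.range_zero, Finset.prod_empty, mul_one,
      implies_true, and_true]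
    exact ⟨⟨j1, j2⟩, hF⟩
  · rintro i hi s' hf ⟨i1, i2, i3, i4⟩
    have g30 : s'.var 30 = e := by rw [hf.var 30 (by norm_num)]; simpa using j30
    have gidx : ∀ a < 35, s'.idx a = s.idx a := by
      intro a ha
      rw [hf.idx a ha]
      simp [j6 a (by omega) (by omega)]
    have g21 : s'.idx 21 e 0 = L.length := by rw [gidx 21 (by norm_num), h21]
    have hai := hacc i hi
    refine ⟨by simp [i1, g30, g21, hi], ?_⟩
    rw [wp_seq, wp_ite]
    by_cases hsl : s.idx 30 e i = 0
    · rw [if_pos (by simp [g30, i1, gidx, hsl])]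
      rw [if_pos hsl] at hai
      have hcard : ((Finset.range (i + 1)).filter fun u => s.idx 30 e u ≠ 0) =
          (Finset.range i).filter fun u => s.idx 30 e u ≠ 0 := by
        rw [Finset.range_add_one, Finset.filter_insert, if_neg (by simpa using hsl)]
      simp only [wp_skip, wp_setVar, Memory.setVar_var, Memory.setVar_idx, Memory.setVar_num,
        IExp.eval, IExp.cost, BExp.cost, i1, Nat.reduceEqDiff, reduceIte, true_and,
        Finset.prod_range_succ, hai, mul_one, hcard]
      exact ⟨by omega, i2, i3, i4⟩
    · rw [if_neg (by simp [g30, i1, gidx, hsl])]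
      rw [if_neg hsl] at hai
      have hcard : ((Finset.range (i + 1)).filter fun u => s.idx 30 e u ≠ 0).card =
          ((Finset.range i).filter fun u => s.idx 30 e u ≠ 0).card + 1 := by
        rw [Finset.range_add_one, Finset.filter_insert, if_pos hsl, Finset.card_insert_of_notMem]
        simp
      rw [wp_seq]
      refine WP.mono (wp_copyErase (f := e) (u := i) (L := L) (by norm_num) (by norm_num)
        g30 i1 (by rw [gidx 20 (by norm_num)]; exact hs.list e he) g21) ?_
      rintro t₂ s₂ ⟨ht₂, k1, k2, k3, k4, k5, k6⟩
      have k30 : s₂.var 30 = e := by rw [k5 30 (by norm_num) (by norm_num), g30]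
      have k35 : s₂.var 35 = i := by rw [k5 35 (by norm_num) (by norm_num), i1]
      have ksl : s₂.idx 30 e i = s.idx 30 e i := by rw [k6 30 (by norm_num) (by norm_num), gidx 30 (by norm_num)]
      simp only [wp_seq, wp_setVar, IExp.eval, Memory.setVar_var, Memory.setVar_idx,
        Nat.reduceEqDiff, reduceIte, k30, k35, ksl]
      refine WP.mono (wp_truncatedMul (m := m) (K := L) (J := L.eraseIdx i)
        (F := F * ∏ u ∈ Finset.range i, acc u) (G := acc i) hnd'
        (hnd'.eraseIdx _) (fun v hv => List.mem_of_mem_eraseIdx hv) ?_ ?_ ?_ ?_ ?_ ?_ ?_) ?_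
      · simp [(k3 0 (by norm_num)).2, i2.2]
      · simp [k2]
      · simpa [(k3 0 (by norm_num)).1] using i2.1
      · simpa using k1
      · intro v hv
        simp [k6 22, gidx 22, hs.mult v (hlt v hv)]
      · simpa [k4] using i3
      · simpa [k4, i4 _ hsl] using hai
      rintro t₃ s₃ ⟨⟨h, hh, ht₃⟩, l1, l2, l3⟩
      have hmc := le_mulCost (boxSize_pos m L) hh ht₃
      rw [← hc] at hmc
      have l35 : s₃.var 35 = i := by rw [l3.var 35 (by norm_num)]; simpa using k35
      have l40 : s₃.idx 40 0 = s'.idx 40 0 := by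
        rw [l3.idx 40 (by norm_num)]; simpa using (k3 0 (by norm_num)).1
      have l41 : s₃.idx 41 0 = s'.idx 41 0 := by
        rw [l3.idx 41 (by norm_num)]; simpa using (k3 0 (by norm_num)).2
      simp only [wp_setVar, IExp.eval, Memory.setVar_var, Memory.setVar_idx, Memory.setVar_num,
        Nat.reduceEqDiff, reduceIte, l35, l40, l41, IExp.cost, BExp.cost, true_and, hcard,
        Finset.prod_range_succ]
      refine ⟨?_, i2, by simpa [mul_assoc] using l1, fun r hr => ?_⟩
      · rw [add_mul, one_mul]
        omega
      · rw [l2 r (by simpa using hr)]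
        simp [k4, i4 r hr]
  · rintro s' hf ⟨i1, -⟩
    have g30 : s'.var 30 = e := by rw [hf.var 30 (by norm_num)]; simpa using j30
    have g21 : s'.idx 21 e 0 = L.length := by
      rw [hf.idx 21 (by norm_num)]
      simp [j6 21, h21]
    simp [i1, g30, g21]
  · rintro t₂ s₂ ⟨ht₂, ⟨k1, k2, k3, k4⟩, hf₂⟩
    simp only [BExp.cost, IExp.cost] at ht₂ ⊢
    exact ⟨by omega, k3, k4⟩

/-! ## The elimination of all vertices -/

/-- The first later neighbor of `e`. -/
noncomputable def parentOf (R : ℕ → List ℕ) (e : ℕ) : ℕ := sInf {v | v ∈ R e}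

/-- The first position in the list of the parent of `e` whose entry is not a neighbor of `e`. -/
noncomputable def missingOf (R : ℕ → List ℕ) (e : ℕ) : ℕ :=
  (parentOf R e :: R (parentOf R e)).findIdx fun v => decide (v ∉ R e)

/-- The later neighbors `R e` of the vertices `e < nv` make up a perfect elimination order. -/
structure IsEliminationOrder (nv : ℕ) (R : ℕ → List ℕ) : Prop where
  nodup : ∀ e < nv, (R e).Nodup
  lt : ∀ e < nv, ∀ u ∈ R e, e < u ∧ u < nv
  chordal : ∀ e < nv, ∀ u ∈ R e, ∀ v ∈ R e, u < v → v ∈ R u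

section

variable {nv : ℕ} {R : ℕ → List ℕ} {e : ℕ}

theorem parentOf_mem (h : R e ≠ []) : parentOf R e ∈ R e :=
  Nat.sInf_mem (s := {v | v ∈ R e}) (List.exists_mem_of_ne_nil _ h)

theorem parentOf_le {v : ℕ} (h : v ∈ R e) : parentOf R e ≤ v := Nat.sInf_le h

theorem IsEliminationOrder.mem_parent (hR : IsEliminationOrder nv R) (he : e < nv) (h : R e ≠ [])
    {v : ℕ} (hv : v ∈ R e) : v ∈ parentOf R e :: R (parentOf R e) := by
  rcases (parentOf_le hv).eq_or_lt with h' | h'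
  · rw [h']; simp
  · exact List.mem_cons_of_mem _ (hR.chordal e he _ (parentOf_mem h) v hv h')

theorem IsEliminationOrder.nodup_cons (hR : IsEliminationOrder nv R) (he : e < nv) :
    (e :: R e).Nodup :=
  List.nodup_cons.mpr ⟨fun h => (hR.lt e he e h).1.false, hR.nodup e he⟩

/-- Chordality puts `R e` inside the list of the parent, and the position left out is by choice not
occupied by a member of `R e`; so the message fits into the smaller box. -/
theorem IsEliminationOrder.mem_erase (hR : IsEliminationOrder nv R) (he : e < nv) (h : R e ≠ []) :
    ∀ v ∈ R e, v ∈ (parentOf R e :: R (parentOf R e)).eraseIdx (missingOf R e) := by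
  refine List.mem_eraseIdx_of_subset (fun v hv => hR.mem_parent he h hv) fun hlt hmem => ?_
  have := List.findIdx_getElem (xs := parentOf R e :: R (parentOf R e))
    (p := fun v => decide (v ∉ R e)) (w := hlt)
  rw [decide_eq_true_eq] at this
  exact this hmem

theorem missingOf_le : missingOf R e ≤ (R (parentOf R e)).length + 1 := by
  simpa [missingOf] using List.findIdx_le_length (xs := parentOf R e :: R (parentOf R e))
    (p := fun v => decide (v ∉ R e))

end

/-- Sets the variable `40` to the first later neighbor of the vertex `var 30`. -/
def findParent : Program :=
  .seq (.setVar 40 (.get 20 (.var 30) (.lit 1))) <|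
  .seq (.setVar 36 (.lit 2)) <|
  .loop (.lt (.var 36) (.get 21 (.var 30) (.lit 0))) <|
    .seq (.ite (.lt (.get 20 (.var 30) (.var 36)) (.var 40))
      (.setVar 40 (.get 20 (.var 30) (.var 36))) .skip)
      (.setVar 36 (.add (.var 36) (.lit 1)))

theorem wp_findParent {s : Memory} {e : ℕ} {R : ℕ → List ℕ} (h30 : s.var 30 = e) (hne : R e ≠ [])
    (hL : StoresList (s.idx 20 e) (e :: R e)) (hl : s.idx 21 e 0 = (R e).length + 1) :
    WP findParent s fun t s' => t ≤ 40 * ((R e).length + 1) ∧ s'.var 40 = parentOf R e ∧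
      s'.idx = s.idx ∧ s'.num = s.num ∧ ∀ x, x ≠ 36 → x ≠ 40 → s'.var x = s.var x := by
  have hL' : ∀ i (h : i < (R e).length), s.idx 20 e (i + 1) = (R e)[i] := by
    intro i h
    rw [hL (i + 1) (by simpa using h)]
    rfl
  have hpos := List.length_pos_iff.mpr hne
  simp only [findParent, wp_seq, wp_setVar]
  -- The first neighbor is the initial candidate for the minimum, and the others are compared with
  -- it.
  refine WP.mono (wp_loop 36 ((R e).length - 1) (fun i s' => s'.var 36 = i + 2 ∧
      s'.var 40 ∈ R e ∧ (∀ j (h : j < (R e).length), j < i + 1 → s'.var 40 ≤ (R e)[j]) ∧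
      s'.idx = s.idx ∧ s'.num = s.num ∧ ∀ x, x ≠ 36 → x ≠ 40 → s'.var x = s.var x)
      (fun i => i * 20) (by decide) ?_ ?_ ?_) ?_
  · have := hL' 0 hpos
    simp +contextual only [Memory.setVar_var, Memory.setVar_idx, Memory.setVar_num, IExp.eval, h30,
      Nat.reduceEqDiff, reduceIte, true_and, this, zero_add, Nat.lt_one_iff, le_refl, implies_true,
      and_true, List.getElem_mem]
  · rintro i hi s' hf ⟨i1, i2, i3, i4, i5, i6⟩
    have g30 : s'.var 30 = e := by rw [i6 30 (by norm_num) (by norm_num), h30]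
    have hi' : i + 1 < (R e).length := by omega
    have gi := hL' (i + 1) hi'
    refine ⟨by simp [i1, i4, g30, hl]; omega, ?_⟩
    rw [← i4] at gi
    by_cases hc : (R e)[i + 1] < s'.var 40
    · simp only [BExp.eval, IExp.eval, i1, g30, gi, hc, decide_true, wp_seq, wp_setVar, wp_ite,
        Memory.setVar_var, Memory.setVar_idx, Memory.setVar_num, IExp.cost, BExp.cost,
        Nat.reduceEqDiff, reduceIte, true_and]
      refine ⟨by omega, by simp, fun j hj hj' => ?_, i4, i5, fun x hx hx' => ?_⟩
      · rcases Nat.lt_succ_iff_lt_or_eq.mp hj' with h | h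
        · exact hc.le.trans (i3 j hj h)
        · simp [h]
      · simp [hx, hx', i6 x hx hx']
    · simp only [BExp.eval, IExp.eval, i1, g30, gi, hc, decide_false, wp_seq, wp_setVar, wp_ite,
        Memory.setVar_var, Memory.setVar_idx, Memory.setVar_num, IExp.cost, BExp.cost,
        Nat.reduceEqDiff, reduceIte, true_and, wp_skip, Bool.false_eq_true]
      refine ⟨by omega, i2, fun j hj hj' => ?_, i4, i5, fun x hx hx' => ?_⟩
      · rcases Nat.lt_succ_iff_lt_or_eq.mp hj' with h | h
        · exact i3 j hj h
        · simpa [h] using hc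
      · simp [hx, i6 x hx hx']
  · rintro s' hf ⟨i1, i2, i3, i4, i5, i6⟩
    have g30 : s'.var 30 = e := by rw [i6 30 (by norm_num) (by norm_num), h30]
    simp [i1, i4, g30, hl]
    omega
  · rintro t s' ⟨ht, ⟨i1, i2, i3, i4, i5, i6⟩, hf⟩
    simp only [BExp.cost, IExp.cost] at ht ⊢
    refine ⟨by omega, le_antisymm ?_ (parentOf_le i2), i4, i5, i6⟩
    obtain ⟨j, hj, h⟩ := List.getElem_of_mem (parentOf_mem hne)
    rw [← h]
    exact i3 j hj (by omega)

/-- Marks the later neighbors of the vertex `var 30`. -/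
def markNeighbors : Program :=
  .seq (.setVar 36 (.lit 1)) <|
  .loop (.lt (.var 36) (.get 21 (.var 30) (.lit 0))) <|
    .seq (.setIdx 28 (.get 20 (.var 30) (.var 36)) (.lit 0) (.add (.var 30) (.lit 1)))
      (.setVar 36 (.add (.var 36) (.lit 1)))

/-- The mark `e + 1` exceeds all marks made earlier, so the array never has to be cleared. -/
theorem wp_markNeighbors {s : Memory} {e : ℕ} {R : ℕ → List ℕ} (h30 : s.var 30 = e)
    (hL : StoresList (s.idx 20 e) (e :: R e)) (hl : s.idx 21 e 0 = (R e).length + 1)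
    (hm : ∀ v, s.idx 28 v 0 ≤ e) :
    WP markNeighbors s fun t s' => t ≤ 40 * ((R e).length + 1) ∧
      (∀ v, s'.idx 28 v 0 ≤ e + 1) ∧ (∀ v, s'.idx 28 v 0 = e + 1 ↔ v ∈ R e) ∧
      (∀ a, a ≠ 28 → s'.idx a = s.idx a) ∧ s'.num = s.num ∧ ∀ x, x ≠ 36 → s'.var x = s.var x := by
  have hL' : ∀ i (h : i < (R e).length), s.idx 20 e (i + 1) = (R e)[i] := by
    intro i h
    rw [hL (i + 1) (by simpa using h)]
    rfl
  simp only [markNeighbors, wp_seq, wp_setVar]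
  refine WP.mono (wp_loop 28 (R e).length (fun i s' => s'.var 36 = i + 1 ∧
      (∀ v, s'.idx 28 v 0 ≤ e + 1) ∧ (∀ v, s'.idx 28 v 0 = e + 1 ↔ v ∈ (R e).take i) ∧
      (∀ a, a ≠ 28 → s'.idx a = s.idx a) ∧ s'.num = s.num ∧ ∀ x, x ≠ 36 → s'.var x = s.var x)
      (fun i => i * 20) (by decide) ?_ ?_ ?_) ?_
  · simp +contextual only [Memory.setVar_var, Memory.setVar_idx, Memory.setVar_num, IExp.eval,
      Nat.reduceEqDiff, reduceIte, true_and, zero_add, List.take_zero, List.not_mem_nil, iff_false,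
      implies_true, and_true]
    exact ⟨fun v => (hm v).trans (Nat.le_succ _), fun v => by have := hm v; omega⟩
  · rintro i hi s' hf ⟨i1, i2, i3, i4, i5, i6⟩
    have g30 : s'.var 30 = e := by rw [i6 30 (by norm_num), h30]
    have gi := hL' i hi
    have gl : s'.idx 21 e 0 = (R e).length + 1 := by rw [i4 21 (by norm_num), hl]
    rw [← i4 20 (by norm_num)] at gi
    refine ⟨by simp [i1, g30, gl, hi], ?_⟩
    simp only [BExp.eval, IExp.eval, i1, g30, gi, wp_seq, wp_setVar, wp_setIdx,
      Memory.setVar_var, Memory.setVar_idx, Memory.setVar_num, Memory.setIdx_var, Memory.setIdx_num,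
      Memory.setIdx_idx, IExp.cost, BExp.cost, Nat.reduceEqDiff, reduceIte, true_and]
    refine ⟨by omega, fun v => ?_, fun v => ?_, fun a ha => ?_, i5, fun x hx => ?_⟩
    · simp only [and_true]
      split_ifs
      exacts [le_rfl, i2 v]
    · rw [List.take_succ_eq_append_getElem hi]
      simp only [List.mem_append, List.mem_singleton, and_true, ← i3 v]
      split_ifs with h <;> simp [h]
    · funext r j
      simp [ha, i4 a ha]
    · simp [hx, i6 x hx]
  · rintro s' hf ⟨i1, i2, i3, i4, i5, i6⟩
    have g30 : s'.var 30 = e := by rw [i6 30 (by norm_num), h30]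
    have gl : s'.idx 21 e 0 = (R e).length + 1 := by rw [i4 21 (by norm_num), hl]
    simp [i1, g30, gl]
  · rintro t s' ⟨ht, ⟨i1, i2, i3, i4, i5, i6⟩, hf⟩
    rw [List.take_length] at i3
    simp only [BExp.cost, IExp.cost] at ht ⊢
    exact ⟨by omega, i2, i3, i4, i5, i6⟩

/-- Sets the variable `41` to the first position in the list of the vertex `var 40` whose entry has
not been marked. -/
def findMissing : Program :=
  .seq (.setVar 41 (.lit 0)) <|
  .loop (.and (.lt (.var 41) (.get 21 (.var 40) (.lit 0)))
      (.eq (.get 28 (.get 20 (.var 40) (.var 41)) (.lit 0)) (.add (.var 30) (.lit 1)))) <|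
    .setVar 41 (.add (.var 41) (.lit 1))

theorem wp_findMissing {s : Memory} {e f : ℕ} {L J : List ℕ} (h30 : s.var 30 = e)
    (h40 : s.var 40 = f) (hL : StoresList (s.idx 20 f) L) (hl : s.idx 21 f 0 = L.length)
    (hJ : ∀ v, s.idx 28 v 0 = e + 1 ↔ v ∈ J) :
    WP findMissing s fun t s' => t ≤ 40 * (L.length + 1) ∧
      s'.var 41 = L.findIdx (fun v => decide (v ∉ J)) ∧
      s'.idx = s.idx ∧ s'.num = s.num ∧ ∀ x, x ≠ 41 → s'.var x = s.var x := by
  have hle := List.findIdx_le_length (xs := L) (p := fun v => decide (v ∉ J))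
  set n := L.findIdx (fun v => decide (v ∉ J)) with hn
  simp only [findMissing, wp_seq, wp_setVar]
  refine WP.mono (wp_loop 41 n (fun i s' => s'.var 41 = i ∧ s'.idx = s.idx ∧ s'.num = s.num ∧
      ∀ x, x ≠ 41 → s'.var x = s.var x)
      (fun i => i * 20) (by decide) ?_ ?_ ?_) ?_
  · simp +contextual
  · rintro i hi s' hf ⟨i1, i2, i3, i4⟩
    have g30 : s'.var 30 = e := by rw [i4 30 (by norm_num), h30]
    have g40 : s'.var 40 = f := by rw [i4 40 (by norm_num), h40]
    have hi' : i < L.length := by omega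
    have hmem : L[i] ∈ J := by
      have := List.not_of_lt_findIdx (p := fun v => decide (v ∉ J)) (xs := L) (by rwa [← hn])
      simpa using this
    have := (hJ _).mpr hmem
    refine ⟨by simp [i1, i2, g30, g40, hl, hL i hi', hi', this], ?_⟩
    simp +contextual [i1, i2, i3, i4]
    omega
  · rintro s' hf ⟨i1, i2, i3, i4⟩
    have g30 : s'.var 30 = e := by rw [i4 30 (by norm_num), h30]
    have g40 : s'.var 40 = f := by rw [i4 40 (by norm_num), h40]
    rcases hle.lt_or_eq with h | h
    · have hmem := List.findIdx_getElem (xs := L) (p := fun v => decide (v ∉ J)) (w := h)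
      rw [decide_eq_true_eq] at hmem
      have := mt (hJ L[n]).mp hmem
      simp [i1, i2, g30, g40, hL n h, this]
    · simp [i1, i2, g40, hl, h]
  · rintro t s' ⟨ht, i, hf⟩
    simp only [BExp.cost, IExp.cost] at ht ⊢
    exact ⟨by omega, i⟩

/-- The state before the elimination of the vertex `e`: the slot `u` of the vertex `f` is the row
`idx 30 f u` of the number array `60`, if this is not zero, and it holds the table of `acc f u`. -/
structure EliminationState (s : Memory) (nv : ℕ) (m : ℕ → ℕ) (R : ℕ → List ℕ) (e : ℕ)
    (acc : ℕ → ℕ → MvPowerSeries ℕ ℂ) : Prop where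
  two_le : 2 ≤ s.var 27
  zero_row : ∀ r, s.var 27 ≤ r → ∀ j, s.num 60 r j = 0
  slot : ∀ f u, s.idx 30 f u = 0 ∨ 2 ≤ s.idx 30 f u ∧ s.idx 30 f u < s.var 27
  slot_inj : ∀ f u f' u', s.idx 30 f u ≠ 0 → s.idx 30 f u = s.idx 30 f' u' → f = f' ∧ u = u'
  slot_child : ∀ f u, s.idx 30 f u ≠ 0 → ∃ e' < e, parentOf R e' = f ∧ missingOf R e' = u
  mark : ∀ v, s.idx 28 v 0 ≤ e
  table : ∀ f, e ≤ f → f < nv → ∀ u < (R f).length + 2, if s.idx 30 f u = 0 then acc f u = 1 else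
    IsTable m ((f :: R f).eraseIdx u) (s.num 60 (s.idx 30 f u)) (acc f u)

/-- Rows `0` and `1` of the number array `60` are work space for the local table and the message;
the slots occupy rows from `2` on and are insensitive to changes there. -/
theorem EliminationState.congr {s s' : Memory} {nv : ℕ} {m : ℕ → ℕ} {R : ℕ → List ℕ} {e e' : ℕ}
    {acc : ℕ → ℕ → MvPowerSeries ℕ ℂ} (h : EliminationState s nv m R e acc) (he : e ≤ e')
    (h27 : s'.var 27 = s.var 27) (h30 : s'.idx 30 = s.idx 30) (h28 : ∀ v, s'.idx 28 v 0 ≤ e')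
    (h60 : ∀ r, 2 ≤ r → s'.num 60 r = s.num 60 r) : EliminationState s' nv m R e' acc := by
  have h2 := h.two_le
  constructor
  · rw [h27]; exact h2
  · intro r hr j
    rw [h27] at hr
    rw [h60 r (h2.trans hr)]
    exact h.zero_row r hr j
  · rw [h27, h30]; exact h.slot
  · rw [h30]; exact h.slot_inj
  · rw [h30]
    intro f u hs
    obtain ⟨a, h1, h2⟩ := h.slot_child f u hs
    exact ⟨a, by omega, h2⟩
  · exact h28
  · rw [h30]
    intro f hf hf' u hu
    have := h.table f (he.trans hf) hf' u hu
    split_ifs at this ⊢ with hs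
    · exact this
    · rw [h60 _ ((h.slot f u).resolve_left hs).1]
      exact this

/-- Allocates the slot `var 41` of the vertex `var 40` if need be. -/
def allocateSlot : Program :=
  .ite (.eq (.get 30 (.var 40) (.var 41)) (.lit 0))
    (.seq (.setIdx 30 (.var 40) (.var 41) (.var 27)) <|
      .seq (.setNum 60 (.var 27) (.lit 0) (.cast (.lit 1))) <|
      .setVar 27 (.add (.var 27) (.lit 1))) .skip

theorem IsTable.one {m : ℕ → ℕ} {D : List ℕ} {A : ℕ → ℂ} (h0 : A 0 = 1) (h : ∀ j, j ≠ 0 → A j = 0) :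
    IsTable m D A 1 := by
  have hz : mixedRadix m D (0 : ℕ →₀ ℕ) = 0 := by
    induction D with
    | nil => rfl
    | cons v D ih => simp only [mixedRadix, ih]; simp
  constructor
  · intro ν h1 h2
    rw [coeff_one]
    split_ifs with hν
    · rw [hν, hz, h0]
    · refine h _ fun hν0 => hν ?_
      ext v
      by_cases hv : v ∈ D
      · exact mixedRadix_injOn h1 (ν := (0 : ℕ →₀ ℕ)) (by simp) (by rw [hν0, hz]) v hv
      · rw [h2 v hv]; rfl
  · intro ν v _ hν
    exact FreeOf.one v ν hν

/-- A new slot is the next unused row. This row is still zero, so writing a single 1 makes it the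
table of the series 1. Setting up a slot thus takes constant time, whatever the size of its box. -/
theorem wp_allocateSlot {s : Memory} {nv : ℕ} {m : ℕ → ℕ} {R : ℕ → List ℕ} {e a f u : ℕ}
    {acc : ℕ → ℕ → MvPowerSeries ℕ ℂ} (h : EliminationState s nv m R e acc) (h40 : s.var 40 = f)
    (h41 : s.var 41 = u) (ha : a < e) (hf : parentOf R a = f) (hu : missingOf R a = u) :
    WP allocateSlot s fun t s' => t ≤ 30 ∧ EliminationState s' nv m R e acc ∧ s'.idx 30 f u ≠ 0 ∧
      (∀ a, a ≠ 30 → s'.idx a = s.idx a) ∧ (∀ a, a ≠ 60 → s'.num a = s.num a) ∧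
      s'.num 60 1 = s.num 60 1 ∧ ∀ x, x ≠ 27 → s'.var x = s.var x := by
  have h2 := h.two_le
  by_cases hc : s.idx 30 f u = 0
  · simp only [allocateSlot, BExp.eval, IExp.eval, NExp.eval, h40, h41, hc, decide_true, wp_seq,
      wp_setVar, wp_ite, wp_setIdx, wp_setNum, Memory.setVar_var, Memory.setVar_idx,
      Memory.setVar_num, Memory.setIdx_var, Memory.setIdx_num, Memory.setIdx_idx, Memory.setNum_var,
      Memory.setNum_num, Memory.setNum_idx, IExp.cost, BExp.cost, NExp.cost, Nat.reduceEqDiff,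
      reduceIte, true_and]
    refine ⟨by omega, ?_, by simp; omega, fun a ha => ?_, fun a ha => ?_, ?_, ?_⟩
    · have hs := h.slot
      constructor
      · simp; omega
      · intro r hr j
        simp only [Memory.setVar_var, reduceIte] at hr
        have hr' : r ≠ s.var 27 := by omega
        simp [hr', h.zero_row r (by omega)]
      · intro f' u'
        have := hs f' u'
        simp
        split_ifs <;> omega
      · intro f₁ u₁ f₂ u₂
        have := hs f₁ u₁
        have := hs f₂ u₂
        have := h.slot_inj f₁ u₁ f₂ u₂
        simp
        split_ifs with c1 c2 c2
        · intros; omega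
        · intros; omega
        · intros; omega
        · exact this
      · intro f' u'
        simp
        split_ifs with c
        · intro _
          exact ⟨a, ha, hf.trans c.1.symm, hu.trans c.2.symm⟩
        · exact h.slot_child f' u'
      · simpa using h.mark
      · intro f' hf1 hf2 u' hu'
        have := h.table f' hf1 hf2 u' hu'
        simp only [Memory.setVar_idx, Memory.setNum_idx, Memory.setIdx_idx, true_and,
          Memory.setVar_num]
        by_cases c : f' = f ∧ u' = u
        · obtain ⟨rfl, rfl⟩ := c
          rw [if_pos hc] at this
          have h0 : s.var 27 ≠ 0 := by omega
          simp only [and_self, if_true, h0, if_false, this]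
          refine IsTable.one (by simp) fun j hj => ?_
          simp [hj, h.zero_row]
        · rw [if_neg c]
          split_ifs at this ⊢ with c'
          · exact this
          · have hne : s.idx 30 f' u' ≠ s.var 27 := by
              have := hs f' u'
              omega
            convert this using 1
            funext j
            simp [hne]
    · funext i j; simp [ha]
    · funext i j; simp [ha]
    · funext j
      have : 1 ≠ s.var 27 := by omega
      simp [this]
    · intro x hx; simp [hx]
  · simp only [allocateSlot, BExp.eval, IExp.eval, h40, h41, hc, decide_false, wp_ite,
      IExp.cost, BExp.cost, reduceIte, true_and, Bool.false_eq_true, wp_skip]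
    exact ⟨by omega, h, hc, by simp⟩

/-- Multiplies the message in row `1` of the number array `60` into a slot of the parent of the
vertex `var 30`. -/
def sendMessage : Program :=
  .seq findParent <|
  .seq markNeighbors <|
  .seq findMissing <|
  .seq allocateSlot <|
  .seq (copyErase 0 40 41) <|
  .seq (.setVar 43 (.lit 0)) <|
  .seq (copyErase 1 30 43) <|
  .seq (.setVar 61 (.get 30 (.var 40) (.var 41))) <|
  .seq (.setVar 62 (.lit 1)) truncatedMul

/-- The multiplication into the slot takes place on the list of the parent with one entry left out.
Its cost has no factor from the multiplicity of the omitted vertex, and it is charged to the sender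
`e`; many children of one parent therefore do not cause many products on the parent's full box. -/
theorem wp_sendMessage {s : Memory} {nv : ℕ} {m : ℕ → ℕ} {R : ℕ → List ℕ} {b : ℕ → ℕ → ℂ}
    {e W : ℕ} {acc : ℕ → ℕ → MvPowerSeries ℕ ℂ} {F : MvPowerSeries ℕ ℂ}
    (h : EliminationState s nv m R e acc) (hs : HoldsNeighbors s nv m R b)
    (hR : IsEliminationOrder nv R) (he : e < nv) (h30 : s.var 30 = e) (hne : R e ≠ [])
    (hF : IsTable m (R e) (s.num 60 1) F) (hW : ∀ e < nv, (R e).length ≤ W) :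
    WP sendMessage s fun t s' => t ≤ 300 * (W + 2) +
        mulCost (boxSize m ((parentOf R e :: R (parentOf R e)).eraseIdx (missingOf R e)))
          ((parentOf R e :: R (parentOf R e)).eraseIdx (missingOf R e)).length ∧
      EliminationState s' nv m R (e + 1)
        (accumulate acc (parentOf R e) (missingOf R e) F) ∧
      s'.var 30 = e ∧ s'.num 30 = s.num 30 ∧ Frame 27 s s' := by
  refine WP.mono (WP.frame (Q := fun t s' => t ≤ 300 * (W + 2) +
        mulCost (boxSize m ((parentOf R e :: R (parentOf R e)).eraseIdx (missingOf R e)))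
          ((parentOf R e :: R (parentOf R e)).eraseIdx (missingOf R e)).length ∧
      EliminationState s' nv m R (e + 1)
        (accumulate acc (parentOf R e) (missingOf R e) F) ∧
      s'.var 30 = e ∧ s'.num 30 = s.num 30) ?_ 27 (by decide))
    (by rintro t s' ⟨⟨h1, h2, h3, h4⟩, h5⟩; exact ⟨h1, h2, h3, h4, h5⟩)
  obtain ⟨hef, hfv⟩ := hR.lt e he _ (parentOf_mem hne)
  have hsub := hR.mem_erase he hne
  have hule : missingOf R e ≤ (R (parentOf R e)).length + 1 := missingOf_le
  have hmis : missingOf R e = (parentOf R e :: R (parentOf R e)).findIdx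
    (fun v => decide (v ∉ R e)) := rfl
  set f := parentOf R e with hf
  set u := missingOf R e with hu
  have hndK : ((f :: R f).eraseIdx u).Nodup := (hR.nodup_cons hfv).eraseIdx _
  have hWe := hW e he
  have hWf := hW f hfv
  simp only [sendMessage, wp_seq]
  refine WP.mono (wp_findParent h30 hne (hs.list e he) (hs.length e he)) ?_
  rintro t₁ s₁ ⟨ht₁, a1, a2, a3, a4⟩
  refine WP.mono (wp_markNeighbors (e := e) (R := R) (by rw [a4 _ (by norm_num) (by norm_num), h30])
    (by rw [a2]; exact hs.list e he) (by rw [a2]; exact hs.length e he)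
    (by rw [a2]; exact h.mark)) ?_
  rintro t₂ s₂ ⟨ht₂, b1, b2, b3, b4, b5⟩
  have hs₂ : EliminationState s₂ nv m R (e + 1) acc := by
    refine h.congr (by omega) ?_ ?_ b1 ?_
    · rw [b5 _ (by norm_num), a4 _ (by norm_num) (by norm_num)]
    · rw [b3 _ (by norm_num), a2]
    · intro r _; rw [b4, a3]
  refine WP.mono (wp_findMissing (e := e) (f := f) (L := f :: R f) (J := R e)
    (by rw [b5 _ (by norm_num), a4 _ (by norm_num) (by norm_num), h30])
    (by rw [b5 _ (by norm_num), a1]) (by rw [b3 _ (by norm_num), a2]; exact hs.list f hfv)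
    (by rw [b3 _ (by norm_num), a2]; exact hs.length f hfv) b2) ?_
  rintro t₃ s₃ ⟨ht₃, c1, c2, c3, c4⟩
  rw [← hmis] at c1
  have hs₃ : EliminationState s₃ nv m R (e + 1) acc := by
    refine hs₂.congr le_rfl ?_ ?_ ?_ ?_
    · rw [c4 _ (by norm_num)]
    · rw [c2]
    · rw [c2]; exact b1
    · intro r _; rw [c3]
  have c40 : s₃.var 40 = f := by rw [c4 _ (by norm_num), b5 _ (by norm_num), a1]
  refine WP.mono (wp_allocateSlot hs₃ c40 c1 (Nat.lt_succ_self e) rfl rfl) ?_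
  rintro t₄ s₄ ⟨ht₄, d1, d2, d3, d4, d5, d6⟩
  have d40 : s₄.var 40 = f := by rw [d6 _ (by norm_num), c40]
  have d41 : s₄.var 41 = u := by rw [d6 _ (by norm_num), c1]
  have d30 : s₄.var 30 = e := by
    rw [d6 _ (by norm_num), c4 _ (by norm_num), b5 _ (by norm_num),
      a4 _ (by norm_num) (by norm_num), h30]
  have didx : ∀ a < 28, s₄.idx a = s.idx a := by
    intro a ha
    rw [d3 a (by omega), c2, b3 a (by omega), a2]
  refine WP.mono (wp_copyErase (f := f) (u := u) (L := f :: R f) (by norm_num) (by norm_num)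
    d40 d41 (by rw [didx _ (by norm_num)]; exact hs.list f hfv)
    (by rw [didx _ (by norm_num)]; exact hs.length f hfv)) ?_
  rintro t₅ s₅ ⟨ht₅, e1, e2, e3, e4, e5, e6⟩
  simp only [wp_setVar, IExp.eval]
  -- Leaving out position 0, which holds `e` itself, gives the list `R e` of the message.
  refine WP.mono (wp_copyErase (f := e) (u := 0) (L := e :: R e) (by norm_num) (by norm_num)
    (by simp [e5, d30]) (by simp) (by simpa [e6, didx] using hs.list e he)
    (by simpa [e6, didx] using hs.length e he)) ?_
  rintro t₆ s₆ ⟨ht₆, f1, f2, f3, f4, f5, f6⟩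
  rw [List.eraseIdx_cons_zero] at f1 f2
  have f40 : s₆.var 40 = f := by simp [f5, e5, d40]
  have f41 : s₆.var 41 = u := by simp [f5, e5, d41]
  have f30 : s₆.var 30 = e := by simp [f5, e5, d30]
  have f27 : s₆.var 27 = s₄.var 27 := by simp [f5, e5]
  have fidx : ∀ a, a ≠ 40 → a ≠ 41 → s₆.idx a = s₄.idx a := by
    intro a ha ha'
    simp [f6 a ha ha', e6 a ha ha']
  have fnum : s₆.num = s₄.num := by simp [f4, e4]
  set r := s₄.idx 30 f u with hr
  have hr2 := ((d1.slot f u).resolve_left d2).1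
  have htab := d1.table f (by omega) hfv u (by omega)
  rw [if_neg d2] at htab
  simp only [f40, f41, fidx 30 (by norm_num) (by norm_num), Memory.setVar_var,
    Memory.setVar_idx, Nat.reduceEqDiff, reduceIte, ← hr]
  refine WP.mono (wp_truncatedMul (m := m) (K := (f :: R f).eraseIdx u) (J := R e)
    (F := acc f u) (G := F) hndK (hR.nodup e he) hsub ?_ ?_ ?_ ?_ ?_ ?_ ?_) ?_
  · simp [f3 0, e2]
  · simp [f2]
  · simpa [f3 0] using e1
  · simpa using f1
  · intro v hv
    have hv' : v < nv := by
      rcases List.mem_cons.mp (List.mem_of_mem_eraseIdx hv) with rfl | hv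
      exacts [hfv, (hR.lt f hfv v hv).2]
    simp [fidx, didx, hs.mult v hv']
  · simpa [fnum] using htab
  · simp only [Memory.setVar_var, Memory.setVar_num, reduceIte, fnum, d5, c3, b4, a3]
    exact hF
  rintro t₇ s₇ ⟨⟨k, hk, ht₇⟩, g1, g2, g3⟩
  have hmc := le_mulCost (boxSize_pos m _) hk ht₇
  simp only [Memory.setVar_var, Memory.setVar_num, Nat.reduceEqDiff, reduceIte, fnum] at g1 g2
  have gidx : ∀ a < 40, s₇.idx a = s₄.idx a := by
    intro a ha
    rw [g3.idx a (by omega)]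
    simp [fidx a (by omega) (by omega)]
  have g27 : s₇.var 27 = s₄.var 27 := by
    rw [g3.var 27 (by norm_num)]
    simp [f27]
  refine ⟨?_, ?_, ?_, ?_⟩
  · simp only [IExp.cost]
    simp only [List.length_cons] at ht₁ ht₂ ht₃ ht₄ ht₅ ht₆
    generalize mulCost _ _ = x at hmc ⊢
    omega
  · constructor
    · rw [g27]; exact d1.two_le
    · intro r' hr' j
      rw [g27] at hr'
      rw [g2 r']
      · exact d1.zero_row r' hr' j
      · have := (d1.slot f u).resolve_left d2
        omega
    · rw [gidx 30 (by norm_num), g27]; exact d1.slot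
    · rw [gidx 30 (by norm_num)]; exact d1.slot_inj
    · rw [gidx 30 (by norm_num)]; exact d1.slot_child
    · rw [gidx 28 (by norm_num)]; exact d1.mark
    · rw [gidx 30 (by norm_num)]
      intro f' hf1 hf2 u' hu'
      have := d1.table f' hf1 hf2 u' hu'
      by_cases c : f' = f ∧ u' = u
      · obtain ⟨rfl, rfl⟩ := c
        rw [if_neg d2, accumulate, if_pos ⟨rfl, rfl⟩]
        exact g1
      · rw [accumulate, if_neg c, mul_one]
        split_ifs at this ⊢ with c'
        · exact this
        · rw [g2]
          · exact this
          · intro hrr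
            exact c (d1.slot_inj _ _ _ _ c' hrr)
  · rw [g3.var 30 (by norm_num)]; simp [f30]
  · rw [g3.num 30 (by norm_num)]
    simp only [Memory.setVar_num, fnum, d4 30 (by norm_num), c3, b4, a3]

/-! ### Counting multiplications and eliminating one vertex -/

theorem boxSize_le_pow {m : ℕ → ℕ} {D : List ℕ} {c W : ℕ} (h : ∀ v ∈ D, m v ≤ c)
    (hW : D.length ≤ W) : boxSize m D ≤ (c + 1) ^ W := by
  refine le_trans ?_ (Nat.pow_le_pow_right (Nat.succ_pos c) hW)
  clear hW
  induction D with
  | nil => simp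
  | cons v D ih =>
    rw [boxSize_cons, List.length_cons, pow_succ, mul_comm]
    exact Nat.mul_le_mul (ih fun u hu => h u (by simp [hu])) (Nat.succ_le_succ (h v (by simp)))

/-- If an entry of the parent's list is missing from `R e`, its removal leaves at most `W` entries.
Otherwise the whole list of the parent lies in `R e`, whose length is at most `W` anyway. -/
theorem IsEliminationOrder.length_erase_le {nv : ℕ} {R : ℕ → List ℕ} {e W : ℕ}
    (hR : IsEliminationOrder nv R) (he : e < nv) (h : R e ≠ [])
    (hW : ∀ e < nv, (R e).length ≤ W) :
    ((parentOf R e :: R (parentOf R e)).eraseIdx (missingOf R e)).length ≤ W := by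
  have hfv := (hR.lt e he _ (parentOf_mem h)).2
  by_cases hlt : missingOf R e < (parentOf R e :: R (parentOf R e)).length
  · rw [List.length_eraseIdx_of_lt hlt]
    simpa using hW _ hfv
  · rw [List.eraseIdx_of_length_le (not_lt.mp hlt)]
    refine le_trans (length_le_of_subset (hR.nodup_cons hfv) fun v hv => ?_) (hW e he)
    have := List.findIdx_eq_length.mp (le_antisymm List.findIdx_le_length (not_lt.mp hlt)) v hv
    simpa using this

/-- The number of vertices that send a message to `f`. -/
noncomputable def childCount (nv : ℕ) (R : ℕ → List ℕ) (f : ℕ) : ℕ :=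
  ((Finset.range nv).filter fun e => parentOf R e = f).card

/-- Every vertex has one value of `parentOf`. Vertices without later neighbors get the default 0 and
are counted as children of the vertex 0, which can only increase the count. -/
theorem sum_childCount_le (nv : ℕ) (R : ℕ → List ℕ) :
    ∑ f ∈ Finset.range nv, childCount nv R f ≤ nv := by
  simp only [childCount]
  rw [← Finset.card_biUnion]
  · exact (Finset.card_le_card (Finset.biUnion_subset.mpr fun f _ => Finset.filter_subset _ _)).trans
      (Finset.card_range nv).le
  · intro f _ g _ hfg
    rw [Function.onFun, Finset.disjoint_filter]
    intro e _ h1 h2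
    exact hfg (h1.symm.trans h2)

/-- A bound for the time of the elimination of the vertex `e`. -/
noncomputable def vertexCost (nv : ℕ) (m : ℕ → ℕ) (R : ℕ → List ℕ) (c W e : ℕ) : ℕ :=
  2 * (min (childCount nv R e) (W + 2) + 1) * mulCost ((m e + 1) * (c + 1) ^ W) (W + 1)

/-- An occupied slot was opened by a child, and different slots of one vertex by different children;
moreover, there are only `(R e).length + 2` slots. Both bounds are needed for the final estimate. -/
theorem EliminationState.card_le {s : Memory} {nv : ℕ} {m : ℕ → ℕ} {R : ℕ → List ℕ} {e W : ℕ}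
    {acc : ℕ → ℕ → MvPowerSeries ℕ ℂ} (h : EliminationState s nv m R e acc) (he : e < nv)
    (hW : (R e).length ≤ W) :
    ((Finset.range ((R e).length + 2)).filter fun u => s.idx 30 e u ≠ 0).card ≤
      min (childCount nv R e) (W + 2) := by
  refine le_min ?_ ?_
  · refine (Finset.card_le_card fun u hu => ?_).trans (Finset.card_image_le (f := missingOf R))
    obtain ⟨a, h1, h2, h3⟩ := h.slot_child e u (Finset.mem_filter.mp hu).2
    rw [Finset.mem_image]
    exact ⟨a, Finset.mem_filter.mpr ⟨Finset.mem_range.mpr (by omega), h2⟩, h3⟩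
  · refine (Finset.card_filter_le _ _).trans ?_
    rw [Finset.card_range]
    omega

/-- Eliminates the vertex `var 30`. -/
def eliminateVertex : Program :=
  .seq localTable <|
  .seq multiplySlots <|
  .seq messageTable <|
  .seq (.ite (.eq (.get 21 (.var 30) (.lit 0)) (.lit 1))
    (.setNum 30 (.lit 0) (.lit 0) (.mul (.get 60 (.lit 1) (.lit 0)) (.get 30 (.lit 0) (.lit 0))))
    sendMessage) <|
  .setVar 30 (.add (.var 30) (.lit 1))

/-- The message of a vertex without later neighbors is a scalar, which goes into the running product
instead of a slot. -/
theorem IsTable.eq_C {m : ℕ → ℕ} {D : List ℕ} {A : ℕ → ℂ} {F : MvPowerSeries ℕ ℂ}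
    (h : IsTable m D A F) (hD : D = []) : F = C (A 0) := by
  subst hD
  ext ν
  rw [coeff_C]
  split_ifs with hν
  · rw [hν, ← h.coeff_eq 0 (by simp) (by simp)]
    rfl
  · obtain ⟨v, hv⟩ := Finsupp.ne_iff.mp hν
    exact h.coeff_zero ν v (by simp) hv

/-- The lists of later vertices contain only vertices after them, and messages in their slots
involve only such lists; so x_e occurs in the factor attached to `e` alone once its turn has come.
-/
theorem EliminationState.freeOf {s : Memory} {nv : ℕ} {m : ℕ → ℕ} {R : ℕ → List ℕ} {e f : ℕ}
    {b : ℕ → ℕ → ℂ} {acc : ℕ → ℕ → MvPowerSeries ℕ ℂ} (h : EliminationState s nv m R e acc)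
    (hR : IsEliminationOrder nv R) (hef : e < f) (hf : f < nv) :
    FreeOf e (attachedFactor b R acc f) := by
  have hnot : e ∉ f :: R f := by
    intro he
    rcases List.mem_cons.mp he with he | he
    · omega
    · have := hR.lt f hf e he
      omega
  refine FreeOf.mul (fun ν hν => coeff_localFactor_of_notMem hef.ne ?_ hν)
    (FreeOf.prod _ fun u hu => ?_)
  · simp at hnot ⊢
    exact hnot.2
  · have := h.table f hef.le hf u (Finset.mem_range.mp hu)
    split_ifs at this with hs
    · rw [this]
      exact FreeOf.one e
    · exact fun ν hν => this.coeff_zero ν e (fun he => hnot (List.mem_of_mem_eraseIdx he)) hν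

/-- In `vertexCost`, the occupied slots account for the minimum, the message to the parent for the
additional 1, and the factor 2 pays for the work that is linear in the table and list sizes. The
product of the scalar found so far and of `pending` is unchanged. -/
theorem wp_eliminateVertex {s : Memory} {nv : ℕ} {m : ℕ → ℕ} {R : ℕ → List ℕ} {b : ℕ → ℕ → ℂ}
    {e W c : ℕ} {acc : ℕ → ℕ → MvPowerSeries ℕ ℂ} (h : EliminationState s nv m R e acc)
    (hs : HoldsNeighbors s nv m R b) (hR : IsEliminationOrder nv R) (he : e < nv)
    (h30 : s.var 30 = e) (hW : ∀ e < nv, (R e).length ≤ W) (hc : ∀ e < nv, m e ≤ c) :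
    WP eliminateVertex s fun t s' => t ≤ vertexCost nv m R c W e ∧ s'.var 30 = e + 1 ∧
      ∃ acc', EliminationState s' nv m R (e + 1) acc' ∧
        s.num 30 0 0 * pending b R acc nv m e =
          s'.num 30 0 0 * pending b R acc' nv m (e + 1) := by
  have hRn : ∀ e < nv, (R e).Nodup ∧ ∀ u ∈ R e, e < u ∧ u < nv :=
    fun e he => ⟨hR.nodup e he, hR.lt e he⟩
  have heR : e ∉ R e := (List.nodup_cons.mp (hR.nodup_cons he)).1
  have hWe := hW e he
  have hcR : ∀ v ∈ R e, m v ≤ c := fun v hv => hc v (hR.lt e he v hv).2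
  have hN : boxSize m (e :: R e) ≤ (m e + 1) * (c + 1) ^ W := by
    rw [boxSize_cons]
    exact Nat.mul_le_mul_left _ (boxSize_le_pow hcR hWe)
  have hB : 0 < (c + 1) ^ W := by positivity
  have hmc := mulCost_mono hN (show (R e).length + 1 ≤ W + 1 by omega)
  have hsmall := add_le_mulCost (N := (m e + 1) * (c + 1) ^ W) (by positivity) (W + 1)
  have hcard := h.card_le he hWe
  simp only [eliminateVertex, wp_seq]
  refine WP.mono (wp_localTable hs hRn he h30) ?_
  rintro t₁ s₁ ⟨ht₁, a1, a2, a3, a4, a5, a6⟩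
  have a30 : s₁.var 30 = e := by rw [a6.var 30 (by norm_num), h30]
  refine WP.mono (wp_multiplySlots (acc := acc e) (hs.of_frame a6 (by norm_num)) hRn he a30 a3 ?_) ?_
  · intro u hu
    have := h.table e le_rfl he u hu
    rw [a2]
    split_ifs at this ⊢ with hsl
    · exact this
    · rw [a5 _ hsl]
      exact this
  rintro t₂ s₂ ⟨ht₂, b1, b2, b3⟩
  rw [a2] at ht₂
  refine WP.mono (wp_messageTable (e := e) (m := m) heR (by rw [b3.var 30 (by norm_num), a30])
    (by rw [b3.var 31 (by norm_num), a1])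
    (by rw [b3.idx 22 (by norm_num), a6.idx 22 (by norm_num), hs.mult e he]) b1) ?_
  rintro t₃ s₃ ⟨ht₃, c1, c2, c3, c4⟩
  rw [← attachedFactor] at c1
  have hf : Frame 31 s s₃ := (a6.trans (b3.mono (by norm_num))).trans c4
  have hst : EliminationState s₃ nv m R e acc := by
    refine h.congr le_rfl (hf.var 27 (by norm_num)) (hf.idx 30 (by norm_num)) ?_ ?_
    · rw [hf.idx 28 (by norm_num)]; exact h.mark
    · intro r hr
      rw [c3 r (by omega), b2 r (by omega), a5 r (by omega)]
  have c30 : s₃.var 30 = e := by rw [hf.var 30 (by norm_num), h30]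
  have c21 : s₃.idx 21 e 0 = (R e).length + 1 := by rw [hf.idx 21 (by norm_num), hs.length e he]
  -- Here `x` is the time of the last branch, either the multiplication of the running scalar or the
  -- sending of a message.
  have hcost : ∀ x, x ≤ 300 * (W + 2) + mulCost ((m e + 1) * (c + 1) ^ W) (W + 1) →
      t₁ + (t₂ + (t₃ + (1 + (1 + (1 + 1 + 1) + 1) + x + (1 + (1 + 1 + 1))))) ≤
        vertexCost nv m R c W e := by
    intro x hx
    set a := min (childCount nv R e) (W + 2) with ha
    have h1 := Nat.mul_le_mul hcard (Nat.mul_le_mul_left 2 hmc)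
    have h2 : vertexCost nv m R c W e =
      a * (2 * mulCost ((m e + 1) * (c + 1) ^ W) (W + 1)) +
        2 * mulCost ((m e + 1) * (c + 1) ^ W) (W + 1) := by
      rw [vertexCost, ← ha]; ring
    rw [h2]
    have h3 := ht₂.trans (Nat.add_le_add_left h1 _)
    clear h1 h2 hcard ht₂
    generalize mulCost ((m e + 1) * (c + 1) ^ W) (W + 1) = y at *
    generalize a * (2 * y) = z at *
    omega
  by_cases hne : R e = []
  · rw [wp_ite, if_pos (by simp [c30, c21, hne])]
    simp only [wp_setNum, wp_setVar, IExp.eval, NExp.eval, Memory.setNum_var, Memory.setVar_var,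
      Memory.setVar_num, Memory.setNum_num, Memory.setVar_idx, Memory.setNum_idx, c30, BExp.cost,
      IExp.cost, NExp.cost, reduceIte, true_and, and_true]
    refine ⟨hcost (1 + 1 + 1 + (1 + (1 + 1 + 1) + (1 + 1 + 1))) (by omega), acc, ?_, ?_⟩
    · refine hst.congr (by omega) (by simp) (by simp) ?_ ?_
      · intro v
        simpa using (hst.mark v).trans (Nat.le_succ e)
      · intro r _
        funext j
        simp
    · rw [pending_eq_mul he (fun f h1 h2 => h.freeOf hR h1 h2) (c1.eq_C hne),
        hf.num 30 (by norm_num)]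
      ring
  · rw [wp_ite, if_neg (by simp [c30, c21, hne])]
    refine WP.mono (wp_sendMessage hst (hs.of_frame hf (by norm_num)) hR he c30 hne c1 hW) ?_
    rintro t₄ s₄ ⟨ht₄, d1, d2, d3, d4⟩
    have hfv := (hR.lt e he _ (parentOf_mem hne)).2
    have hK := hR.length_erase_le he hne hW
    have hmK := mulCost_mono (boxSize_le_pow (m := m) (c := c) (D := (parentOf R e ::
      R (parentOf R e)).eraseIdx (missingOf R e)) (fun v hv => by
        rcases List.mem_cons.mp (List.mem_of_mem_eraseIdx hv) with rfl | hv
        exacts [hc _ hfv, hc v (hR.lt _ hfv v hv).2]) hK) (hK.trans (Nat.le_add_right W 1))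
    have hmK' := hmK.trans (mulCost_mono (N' := (m e + 1) * (c + 1) ^ W)
      (Nat.le_mul_of_pos_left _ (Nat.succ_pos (m e))) le_rfl)
    simp only [wp_setVar, IExp.eval, Memory.setVar_var, Memory.setVar_num, d2, reduceIte, true_and,
      BExp.cost, IExp.cost, d3]
    refine ⟨hcost t₄ (by omega), _, d1.congr le_rfl (by simp) (by simp) (by simpa using d1.mark)
      (by simp), ?_⟩
    rw [hf.num 30 (by norm_num), pending_eq_pending_accumulate he
      (fun f h1 h2 => h.freeOf hR h1 h2) (hR.lt e he _ (parentOf_mem hne)).1 hfv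
      (Nat.lt_succ_of_le missingOf_le)]

/-- Eliminates all vertices and writes down the result. -/
def eliminate : Program :=
  .seq (.setNum 30 (.lit 0) (.lit 0) (.cast (.lit 1))) <|
  .seq (.setVar 27 (.lit 2)) <|
  .seq (.setVar 30 (.lit 0)) <|
  .seq (.loop (.lt (.var 30) (.var 20)) eliminateVertex) <|
  .setNum 1 (.lit 0) (.lit 0) (.get 30 (.lit 0) (.lit 0))

theorem wp_eliminate {s : Memory} {nv : ℕ} {m : ℕ → ℕ} {R : ℕ → List ℕ} {b : ℕ → ℕ → ℂ}
    {W c : ℕ} (hs : HoldsNeighbors s nv m R b) (hR : IsEliminationOrder nv R)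
    (hW : ∀ e < nv, (R e).length ≤ W) (hc : ∀ e < nv, m e ≤ c) (h20 : s.var 20 = nv)
    (h28 : ∀ v, s.idx 28 v 0 = 0) (hsl : ∀ f u, s.idx 30 f u = 0) (h60 : ∀ r j, s.num 60 r j = 0) :
    WP eliminate s fun t s' => t ≤ ∑ e ∈ Finset.range nv, (vertexCost nv m R c W e + 10) + 30 ∧
      s'.num 1 0 0 = pending b R 1 nv m 0 := by
  simp only [eliminate, wp_seq, wp_setVar, wp_setNum]
  refine WP.mono (wp_loop 27 nv (fun e s' => s'.var 30 = e ∧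
      ∃ acc, EliminationState s' nv m R e acc ∧
        pending b R 1 nv m 0 = s'.num 30 0 0 * pending b R acc nv m e)
      (fun i => ∑ e ∈ Finset.range i, (vertexCost nv m R c W e + 10)) (by decide) ?_ ?_ ?_) ?_
  · refine ⟨by simp, 1, ?_, by simp⟩
    constructor <;> simp +contextual [h28, hsl, h60]
  · rintro e he s' hf ⟨i1, acc, i2, i3⟩
    have g20 : s'.var 20 = nv := by rw [hf.var 20 (by norm_num)]; simpa using h20
    have hs' : HoldsNeighbors s' nv m R b := by
      refine HoldsNeighbors.of_frame (k := 27) (s := s) hs ?_ (by norm_num)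
      refine Frame.trans ?_ hf
      constructor
      · intro x hx; simp [hx.ne, show x ≠ 30 by omega]
      · intro a ha; funext i j; simp
      · intro a ha; funext i j; simp [show a ≠ 30 by omega]
    refine ⟨by simp [i1, g20, he], ?_⟩
    refine WP.mono (wp_eliminateVertex i2 hs' hR he i1 hW hc) ?_
    rintro t s'' ⟨ht, j1, acc', j2, j3⟩
    rw [Finset.sum_range_succ]
    simp only [BExp.cost, IExp.cost]
    exact ⟨by omega, j1, acc', j2, by rw [i3, j3]⟩
  · rintro s' hf ⟨i1, -⟩
    have g20 : s'.var 20 = nv := by rw [hf.var 20 (by norm_num)]; simpa using h20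
    simp [i1, g20]
  · rintro t s' ⟨ht, ⟨-, acc, -, i3⟩, hf⟩
    simp only [BExp.cost, IExp.cost, NExp.cost] at ht ⊢
    refine ⟨by omega, ?_⟩
    rw [i3, pending_self]
    simp

/-! ## The elimination order of a tree decomposition -/

/-- The program assigns only to arrays with a number that is less than `k`. -/
def Program.writesBelow (k : ℕ) : Program → Bool
  | skip => true
  | setVar _ _ => true
  | setIdx a _ _ _ => decide (a < k)
  | setNum a _ _ _ => decide (a < k)
  | seq p q => p.writesBelow k && q.writesBelow k
  | ite _ p q => p.writesBelow k && q.writesBelow k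
  | loop _ p => p.writesBelow k

/-- The preparatory passes must leave the marks, slots and tables of the elimination at their
initial value zero, which the restriction on the arrays they write to guarantees. -/
theorem Exec.of_writesBelow {k : ℕ} {p : Program} {s s' : Memory} {t : ℕ} (h : Exec p s t s')
    (hp : p.writesBelow k = true) {a : ℕ} (ha : k ≤ a) : s'.idx a = s.idx a ∧ s'.num a = s.num a := by
  induction h with
  | skip | loop_false | setVar => exact ⟨rfl, rfl⟩
  | setIdx s b e f v =>
    have hk : b < k := by simpa [Program.writesBelow] using hp
    exact ⟨Function.update_of_ne (by omega) _ _, rfl⟩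
  | setNum s b e f v =>
    have hk : b < k := by simpa [Program.writesBelow] using hp
    exact ⟨rfl, Function.update_of_ne (by omega) _ _⟩
  | seq _ _ h₁ h₂ =>
    simp only [Program.writesBelow, Bool.and_eq_true] at hp
    exact ⟨(h₂ hp.2).1.trans (h₁ hp.1).1, (h₂ hp.2).2.trans (h₁ hp.1).2⟩
  | ite_true _ _ h₁ =>
    simp only [Program.writesBelow, Bool.and_eq_true] at hp
    exact h₁ hp.1
  | ite_false _ _ h₁ =>
    simp only [Program.writesBelow, Bool.and_eq_true] at hp
    exact h₁ hp.2
  | loop_true _ _ _ h₁ h₂ =>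
    exact ⟨(h₂ hp).1.trans (h₁ hp).1, (h₂ hp).2.trans (h₁ hp).2⟩

theorem WP.of_writesBelow {p : Program} {s : Memory} {Q : ℕ → Memory → Prop} (h : WP p s Q) (k : ℕ)
    (hp : p.writesBelow k = true) :
    WP p s fun t s' => Q t s' ∧ ∀ a, k ≤ a → s'.idx a = s.idx a ∧ s'.num a = s.num a := by
  obtain ⟨t, s', he, hq⟩ := h
  exact ⟨t, s', he, hq, fun a ha => he.of_writesBelow hp ha⟩

theorem StoresList.concat {A B : ℕ → ℕ} {D : List ℕ} {x : ℕ} (h : StoresList A D)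
    (hx : B D.length = x) (hB : ∀ j < D.length, B j = A j) : StoresList B (D ++ [x]) := by
  intro j hj
  rw [List.length_append, List.length_singleton] at hj
  by_cases hjl : j = D.length
  · subst hjl
    simp [hx]
  · have hj' : j < D.length := by omega
    rw [List.getElem_append_left hj', hB j hj', h j hj']

/-- Appends the list in row `var 11` of the index array `a + 1`, shifted by `var 14`, to the bag in
row `var 11` of the index array `10`. -/
def copyPart (a : ℕ) : Program :=
  .seq (.setVar 13 (.lit 0)) <|
  .loop (.lt (.var 13) (.get a (.var 11) (.lit 0))) <|
    .seq (.setVar 15 (.add (.get (a + 1) (.var 11) (.var 13)) (.var 14))) <|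
    .seq (.setIdx 10 (.var 11) (.var 12) (.var 15)) <|
    .seq (.setIdx 12 (.var 15) (.lit 0) (.var 11)) <|
    .seq (.setVar 12 (.add (.var 12) (.lit 1))) <|
    .setVar 13 (.add (.var 13) (.lit 1))

theorem wp_copyPart {s : Memory} {a t d : ℕ} {L D : List ℕ} (ha : a < 9) (h11 : s.var 11 = t)
    (h14 : s.var 14 = d) (hl : s.idx a t 0 = L.length) (hL : StoresList (s.idx (a + 1) t) L)
    (h12 : s.var 12 = D.length) (hD : StoresList (s.idx 10 t) D) :
    WP (copyPart a) s fun n s' => n ≤ 40 * L.length + 10 ∧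
      s'.var 12 = (D ++ L.map (· + d)).length ∧
      StoresList (s'.idx 10 t) (D ++ L.map (· + d)) ∧
      (∀ r, r ≠ t → s'.idx 10 r = s.idx 10 r) ∧
      (∀ v, s'.idx 12 v 0 = if v ∈ L.map (· + d) then t else s.idx 12 v 0) ∧
      (∀ b, b ≠ 10 → b ≠ 12 → s'.idx b = s.idx b) ∧ s'.num = s.num ∧
      ∀ x, x ≠ 12 → x ≠ 13 → x ≠ 15 → s'.var x = s.var x := by
  simp only [copyPart, wp_seq, wp_setVar]
  refine WP.mono (wp_loop 10 L.length (fun i s' => s'.var 13 = i ∧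
      s'.var 12 = (D ++ (L.take i).map (· + d)).length ∧
      StoresList (s'.idx 10 t) (D ++ (L.take i).map (· + d)) ∧
      (∀ r, r ≠ t → s'.idx 10 r = s.idx 10 r) ∧
      (∀ v, s'.idx 12 v 0 = if v ∈ (L.take i).map (· + d) then t else s.idx 12 v 0) ∧
      (∀ b, b ≠ 10 → b ≠ 12 → s'.idx b = s.idx b) ∧ s'.num = s.num ∧
      ∀ x, x ≠ 12 → x ≠ 13 → x ≠ 15 → s'.var x = s.var x)
      (fun i => i * 40) (by simp [Program.fresh]) ?_ ?_ ?_) ?_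
  · simp only [Memory.setVar_var, Memory.setVar_idx, Memory.setVar_num, IExp.eval,
      Nat.reduceEqDiff, reduceIte, true_and, List.take_zero, List.map_nil, List.append_nil,
      List.not_mem_nil, implies_true, and_true]
    refine ⟨h12, hD, fun x _ hx _ => ?_⟩
    simp [hx]
  · rintro i hi s' hf ⟨i1, i2, i3, i4, i5, i6, i7, i8⟩
    have g11 : s'.var 11 = t := by rw [i8 11 (by norm_num) (by norm_num) (by norm_num), h11]
    have g14 : s'.var 14 = d := by rw [i8 14 (by norm_num) (by norm_num) (by norm_num), h14]
    have gl : s'.idx a t 0 = L.length := by rw [i6 a (by omega) (by omega), hl]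
    have gi : s'.idx (a + 1) t i = L[i] := by rw [i6 (a + 1) (by omega) (by omega), hL i hi]
    have hmap : (L.take (i + 1)).map (· + d) = (L.take i).map (· + d) ++ [L[i] + d] := by
      rw [List.take_succ_eq_append_getElem hi, List.map_append, List.map_singleton]
    refine ⟨by simp [i1, g11, gl, hi], ?_⟩
    simp only [IExp.eval, i1, g11, g14, gi, wp_seq, wp_setVar, wp_setIdx,
      Memory.setVar_var, Memory.setVar_idx, Memory.setVar_num, Memory.setIdx_var, Memory.setIdx_num,
      Memory.setIdx_idx, IExp.cost, BExp.cost, Nat.reduceEqDiff, reduceIte, true_and, false_and,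
      and_true, hmap, ← List.append_assoc]
    refine ⟨by omega, ?_, ?_, fun r hr => ?_, fun v => ?_, fun b hb hb' => ?_, i7,
      fun x hx hx' hx'' => ?_⟩
    · rw [i2, List.length_append (bs := [L[i] + d]), List.length_singleton]
    · refine i3.concat (by simp [i2]) fun j hj => ?_
      simp only [Memory.setVar_idx, Memory.setIdx_idx, i2, hj.ne, Nat.reduceEqDiff, false_and,
        and_false, if_false]
    · funext j
      simp [hr, i4 r hr]
    · rw [i5 v]
      simp only [List.mem_append, List.mem_singleton]
      by_cases h1 : v = L[i] + d <;> simp [h1]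
    · funext r j
      simp [hb, hb', i6 b hb hb']
    · simp [hx, hx', hx'', i8 x hx hx' hx'']
  · rintro s' hf ⟨i1, i2, i3, i4, i5, i6, i7, i8⟩
    have g11 : s'.var 11 = t := by rw [i8 11 (by norm_num) (by norm_num) (by norm_num), h11]
    have gl : s'.idx a t 0 = L.length := by rw [i6 a (by omega) (by omega), hl]
    simp [i1, g11, gl]
  · rintro n s' ⟨hn, ⟨i1, i2, i3, i4, i5, i6, i7, i8⟩, hf⟩
    rw [List.take_length] at i2 i3 i5
    simp only [BExp.cost, IExp.cost] at hn ⊢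
    exact ⟨by omega, i2, i3, i4, i5, i6, i7, i8⟩

/-- The input of the elimination: a list of `nT` bags, each with a list of rows and one of columns,
of a matrix of dimension `M`. -/
structure HoldsBags (s : Memory) (nT M : ℕ) (rows cols : ℕ → List ℕ) : Prop where
  nodes : s.var 0 = nT
  dim : s.var 1 = M
  rowLength : ∀ t < nT, s.idx 1 t 0 = (rows t).length
  row : ∀ t < nT, StoresList (s.idx 2 t) (rows t)
  colLength : ∀ t < nT, s.idx 3 t 0 = (cols t).length
  col : ∀ t < nT, StoresList (s.idx 4 t) (cols t)

theorem HoldsBags.of_frame {s s' : Memory} {nT M k : ℕ} {rows cols : ℕ → List ℕ}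
    (h : HoldsBags s nT M rows cols) (hf : Frame k s s') (hk : 5 ≤ k) :
    HoldsBags s' nT M rows cols := by
  constructor
  · rw [hf.var 0 (by omega)]; exact h.nodes
  · rw [hf.var 1 (by omega)]; exact h.dim
  · rw [hf.idx 1 (by omega)]; exact h.rowLength
  · rw [hf.idx 2 (by omega)]; exact h.row
  · rw [hf.idx 3 (by omega)]; exact h.colLength
  · rw [hf.idx 4 (by omega)]; exact h.col

/-- The members of the `t`-th bag; the column `x` has the number `x + M`. -/
def bagOf (M : ℕ) (rows cols : ℕ → List ℕ) (t : ℕ) : List ℕ := rows t ++ (cols t).map (· + M)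

/-- The memory holds the bags `k, …, nT - 1`, and the first of them that a vertex belongs to. -/
structure HoldsTops (s : Memory) (nT : ℕ) (bag : ℕ → List ℕ) (k : ℕ) : Prop where
  length : ∀ t, k ≤ t → t < nT → s.idx 11 t 0 = (bag t).length
  list : ∀ t, k ≤ t → t < nT → StoresList (s.idx 10 t) (bag t)
  top : ∀ t, k ≤ t → t < nT → ∀ v ∈ bag t,
    k ≤ s.idx 12 v 0 ∧ s.idx 12 v 0 ≤ t ∧ v ∈ bag (s.idx 12 v 0)

/-- Copies the bags. -/
def copyBags : Program :=
  .seq (.setVar 11 (.var 0)) <|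
  .loop (.lt (.lit 0) (.var 11)) <|
    .seq (.setVar 11 (.sub (.var 11) (.lit 1))) <|
    .seq (.setVar 12 (.lit 0)) <|
    .seq (.setVar 14 (.lit 0)) <|
    .seq (copyPart 1) <|
    .seq (.setVar 14 (.var 1)) <|
    .seq (copyPart 3) <|
    .setIdx 11 (.var 11) (.lit 0) (.var 12)

/-- The bags are run through from the last to the first, so the final entry recorded for a vertex is
its first bag. As parents are listed before children, this is the root of the subtree of that
vertex. -/
theorem wp_copyBags {s : Memory} {nT M W : ℕ} {rows cols : ℕ → List ℕ}
    (hs : HoldsBags s nT M rows cols) (hW : ∀ t < nT, (bagOf M rows cols t).length ≤ W) :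
    WP copyBags s fun n s' => n ≤ nT * (40 * W + 60) + 10 ∧
      HoldsTops s' nT (bagOf M rows cols) 0 ∧ Frame 10 s s' ∧ ∀ x, 16 ≤ x → s'.var x = s.var x := by
  simp only [copyBags, wp_seq, wp_setVar]
  have h0 : Frame 10 s (s.setVar 11 (IExp.eval s (.var 0))) :=
    ⟨fun x hx => by simp [show x ≠ 11 by omega], fun _ _ => rfl, fun _ _ => rfl⟩
  refine WP.mono (wp_loop 10 nT (fun i s' => s'.var 11 = nT - i ∧
      HoldsTops s' nT (bagOf M rows cols) (nT - i) ∧ ∀ x, 16 ≤ x → s'.var x = s.var x)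
      (fun i => i * (40 * W + 60)) (by decide) ?_ ?_ ?_) ?_
  · refine ⟨by simp [hs.nodes], ?_, fun x hx => by simp [show x ≠ 11 by omega]⟩
    constructor <;> intros <;> omega
  · rintro i hi s₁ hf ⟨i1, i2, i3⟩
    obtain ⟨t, ht⟩ : ∃ t, nT - i = t + 1 := ⟨nT - i - 1, by omega⟩
    have ht' : nT - (i + 1) = t := by omega
    have htn : t < nT := by omega
    have hs₁ : HoldsBags s₁ nT M rows cols :=
      hs.of_frame (h0.trans hf) (by norm_num)
    rw [ht] at i1 i2
    rw [ht']
    refine ⟨by simp [i1], ?_⟩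
    simp only [wp_seq, wp_setVar, IExp.eval, i1, Nat.add_sub_cancel]
    refine WP.mono (wp_copyPart (t := t) (d := 0) (L := rows t) (D := []) (by norm_num) (by simp)
      (by simp) (by simpa using hs₁.rowLength t htn) (by simpa using hs₁.row t htn) (by simp)
      (by intro j hj; simp at hj)) ?_
    rintro n₁ s₂ ⟨hn₁, a1, a2, a3, a4, a5, a6, a7⟩
    have avar : ∀ x, x < 11 ∨ 16 ≤ x → s₂.var x = s₁.var x := by
      intro x hx
      rw [a7 x (by omega) (by omega) (by omega)]
      simp [show x ≠ 14 by omega, show x ≠ 12 by omega, show x ≠ 11 by omega]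
    have a11 : s₂.var 11 = t := by
      rw [a7 11 (by norm_num) (by norm_num) (by norm_num)]
      simp
    have aidx : ∀ b, b ≠ 10 → b ≠ 12 → s₂.idx b = s₁.idx b := fun b hb hb' => a5 b hb hb'
    simp only [Nat.add_zero, List.map_id', List.nil_append] at a1 a2 a4
    rw [avar 1 (by omega), hs₁.dim]
    refine WP.mono (wp_copyPart (t := t) (d := M) (L := cols t) (D := rows t) (by norm_num)
      (by simp [a11]) (by simp) (by simpa [aidx] using hs₁.colLength t htn)
      (by simpa [aidx] using hs₁.col t htn) (by simpa using a1)
      (by simpa using a2)) ?_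
    rintro n₂ s₃ ⟨hn₂, b1, b2, b3, b4, b5, b6, b7⟩
    rw [← bagOf] at b1 b2
    have b11 : s₃.var 11 = t := by
      rw [b7 11 (by norm_num) (by norm_num) (by norm_num)]
      simp [a11]
    have hlen : (rows t).length + (cols t).length ≤ W := by
      have := hW t htn
      simpa [bagOf] using this
    have htop : ∀ v, s₃.idx 12 v 0 = if v ∈ bagOf M rows cols t then t else s₁.idx 12 v 0 := by
      intro v
      rw [b4 v, Memory.setVar_idx, a4 v, bagOf]
      simp only [List.mem_append, Memory.setVar_idx]
      by_cases h1 : v ∈ (cols t).map (· + M) <;> by_cases h2 : v ∈ rows t <;> simp [h1, h2]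
    have hrows : ∀ r, r ≠ t → s₃.idx 10 r = s₁.idx 10 r := by
      intro r hr
      rw [b3 r hr, Memory.setVar_idx, a3 r hr]
      rfl
    have h11 : s₃.idx 11 = s₁.idx 11 := by
      rw [b5 11 (by norm_num) (by norm_num), Memory.setVar_idx, aidx 11 (by norm_num) (by norm_num)]
    simp only [wp_setIdx, IExp.eval, b11, b1, Memory.setIdx_var, IExp.cost, BExp.cost, true_and]
    refine ⟨?_, ⟨fun t' h1 h2 => ?_, fun t' h1 h2 => ?_, fun t' h1 h2 v hv => ?_⟩, fun x hx => ?_⟩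
    · rw [add_mul, one_mul]
      omega
    · by_cases h : t' = t
      · simp [h]
      · simp [h, h11, i2.length t' (by omega) h2]
    · by_cases h : t' = t
      · subst h
        intro j hj; simpa using b2 j hj
      · intro j hj
        simpa [hrows t' h] using i2.list t' (by omega) h2 j hj
    · simp only [Memory.setIdx_idx, Nat.reduceEqDiff, false_and, if_false, htop]
      by_cases hvt : v ∈ bagOf M rows cols t
      · simp only [hvt, if_true]
        exact ⟨le_rfl, h1, trivial⟩
      · simp only [hvt, if_false]
        have hne : t' ≠ t := fun h => hvt (h ▸ hv)
        have := i2.top t' (by omega) h2 v hv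
        exact ⟨by omega, this.2⟩
    · rw [b7 x (by omega) (by omega) (by omega)]
      simp [show x ≠ 14 by omega, avar x (Or.inr hx), i3 x hx]
  · rintro s' hf ⟨i1, -⟩
    simp [i1]
  · rintro n s' ⟨hn, ⟨i1, i2, i3⟩, hf⟩
    rw [Nat.sub_self] at i2
    simp only [BExp.cost, IExp.cost] at hn ⊢
    exact ⟨by omega, i2, h0.trans hf, i3⟩

/-- The vertices whose first bag is one of the last `i` of the `nT` bags, in the order in which they
are eliminated. -/
def vertexList (top : ℕ → ℕ) (bag : ℕ → List ℕ) (nT : ℕ) : ℕ → List ℕ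
  | 0 => []
  | i + 1 => vertexList top bag nT i ++
      (bag (nT - (i + 1))).filter fun v => decide (top v = nT - (i + 1))

section

variable {top : ℕ → ℕ} {bag : ℕ → List ℕ} {nT : ℕ}

theorem mem_vertexList {i v : ℕ} (hi : i ≤ nT) : v ∈ vertexList top bag nT i ↔
    nT - i ≤ top v ∧ top v < nT ∧ v ∈ bag (top v) := by
  induction i with
  | zero => simp [vertexList]; omega
  | succ i ih =>
    rw [vertexList, List.mem_append, ih (by omega), List.mem_filter, decide_eq_true_eq]
    constructor
    · rintro (⟨h1, h2⟩ | ⟨h1, h2⟩)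
      · exact ⟨by omega, h2⟩
      · rw [h2]
        exact ⟨le_rfl, by omega, h1⟩
    · rintro ⟨h1, h2, h3⟩
      by_cases h : top v = nT - (i + 1)
      · exact Or.inr ⟨h ▸ h3, h⟩
      · exact Or.inl ⟨by omega, h2, h3⟩

theorem vertexList_nodup (hb : ∀ t < nT, (bag t).Nodup) {i : ℕ} (hi : i ≤ nT) :
    (vertexList top bag nT i).Nodup := by
  induction i with
  | zero => simp [vertexList]
  | succ i ih =>
    rw [vertexList, List.nodup_append]
    refine ⟨ih (by omega), (hb _ (by omega)).filter _, fun u hu v hv huv => ?_⟩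
    rw [mem_vertexList (by omega)] at hu
    rw [List.mem_filter, decide_eq_true_eq] at hv
    subst huv
    omega

theorem vertexList_pairwise {i : ℕ} (hi : i ≤ nT) :
    (vertexList top bag nT i).Pairwise fun u v => top v ≤ top u := by
  induction i with
  | zero => simp [vertexList]
  | succ i ih =>
    rw [vertexList, List.pairwise_append]
    refine ⟨ih (by omega), ?_, fun u hu v hv => ?_⟩
    · rw [List.pairwise_filter]
      refine List.pairwise_of_forall fun u v hu hv => ?_
      rw [decide_eq_true_eq] at hu hv
      omega
    · rw [mem_vertexList (by omega)] at hu
      rw [List.mem_filter, decide_eq_true_eq] at hv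
      omega

end

/-- The vertices in the list `L` have been numbered in this order. -/
structure Numbered (s : Memory) (L : List ℕ) : Prop where
  count : s.var 16 = L.length
  vertex : StoresList (fun e => s.idx 14 e 0) L
  index : ∀ i (h : i < L.length), s.idx 13 L[i] 0 = i

/-- Numbers the vertices. -/
def numberVertices : Program :=
  .seq (.setVar 16 (.lit 0)) <|
  .seq (.setVar 13 (.var 0)) <|
  .loop (.lt (.lit 0) (.var 13)) <|
    .seq (.setVar 13 (.sub (.var 13) (.lit 1))) <|
    .seq (.setVar 14 (.lit 0)) <|
    .loop (.lt (.var 14) (.get 11 (.var 13) (.lit 0))) <|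
      .seq (.setVar 15 (.get 10 (.var 13) (.var 14))) <|
      .seq (.ite (.eq (.get 12 (.var 15) (.lit 0)) (.var 13))
        (.seq (.setIdx 13 (.var 15) (.lit 0) (.var 16)) <|
          .seq (.setIdx 14 (.var 16) (.lit 0) (.var 15)) <|
          .setVar 16 (.add (.var 16) (.lit 1))) .skip) <|
      .setVar 14 (.add (.var 14) (.lit 1))

/-- Running backwards through the bags and numbering a vertex only at its first bag gives each
vertex one number, and deep vertices come before shallow ones. -/
theorem wp_numberVertices {s : Memory} {nT W : ℕ} {bag : ℕ → List ℕ} {top : ℕ → ℕ}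
    (hs : HoldsTops s nT bag 0) (h0 : s.var 0 = nT) (htop : ∀ v, s.idx 12 v 0 = top v)
    (hb : ∀ t < nT, (bag t).Nodup) (hW : ∀ t < nT, (bag t).length ≤ W) :
    WP numberVertices s fun n s' => n ≤ nT * (60 * W + 60) + 10 ∧
      Numbered s' (vertexList top bag nT nT) ∧ Frame 13 s s' ∧
      ∀ x, 17 ≤ x → s'.var x = s.var x := by
  refine WP.mono (WP.frame (Q := fun n s' => n ≤ nT * (60 * W + 60) + 10 ∧
      Numbered s' (vertexList top bag nT nT) ∧ ∀ x, 17 ≤ x → s'.var x = s.var x) ?_ 13 (by decide))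
    (by rintro t s' ⟨⟨h1, h2, h3⟩, h4⟩; exact ⟨h1, h2, h4, h3⟩)
  simp only [numberVertices, wp_seq, wp_setVar]
  refine WP.mono (wp_loop 13 nT (fun i s' => s'.var 13 = nT - i ∧
      Numbered s' (vertexList top bag nT i) ∧ ∀ x, 17 ≤ x → s'.var x = s.var x)
      (fun i => i * (60 * W + 60)) (by decide) ?_ ?_ ?_) ?_
  · refine ⟨by simp [h0], ⟨by simp [vertexList], ?_, ?_⟩, fun x hx => ?_⟩
    · intro i hi; simp [vertexList] at hi
    · intro i hi; simp [vertexList] at hi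
    · simp [show x ≠ 13 by omega, show x ≠ 16 by omega]
  · rintro i hi s₁ hf ⟨i1, i2, i3⟩
    obtain ⟨t, ht⟩ : ∃ t, nT - i = t + 1 := ⟨nT - i - 1, by omega⟩
    have ht' : nT - (i + 1) = t := by omega
    have htn : t < nT := by omega
    have hidx : ∀ a < 13, s₁.idx a = s.idx a := by
      intro a ha
      rw [hf.idx a ha]
      simp
    rw [ht] at i1
    refine ⟨by simp [i1], ?_⟩
    simp only [wp_seq, wp_setVar, IExp.eval, i1, Nat.add_sub_cancel]
    rw [vertexList, ht']
    have hnd := vertexList_nodup (top := top) hb (i := i + 1) (by omega)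
    rw [vertexList, ht'] at hnd
    set L := vertexList top bag nT i with hL
    refine WP.mono (wp_loop 13 (bag t).length (fun j s' => s'.var 14 = j ∧ s'.var 13 = t ∧
        Numbered s' (L ++ ((bag t).take j).filter fun v => decide (top v = t)) ∧
        ∀ x, 17 ≤ x → s'.var x = s.var x)
        (fun j => j * 60) (by decide) ?_ ?_ ?_) ?_
    · refine ⟨by simp, by simp, ?_, fun x hx => ?_⟩
      · simpa using ⟨by simpa using i2.count, i2.vertex, i2.index⟩
      · simp [show x ≠ 14 by omega, show x ≠ 13 by omega, i3 x hx]
    · rintro j hj s₂ hf₂ ⟨j1, j2, j3, j4⟩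
      have gidx : ∀ a < 13, s₂.idx a = s.idx a := by
        intro a ha
        rw [hf₂.idx a ha]
        simp [hidx a ha]
      have gj : s₂.idx 10 t j = (bag t)[j] := by
        rw [gidx 10 (by norm_num), hs.list t (Nat.zero_le _) htn j hj]
      have gl : s₂.idx 11 t 0 = (bag t).length := by
        rw [gidx 11 (by norm_num), hs.length t (Nat.zero_le _) htn]
      have gt : s₂.idx 12 (bag t)[j] 0 = top (bag t)[j] := by
        rw [gidx 12 (by norm_num), htop]
      have htake : (bag t).take (j + 1) = (bag t).take j ++ [(bag t)[j]] :=
        List.take_succ_eq_append_getElem hj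
      have hnd' := hnd.sublist ((List.Sublist.filter (fun v => decide (top v = t))
        (List.take_sublist (j + 1) (bag t))).append_left L)
      refine ⟨by simp [j1, j2, gl, hj], ?_⟩
      rw [htake, List.filter_append, ← List.append_assoc] at hnd' ⊢
      set D := L ++ ((bag t).take j).filter (fun v => decide (top v = t)) with hD
      obtain ⟨n1, n2, n3⟩ := j3
      by_cases hc : top (bag t)[j] = t
      · rw [List.filter_singleton, show decide (top (bag t)[j] = t) = true by simpa using hc,
          cond_true] at hnd' ⊢
        simp only [BExp.eval, IExp.eval, j1, j2, n1, gj, gt, hc, decide_true, wp_seq, wp_setVar,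
          wp_ite, wp_setIdx, Memory.setVar_var, Memory.setVar_idx, Memory.setIdx_idx,
          Memory.setIdx_var, IExp.cost, BExp.cost, Nat.reduceEqDiff, reduceIte, true_and]
        refine ⟨by omega, ⟨by simp, ?_, fun i hi' => ?_⟩, fun x hx => ?_⟩
        · refine n2.concat (by simp) fun k hk => ?_
          simp [hk.ne]
        · rw [List.length_append, List.length_singleton] at hi'
          rcases Nat.lt_succ_iff_lt_or_eq.mp hi' with h | h
          · have hne : D[i] ≠ (bag t)[j] :=
              (List.nodup_append.mp hnd').2.2 _ (List.getElem_mem h) _ (by simp)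
            rw [List.getElem_append_left h]
            simp [hne, n3 i h]
          · subst h
            simp
        · simp [show x ≠ 14 by omega, show x ≠ 15 by omega, show x ≠ 16 by omega, j4 x hx]
      · rw [List.filter_singleton, show decide (top (bag t)[j] = t) = false by simpa using hc,
          cond_false, List.append_nil]
        simp only [BExp.eval, IExp.eval, j1, j2, gj, gt, hc, decide_false, wp_seq, wp_setVar,
          wp_ite, wp_skip, Memory.setVar_var, Memory.setVar_idx, Memory.setIdx_idx,
          Memory.setIdx_var, IExp.cost, BExp.cost, Nat.reduceEqDiff, reduceIte, true_and,
          Bool.false_eq_true]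
        refine ⟨by omega, ⟨by simpa using n1, n2, n3⟩, fun x hx => ?_⟩
        simp [show x ≠ 14 by omega, show x ≠ 15 by omega, j4 x hx]
    · rintro s₂ hf₂ ⟨j1, j2, -⟩
      have gl : s₂.idx 11 t 0 = (bag t).length := by
        rw [hf₂.idx 11 (by norm_num), Memory.setVar_idx, Memory.setVar_idx, hidx 11 (by norm_num),
          hs.length t (Nat.zero_le _) htn]
      simp [j1, j2, gl]
    · rintro n s₂ ⟨hn, ⟨j1, j2, j3, j4⟩, -⟩
      rw [List.take_length] at j3
      have := hW t htn
      simp only [BExp.cost, IExp.cost] at hn ⊢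
      refine ⟨?_, j2, j3, j4⟩
      rw [add_mul, one_mul]
      omega
  · rintro s' hf ⟨i1, -⟩
    simp [i1]
  · rintro n s' ⟨hn, ⟨-, i2, i3⟩, hf⟩
    simp only [BExp.cost, IExp.cost] at hn ⊢
    exact ⟨by omega, i2, i3⟩

/-- The weight of the pair of vertices `u`, `v`; the rows of the matrix `A` are the vertices less
than `M`, and the column `x` is the vertex `x + M`. -/
noncomputable def vertexWeight (flag : ℂ) (A : ℕ → ℕ → ℂ) (M u v : ℕ) : ℂ :=
  if u < M then if v < M then flag * A u v else A u (v - M) else if v < M then A v (u - M) else 0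

/-- Writes the weight of the vertices `var 18` and `var 24` to the place `var 21` in row `var 17` of
the number array `20`. -/
def fetchWeight : Program :=
  .ite (.lt (.var 18) (.var 1))
    (.ite (.lt (.var 24) (.var 1))
      (.setNum 20 (.var 17) (.var 21) (.mul (.cast (.var 10)) (.get 0 (.var 18) (.var 24))))
      (.setNum 20 (.var 17) (.var 21) (.get 0 (.var 18) (.sub (.var 24) (.var 1)))))
    (.ite (.lt (.var 24) (.var 1))
      (.setNum 20 (.var 17) (.var 21) (.get 0 (.var 24) (.sub (.var 18) (.var 1))))
      (.setNum 20 (.var 17) (.var 21) (.cast (.lit 0))))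

theorem wp_fetchWeight (s : Memory) : WP fetchWeight s fun n s' => n ≤ 30 ∧
    s' = s.setNum 20 (s.var 17) (s.var 21)
      (vertexWeight (s.var 10) (s.num 0) (s.var 1) (s.var 18) (s.var 24)) := by
  by_cases h1 : s.var 18 < s.var 1 <;> by_cases h2 : s.var 24 < s.var 1 <;>
    simp [fetchWeight, vertexWeight, h1, h2]

/-- Writes down the later neighbors of all vertices. -/
def findNeighbors : Program :=
  .seq (.setVar 20 (.var 16)) <|
  .seq (.setVar 17 (.lit 0)) <|
  .loop (.lt (.var 17) (.var 20)) <|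
    .seq (.setVar 18 (.get 14 (.var 17) (.lit 0))) <|
    .seq (.setVar 19 (.get 12 (.var 18) (.lit 0))) <|
    .seq (.ite (.lt (.var 18) (.var 1)) (.setIdx 22 (.var 17) (.lit 0) (.get 5 (.var 18) (.lit 0)))
      (.setIdx 22 (.var 17) (.lit 0) (.get 6 (.sub (.var 18) (.var 1)) (.lit 0)))) <|
    .seq (.setIdx 20 (.var 17) (.lit 0) (.var 17)) <|
    .seq (.setVar 21 (.lit 0)) <|
    .seq (.setVar 24 (.var 18)) <|
    .seq fetchWeight <|
    .seq (.setVar 21 (.lit 1)) <|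
    .seq (.setVar 23 (.lit 0)) <|
    .seq (.loop (.lt (.var 23) (.get 11 (.var 19) (.lit 0))) <|
      .seq (.setVar 24 (.get 10 (.var 19) (.var 23))) <|
      .seq (.setVar 22 (.get 13 (.var 24) (.lit 0))) <|
      .seq (.ite (.lt (.var 17) (.var 22))
        (.seq (.setIdx 20 (.var 17) (.var 21) (.var 22)) <|
          .seq fetchWeight (.setVar 21 (.add (.var 21) (.lit 1)))) .skip) <|
      .setVar 23 (.add (.var 23) (.lit 1))) <|
    .seq (.setIdx 21 (.var 17) (.lit 0) (.var 21)) <|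
    .setVar 17 (.add (.var 17) (.lit 1))

/-- The numbers of the vertices in the list `B` that are greater than `e`. -/
def laterIndices (index : ℕ → ℕ) (e : ℕ) (B : List ℕ) : List ℕ :=
  (B.map index).filter fun f => decide (e < f)

theorem laterIndices_take_succ {index : ℕ → ℕ} {e j : ℕ} {B : List ℕ} (hj : j < B.length) :
    laterIndices index e (B.take (j + 1)) = if e < index B[j] then
      laterIndices index e (B.take j) ++ [index B[j]] else laterIndices index e (B.take j) := by
  rw [laterIndices, List.take_succ_eq_append_getElem hj, List.map_append, List.filter_append,
    ← laterIndices, List.map_singleton, List.filter_singleton]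
  split_ifs with h <;> simp [h]

/-- Scanning the first bag of each vertex takes time proportional to its size. All later-numbered
vertices in it are listed, whether or not the matrix entry is zero; this fill-in is what makes the
elimination order perfect. -/
theorem wp_findNeighbors {s : Memory} {nT M W nv : ℕ} {bag : ℕ → List ℕ} {L : List ℕ}
    {top : ℕ → ℕ} {flag : ℕ}
    (hs : HoldsTops s nT bag 0) (hL : Numbered s L) (htop : ∀ v, s.idx 12 v 0 = top v)
    (h1 : s.var 1 = M) (h10 : s.var 10 = flag) (hnv : L.length = nv)
    (hmem : ∀ v, v ∈ L ↔ top v < nT ∧ v ∈ bag (top v)) (hW : ∀ t < nT, (bag t).length ≤ W) :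
    WP findNeighbors s fun n s' => n ≤ nv * (100 * W + 200) + 10 ∧ s'.var 20 = nv ∧
      HoldsNeighbors s' nv
        (fun e => if s.idx 14 e 0 < M then s.idx 5 (s.idx 14 e 0) 0
          else s.idx 6 (s.idx 14 e 0 - M) 0)
        (fun e => laterIndices (fun v => s.idx 13 v 0) e (bag (top (s.idx 14 e 0))))
        (fun e f => vertexWeight flag (s.num 0) M (s.idx 14 e 0) (s.idx 14 f 0)) := by
  set vert : ℕ → ℕ := fun e => s.idx 14 e 0 with hvert
  set index : ℕ → ℕ := fun v => s.idx 13 v 0 with hindex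
  set mult : ℕ → ℕ := fun e => if vert e < M then s.idx 5 (vert e) 0 else s.idx 6 (vert e - M) 0
    with hmult
  set R : ℕ → List ℕ := fun e => laterIndices index e (bag (top (vert e))) with hR
  set b : ℕ → ℕ → ℂ := fun e f => vertexWeight flag (s.num 0) M (vert e) (vert f) with hb
  have hvertL : ∀ e < nv, vert e ∈ L := by
    intro e he
    rw [← hnv] at he
    rw [hvert]
    simp only [hL.vertex e he]
    exact List.getElem_mem he
  have hvi : ∀ v ∈ L, vert (index v) = v := by
    intro v hv
    obtain ⟨i, hi, rfl⟩ := List.getElem_of_mem hv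
    rw [hindex]
    simp only [hL.index i hi]
    exact hL.vertex i hi
  have h0 : Frame 17 s ((s.setVar 20 (IExp.eval s (.var 16))).setVar 17 0) :=
    ⟨fun x hx => by simp [show x ≠ 20 by omega, show x ≠ 17 by omega], fun _ _ => rfl,
      fun _ _ => rfl⟩
  simp only [findNeighbors, wp_seq, wp_setVar]
  refine WP.mono (wp_loop 17 nv (fun e s' => s'.var 17 = e ∧ s'.var 20 = nv ∧
      HoldsNeighbors s' e mult R b)
      (fun i => i * (100 * W + 200)) (by decide) ?_ ?_ ?_) ?_
  · refine ⟨by simp, by simp [hL.count, hnv], ?_⟩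
    constructor <;> intros <;> omega
  · rintro e he s₁ hf ⟨i1, i2, i3⟩
    have hf₁ : Frame 17 s s₁ := h0.trans hf
    have hve := hvertL e he
    obtain ⟨htn, hvb⟩ := (hmem _).mp hve
    set v := vert e with hv
    set t := top v with ht
    refine ⟨by simp [i1, i2, he], ?_⟩
    -- The rest of the round after the multiplicity has been stored; it is the same for rows and for
    -- columns.
    have hstart : ∀ s₂ : Memory, Frame 17 s s₂ → s₂.var 17 = e → s₂.var 18 = v → s₂.var 19 = t →
        s₂.var 20 = nv →
        (∀ e' < e, s₂.idx 20 e' = s₁.idx 20 e' ∧ s₂.num 20 e' = s₁.num 20 e' ∧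
          s₂.idx 22 e' 0 = s₁.idx 22 e' 0) → s₂.idx 21 = s₁.idx 21 → s₂.idx 22 e 0 = mult e →
        WP (.seq (.setIdx 20 (.var 17) (.lit 0) (.var 17)) <|
          .seq (.setVar 21 (.lit 0)) <|
          .seq (.setVar 24 (.var 18)) <|
          .seq fetchWeight <|
          .seq (.setVar 21 (.lit 1)) <|
          .seq (.setVar 23 (.lit 0)) <|
          .seq (.loop (.lt (.var 23) (.get 11 (.var 19) (.lit 0))) <|
            .seq (.setVar 24 (.get 10 (.var 19) (.var 23))) <|
            .seq (.setVar 22 (.get 13 (.var 24) (.lit 0))) <|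
            .seq (.ite (.lt (.var 17) (.var 22))
              (.seq (.setIdx 20 (.var 17) (.var 21) (.var 22)) <|
                .seq fetchWeight (.setVar 21 (.add (.var 21) (.lit 1)))) .skip) <|
            .setVar 23 (.add (.var 23) (.lit 1))) <|
          .seq (.setIdx 21 (.var 17) (.lit 0) (.var 21)) <|
          .setVar 17 (.add (.var 17) (.lit 1))) s₂ fun n s' => n ≤ 100 * W + 100 ∧
            s'.var 17 = e + 1 ∧ s'.var 20 = nv ∧ HoldsNeighbors s' (e + 1) mult R b := by
      intro s₂ hf₂ a17 a18 a19 a20 a1 a2 a3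
      simp only [wp_seq, wp_setVar, wp_setIdx]
      refine WP.mono (wp_fetchWeight _) ?_
      rintro n₁ _ ⟨hn₁, rfl⟩
      refine WP.mono (wp_loop 17 (bag t).length (fun j s' => s'.var 23 = j ∧ s'.var 17 = e ∧
          s'.var 18 = v ∧ s'.var 19 = t ∧ s'.var 20 = nv ∧
          s'.var 21 = (e :: laterIndices index e ((bag t).take j)).length ∧
          StoresList (s'.idx 20 e) (e :: laterIndices index e ((bag t).take j)) ∧
          (∀ i (h : i < (e :: laterIndices index e ((bag t).take j)).length), s'.num 20 e i =
            b e (e :: laterIndices index e ((bag t).take j))[i]) ∧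
          (∀ e' < e, s'.idx 20 e' = s₁.idx 20 e' ∧ s'.num 20 e' = s₁.num 20 e') ∧
          s'.idx 21 = s₁.idx 21 ∧ s'.idx 22 = s₂.idx 22)
          (fun j => j * 80) (by decide) ?_ ?_ ?_) ?_
      · refine ⟨by simp, by simp [a17], by simp [a18], by simp [a19], by simp [a20],
          by simp [laterIndices], ?_, ?_, fun e' he' => ⟨?_, ?_⟩, ?_, ?_⟩
        · intro i hi
          have : i = 0 := by simpa [laterIndices] using hi
          subst this
          simp [a17]
        · intro i hi
          have : i = 0 := by simpa [laterIndices] using hi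
          subst this
          simp [a17, a18, hf₂.var, hf₂.num, h1, h10, hb, ← hv]
        · funext j
          simp [a17, he'.ne, (a1 e' he').1]
        · funext j
          simp [a17, he'.ne, (a1 e' he').2.1]
        · funext r j
          simp [a2]
        · funext r j
          simp
      · rintro j hj s₃ hf₃ ⟨b23, b17, b18, b19, b20, b21, b1, b2, b3, b4, b5⟩
        have hf₃' : Frame 17 s s₃ := by
          refine hf₂.trans (Frame.trans ?_ hf₃)
          constructor
          · intro x hx
            simp [show x ≠ 23 by omega, show x ≠ 21 by omega, show x ≠ 24 by omega]
          · intro a ha; funext i j; simp [show a ≠ 20 by omega]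
          · intro a ha; funext i j; simp [show a ≠ 20 by omega]
        set D := laterIndices index e ((bag t).take j) with hD
        set u := (bag t)[j] with hu
        have hub : u ∈ bag t := List.getElem_mem hj
        have huL : u ∈ L := by
          have := hs.top t (Nat.zero_le _) htn u hub
          rw [htop] at this
          exact (hmem u).mpr ⟨by omega, this.2.2⟩
        have gu : s₃.idx 10 t j = u := by
          rw [hf₃'.idx 10 (by norm_num), hs.list t (Nat.zero_le _) htn j hj]
        have gl : s₃.idx 11 t 0 = (bag t).length := by
          rw [hf₃'.idx 11 (by norm_num), hs.length t (Nat.zero_le _) htn]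
        have gi : s₃.idx 13 u 0 = index u := by rw [hf₃'.idx 13 (by norm_num)]
        refine ⟨by simp [b23, b19, gl, hj], ?_⟩
        rw [laterIndices_take_succ hj, ← hu, ← hD]
        by_cases hc : e < index u
        · rw [if_pos hc]
          simp only [BExp.eval, IExp.eval, b23, b19, b17, gu, gi, hc, decide_true, wp_seq,
            wp_setVar, wp_ite, wp_setIdx, Memory.setVar_var, Memory.setVar_idx, Memory.setIdx_idx,
            Memory.setIdx_var, IExp.cost, BExp.cost, Nat.reduceEqDiff, reduceIte, true_and,
            false_and]
          refine WP.mono (wp_fetchWeight _) ?_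
          rintro n₂ _ ⟨hn₂, rfl⟩
          simp only [Memory.setVar_var, Memory.setVar_idx, Memory.setVar_num, Memory.setIdx_idx,
            Memory.setIdx_var, Memory.setIdx_num, Memory.setNum_var, Memory.setNum_idx,
            Nat.reduceEqDiff, reduceIte, true_and, b17, b18, b21, b23, hf₃'.num 0 (by norm_num),
            hf₃'.var 10 (by norm_num), hf₃'.var 1 (by norm_num), h1, h10]
          refine ⟨by omega, b19, b20, by simp, ?_, fun i hi => ?_, fun e' he' => ⟨?_, ?_⟩, ?_, ?_⟩
          · rw [← List.cons_append]
            refine b1.concat ?_ fun k hk => ?_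
            · simp
            · simp only [Memory.setVar_idx, Memory.setNum_idx, Memory.setIdx_idx, hk.ne, and_false,
                if_false]
          · simp only [← List.cons_append] at hi ⊢
            rw [List.length_append (bs := [index u]), List.length_singleton] at hi
            simp only [Memory.setVar_num, Memory.setIdx_num, Memory.setNum_num, true_and]
            rcases Nat.lt_succ_iff_lt_or_eq.mp hi with h | h
            · rw [List.getElem_append_left h, if_neg h.ne]
              exact b2 i h
            · subst h
              rw [if_pos rfl, List.getElem_append_right (by simp)]
              simp [hb, hvi u huL, ← hv]
          · funext k
            simp [he'.ne, (b3 e' he').1]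
          · funext k
            simp [he'.ne, (b3 e' he').2]
          · funext r k
            simp [b4]
          · funext r k
            simp [b5]
        · rw [if_neg hc]
          simp only [BExp.eval, IExp.eval, b23, b19, b17, gu, gi, hc, decide_false, wp_seq,
            wp_setVar, wp_ite, wp_skip, Memory.setVar_var, Memory.setVar_idx, Memory.setVar_num,
            IExp.cost, BExp.cost, Nat.reduceEqDiff, reduceIte, true_and, Bool.false_eq_true]
          exact ⟨by omega, b18, b20, b21, b1, b2, b3, b4, b5⟩
      · rintro s₃ hf₃ ⟨b23, b17, b18, b19, -⟩
        have gl : s₃.idx 11 t 0 = (bag t).length := by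
          rw [hf₃.idx 11 (by norm_num)]
          simp [hf₂.idx 11, hs.length t (Nat.zero_le _) htn]
        simp [b23, b19, gl]
      · rintro n₂ s₃ ⟨hn₂, ⟨b23, b17, b18, b19, b20, b21, b1, b2, b3, b4, b5⟩, -⟩
        rw [List.take_length] at b1 b2 b21
        have hWt := hW t htn
        have hlist : e :: laterIndices index e (bag t) = e :: R e := rfl
        simp only [hlist] at b1 b2 b21
        simp only [BExp.cost, IExp.cost] at hn₂
        simp only [IExp.eval, IExp.cost, wp_setVar, Memory.setVar_var, Memory.setIdx_var, b17,
          reduceIte, true_and, Nat.reduceEqDiff, b21, b20]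
        refine ⟨by omega, ⟨fun e' he' => ?_, fun e' he' => ?_, fun e' he' => ?_,
          fun e' he' => ?_⟩⟩
        · rcases Nat.lt_succ_iff_lt_or_eq.mp he' with h | h
          · intro k hk
            simpa [(b3 e' h).1] using i3.list e' h k hk
          · subst h
            intro k hk
            simpa using b1 k hk
        · rcases Nat.lt_succ_iff_lt_or_eq.mp he' with h | h
          · simpa [h.ne, b4] using i3.length e' h
          · simp [h]
        · rcases Nat.lt_succ_iff_lt_or_eq.mp he' with h | h
          · simpa [b5, (a1 e' h).2.2] using i3.mult e' h
          · simp [h, b5, a3]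
        · rcases Nat.lt_succ_iff_lt_or_eq.mp he' with h | h
          · simpa [(b3 e' h).2] using i3.weight e' h
          · subst h
            simpa using b2
    have g14 : s₁.idx 14 e 0 = v := by rw [hf₁.idx 14 (by norm_num)]
    have g12 : s₁.idx 12 v 0 = t := by rw [hf₁.idx 12 (by norm_num), htop]
    have hset : ∀ x y : ℕ, 17 ≤ x → Frame 17 s₁ (s₁.setVar x y) := by
      intro x y hx
      exact ⟨fun z hz => by simp [show z ≠ x by omega], fun _ _ => rfl, fun _ _ => rfl⟩
    have hset' : Frame 17 s (((s₁.setVar 18 v).setVar 19 t).setIdx 22 e 0 (mult e)) := by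
      refine hf₁.trans ⟨fun z hz => ?_, fun a ha => ?_, fun _ _ => rfl⟩
      · simp [show z ≠ 18 by omega, show z ≠ 19 by omega]
      · funext i j
        simp [show a ≠ 22 by omega]
    rw [wp_seq, wp_setVar]
    simp only [IExp.eval, i1, g14]
    rw [wp_seq, wp_setVar]
    simp only [IExp.eval, Memory.setVar_var, Memory.setVar_idx, reduceIte, g12]
    rw [wp_seq, wp_ite]
    have hmu : mult e = if v < M then s.idx 5 v 0 else s.idx 6 (v - M) 0 := rfl
    have key := hstart _ hset' (by simp [i1]) (by simp) (by simp) (by simp [i2])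
      (fun e' he' => ⟨by funext k; simp, by simp, by simp [he'.ne]⟩) (by funext r k; simp) (by simp)
    by_cases hc : v < M
    · rw [if_pos (by simp [hf₁.var 1 (by norm_num), h1, hc])]
      rw [if_pos hc] at hmu
      rw [hmu] at key
      simp only [wp_setIdx, IExp.eval, Memory.setVar_var, Memory.setVar_idx, Nat.reduceEqDiff,
        reduceIte, i1, hf₁.idx 5 (by norm_num)]
      refine key.mono ?_
      rintro n s' ⟨hn, k1, k2, k3⟩
      simp only [IExp.cost, BExp.cost]
      refine ⟨?_, k1, k2, k3⟩
      rw [add_mul, one_mul]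
      omega
    · rw [if_neg (by simpa [hf₁.var 1 (by norm_num), h1] using hc)]
      rw [if_neg hc] at hmu
      rw [hmu] at key
      simp only [wp_setIdx, IExp.eval, Memory.setVar_var, Memory.setVar_idx, Nat.reduceEqDiff,
        reduceIte, i1, hf₁.idx 6 (by norm_num), hf₁.var 1 (by norm_num), h1]
      refine key.mono ?_
      rintro n s' ⟨hn, k1, k2, k3⟩
      simp only [IExp.cost, BExp.cost]
      refine ⟨?_, k1, k2, k3⟩
      rw [add_mul, one_mul]
      omega
  · rintro s' hf ⟨i1, i2, -⟩
    simp [i1, i2]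
  · rintro n s' ⟨hn, ⟨i1, i2, i3⟩, -⟩
    simp only [BExp.cost, IExp.cost] at hn ⊢
    exact ⟨by omega, i2, i3⟩

/-! ### Rooted trees -/

section Rooted

variable {V ι : Type*} [Fintype ι] {G : SimpleGraph V} {D : TreeDecomposition G ι} (L : Listing D)

/-- All edges of the tree join a node to its parent. -/
theorem Listing.eq_parent_of_adj {a b : Fin (Fintype.card ι)}
    (h : D.tree.Adj (L.node a) (L.node b)) :
    (a.val ≠ 0 ∧ L.parent a = b) ∨ (b.val ≠ 0 ∧ L.parent b = a) := by
  classical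
  set S : Finset (Fin (Fintype.card ι)) := Finset.univ.filter fun t => t.val ≠ 0 with hS
  have hsub : S.image (fun t => s(L.node t, L.node (L.parent t))) ⊆ D.tree.edgeFinset := by
    intro e he
    obtain ⟨t, ht, rfl⟩ := Finset.mem_image.mp he
    rw [SimpleGraph.mem_edgeFinset, SimpleGraph.mem_edgeSet]
    exact L.parent_adj t (Finset.mem_filter.mp ht).2
  have hinj : Set.InjOn (fun t => s(L.node t, L.node (L.parent t))) (S : Set _) := by
    intro i hi j hj hij
    have hi' := L.parent_lt i (Finset.mem_filter.mp hi).2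
    have hj' := L.parent_lt j (Finset.mem_filter.mp hj).2
    rcases Sym2.eq_iff.mp hij with ⟨h1, -⟩ | ⟨h1, h2⟩
    · exact L.node.injective h1
    · have h1 := L.node.injective h1
      have h2 := L.node.injective h2
      rw [← h1] at hj'
      rw [h2] at hi'
      exact absurd (hi'.trans hj') (lt_irrefl _)
  have hcard : S.card + 1 = Fintype.card ι := by
    have hpos : 0 < Fintype.card ι := a.pos
    have : S = Finset.univ.erase ⟨0, hpos⟩ := by
      ext t
      simp [hS, Fin.ext_iff]
    rw [this, Finset.card_erase_of_mem (Finset.mem_univ _), Finset.card_univ, Fintype.card_fin]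
    omega
  -- The pairs of a node and its parent are distinct edges, one for each node but the first. A tree
  -- with n nodes has n - 1 edges, so there are no others.
  have heq : S.image (fun t => s(L.node t, L.node (L.parent t))) = D.tree.edgeFinset := by
    refine Finset.eq_of_subset_of_card_le hsub ?_
    rw [Finset.card_image_of_injOn hinj]
    have := D.isTree.card_edgeFinset
    omega
  have hmem : s(L.node a, L.node b) ∈ D.tree.edgeFinset := by
    rw [SimpleGraph.mem_edgeFinset]
    exact h
  rw [← heq] at hmem
  obtain ⟨t, ht, hst⟩ := Finset.mem_image.mp hmem
  have ht' := (Finset.mem_filter.mp ht).2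
  rcases Sym2.eq_iff.mp hst with ⟨h1, h2⟩ | ⟨h1, h2⟩
  · have h1 := L.node.injective h1
    have h2 := L.node.injective h2
    subst h1
    exact Or.inl ⟨ht', h2⟩
  · have h1 := L.node.injective h1
    have h2 := L.node.injective h2
    subst h1
    exact Or.inr ⟨ht', h2⟩

/-- The nodes containing `x` are connected, and the only edge leaving the descendants of `t` joins
`t` to its parent. A path from `t` to the earlier node `t'`, which is not a descendant, must use
this edge. -/
theorem Listing.mem_bag_parent {t t' : Fin (Fintype.card ι)} {x : V} (ht : x ∈ D.bag (L.node t))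
    (ht' : x ∈ D.bag (L.node t')) (hlt : t' < t) : x ∈ D.bag (L.node (L.parent t)) := by
  set r : Fin (Fintype.card ι) → Fin (Fintype.card ι) → Prop :=
    fun a b => a.val ≠ 0 ∧ L.parent a = b with hr
  have hle : ∀ a, Relation.ReflTransGen r a t → t ≤ a := by
    intro a h
    induction h using Relation.ReflTransGen.head_induction_on with
    | refl => exact le_rfl
    | head h _ ih =>
      have := L.parent_lt _ h.1
      rw [h.2] at this
      exact ih.trans this.le
  obtain ⟨p⟩ := (D.subtree x).preconnected ⟨L.node t, ht⟩ ⟨L.node t', ht'⟩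
  -- The path lies within the nodes containing `x`, so both ends of the dart where it leaves the
  -- descendants of `t` contain `x`.
  obtain ⟨d, -, h1, h2⟩ := p.exists_boundary_dart
    {z | Relation.ReflTransGen r (L.node.symm z.val) t} (by simp [Relation.ReflTransGen.refl])
    (fun h => by
      have := hle _ h
      simp only [Equiv.symm_apply_apply] at this
      exact absurd hlt (not_lt.mpr this))
  have hadj : D.tree.Adj d.fst.val d.snd.val := d.adj
  simp only [Set.mem_setOf_eq] at h1 h2
  have hmem : x ∈ D.bag d.snd.val := d.snd.prop
  obtain ⟨a, ha⟩ := L.node.surjective d.fst.val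
  obtain ⟨b, hb⟩ := L.node.surjective d.snd.val
  rw [← ha, ← hb] at hadj
  rw [← ha, Equiv.symm_apply_apply] at h1
  rw [← hb, Equiv.symm_apply_apply] at h2
  rw [← hb] at hmem
  rcases L.eq_parent_of_adj hadj with h | h
  · rcases Relation.ReflTransGen.cases_head h1 with rfl | ⟨c, hc, hct⟩
    · rw [h.2]
      exact hmem
    · rw [← hc.2, h.2] at hct
      exact absurd hct h2
  · exact absurd (Relation.ReflTransGen.head (show r b a from h) h1) h2

end Rooted

/-- If every vertex occurs in the parent of each of its nodes but the first, then of two vertices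
in a common bag the one that occurs first also belongs to the first bag of the other. -/
theorem mem_bag_top {nT : ℕ} {bag : ℕ → List ℕ} {parent top : ℕ → ℕ}
    (hp : ∀ t < nT, t ≠ 0 → parent t < t)
    (hup : ∀ t < nT, ∀ v ∈ bag t, ∀ t' < t, v ∈ bag t' → v ∈ bag (parent t))
    (htop : ∀ t < nT, ∀ v ∈ bag t, top v ≤ t ∧ v ∈ bag (top v)) {t : ℕ} (ht : t < nT) {u v : ℕ}
    (hu : u ∈ bag t) (hv : v ∈ bag t) (huv : top u ≤ top v) : u ∈ bag (top v) := by
  induction t using Nat.strong_induction_on with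
  | _ t ih =>
    obtain ⟨h1, h2⟩ := htop t ht v hv
    obtain ⟨h3, h4⟩ := htop t ht u hu
    -- Both vertices are followed upwards together: as long as `t` lies strictly below `top v`, it
    -- lies below `top u` as well, so the parent of `t` contains both.
    rcases h1.eq_or_lt with h | h
    · rw [h]
      exact hu
    · have hlt := hp t ht (by omega)
      exact ih (parent t) hlt (by omega) (hup t ht u hu (top u) (by omega) h4)
        (hup t ht v hv (top v) h h2)

/-- The bags `0, …, nT - 1` are arranged in a tree, in which the nodes of every vertex `v` form a
subtree with the root `top v`. -/
structure IsBagTree (nT : ℕ) (bag : ℕ → List ℕ) (parent top : ℕ → ℕ) : Prop where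
  nodup : ∀ t < nT, (bag t).Nodup
  parent_lt : ∀ t < nT, t ≠ 0 → parent t < t
  mem_parent : ∀ t < nT, ∀ v ∈ bag t, ∀ t' < t, v ∈ bag t' → v ∈ bag (parent t)
  top_mem : ∀ t < nT, ∀ v ∈ bag t, top v ≤ t ∧ v ∈ bag (top v)

/-- The vertices are numbered so that those with later first bags come first. -/
structure IsNumbering (nT : ℕ) (bag : ℕ → List ℕ) (top : ℕ → ℕ) (nv : ℕ) (vert index : ℕ → ℕ) :
    Prop where
  vert_mem : ∀ e < nv, top (vert e) < nT ∧ vert e ∈ bag (top (vert e))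
  index_vert : ∀ e < nv, index (vert e) = e
  index_lt : ∀ t < nT, ∀ v ∈ bag t, index v < nv
  vert_index : ∀ t < nT, ∀ v ∈ bag t, vert (index v) = v
  anti : ∀ e e', e ≤ e' → e' < nv → top (vert e') ≤ top (vert e)

/-- The properties of the two index arrays in the memory, freed from the lists they were built from.
-/
theorem Numbered.isNumbering {s : Memory} {nT : ℕ} {bag : ℕ → List ℕ} {parent top : ℕ → ℕ}
    (hT : IsBagTree nT bag parent top) (h : Numbered s (vertexList top bag nT nT)) :
    IsNumbering nT bag top (vertexList top bag nT nT).length (fun e => s.idx 14 e 0)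
      fun v => s.idx 13 v 0 := by
  have hmem : ∀ v, v ∈ vertexList top bag nT nT ↔ top v < nT ∧ v ∈ bag (top v) := by
    intro v
    rw [mem_vertexList le_rfl]
    simp
  have hL : ∀ t < nT, ∀ v ∈ bag t, v ∈ vertexList top bag nT nT := by
    intro t ht v hv
    obtain ⟨h1, h2⟩ := hT.top_mem t ht v hv
    exact (hmem v).mpr ⟨by omega, h2⟩
  have hpw := vertexList_pairwise (top := top) (bag := bag) (nT := nT) le_rfl
  set L := vertexList top bag nT nT
  have hvert : ∀ e (he : e < L.length), s.idx 14 e 0 = L[e] := h.vertex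
  constructor
  · intro e he
    simp only [hvert e he]
    exact (hmem _).mp (List.getElem_mem he)
  · intro e he
    simp only [hvert e he, h.index e he]
  · intro t ht v hv
    obtain ⟨i, hi, rfl⟩ := List.getElem_of_mem (hL t ht v hv)
    simpa only [h.index i hi] using hi
  · intro t ht v hv
    obtain ⟨i, hi, rfl⟩ := List.getElem_of_mem (hL t ht v hv)
    simp only [h.index i hi, hvert i hi]
  · intro e e' hle he'
    simp only [hvert e' he', hvert e (by omega)]
    rcases hle.eq_or_lt with rfl | hlt
    · exact le_rfl
    · exact List.pairwise_iff_getElem.mp hpw e e' (by omega) he' hlt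

/-! ### The perfect elimination order of a bag tree -/

section

variable {nT nv : ℕ} {bag : ℕ → List ℕ} {parent top vert index : ℕ → ℕ}

/-- The earlier of two vertices has the deeper top. If they share any bag, they therefore share the
first bag of the earlier one, which is where its neighbors are looked up. -/
theorem IsNumbering.mem_laterIndices (hN : IsNumbering nT bag top nv vert index)
    (hT : IsBagTree nT bag parent top) {e u t : ℕ} (heu : e < u) (hu : u < nv) (ht : t < nT)
    (he' : vert e ∈ bag t) (hu' : vert u ∈ bag t) :
    u ∈ laterIndices index e (bag (top (vert e))) := by
  have h := mem_bag_top hT.parent_lt hT.mem_parent hT.top_mem ht hu' he'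
    (hN.anti e u heu.le hu)
  rw [laterIndices, List.mem_filter, List.mem_map]
  exact ⟨⟨vert u, h, hN.index_vert u hu⟩, by simpa using heu⟩

theorem IsNumbering.of_mem_laterIndices (hN : IsNumbering nT bag top nv vert index) {e u : ℕ}
    (he : e < nv) (hu : u ∈ laterIndices index e (bag (top (vert e)))) :
    e < u ∧ u < nv ∧ vert u ∈ bag (top (vert e)) := by
  rw [laterIndices, List.mem_filter, List.mem_map] at hu
  obtain ⟨⟨v, hv, rfl⟩, h⟩ := hu
  have ht := (hN.vert_mem e he).1
  exact ⟨by simpa using h, hN.index_lt _ ht v hv, by rwa [hN.vert_index _ ht v hv]⟩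

theorem IsNumbering.nodup_laterIndices (hN : IsNumbering nT bag top nv vert index)
    (hT : IsBagTree nT bag parent top) {e : ℕ} (he : e < nv) :
    (laterIndices index e (bag (top (vert e)))).Nodup := by
  have ht := (hN.vert_mem e he).1
  refine List.Nodup.filter _ (List.Nodup.map_on (fun u hu v hv huv => ?_) (hT.nodup _ ht))
  rw [← hN.vert_index _ ht u hu, huv, hN.vert_index _ ht v hv]

theorem IsNumbering.isEliminationOrder (hN : IsNumbering nT bag top nv vert index)
    (hT : IsBagTree nT bag parent top) :
    IsEliminationOrder nv fun e => laterIndices index e (bag (top (vert e))) where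
  nodup e he := hN.nodup_laterIndices hT he
  lt e he u hu := by
    obtain ⟨h1, h2, -⟩ := hN.of_mem_laterIndices he hu
    exact ⟨h1, h2⟩
  chordal e he u hu v hv huv := by
    obtain ⟨h1, h2, h3⟩ := hN.of_mem_laterIndices he hu
    obtain ⟨h4, h5, h6⟩ := hN.of_mem_laterIndices he hv
    exact hN.mem_laterIndices hT huv h5 (hN.vert_mem e he).1 h3 h6

/-- The bag also contains `e` itself; this turns the bag size, at most the width plus one, into at
most as many later neighbors as the width. -/
theorem IsNumbering.length_laterIndices_lt (hN : IsNumbering nT bag top nv vert index)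
    (hT : IsBagTree nT bag parent top) {e : ℕ} (he : e < nv) :
    (laterIndices index e (bag (top (vert e)))).length < (bag (top (vert e))).length := by
  have hnd : (e :: laterIndices index e (bag (top (vert e)))).Nodup :=
    List.nodup_cons.mpr ⟨fun h => (hN.of_mem_laterIndices he h).1.false,
      hN.nodup_laterIndices hT he⟩
  have := length_le_of_subset (K := (bag (top (vert e))).map index) hnd (by
    intro v hv
    rcases List.mem_cons.mp hv with rfl | hv
    · exact List.mem_map.mpr ⟨vert v, (hN.vert_mem v he).2, hN.index_vert v he⟩
    · exact (List.mem_filter.mp hv).1)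
  simpa using this

/-- The loop hafnian of the matrix of label weights is what remains to be computed at the start of
the elimination. -/
theorem pending_one_eq {b : ℕ → ℕ → ℂ} {R : ℕ → List ℕ} {m : ℕ → ℕ} {Y : Type*} [Fintype Y]
    {ρ : Y → ℕ} {w : Sym2 Y → ℂ} (hb : ∀ u v, b u v = b v u) (hR : IsEliminationOrder nv R)
    (hbR : ∀ e u, e < u → u < nv → b e u ≠ 0 → u ∈ R e) (hρ : ∀ y, ρ y < nv)
    (hm : ∀ e < nv, m e = (Finset.univ.filter fun y => ρ y = e).card)
    (hw : ∀ i j, w s(i, j) = b (ρ i) (ρ j)) :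
    pending b R 1 nv m 0 = loopHafnianOn w Finset.univ := by
  classical
  have hfac : ∀ f, attachedFactor b R 1 f = localFactor b f (R f).toFinset := by
    intro f
    simp [attachedFactor]
  -- Every index has a label less than `nv`, and `m` counts the indices of each label, so the
  -- coefficient to be found is the one at the exponents `m`.
  have hcount : labelCount ρ Finset.univ = exponentsFrom nv m 0 := by
    ext u
    rw [labelCount_apply, exponentsFrom_apply]
    split_ifs with h
    · rw [hm u h.2]
    · rw [Finset.card_eq_zero, Finset.filter_eq_empty_iff]
      rintro y - rfl
      exact h ⟨Nat.zero_le _, hρ y⟩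
  have hZ : MvPowerSeries.coeff 0
      (∏ e ∈ Finset.range nv, localFactor b e (R e).toFinset) = 1 := by
    rw [MvPowerSeries.coeff_zero_eq_constantCoeff_apply, map_prod]
    refine Finset.prod_eq_one fun e _ => ?_
    rw [← MvPowerSeries.coeff_zero_eq_constantCoeff_apply, coeff_localFactor_zero]
  rw [loopHafnianOn_eq_coeff ρ hρ hw hZ (fun v hv => pderiv_prod_localFactor
    (R := fun e => (R e).toFinset) hb
    (fun e he u hu => hR.lt e he u (List.mem_toFinset.mp hu))
    (fun e u h1 h2 h3 => List.mem_toFinset.mpr (hbR e u h1 h2 h3)) hv), hcount, pending,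
    ← Finset.range_eq_Ico, factorialProd]
  push_cast
  congr 1
  · refine Finset.prod_congr rfl fun e he => ?_
    rw [exponentsFrom_apply, if_pos ⟨Nat.zero_le _, Finset.mem_range.mp he⟩]
  · rw [Finset.prod_congr rfl fun f _ => hfac f]

end

/-! ### Summation of the costs and correctness of the program -/

/-- A bound for the time per vertex and multiplicity. -/
def unitCost (c W : ℕ) : ℕ :=
  16000 * (c + 1) ^ W * (W + 2) * (Nat.log 2 (8 * (c + 1) ^ (W + 1) * (W + 2)) + 1)

theorem mulCost_le_unitCost {m c W : ℕ} (hm : m ≤ c) :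
    mulCost ((m + 1) * (c + 1) ^ W) (W + 1) ≤ (m + 1) * unitCost c W := by
  have h1 : 8 * ((m + 1) * (c + 1) ^ W) * (W + 1 + 1) ≤ 8 * (c + 1) ^ (W + 1) * (W + 2) := by
    rw [pow_succ, mul_comm ((c + 1) ^ W) (c + 1)]
    gcongr
  calc mulCost ((m + 1) * (c + 1) ^ W) (W + 1)
      ≤ 2000 * (8 * ((m + 1) * (c + 1) ^ W) * (W + 1 + 1) *
          (Nat.log 2 (8 * (c + 1) ^ (W + 1) * (W + 2)) + 1)) := by
        rw [mulCost]
        gcongr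
    _ = (m + 1) * unitCost c W := by
        rw [unitCost]
        ring

/-- If c is small compared with the width, every multiplicity is replaced by c and the numbers of
children are summed, with total at most `nv`. Otherwise the number of products per vertex is bounded
by the number of slots and the multiplicities are summed, with total `k`. Since every multiplicity
is positive, `nv ≤ k` in both cases. -/
theorem sum_vertexCost_le {nv c W k : ℕ} {m : ℕ → ℕ} {R : ℕ → List ℕ} (hm : ∀ e < nv, m e ≤ c)
    (hm1 : ∀ e < nv, 1 ≤ m e) (hk : ∑ e ∈ Finset.range nv, m e = k) :
    ∑ e ∈ Finset.range nv, (vertexCost nv m R c W e + 10) ≤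
      4 * k * unitCost c W * min (c + 1) (W + 3) + 10 * k := by
  have hnv : nv ≤ k := by
    rw [← hk]
    calc nv = ∑ e ∈ Finset.range nv, 1 := by simp
      _ ≤ _ := Finset.sum_le_sum fun e he => hm1 e (Finset.mem_range.mp he)
  have hcost : ∀ e < nv, vertexCost nv m R c W e ≤
      2 * (min (childCount nv R e) (W + 2) + 1) * ((m e + 1) * unitCost c W) := fun e he =>
    Nat.mul_le_mul_left _ (mulCost_le_unitCost (hm e he))
  rw [Finset.sum_add_distrib, Finset.sum_const, Finset.card_range, smul_eq_mul]
  refine add_le_add ?_ (by omega)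
  rcases le_total (c + 1) (W + 3) with h | h
  · rw [min_eq_left h]
    calc ∑ e ∈ Finset.range nv, vertexCost nv m R c W e
        ≤ ∑ e ∈ Finset.range nv, 2 * (c + 1) * unitCost c W * (childCount nv R e + 1) := by
          refine Finset.sum_le_sum fun e he => (hcost e (Finset.mem_range.mp he)).trans ?_
          calc 2 * (min (childCount nv R e) (W + 2) + 1) * ((m e + 1) * unitCost c W)
              ≤ 2 * (childCount nv R e + 1) * ((c + 1) * unitCost c W) := by
                gcongr
                · exact min_le_left _ _
                · exact hm e (Finset.mem_range.mp he)
            _ = _ := by ring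
      _ = 2 * (c + 1) * unitCost c W * (∑ e ∈ Finset.range nv, childCount nv R e + nv) := by
          rw [← Finset.mul_sum, Finset.sum_add_distrib]
          simp
      _ ≤ 2 * (c + 1) * unitCost c W * (k + k) := by
          gcongr
          exact (sum_childCount_le nv R).trans hnv
      _ = 4 * k * unitCost c W * (c + 1) := by ring
  · rw [min_eq_right h]
    calc ∑ e ∈ Finset.range nv, vertexCost nv m R c W e
        ≤ ∑ e ∈ Finset.range nv, 2 * (W + 3) * unitCost c W * (m e + 1) := by
          refine Finset.sum_le_sum fun e he => (hcost e (Finset.mem_range.mp he)).trans ?_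
          calc 2 * (min (childCount nv R e) (W + 2) + 1) * ((m e + 1) * unitCost c W)
              ≤ 2 * (W + 2 + 1) * ((m e + 1) * unitCost c W) := by
                gcongr
                exact min_le_right _ _
            _ = _ := by ring
      _ = 2 * (W + 3) * unitCost c W * (k + nv) := by
          rw [← Finset.mul_sum, Finset.sum_add_distrib, hk]
          simp
      _ ≤ 2 * (W + 3) * unitCost c W * (k + k) := by gcongr
      _ = 4 * k * unitCost c W * (W + 3) := by ring

/-- Computes the loop hafnian with multiplicities of the matrix of vertex weights. -/
def countMatchings (flag : ℕ) : Program :=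
  .seq copyBags <| .seq (.setVar 10 (.lit flag)) <| .seq numberVertices <|
    .seq findNeighbors eliminate

/-- The vertices are given by their codes in memory, `Y` is the set of indices of the matrix with
repetitions, and `ρ` labels each index with its vertex. The size of `Y` is the sum of the
multiplicities, which is why it governs the time. -/
theorem wp_countMatchings {s : Memory} {nT M W c flag : ℕ} {rows cols : ℕ → List ℕ}
    {parent : ℕ → ℕ} {Y : Type*} [Fintype Y] {ρ : Y → ℕ} {w : Sym2 Y → ℂ}
    (hs : HoldsBags s nT M rows cols)
    (hnd : ∀ t < nT, (bagOf M rows cols t).Nodup)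
    (hlen : ∀ t < nT, (bagOf M rows cols t).length ≤ W + 1)
    (hp : ∀ t < nT, t ≠ 0 → parent t < t)
    (hup : ∀ t < nT, ∀ v ∈ bagOf M rows cols t, ∀ t' < t, v ∈ bagOf M rows cols t' →
      v ∈ bagOf M rows cols (parent t))
    (hidx : ∀ a, 27 ≤ a → ∀ i j, s.idx a i j = 0) (hnum : ∀ a, 27 ≤ a → ∀ i j, s.num a i j = 0)
    (hsymm : ∀ u v, vertexWeight flag (s.num 0) M u v = vertexWeight flag (s.num 0) M v u)
    (hedge : ∀ u v, u ≠ v → vertexWeight flag (s.num 0) M u v ≠ 0 →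
      (∃ t < nT, u ∈ bagOf M rows cols t) → (∃ t < nT, v ∈ bagOf M rows cols t) →
      ∃ t < nT, u ∈ bagOf M rows cols t ∧ v ∈ bagOf M rows cols t)
    (hρ : ∀ y, ∃ t < nT, ρ y ∈ bagOf M rows cols t)
    (hmult : ∀ t < nT, ∀ v ∈ bagOf M rows cols t,
      (if v < M then s.idx 5 v 0 else s.idx 6 (v - M) 0) =
        (Finset.univ.filter fun y => ρ y = v).card)
    (hpos : ∀ t < nT, ∀ v ∈ bagOf M rows cols t, ∃ y, ρ y = v)
    (hc : ∀ v, (Finset.univ.filter fun y => ρ y = v).card ≤ c)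
    (hw : ∀ i j, w s(i, j) = vertexWeight flag (s.num 0) M (ρ i) (ρ j)) :
    WP (countMatchings flag) s fun t s' =>
      t ≤ nT * (100 * W + 220) + Fintype.card Y * (100 * W + 320) +
        4 * Fintype.card Y * unitCost c W * min (c + 1) (W + 3) + 100 ∧
      s'.num 1 0 0 = loopHafnianOn w Finset.univ := by
  set bag := bagOf M rows cols with hbag
  simp only [countMatchings, wp_seq, wp_setVar]
  refine WP.mono ((wp_copyBags hs hlen).of_writesBelow 27 (by decide)) ?_
  rintro t₁ s₁ ⟨⟨ht₁, a1, a2, -⟩, a3⟩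
  set s₂ := s₁.setVar 10 (IExp.eval s₁ (.lit flag)) with hs₂
  have f₂ : Frame 10 s s₂ := a2.trans ⟨fun x hx => by simp [hs₂, show x ≠ 10 by omega],
    fun _ _ => rfl, fun _ _ => rfl⟩
  have hT₂ : HoldsTops s₂ nT bag 0 := ⟨a1.length, a1.list, a1.top⟩
  set top : ℕ → ℕ := fun v => s₂.idx 12 v 0 with htop
  have hT : IsBagTree nT bag parent top := by
    refine ⟨hnd, hp, hup, fun t ht v hv => ?_⟩
    exact (hT₂.top t (Nat.zero_le _) ht v hv).2
  refine WP.mono ((wp_numberVertices hT₂ (by rw [f₂.var 0 (by norm_num), hs.nodes])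
    (fun v => rfl) hnd hlen).of_writesBelow 27 (by decide)) ?_
  rintro t₂ s₃ ⟨⟨ht₂, b1, b2, -⟩, b3⟩
  have hN := b1.isNumbering hT
  set nv := (vertexList top bag nT nT).length with hnv
  set vert : ℕ → ℕ := fun e => s₃.idx 14 e 0 with hvert
  set index : ℕ → ℕ := fun v => s₃.idx 13 v 0 with hindex
  have f₃ : Frame 10 s s₃ := f₂.trans (b2.mono (by norm_num))
  have hT₃ : HoldsTops s₃ nT bag 0 := by
    refine ⟨?_, ?_, ?_⟩
    · rw [b2.idx 11 (by norm_num)]; exact hT₂.length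
    · rw [b2.idx 10 (by norm_num)]; exact hT₂.list
    · rw [b2.idx 12 (by norm_num)]; exact hT₂.top
  have hmem : ∀ v, v ∈ vertexList top bag nT nT ↔ top v < nT ∧ v ∈ bag (top v) := by
    intro v
    rw [mem_vertexList le_rfl]
    simp
  refine WP.mono ((wp_findNeighbors hT₃ b1 (fun v => by rw [b2.idx 12 (by norm_num)])
    (by rw [f₃.var 1 (by norm_num), hs.dim]) (flag := flag)
    (by rw [b2.var 10 (by norm_num)]; simp [hs₂, IExp.eval]) rfl hmem hlen).of_writesBelow 27
      (by decide)) ?_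
  rintro t₃ s₄ ⟨⟨ht₃, c1, c2⟩, c3⟩
  rw [f₃.idx 5 (by norm_num), f₃.idx 6 (by norm_num), f₃.num 0 (by norm_num)] at c2
  have hidx₄ : ∀ a, 27 ≤ a → s₄.idx a = s.idx a ∧ s₄.num a = s.num a := by
    intro a ha
    refine ⟨(c3 a ha).1.trans ((b3 a ha).1.trans ?_), (c3 a ha).2.trans ((b3 a ha).2.trans ?_)⟩
    · exact (a3 a ha).1
    · exact (a3 a ha).2
  set m : ℕ → ℕ := fun e => if s₃.idx 14 e 0 < M then s.idx 5 (s₃.idx 14 e 0) 0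
    else s.idx 6 (s₃.idx 14 e 0 - M) 0 with hm
  have hmv : ∀ e < nv, m e = (Finset.univ.filter fun y => ρ y = vert e).card := by
    intro e he
    obtain ⟨h1, h2⟩ := hN.vert_mem e he
    exact hmult _ h1 _ h2
  have hmc : ∀ e < nv, m e ≤ c := fun e he => (hmv e he).trans_le (hc _)
  have hm1 : ∀ e < nv, 1 ≤ m e := by
    intro e he
    obtain ⟨h1, h2⟩ := hN.vert_mem e he
    obtain ⟨y, hy⟩ := hpos _ h1 _ h2
    rw [hmv e he]
    exact Finset.card_pos.mpr ⟨y, by simpa using hy⟩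
  have hiy : ∀ y, index (ρ y) < nv ∧ vert (index (ρ y)) = ρ y := by
    intro y
    obtain ⟨t, ht, h⟩ := hρ y
    exact ⟨hN.index_lt t ht _ h, hN.vert_index t ht _ h⟩
  have hmi : ∀ e < nv, m e = (Finset.univ.filter fun y => index (ρ y) = e).card := by
    intro e he
    rw [hmv e he]
    congr 1
    ext y
    rw [Finset.mem_filter, Finset.mem_filter]
    refine and_congr_right fun _ => ⟨fun h => ?_, fun h => ?_⟩
    · rw [h]
      exact hN.index_vert e he
    · rw [← h, (hiy y).2]
  have hsum : ∑ e ∈ Finset.range nv, m e = Fintype.card Y := by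
    rw [← Finset.card_univ, Finset.card_eq_sum_card_fiberwise (f := fun y => index (ρ y))
      (t := Finset.range nv) (fun y _ => Finset.mem_coe.mpr (Finset.mem_range.mpr (hiy y).1))]
    exact Finset.sum_congr rfl fun e he => hmi e (Finset.mem_range.mp he)
  have hnvk : nv ≤ Fintype.card Y := by
    rw [← hsum]
    calc nv = ∑ e ∈ Finset.range nv, 1 := by simp
      _ ≤ _ := Finset.sum_le_sum fun e he => hm1 e (Finset.mem_range.mp he)
  have hR := hN.isEliminationOrder hT
  refine WP.mono (wp_eliminate (W := W) (c := c) c2 hR (fun e he => ?_) hmc c1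
    (fun v => by rw [(hidx₄ 28 (by norm_num)).1, hidx 28 (by norm_num)])
    (fun f u => by rw [(hidx₄ 30 (by norm_num)).1, hidx 30 (by norm_num)])
    (fun r j => by rw [(hidx₄ 60 (by norm_num)).2, hnum 60 (by norm_num)])) ?_
  · have h1 := hN.length_laterIndices_lt hT he
    have h2 := hlen _ (hN.vert_mem e he).1
    exact Nat.le_of_lt_succ (h1.trans_le h2)
  · rintro t₄ s₅ ⟨ht₄, d1⟩
    constructor
    · have h1 := sum_vertexCost_le (W := W) (R := fun e => laterIndices index e (bag (top (vert e))))
        hmc hm1 hsum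
      have h2 : nv * (100 * (W + 1) + 200) ≤ Fintype.card Y * (100 * (W + 1) + 200) :=
        Nat.mul_le_mul_right _ hnvk
      have h3 : t₄ ≤ 4 * Fintype.card Y * unitCost c W * min (c + 1) (W + 3) +
          10 * Fintype.card Y + 30 := ht₄.trans (Nat.add_le_add_right h1 30)
      have h4 : t₃ ≤ Fintype.card Y * (100 * (W + 1) + 200) + 10 :=
        ht₃.trans (Nat.add_le_add_right h2 10)
      simp only [IExp.cost]
      generalize 4 * Fintype.card Y * unitCost c W * min (c + 1) (W + 3) = z at h3 ⊢
      generalize Fintype.card Y = k at h4 h3 ⊢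
      clear * - ht₁ ht₂ h3 h4
      rw [mul_add] at ht₁ ht₂ h4 ⊢
      linarith
    · rw [d1]
      refine pending_one_eq (ρ := fun y => index (ρ y)) (fun u v => hsymm _ _) hR
        (fun e u heu hu hne => ?_) (fun y => (hiy y).1) hmi (fun i j => ?_)
      · have he : e < nv := heu.trans hu
        obtain ⟨t, ht, h1, h2⟩ := hedge (vert e) (vert u) (fun h => by
          have := congrArg index h
          rw [hN.index_vert e he, hN.index_vert u hu] at this
          omega) hne ⟨_, hN.vert_mem e he⟩ ⟨_, hN.vert_mem u hu⟩
        exact hN.mem_laterIndices hT heu hu ht h1 h2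
      · have h1 := (hiy i).2
        have h2 := (hiy j).2
        simp only [hvert] at h1 h2
        rw [hw, h1, h2]

/-! ## Bounds for the running time -/

theorem log_le_of_le_two_pow {n a : ℕ} (h : n ≤ 2 ^ a) : Nat.log 2 n ≤ a :=
  (Nat.log_mono_right h).trans (Nat.log_pow (by norm_num) a).le

theorem add_two_le_two_pow (W : ℕ) : W + 2 ≤ 2 ^ (W + 1) := Nat.lt_two_pow_self

/-- For c = 1 the logarithm is linear in the width, as is the number of variables; 384000 is 16000 ·
3 · 8. -/
theorem unitCost_one_le (W : ℕ) : unitCost 1 W ≤ 384000 * (max W 1) ^ 2 * 2 ^ W := by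
  have h1 : 8 * (1 + 1) ^ (W + 1) * (W + 2) ≤ 2 ^ (2 * W + 5) := by
    calc 8 * (1 + 1) ^ (W + 1) * (W + 2) ≤ 8 * (1 + 1) ^ (W + 1) * 2 ^ (W + 1) :=
        Nat.mul_le_mul_left _ (add_two_le_two_pow W)
      _ = 2 ^ (2 * W + 5) := by ring
  have h2 := log_le_of_le_two_pow h1
  have hw : W ≤ max W 1 := le_max_left _ _
  have hw1 : 1 ≤ max W 1 := le_max_right _ _
  set w := max W 1
  calc unitCost 1 W ≤ 16000 * 2 ^ W * (3 * w) * (8 * w) := by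
        rw [unitCost]
        refine Nat.mul_le_mul (Nat.mul_le_mul_left _ (by omega)) (by omega)
    _ = _ := by ring

/-- A tree has at least one node, so the additive constant is absorbed in the term for the nodes.
The bound `2 * N` allows for the rows and the columns of a permanent. -/
theorem linear_time_le {nT y N W : ℕ} (hn : 1 ≤ nT) (hy : y ≤ 2 * N) {X : ℕ} (hX : 1 ≤ X) :
    nT * (100 * W + 220) + y * (100 * W + 320) + 100 ≤ 840 * (N + nT) * max W 1 * X := by
  have hw : W ≤ max W 1 := le_max_left _ _
  have hw1 : 1 ≤ max W 1 := le_max_right _ _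
  set w := max W 1
  have h1 : 1 * 1 ≤ nT * w := Nat.mul_le_mul hn hw1
  calc nT * (100 * W + 220) + y * (100 * W + 320) + 100
      ≤ nT * (320 * w) + 2 * N * (420 * w) + 100 * (nT * w) := by
        refine Nat.add_le_add (Nat.add_le_add ?_ ?_) (by omega)
        · exact Nat.mul_le_mul_left _ (by omega)
        · exact Nat.mul_le_mul hy (by omega)
    _ ≤ 840 * (N + nT) * w := by
        nlinarith
    _ ≤ 840 * (N + nT) * w * X := Nat.le_mul_of_pos_right _ hX

theorem time_le_of_one {nT y N W : ℕ} (hn : 1 ≤ nT) (hy : y ≤ 2 * N) :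
    nT * (100 * W + 220) + y * (100 * W + 320) +
      4 * y * unitCost 1 W * min (1 + 1) (W + 3) + 100 ≤
      10 ^ 7 * (N + nT) * (max W 1) ^ 2 * 2 ^ W := by
  have hw1 : 1 ≤ max W 1 := le_max_right _ _
  have h1 := linear_time_le (W := W) hn hy (X := max W 1 * 2 ^ W)
    (Nat.mul_pos hw1 (by positivity))
  have h2 := unitCost_one_le W
  set w := max W 1
  have h3 : 4 * y * unitCost 1 W * min (1 + 1) (W + 3) ≤
      4 * (2 * N) * (384000 * w ^ 2 * 2 ^ W) * 2 := by
    gcongr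
    exact min_le_left _ _
  have h4 : 0 ≤ nT * w ^ 2 * 2 ^ W := Nat.zero_le _
  have h5 : 0 ≤ N * w ^ 2 * 2 ^ W := Nat.zero_le _
  nlinarith

/-- The cases W < 2 are checked directly. At W = 2 the claim is 80 ≤ 81, and from there on the left
side grows by a factor 2 (W + 4) / (W + 2) ≤ 3 in each step. -/
theorem quadratic_mul_two_pow_le (W : ℕ) : (W + 2) * (W + 3) * 2 ^ W ≤ 9 * 3 ^ W := by
  by_cases h : W < 2
  · interval_cases W <;> norm_num
  · push Not at h
    induction W, h using Nat.le_induction with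
    | base => norm_num
    | succ n hn ih =>
      calc (n + 1 + 2) * (n + 1 + 3) * 2 ^ (n + 1)
          = (n + 3) * (2 * (n + 4)) * 2 ^ n := by ring
        _ ≤ (n + 3) * (3 * (n + 2)) * 2 ^ n := 
          Nat.mul_le_mul_right _ (Nat.mul_le_mul_left _ (by omega))
        _ = 3 * ((n + 2) * (n + 3) * 2 ^ n) := by ring
        _ ≤ 3 * (9 * 3 ^ n) := by gcongr
        _ = 9 * 3 ^ (n + 1) := by ring

/-- For c ≥ 1 the ratio of 2c + 1 to c + 1 is at least 3/2, its value at c = 1, so the previous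
bound after division by 2^W suffices. -/
theorem quadratic_mul_pow_le {c : ℕ} (hc : 1 ≤ c) (W : ℕ) :
    (W + 2) * (W + 3) * (c + 1) ^ W ≤ 9 * (2 * c + 1) ^ W := by
  refine Nat.le_of_mul_le_mul_left ?_ (show 0 < 2 ^ W by positivity)
  calc 2 ^ W * ((W + 2) * (W + 3) * (c + 1) ^ W)
      = (W + 2) * (W + 3) * 2 ^ W * (c + 1) ^ W := by ring
    _ ≤ 9 * 3 ^ W * (c + 1) ^ W := Nat.mul_le_mul_right _ (quadratic_mul_two_pow_le W)
    _ = 9 * (3 * (c + 1)) ^ W := by rw [mul_pow, mul_assoc]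
    _ ≤ 9 * (2 * (2 * c + 1)) ^ W :=
        Nat.mul_le_mul_left _ (Nat.pow_le_pow_left (by omega) W)
    _ = 2 ^ W * (9 * (2 * c + 1) ^ W) := by rw [mul_pow]; ring

/-- The number of variables and the number of slots give a quadratic factor in W, absorbed by the
larger base; the remaining logarithm gives the factors w and log c. The constant is 16000 · 9 · 8.
-/
theorem unitCost_mul_le {c : ℕ} (hc : 1 ≤ c) (W : ℕ) : unitCost c W * (W + 3) ≤
    1152000 * max W 1 * (2 * c + 1) ^ W * (Nat.log 2 c + 1) := by
  set l := Nat.log 2 c with hl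
  have h0 : c + 1 ≤ 2 ^ (l + 1) := Nat.lt_pow_succ_log_self (by norm_num) c
  have h1 : 8 * (c + 1) ^ (W + 1) * (W + 2) ≤ 2 ^ (3 + (l + 1) * (W + 1) + (W + 1)) := by
    calc 8 * (c + 1) ^ (W + 1) * (W + 2) ≤ 8 * (2 ^ (l + 1)) ^ (W + 1) * 2 ^ (W + 1) :=
          Nat.mul_le_mul (Nat.mul_le_mul_left _ (Nat.pow_le_pow_left h0 _)) (add_two_le_two_pow W)
      _ = _ := by rw [← pow_mul]; ring
  have h2 := log_le_of_le_two_pow h1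
  have hw : W ≤ max W 1 := le_max_left _ _
  have hw1 : 1 ≤ max W 1 := le_max_right _ _
  have h3 := quadratic_mul_pow_le hc W
  set w := max W 1
  have h4 : 3 + (l + 1) * (W + 1) + (W + 1) + 1 ≤ 8 * w * (l + 1) := by
    nlinarith [Nat.zero_le (l * w), Nat.mul_le_mul_left l hw, Nat.mul_le_mul_left l hw1]
  calc unitCost c W * (W + 3) = 16000 * ((W + 2) * (W + 3) * (c + 1) ^ W) *
        (Nat.log 2 (8 * (c + 1) ^ (W + 1) * (W + 2)) + 1) := by rw [unitCost]; ring
    _ ≤ 16000 * (9 * (2 * c + 1) ^ W) * (8 * w * (l + 1)) :=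
        Nat.mul_le_mul (Nat.mul_le_mul_left _ h3) (by omega)
    _ = _ := by ring

/-- The case c = 0 has to be separated, as the comparison of bases needs c ≥ 1; then k = 0 and no
multiplication is counted. The main term has the constant 8 · 1152000, and the rest of 10^7 covers
the linear terms. -/
theorem time_le {nT y k c W : ℕ} (hn : 1 ≤ nT) (hy : y ≤ 2 * k) (hc : c = 0 → k = 0) :
    nT * (100 * W + 220) + y * (100 * W + 320) +
      4 * y * unitCost c W * min (c + 1) (W + 3) + 100 ≤
      10 ^ 7 * (k + nT) * max W 1 * (2 * c + 1) ^ W * (Nat.log 2 c + 1) := by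
  set l := Nat.log 2 c + 1 with hl
  have h1 := linear_time_le (W := W) hn hy (X := (2 * c + 1) ^ W * l)
    (Nat.mul_pos (by positivity) (by omega))
  have h3 : 4 * y * unitCost c W * min (c + 1) (W + 3) ≤
      8 * k * (1152000 * max W 1 * (2 * c + 1) ^ W * l) := by
    rcases Nat.eq_zero_or_pos c with h | h
    · have := hc h
      have : y = 0 := by omega
      simp [this]
    · calc 4 * y * unitCost c W * min (c + 1) (W + 3) ≤ 4 * (2 * k) * unitCost c W * (W + 3) := by
            gcongr
            exact min_le_right _ _
        _ = 8 * k * (unitCost c W * (W + 3)) := by ring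
        _ ≤ _ := Nat.mul_le_mul_left _ (unitCost_mul_le h W)
  set w := max W 1
  have h4 : 0 ≤ nT * w * (2 * c + 1) ^ W * l := Nat.zero_le _
  have h5 : 0 ≤ k * w * (2 * c + 1) ^ W * l := Nat.zero_le _
  nlinarith

/-- With the maximum of c and 2, both the binary logarithm and 1 are at most the natural logarithm
divided by log 2, and 2 / log 2 < 3. -/
theorem log_add_one_le (c : ℕ) : ((Nat.log 2 c + 1 : ℕ) : ℝ) ≤ 3 * Real.log (max (c : ℝ) 2) := by
  have h2 := Real.log_two_gt_d9
  have hL : Real.log 2 ≤ Real.log (max (c : ℝ) 2) :=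
    Real.log_le_log (by norm_num) (le_max_right _ _)
  have h0 : 0 ≤ Real.log (max (c : ℝ) 2) := by linarith
  have h : (Nat.log 2 c : ℝ) * Real.log 2 ≤ Real.log (max (c : ℝ) 2) := by
    rcases Nat.eq_zero_or_pos c with rfl | hc
    · simp only [Nat.log_zero_right, Nat.cast_zero, zero_mul]
      simpa using h0
    · rw [← Real.log_pow]
      refine Real.log_le_log (by positivity) (le_trans ?_ (le_max_left _ _))
      exact_mod_cast Nat.pow_log_le_self 2 hc.ne'
  push_cast
  nlinarith

theorem cast_time_le_of_one {nT N W T : ℕ} (h : T ≤ 10 ^ 7 * (N + nT) * (max W 1) ^ 2 * 2 ^ W) :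
    (T : ℝ) ≤ 10 ^ 7 * ((N : ℝ) + nT) * (max (W : ℝ) 1) ^ 2 * 2 ^ W := by
  exact_mod_cast h

theorem cast_time_le {nT k c W T : ℕ}
    (h : T ≤ 10 ^ 7 * (k + nT) * max W 1 * (2 * c + 1) ^ W * (Nat.log 2 c + 1)) :
    (T : ℝ) ≤ 3 * 10 ^ 7 * ((k : ℝ) + nT) * max (W : ℝ) 1 * (2 * (c : ℝ) + 1) ^ W *
      Real.log (max (c : ℝ) 2) := by
  have h1 : (T : ℝ) ≤ 10 ^ 7 * ((k : ℝ) + nT) * max (W : ℝ) 1 * (2 * (c : ℝ) + 1) ^ W *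
      (Nat.log 2 c + 1 : ℕ) := by
    exact_mod_cast h
  refine h1.trans ?_
  calc _ ≤ 10 ^ 7 * ((k : ℝ) + nT) * max (W : ℝ) 1 * (2 * (c : ℝ) + 1) ^ W *
        (3 * Real.log (max (c : ℝ) 2)) := by
        gcongr
        exact log_add_one_le c
    _ = _ := by ring

/-! ## The input -/

theorem extendFin_val {n : ℕ} {β : Type*} (d : β) (f : Fin n → β) (i : Fin n) :
    extendFin d f i = f i := dif_pos i.isLt

theorem extendFin_of_lt {n : ℕ} {β : Type*} (d : β) (f : Fin n → β) {i : ℕ} (hi : i < n) :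
    extendFin d f i = f ⟨i, hi⟩ := dif_pos hi

section

variable {n M : ℕ} (parent : Fin n → Fin n) (rows cols : Fin n → List (Fin M))
  (rowMult colMult : Fin M → ℕ) (U : Matrix (Fin M) (Fin M) ℂ)

theorem inputMemory_idx_eq_zero {a : ℕ} (ha : 7 ≤ a) (i j : ℕ) :
    (inputMemory parent rows cols rowMult colMult U).idx a i j = 0 := by
  obtain ⟨b, rfl⟩ := Nat.exists_eq_add_of_le' ha
  rfl

theorem inputMemory_num_eq_zero {a : ℕ} (ha : 1 ≤ a) (i j : ℕ) :
    (inputMemory parent rows cols rowMult colMult U).num a i j = 0 := by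
  obtain ⟨b, rfl⟩ := Nat.exists_eq_add_of_le' ha
  rfl

theorem inputMemory_num_zero (i j : Fin M) :
    (inputMemory parent rows cols rowMult colMult U).num 0 i j = U i j := by
  change extendFin 0 (fun a => extendFin 0 (U a) j) i = U i j
  rw [extendFin_val, extendFin_val]

theorem inputMemory_num_zero_symm (hU : U.IsSymm) (i j : ℕ) :
    (inputMemory parent rows cols rowMult colMult U).num 0 i j =
      (inputMemory parent rows cols rowMult colMult U).num 0 j i := by
  change extendFin 0 (fun a => extendFin 0 (U a) j) i = extendFin 0 (fun a => extendFin 0 (U a) i) j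
  by_cases hi : i < M <;> by_cases hj : j < M
  · simp only [extendFin_of_lt _ _ hi, extendFin_of_lt _ _ hj, hU.apply]
  all_goals simp [extendFin, hi, hj]

theorem storesList_extendFin (A : Fin n → List (Fin M)) (t : ℕ) :
    StoresList (fun j => (extendFin [] (fun i => (A i).map Fin.val) t).getD j 0)
      (extendFin [] (fun i => (A i).map Fin.val) t) := by
  intro j hj
  simp only [List.getD_eq_getElem _ _ hj]

theorem holdsBags_inputMemory : HoldsBags (inputMemory parent rows cols rowMult colMult U) n M
    (extendFin [] fun i => (rows i).map Fin.val) (extendFin [] fun i => (cols i).map Fin.val) where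
  nodes := rfl
  dim := rfl
  rowLength t ht := by
    change extendFin 0 (fun i => (rows i).length) t = _
    simp [extendFin_of_lt _ _ ht]
  row t _ := storesList_extendFin rows t
  colLength t ht := by
    change extendFin 0 (fun i => (cols i).length) t = _
    simp [extendFin_of_lt _ _ ht]
  col t _ := storesList_extendFin cols t

end

/-- The program `countMatchings` on a listing of a tree decomposition, whose vertices `x` have the
numbers `code x` in the memory. -/
theorem wp_countMatchings_inputMemory {V ι : Type*} [Fintype ι] {G : SimpleGraph V}
    {D : TreeDecomposition G ι} (L : Listing D) {M c flag : ℕ}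
    {rows cols : Fin (Fintype.card ι) → List (Fin M)} {rowMult colMult : Fin M → ℕ}
    {U : Matrix (Fin M) (Fin M) ℂ} {A : ℕ → ℕ → ℂ}
    (hA : (inputMemory L.parent rows cols rowMult colMult U).num 0 = A)
    {code : V → ℕ} (hcode : Function.Injective code)
    (hbag : ∀ t, ((rows t).map Fin.val ++ ((cols t).map Fin.val).map (· + M)).Perm
      ((L.bagList t).map code))
    {Y : Type*} [Fintype Y] {ρ : Y → V} (hρ : Function.Surjective ρ)
    (hsymm : ∀ u v, vertexWeight flag A M u v = vertexWeight flag A M v u)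
    (hedge : ∀ x y, x ≠ y → vertexWeight flag A M (code x) (code y) ≠ 0 → G.Adj x y)
    (hmult : ∀ x, (if code x < M then extendFin 0 rowMult (code x)
      else extendFin 0 colMult (code x - M)) = Nat.card {y // ρ y = x})
    (hc : ∀ x, Nat.card {y // ρ y = x} ≤ c)
    {w : Sym2 Y → ℂ} (hw : ∀ i j, w s(i, j) = vertexWeight flag A M (code (ρ i)) (code (ρ j))) :
    WP (countMatchings flag) (inputMemory L.parent rows cols rowMult colMult U) fun t s' =>
      t ≤ Fintype.card ι * (100 * D.width + 220) + Fintype.card Y * (100 * D.width + 320) +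
        4 * Fintype.card Y * unitCost c D.width * min (c + 1) (D.width + 3) + 100 ∧
      s'.num 1 0 0 = loopHafnianOn w Finset.univ := by
  classical
  subst hA
  set R := extendFin [] fun i => (rows i).map Fin.val with hR
  set K := extendFin [] fun i => (cols i).map Fin.val with hK
  have hperm : ∀ t (ht : t < Fintype.card ι),
      (bagOf M R K t).Perm ((L.bagList ⟨t, ht⟩).map code) := by
    intro t ht
    rw [bagOf, hR, hK, extendFin_of_lt _ _ ht, extendFin_of_lt _ _ ht]
    exact hbag _
  have hmem : ∀ t (ht : t < Fintype.card ι) v, v ∈ bagOf M R K t ↔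
      ∃ x ∈ D.bag (L.node ⟨t, ht⟩), code x = v := by
    intro t ht v
    rw [(hperm t ht).mem_iff, List.mem_map]
    simp only [L.mem_bagList]
  have hcard : ∀ x, (Finset.univ.filter fun y => code (ρ y) = code x).card =
      Nat.card {y // ρ y = x} := by
    intro x
    rw [Nat.card_eq_fintype_card, Fintype.card_subtype]
    simp only [hcode.eq_iff]
  have hnode : ∀ x, ∃ t, ∃ ht : t < Fintype.card ι, x ∈ D.bag (L.node ⟨t, ht⟩) := by
    intro x
    obtain ⟨i, hi⟩ := D.vertex_mem x
    obtain ⟨t, rfl⟩ := L.node.surjective i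
    exact ⟨t, t.isLt, hi⟩
  refine wp_countMatchings (ρ := fun y => code (ρ y)) (parent := extendFin 0 fun t => (L.parent t : ℕ))
    (holdsBags_inputMemory L.parent rows cols rowMult colMult U) ?_ ?_ ?_ ?_
    (fun a ha => inputMemory_idx_eq_zero _ _ _ _ _ _ (by omega))
    (fun a ha => inputMemory_num_eq_zero _ _ _ _ _ _ (by omega)) hsymm ?_ ?_ ?_ ?_ ?_ hw
  · intro t ht
    rw [(hperm t ht).nodup_iff]
    exact (L.nodup _).map hcode
  · intro t ht
    rw [(hperm t ht).length_eq, List.length_map]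
    have h1 : (L.bagList ⟨t, ht⟩).length = (D.bag (L.node ⟨t, ht⟩)).card := by
      rw [← List.toFinset_card_of_nodup (L.nodup _)]
      congr 1
      ext x
      rw [List.mem_toFinset, L.mem_bagList]
    have h2 := Finset.le_sup (f := fun t => (D.bag t).card) (Finset.mem_univ (L.node ⟨t, ht⟩))
    rw [TreeDecomposition.width]
    omega
  · intro t ht h0
    rw [extendFin_of_lt _ _ ht]
    exact L.parent_lt ⟨t, ht⟩ h0
  · intro t ht v hv t' ht' hv'
    have htn : t' < Fintype.card ι := ht'.trans ht
    rw [hmem t ht] at hv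
    rw [hmem t' htn] at hv'
    obtain ⟨x, hx, rfl⟩ := hv
    obtain ⟨y, hy, hxy⟩ := hv'
    obtain rfl := hcode hxy
    rw [extendFin_of_lt _ _ ht, hmem _ (L.parent ⟨t, ht⟩).isLt]
    exact ⟨y, L.mem_bag_parent hx hy ht', rfl⟩
  · rintro u v huv hne ⟨t, ht, hu⟩ ⟨t', ht', hv⟩
    obtain ⟨x, -, rfl⟩ := (hmem t ht u).mp hu
    obtain ⟨y, -, rfl⟩ := (hmem t' ht' v).mp hv
    obtain ⟨i, hx, hy⟩ := D.edge_mem x y (hedge x y (fun h => huv (by rw [h])) hne)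
    obtain ⟨j, rfl⟩ := L.node.surjective i
    exact ⟨j, j.isLt, (hmem _ j.isLt _).mpr ⟨x, hx, rfl⟩, (hmem _ j.isLt _).mpr ⟨y, hy, rfl⟩⟩
  · intro y
    obtain ⟨t, ht, h⟩ := hnode (ρ y)
    exact ⟨t, ht, (hmem t ht _).mpr ⟨_, h, rfl⟩⟩
  · intro t ht v hv
    obtain ⟨x, -, rfl⟩ := (hmem t ht v).mp hv
    rw [hcard]
    exact hmult x
  · intro t ht v hv
    obtain ⟨x, -, rfl⟩ := (hmem t ht v).mp hv
    obtain ⟨y, rfl⟩ := hρ x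
    exact ⟨y, rfl⟩
  · intro v
    by_cases h : ∃ y, code (ρ y) = v
    · obtain ⟨y, rfl⟩ := h
      rw [hcard]
      exact hc _
    · rw [Finset.card_eq_zero.mpr]
      · exact Nat.zero_le _
      · rw [Finset.filter_eq_empty_iff]
        exact fun y _ hy => h ⟨y, hy⟩

/-! ## Permanents and loop hafnians -/

/-- The indices are treated as rows with no columns present; the flag 1 lets the weights between
rows count. -/
theorem wp_loopHafnianInput {X ι : Type*} [Fintype ι] {G : SimpleGraph X}
    {D : TreeDecomposition G ι} (L : Listing D) {M k c : ℕ} {B : Matrix (Fin M) (Fin M) ℂ}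
    (hB : B.IsSymm) {g : X → Fin M} (hg : Function.Injective g)
    (hG : ∀ x y, x ≠ y → B (g x) (g y) ≠ 0 → G.Adj x y) {r : Fin k → X}
    (hr : Function.Surjective r) {mult : Fin M → ℕ}
    (hmult : ∀ x, mult (g x) = Nat.card {l // r l = x}) (hc : ∀ x, mult (g x) ≤ c)
    {B' : Matrix (Fin k) (Fin k) ℂ} (hB' : B'.IsSymm) (hBB' : ∀ i j, B' i j = B (g (r i)) (g (r j))) :
    WP (countMatchings 1) (loopHafnianInput B mult L g) fun t s' =>
      t ≤ Fintype.card ι * (100 * D.width + 220) + k * (100 * D.width + 320) +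
        4 * k * unitCost c D.width * min (c + 1) (D.width + 3) + 100 ∧
      s'.num 1 0 0 = loopHafnian B' hB' := by
  have hA := inputMemory_num_zero L.parent (fun t => (L.bagList t).map g) (fun _ => []) mult
    (fun _ => 0) B
  have hsymm := inputMemory_num_zero_symm L.parent (fun t => (L.bagList t).map g) (fun _ => [])
    mult (fun _ => 0) B hB
  have hw : ∀ x y : Fin M, vertexWeight (1 : ℕ) ((loopHafnianInput B mult L g).num 0) M x y =
      B x y := by
    intro x y
    rw [vertexWeight, if_pos x.isLt, if_pos y.isLt, Nat.cast_one, one_mul]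
    exact hA x y
  have h := wp_countMatchings_inputMemory (flag := 1) (c := c) L (rows := fun t => (L.bagList t).map g)
    (cols := fun _ => []) (rowMult := mult) (colMult := fun _ => 0) (U := B)
    (A := (loopHafnianInput B mult L g).num 0) rfl
    (code := fun x => (g x : ℕ)) (Fin.val_injective.comp hg)
    (fun t => by simp [Function.comp_def]) hr
    (fun u v => by
      have huv : (loopHafnianInput B mult L g).num 0 u v = (loopHafnianInput B mult L g).num 0 v u :=
        hsymm u v
      simp only [vertexWeight, huv]
      split_ifs <;> rfl)
    (fun x y hxy hne => hG x y hxy (by rwa [hw] at hne))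
    (fun x => by rw [if_pos (g x).isLt, extendFin_val, hmult])
    (fun x => (hmult x).symm.trans_le (hc x))
    (w := edgeWeight B' hB') (fun i j => by rw [hw]; exact hBB' i j)
  rw [Fintype.card_fin, ← loopHafnian_eq_loopHafnianOn] at h
  exact h

theorem perm_filterMap_getLeft_append {A X : Type*} {M : ℕ} (f : A → Fin M) (g : X → Fin M)
    (l : List (A ⊕ X)) :
    ((l.filterMap fun v => (Sum.map f g v).getLeft?).map Fin.val ++
      ((l.filterMap fun v => (Sum.map f g v).getRight?).map Fin.val).map (· + M)).Perm
      (l.map (Sum.elim (fun a => (f a : ℕ)) fun x => (g x : ℕ) + M)) := by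
  induction l with
  | nil => simp
  | cons v l ih =>
    rcases v with a | x
    · simp only [List.filterMap_cons, Sum.map_inl, Sum.getLeft?_inl, Sum.getRight?_inl,
        List.map_cons, Sum.elim_inl, List.cons_append]
      exact ih.cons _
    · simp only [List.filterMap_cons, Sum.map_inr, Sum.getLeft?_inr, Sum.getRight?_inr,
        List.map_cons, Sum.elim_inr]
      exact List.perm_middle.trans (ih.cons _)

theorem card_fiber_inl {A X Y Z : Type*} (α : Y → A) (r : Z → X) (a : A) :
    Nat.card {y // Sum.map α r y = Sum.inl a} = Nat.card {l // α l = a} := by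
  symm
  refine Nat.card_eq_of_bijective (fun l => ⟨Sum.inl l.1, by simp [l.2]⟩) ⟨?_, ?_⟩
  · rintro ⟨l, hl⟩ ⟨l', hl'⟩ h
    simpa using h
  · rintro ⟨l | l, hl⟩
    · exact ⟨⟨l, by simpa using hl⟩, rfl⟩
    · simp at hl

theorem card_fiber_inr {A X Y Z : Type*} (α : Y → A) (r : Z → X) (x : X) :
    Nat.card {y // Sum.map α r y = Sum.inr x} = Nat.card {l // r l = x} := by
  symm
  refine Nat.card_eq_of_bijective (fun l => ⟨Sum.inr l.1, by simp [l.2]⟩) ⟨?_, ?_⟩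
  · rintro ⟨l, hl⟩ ⟨l', hl'⟩ h
    simpa using h
  · rintro ⟨l | l, hl⟩
    · simp at hl
    · exact ⟨⟨l, by simpa using hl⟩, rfl⟩

theorem flaggedMatrix_zero_isSymm {Y : Type*} (U : Matrix Y Y ℂ) : (flaggedMatrix 0 U).IsSymm := by
  refine Matrix.IsSymm.ext ?_
  rintro (i | i) (j | j) <;> simp [flaggedMatrix]

/-- Rows and columns receive disjoint codes by shifting the columns by `M`, and the flag 0
suppresses the weights between rows. The index set has 2k elements, k rows and k columns with
repetitions. -/
theorem wp_permanentInput {A X ι : Type*} [Fintype ι] {G : SimpleGraph (A ⊕ X)}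
    {D : TreeDecomposition G ι} (L : Listing D) {M k c : ℕ} {U : Matrix (Fin M) (Fin M) ℂ}
    {f : A → Fin M} (hf : Function.Injective f) {g : X → Fin M} (hg : Function.Injective g)
    (hG : ∀ a x, U (f a) (g x) ≠ 0 → G.Adj (Sum.inl a) (Sum.inr x)) {α : Fin k → A}
    (hα : Function.Surjective α) {r : Fin k → X} (hr : Function.Surjective r)
    {rowMult colMult : Fin M → ℕ} (hrow : ∀ a, rowMult (f a) = Nat.card {l // α l = a})
    (hcol : ∀ x, colMult (g x) = Nat.card {l // r l = x}) (hrow' : ∀ a, rowMult (f a) ≤ c)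
    (hcol' : ∀ x, colMult (g x) ≤ c) {U' : Matrix (Fin k) (Fin k) ℂ}
    (hU' : ∀ i j, U' i j = U (f (α i)) (g (r j))) :
    WP (countMatchings 0) (permanentInput U rowMult colMult L (Sum.map f g)) fun t s' =>
      t ≤ Fintype.card ι * (100 * D.width + 220) + (k + k) * (100 * D.width + 320) +
        4 * (k + k) * unitCost c D.width * min (c + 1) (D.width + 3) + 100 ∧
      s'.num 1 0 0 = U'.permanent := by
  set s := permanentInput U rowMult colMult L (Sum.map f g) with hs
  have hA : ∀ i j : Fin M, s.num 0 i j = U i j := inputMemory_num_zero _ _ _ _ _ _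
  set code : A ⊕ X → ℕ := Sum.elim (fun a => (f a : ℕ)) fun x => (g x : ℕ) + M with hcode
  have hll : ∀ a a', vertexWeight (0 : ℕ) (s.num 0) M (code (Sum.inl a)) (code (Sum.inl a')) = 0 := by
    intro a a'
    simp [hcode, vertexWeight]
  have hrr : ∀ x x', vertexWeight (0 : ℕ) (s.num 0) M (code (Sum.inr x)) (code (Sum.inr x')) = 0 := by
    intro a a'
    simp [hcode, vertexWeight]
  have hlr : ∀ a x, vertexWeight (0 : ℕ) (s.num 0) M (code (Sum.inl a)) (code (Sum.inr x)) =
      U (f a) (g x) := by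
    intro a x
    simp [hcode, vertexWeight, hA]
  have hrl : ∀ a x, vertexWeight (0 : ℕ) (s.num 0) M (code (Sum.inr x)) (code (Sum.inl a)) =
      U (f a) (g x) := by
    intro a x
    simp [hcode, vertexWeight, hA]
  have hinj : Function.Injective code := by
    rintro (a | x) (a' | x') h
    · exact congrArg _ (hf (Fin.val_injective h))
    · have h : (f a : ℕ) = g x' + M := h
      have := (f a).isLt
      omega
    · have h : (g x : ℕ) + M = f a' := h
      have := (f a').isLt
      omega
    · have h : (g x : ℕ) + M = g x' + M := h
      exact congrArg _ (hg (Fin.val_injective (by omega)))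
  have h := wp_countMatchings_inputMemory (flag := 0) (c := c) L
    (rows := fun t => (L.bagList t).filterMap fun v => (Sum.map f g v).getLeft?)
    (cols := fun t => (L.bagList t).filterMap fun v => (Sum.map f g v).getRight?)
    (rowMult := rowMult) (colMult := colMult) (U := U) (A := s.num 0) rfl hinj
    (fun t => perm_filterMap_getLeft_append f g _) (ρ := Sum.map α r) (hα.sumMap hr)
    (fun u v => by
      simp only [vertexWeight, Nat.cast_zero, zero_mul]
      split_ifs <;> rfl)
    (by
      rintro (a | x) (a' | x') - hne
      · exact absurd (hll a a') hne
      · rw [hlr] at hne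
        exact hG a x' hne
      · rw [hrl] at hne
        exact (hG a' x hne).symm
      · exact absurd (hrr x x') hne)
    (by
      rintro (a | x)
      · rw [card_fiber_inl, ← hrow]
        simp [hcode, extendFin_val]
      · rw [card_fiber_inr, ← hcol]
        simp [hcode, extendFin_val])
    (by
      rintro (a | x)
      · rw [card_fiber_inl, ← hrow]
        exact hrow' a
      · rw [card_fiber_inr, ← hcol]
        exact hcol' x)
    (w := edgeWeight (flaggedMatrix 0 U') (flaggedMatrix_zero_isSymm U')) (by
      change ∀ i j, flaggedMatrix 0 U' i j = _
      rintro (i | i) (j | j)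
      · simp only [Sum.map_inl, hll]
        simp [flaggedMatrix]
      · simp only [Sum.map_inl, Sum.map_inr, hlr]
        simp [flaggedMatrix, hU']
      · simp only [Sum.map_inl, Sum.map_inr, hrl]
        simp [flaggedMatrix, hU']
      · simp only [Sum.map_inr, hrr]
        simp [flaggedMatrix])
  rw [Fintype.card_sum, Fintype.card_fin, ← permanent_eq_loopHafnianOn U' (fun i j => rfl)] at h
  exact h

theorem occupancy_eq_card {k M : ℕ} (r : Fin k → Fin M) (x : Set.range r) :
    occupancy r x = Nat.card {l // Set.rangeFactorization r l = x} := by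
  classical
  rw [Nat.card_eq_fintype_card, Fintype.card_subtype, occupancy]
  congr 1
  ext l
  simp [Subtype.ext_iff]

theorem TreeDecomposition.card_pos {V ι : Type*} [Fintype ι] {G : SimpleGraph V}
    (D : TreeDecomposition G ι) : 1 ≤ Fintype.card ι :=
  have := D.isTree.isConnected.nonempty
  Fintype.card_pos

/-- A nonempty list takes some value at least once, so c = 0 forces the list to be empty. -/
theorem eq_zero_of_occupancy_le {k M c : ℕ} {r : Fin k → Fin M} (h : ∀ i, occupancy r i ≤ c)
    (hc : c = 0) : k = 0 := by
  by_contra hk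
  have h1 := h (r ⟨0, by omega⟩)
  rw [hc, Nat.le_zero, occupancy, Finset.card_eq_zero, Finset.filter_eq_empty_iff] at h1
  exact h1 (Finset.mem_univ _) rfl

/-! ### The four algorithms -/

theorem lemma1 :
    -- permanent of an N × N matrix
    (∃ (P : Program) (C : ℝ), ∀ (N : ℕ) (U : Matrix (Fin N) (Fin N) ℂ)
      (ι : Type) [Fintype ι] (D : TreeDecomposition (bipartiteGraph U) ι) (L : Listing D),
      ComputesWithin P (permanentInput U (fun _ => 1) (fun _ => 1) L id) U.permanent
        (C * ((N : ℝ) + (Fintype.card ι : ℝ)) * (max (D.width : ℝ) 1) ^ 2 * 2 ^ D.width)) ∧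
    -- loop hafnian of an N × N symmetric matrix
    (∃ (P : Program) (C : ℝ), ∀ (N : ℕ) (B : Matrix (Fin N) (Fin N) ℂ) (hB : B.IsSymm)
      (ι : Type) [Fintype ι] (D : TreeDecomposition (symmetricGraph B) ι) (L : Listing D),
      ComputesWithin P (loopHafnianInput B (fun _ => 1) L id) (loopHafnian B hB)
        (C * ((N : ℝ) + (Fintype.card ι : ℝ)) * (max (D.width : ℝ) 1) ^ 2 * 2 ^ D.width)) ∧
    -- permanent of the k × k matrix with rows α_1, …, α_k and columns r_1, …, r_k of U, each
    -- repeated at most c times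
    (∃ (P : Program) (C : ℝ), ∀ (M k c : ℕ) (U : Matrix (Fin M) (Fin M) ℂ)
      (α r : Fin k → Fin M) (_ : ∀ i, occupancy α i ≤ c) (_ : ∀ i, occupancy r i ≤ c)
      (ι : Type) [Fintype ι]
      (D : TreeDecomposition (bipartiteGraph (U.submatrix
        (Subtype.val : Set.range α → Fin M) (Subtype.val : Set.range r → Fin M))) ι)
      (L : Listing D),
      ComputesWithin P
        (permanentInput U (occupancy α) (occupancy r) L (Sum.map Subtype.val Subtype.val))
        (U.submatrix α r).permanent
        (C * ((k : ℝ) + (Fintype.card ι : ℝ)) * max (D.width : ℝ) 1 *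
          (2 * (c : ℝ) + 1) ^ D.width * Real.log (max (c : ℝ) 2))) ∧
    -- loop hafnian of the k × k matrix with rows and columns r_1, …, r_k of B, each repeated at
    -- most c times
    (∃ (P : Program) (C : ℝ), ∀ (M k c : ℕ) (B : Matrix (Fin M) (Fin M) ℂ) (hB : B.IsSymm)
      (r : Fin k → Fin M) (_ : ∀ i, occupancy r i ≤ c)
      (ι : Type) [Fintype ι]
      (D : TreeDecomposition (symmetricGraph (B.submatrix
        (Subtype.val : Set.range r → Fin M) (Subtype.val : Set.range r → Fin M))) ι)
      (L : Listing D),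
      ComputesWithin P (loopHafnianInput B (occupancy r) L Subtype.val)
        (loopHafnian (B.submatrix r r) (hB.submatrix r))
        (C * ((k : ℝ) + (Fintype.card ι : ℝ)) * max (D.width : ℝ) 1 *
          (2 * (c : ℝ) + 1) ^ D.width * Real.log (max (c : ℝ) 2))) := by

  -- The same program with the two values of the flag. The factor 3 in the last two constants comes
  -- from passing from the binary to the natural logarithm. Without collisions every multiplicity is
  -- 1 and all labelings are identities; with collisions the vertices are the distinct indices in
  -- the lists.
  refine ⟨⟨countMatchings 0, 10 ^ 7, ?_⟩, ⟨countMatchings 1, 10 ^ 7, ?_⟩,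
    ⟨countMatchings 0, 3 * 10 ^ 7, ?_⟩, ⟨countMatchings 1, 3 * 10 ^ 7, ?_⟩⟩
  · intro N U ι _ D L
    have h := wp_permanentInput (c := 1) L (U := U) (f := id) (g := id) (α := id) (r := id)
      (rowMult := fun _ => 1) (colMult := fun _ => 1) (U' := U)
      Function.injective_id Function.injective_id
      (fun a x hax => ⟨Sum.inl_ne_inr, Or.inl ⟨a, x, rfl, rfl, hax⟩⟩) Function.surjective_id
      Function.surjective_id (fun a => by simp) (fun x => by simp) (fun _ => le_rfl)
      (fun _ => le_rfl) fun _ _ => rfl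
    rw [Sum.map_id_id] at h
    exact h.computesWithin (cast_time_le_of_one (time_le_of_one D.card_pos (by omega)))
  · intro N B hB ι _ D L
    exact (wp_loopHafnianInput (c := 1) L hB (g := id) (r := id) (mult := fun _ => 1)
      Function.injective_id (fun x y hxy h => ⟨hxy, Or.inl h⟩) Function.surjective_id
      (fun x => by simp) (fun _ => le_rfl) hB fun _ _ => rfl).computesWithin
      (cast_time_le_of_one (time_le_of_one D.card_pos (by omega)))
  · intro M k c U α r hα hr ι _ D L
    exact (wp_permanentInput L Subtype.val_injective Subtype.val_injective
      (fun a x hax => ⟨Sum.inl_ne_inr, Or.inl ⟨a, x, rfl, rfl, hax⟩⟩)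
      Set.rangeFactorization_surjective Set.rangeFactorization_surjective
      (occupancy_eq_card α) (occupancy_eq_card r) (fun a => hα a) (fun x => hr x)
      fun _ _ => rfl).computesWithin
      (cast_time_le (time_le D.card_pos (by omega) (eq_zero_of_occupancy_le hr)))
  · intro M k c B hB r hr ι _ D L
    exact (wp_loopHafnianInput L hB Subtype.val_injective
      (fun x y hxy h => ⟨hxy, Or.inl h⟩) Set.rangeFactorization_surjective
      (occupancy_eq_card r) (fun x => hr x) (hB.submatrix r) fun _ _ => rfl).computesWithin
      (cast_time_le (time_le D.card_pos (by omega) (eq_zero_of_occupancy_le hr)))
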